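/- Let $M$ be a smooth surface, $\alpha:M\to\mathbb R^4$ an immersion of class $C^r$, $5\le r\le\infty$, with normal curvature vector $k_n$ and mean curvature vector $H$. A point is axiumbilic if its ellipse of curvature is a circle, i.e. $\|k_n-H\|^2$ is constant on tangent directions; elsewhere the principal (resp. mean) axial directions are those maximizing (resp. minimizing) $\|k_n-H\|^2$, and the principal (mean) axial lines are the maximal curves tangent to them. With $E,F,G$ the first and $e_i,f_i,g_i$ the second fundamental form coefficients in an orthonormal normal frame, let $$a_0=4F(EG-2F^2)|e|^2-4E(EG-4F^2)\langle e,f\rangle+4E^3\langle f,g\rangle-4E^2F\langle e,g\rangle-8E^2F|f|^2,$$ $$a_1=4G(EG-4F^2)|e|^2+32EFG\langle e,f\rangle+4E^3|g|^2-8E^2G\langle e,g\rangle-16E^2G|f|^2,$$ $$\mathcal G=[a_0G(EG-4F^2)+a_1F(2F^2-EG)]dy^4+[-8a_0EFG+a_1E(4F^2-EG)]dy^3dx+[-6a_0GE^2+3a_1FE^2]dy^2dx^2+a_1E^3\,dy\,dx^3+a_0E^3dx^4$$ (where $e=(e_1,e_2)$, etc.). The Lie–Cartan surface is $\{\mathcal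 G=0\}$ in the projectivized tangent bundle, and in coordinates $(x,y,p)$, $p=dy/dx$, the Lie–Cartan field is $\mathcal G_p\partial_x+p\,\mathcal G_p\partial_y-(\mathcal G_x+p\,\mathcal G_y)\partial_p$ (and similarly in the other affine charts of the projective line). Let $\mathfrak p\in M$ be an axiumbilic point. Suppose that near $\mathfrak p$, up to a rigid motion of $\mathbb R^4$, the surface is the graph $(x,y)\mapsto(x,y,R(x,y),S(x,y))$, with $\mathfrak p$ at the origin, where $R,S$ vanish to first order at $0$ and have partial derivatives $r_{jk}=\partial_x^j\partial_y^kR(0)$, $s_{jk}=\partial_x^j\partial_y^kS(0)$ with $r_{11}=-\tfrac12(s_{02}-s_{20})$, $s_{11}=\tfrac12(r_{02}-r_{20})$ and $$\alpha_1=s_{12}-s_{30}+2r_{21}=0,\qquad \alpha_3=s_{03}-s_{21}+2r_{12}=0 .$$ Suppose that, after some rotation of the $(x,y)$-plane (possibly trivial), $\partial_xa_0(0)=0$, $\partial_ya_0(0)\ne0$ and $$\chi=\partial_x^2a_1(0)-\frac{\partial_x^2a_0(0)\,\partial_ya_1(0)}{\partial_ya_0(0)}\neq0 .$$ (If, by a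 homothety of $\mathbb R^4$, $\partial_ya_0(0)=1$, this is $\chi=b_{20}-a_{20}b_{01}$ in terms of the Taylor coefficients $a_{jk},b_{jk}$ of $a_0,a_1$.) Then: 1. $\mathfrak p$ is of type $E^1_{45}$: the Lie–Cartan surface has exactly four singular points on the projective line over $\mathfrak p$, and they are of Morse type. 2. These four points are conical (Morse index $1$ or $2$) and are saddles of the Lie–Cartan field: its linear part has two real eigenvalues of opposite signs, with eigenvectors tangent to the cone, one along the projective line and one transverse to it (the third eigenvalue being $0$). 3. The field has exactly one more equilibrium on the projective line. It is a regular point of the Lie–Cartan surface and a quadratic saddle-node: the eigenvalue along the projective line is nonzero, and there is a $C^1$ centre manifold in the surface, transverse to the projective line, on which the field is $(cs^2+o(s^2))\,\partial_s$ with $c\ne0$. 4. $\mathfrak p$ has a neighbourhood without other axiumbilic points in which one of the two axial configurations (the principal one if $\chi>0$, the mean one if $\chi<0$) is carried, by a homeomorphism onto the square $(-1,1)^2$ with $\mathfrak p\mapsto0$, onto the net formed by the vertical lines and the saddle-node foliation with lines $\{(-t,mt):0<t<1\}$ ($|m|\le1$; parabolic sector), $\{(t,0):0<t<1\}$, and $y=\pm(c+\max(-x,0))$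 ($0<c<1$; two hyperbolic sectors). The other configuration is likewise carried, near $\mathfrak p$, onto the net of horizontal and vertical lines of $(-1,1)^2$. (In both models the origin is removed, so lines through it are cut in two.) -/

import Mathlib

open scoped Manifold ContDiff Topology RealInnerProductSpace LinearAlgebra.Projectivization
open Set

noncomputable section

namespace Axial

abbrev Plane := EuclideanSpace ℝ (Fin 2)

abbrev Space4 := EuclideanSpace ℝ (Fin 4)

/-- The coordinate vectors `∂/∂x` (`i = 0`) and `∂/∂y` (`i = 1`). -/
def e (i : Fin 2) : Plane := EuclideanSpace.single i 1

/-- Partial derivative in the `i`-th coordinate direction. -/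
def pd (i : Fin 2) (f : Plane → ℝ) : Plane → ℝ := fun z => fderiv ℝ f z (e i)

/-- Rotation of the plane by a right angle. -/
def J (w : Plane) : Plane := !₂[-w 1, w 0]

/-- The change of coordinates `x = cos θ u + sin θ v`, `y = -sin θ u + cos θ v`. -/
def rot (θ : ℝ) (z : Plane) : Plane :=
  !₂[Real.cos θ * z 0 + Real.sin θ * z 1, -Real.sin θ * z 0 + Real.cos θ * z 1]

/-! ### Parametrized surfaces in 4-space -/

/-- First fundamental form of a parametrized surface. -/
def firstForm (X : Plane → Space4) (z v w : Plane) : ℝ := ⟪fderiv ℝ X z v, fderiv ℝ X z w⟫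

/-- Second fundamental form with values in the normal plane: the normal component of the second
derivative. Its components in an orthonormal normal frame are the scalar second fundamental
forms. -/
def secondForm (X : Plane → Space4) (z v w : Plane) : Space4 :=
  (LinearMap.range (fderiv ℝ X z).toLinearMap)ᗮ.starProjection (fderiv ℝ (fderiv ℝ X) z v w)

def cE (X : Plane → Space4) (z : Plane) : ℝ := firstForm X z (e 0) (e 0)
def cF (X : Plane → Space4) (z : Plane) : ℝ := firstForm X z (e 0) (e 1)
def cG (X : Plane → Space4) (z : Plane) : ℝ := firstForm X z (e 1) (e 1)

/-- The normal vectors `(e₁, e₂)`, `(f₁, f₂)`, `(g₁, g₂)` of coefficients of the second form. -/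
def ve (X : Plane → Space4) (z : Plane) : Space4 := secondForm X z (e 0) (e 0)
def vf (X : Plane → Space4) (z : Plane) : Space4 := secondForm X z (e 0) (e 1)
def vg (X : Plane → Space4) (z : Plane) : Space4 := secondForm X z (e 1) (e 1)

/-- Mean curvature vector. -/
def meanCurv (X : Plane → Space4) (z : Plane) : Space4 :=
  (2 * (cE X z * cG X z - cF X z ^ 2))⁻¹ •
    (cE X z • vg X z - (2 * cF X z) • vf X z + cG X z • ve X z)

/-- Normal curvature vector in the direction `v`. -/
def normalCurv (X : Plane → Space4) (z v : Plane) : Space4 :=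
  (firstForm X z v v)⁻¹ • secondForm X z v v

/-- `‖k_n - H‖²`: squared distance from the centre of the ellipse of curvature to its point given
by the direction `v`. -/
def deviation (X : Plane → Space4) (z v : Plane) : ℝ := ‖normalCurv X z v - meanCurv X z‖ ^ 2

/-- The coefficient `a₀` of the differential equation of axial lines. -/
def a0 (X : Plane → Space4) (z : Plane) : ℝ :=
  4 * cF X z * (cE X z * cG X z - 2 * cF X z ^ 2) * ⟪ve X z, ve X z⟫
    - 4 * cE X z * (cE X z * cG X z - 4 * cF X z ^ 2) * ⟪ve X z, vf X z⟫
    + 4 * cE X z ^ 3 * ⟪vf X z, vg X z⟫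
    - 4 * cE X z ^ 2 * cF X z * ⟪ve X z, vg X z⟫
    - 8 * cE X z ^ 2 * cF X z * ⟪vf X z, vf X z⟫

/-- The coefficient `a₁` of the differential equation of axial lines. -/
def a1 (X : Plane → Space4) (z : Plane) : ℝ :=
  4 * cG X z * (cE X z * cG X z - 4 * cF X z ^ 2) * ⟪ve X z, ve X z⟫
    + 32 * cE X z * cF X z * cG X z * ⟪ve X z, vf X z⟫
    + 4 * cE X z ^ 3 * ⟪vg X z, vg X z⟫
    - 8 * cE X z ^ 2 * cG X z * ⟪ve X z, vg X z⟫
    - 16 * cE X z ^ 2 * cG X z * ⟪vf X z, vf X z⟫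

/-- The quartic form `𝒢(x, y, dx, dy)` whose zeros are the axial directions (`w = (dx, dy)`). -/
def quartic (X : Plane → Space4) (z w : Plane) : ℝ :=
  (a0 X z * cG X z * (cE X z * cG X z - 4 * cF X z ^ 2)
      + a1 X z * cF X z * (2 * cF X z ^ 2 - cE X z * cG X z)) * w 1 ^ 4
    + (-8 * a0 X z * cE X z * cF X z * cG X z
      + a1 X z * cE X z * (4 * cF X z ^ 2 - cE X z * cG X z)) * w 1 ^ 3 * w 0
    + (-6 * a0 X z * cG X z * cE X z ^ 2
      + 3 * a1 X z * cF X z * cE X z ^ 2) * w 1 ^ 2 * w 0 ^ 2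
    + a1 X z * cE X z ^ 3 * w 1 * w 0 ^ 3
    + a0 X z * cE X z ^ 3 * w 0 ^ 4

/-! ### The Lie-Cartan surface and the Lie-Cartan field over the origin of the chart -/

/-- `𝒢` in the affine chart of the projectivized tangent bundle centred at the direction `w`, with
coordinates `(z, t) ↦ (z, [w + t J w])`. For `w = ∂/∂x` this is `𝒢(x, y, p)`, `p = t = dy/dx`. The
Lie-Cartan surface is the zero set of this function. -/
def lieCartan (X : Plane → Space4) (w : Plane) (m : Plane × ℝ) : ℝ :=
  quartic X m.1 (w + m.2 • J w)

/-- The Lie-Cartan vector field in the same chart; for `w = ∂/∂x` it is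
`𝒢_p ∂/∂x + p 𝒢_p ∂/∂y - (𝒢_x + p 𝒢_y) ∂/∂p`. -/
def lieCartanField (X : Plane → Space4) (w : Plane) (m : Plane × ℝ) : Plane × ℝ :=
  (fderiv ℝ (lieCartan X w) m (0, 1) • (w + m.2 • J w),
    -fderiv ℝ (lieCartan X w) m (w + m.2 • J w, 0))

def hess (X : Plane → Space4) (w : Plane) (u v : Plane × ℝ) : ℝ :=
  fderiv ℝ (fderiv ℝ (lieCartan X w)) 0 u v

/-- Points of the projective line over the origin at which the Lie-Cartan surface is singular. -/
def singularDirections (X : Plane → Space4) : Set (ℙ ℝ Plane) :=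
  {d | lieCartan X d.rep 0 = 0 ∧ fderiv ℝ (lieCartan X d.rep) 0 = 0}

/-- Equilibria of the Lie-Cartan field on the part of the Lie-Cartan surface over the origin. -/
def equilibria (X : Plane → Space4) : Set (ℙ ℝ Plane) :=
  {d | lieCartan X d.rep 0 = 0 ∧ lieCartanField X d.rep 0 = 0}

/-- Nondegenerate Hessian. -/
def IsMorse (X : Plane → Space4) (w : Plane) : Prop :=
  ∀ u, (∀ v, hess X w u v = 0) → u = 0

/-- Morse point of index 1 or 2, so that the Lie-Cartan surface is a cone there. -/
def IsConical (X : Plane → Space4) (w : Plane) : Prop :=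
  IsMorse X w ∧ (∃ u, 0 < hess X w u u) ∧ ∃ u, hess X w u u < 0

/-- The origin is of type `E₄₅¹`: the Lie-Cartan surface has exactly four singular points on the
projective line, all of Morse type. -/
def IsTypeE45 (X : Plane → Space4) : Prop :=
  (singularDirections X).ncard = 4 ∧ ∀ d ∈ singularDirections X, IsMorse X d.rep

/-- A saddle of the Lie-Cartan field at a singular point of the Lie-Cartan surface: the linear part
has two real eigenvalues of opposite signs, with eigenvectors tangent to the surface (isotropic for
the Hessian), one along the projective line and one transverse to it. The third eigenvalue is `0`,
as the field has the first integral `𝒢`. -/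
def IsSaddle (X : Plane → Space4) (w : Plane) : Prop :=
  lieCartanField X w 0 = 0 ∧
  ∃ (l₁ l₂ : ℝ) (v u : Plane × ℝ), l₁ * l₂ < 0 ∧
    fderiv ℝ (lieCartanField X w) 0 v = l₁ • v ∧ v.1 ≠ 0 ∧ hess X w v v = 0 ∧
    fderiv ℝ (lieCartanField X w) 0 (0, 1) = l₂ • ((0, 1) : Plane × ℝ) ∧
    hess X w (0, 1) (0, 1) = 0 ∧
    fderiv ℝ (lieCartanField X w) 0 u = 0 ∧ u ≠ 0

/-- A quadratic saddle-node of the Lie-Cartan field at a regular point of the Lie-Cartan surface,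
with centre manifold transverse to the projective line: the projective line is an eigendirection
with nonzero eigenvalue, and there is a `C¹` invariant curve in the surface, tangent to the kernel
of the linear part and transverse to the projective line, on which the field is
`(c s² + o(s²)) d/ds`, `c ≠ 0`. -/
def IsTransverseSaddleNode (X : Plane → Space4) (w : Plane) : Prop :=
  lieCartan X w 0 = 0 ∧ fderiv ℝ (lieCartan X w) 0 ≠ 0 ∧ lieCartanField X w 0 = 0 ∧
  (∃ l : ℝ, l ≠ 0 ∧
    fderiv ℝ (lieCartanField X w) 0 (0, 1) = l • ((0, 1) : Plane × ℝ)) ∧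
  ∃ (γ : ℝ → Plane × ℝ) (k : ℝ → ℝ) (c : ℝ), c ≠ 0 ∧
    ContDiffAt ℝ 1 γ 0 ∧ γ 0 = 0 ∧
    fderiv ℝ (lieCartanField X w) 0 (deriv γ 0) = 0 ∧ (deriv γ 0).1 ≠ 0 ∧
    (∀ᶠ s in 𝓝 (0 : ℝ), lieCartan X w (γ s) = 0 ∧
      lieCartanField X w (γ s) = k s • deriv γ s) ∧
    (fun s => k s - c * s ^ 2) =o[𝓝 (0 : ℝ)] fun s => s ^ 2

/-! ### Monge charts -/

/-- The parametrization `(x, y) ↦ (x, y, R(x, y), S(x, y))`. -/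
def monge (R S : Plane → ℝ) (z : Plane) : Space4 := !₂[z 0, z 1, R z, S z]

/-- The Taylor coefficient `r_{jk} = ∂ʲ⁺ᵏR/∂xʲ∂yᵏ (0, 0)`. -/
def jet (R : Plane → ℝ) (j k : ℕ) : ℝ := ((pd 0)^[j] ((pd 1)^[k] R)) 0

def alpha1 (R S : Plane → ℝ) : ℝ := jet S 1 2 - jet S 3 0 + 2 * jet R 2 1
def alpha3 (R S : Plane → ℝ) : ℝ := jet S 0 3 - jet S 2 1 + 2 * jet R 1 2

/-- `χ = b₂₀ - a₂₀ b₀₁`, in a chart in which `a₁₀ = 0` and, after rescaling, `a₀₁ = 1`. (A homothety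
of 4-space of ratio `a₀₁^{1/3}` turns `a₀₁` into `1` and multiplies the number below by a positive
constant.) -/
def chi (X : Plane → Space4) : ℝ :=
  jet (a1 X) 2 0 - jet (a0 X) 2 0 * jet (a1 X) 0 1 / jet (a0 X) 0 1

section Manifold

variable {M : Type*} [TopologicalSpace M] [ChartedSpace Plane M]

/-- `α` is an immersion of class `C^r`. -/
def IsImmersionOfClass (r : ℕ∞) (α : M → Space4) : Prop :=
  ContMDiff (𝓡 2) 𝓘(ℝ, Space4) r α ∧
    ∀ q, Function.Injective (mfderiv (𝓡 2) 𝓘(ℝ, Space4) α q)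

/-- `φ` is a Monge chart of the surface `α` at `p` given by `(R, S)`: up to a rigid motion the
surface is the graph of `(R, S)` over its tangent plane at `p`. The quadratic parts satisfy
`r₁₁ = -s/2` and `s₁₁ = r/2`, with `r = r₀₂ - r₂₀` and `s = s₀₂ - s₂₀`. -/
structure IsMongeChart (r : ℕ∞) (α : M → Space4) (p : M) (φ : OpenPartialHomeomorph M Plane)
    (R S : Plane → ℝ) : Prop where
  mem_atlas : φ ∈ IsManifold.maximalAtlas (𝓡 2) r M
  mem_source : p ∈ φ.source
  map_base : φ p = 0
  graph : ∃ A : Space4 ≃ₗᵢ[ℝ] Space4, ∀ q ∈ φ.source, A (α q - α p) = monge R S (φ q)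
  tangent_R : fderiv ℝ R 0 = 0
  tangent_S : fderiv ℝ S 0 = 0
  r11 : jet R 1 1 = -(jet S 0 2 - jet S 2 0) / 2
  s11 : jet S 1 1 = (jet R 0 2 - jet R 2 0) / 2

/-! ### Axial lines and axial configurations -/

/-- `‖k_n - H‖²` for the surface `α` at `q` in the direction `v`, computed in the preferred chart
at `q`, which identifies the tangent space at `q` with the plane. -/
def dev (α : M → Space4) (q : M) (v : TangentSpace (𝓡 2) q) : ℝ :=
  deviation (α ∘ (extChartAt (𝓡 2) q).symm) (extChartAt (𝓡 2) q q) v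

/-- The ellipse of curvature at `q` is a circle. -/
def IsAxiumbilic (α : M → Space4) (q : M) : Prop :=
  ∀ v w : TangentSpace (𝓡 2) q, v ≠ 0 → w ≠ 0 → dev α q v = dev α q w

/-- Directions of the large axis of the ellipse of curvature. -/
def IsPrincipal (α : M → Space4) (q : M) (v : TangentSpace (𝓡 2) q) : Prop :=
  v ≠ 0 ∧ ∀ w : TangentSpace (𝓡 2) q, w ≠ 0 → dev α q w ≤ dev α q v

/-- Directions of the small axis of the ellipse of curvature. -/
def IsMean (α : M → Space4) (q : M) (v : TangentSpace (𝓡 2) q) : Prop :=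
  v ≠ 0 ∧ ∀ w : TangentSpace (𝓡 2) q, w ≠ 0 → dev α q v ≤ dev α q w

/-- `L` is an arc in `U`, free of axiumbilic points, whose tangent directions all satisfy `P`. -/
def IsAxialArc (α : M → Space4) (P : ∀ q : M, TangentSpace (𝓡 2) q → Prop) (U L : Set M) : Prop :=
  ∃ c : ℝ → M, ContMDiffOn 𝓘(ℝ, ℝ) (𝓡 2) 1 c (Ioo 0 1) ∧ L = c '' Ioo 0 1 ∧
    ∀ t ∈ Ioo (0 : ℝ) 1, c t ∈ U ∧ ¬ IsAxiumbilic α (c t) ∧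
      P (c t) (mfderiv 𝓘(ℝ, ℝ) (𝓡 2) c t (1 : ℝ))

/-- Near `p` the axial configuration (axiumbilic points and maximal axial lines) is
homeomorphic to the origin with the family of lines `𝓕` in the open square `(-1, 1)²`. -/
def LooksLike (α : M → Space4) (P : ∀ q : M, TangentSpace (𝓡 2) q → Prop) (p : M)
    (𝓕 : Set (Set (ℝ × ℝ))) : Prop :=
  ∃ h : OpenPartialHomeomorph M (ℝ × ℝ), p ∈ h.source ∧ h p = 0 ∧
    h.target = Ioo (-1) 1 ×ˢ Ioo (-1) 1 ∧
    (∀ q ∈ h.source, IsAxiumbilic α q ↔ q = p) ∧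
    ∀ L ⊆ h.source, Maximal (IsAxialArc α P h.source) L ↔ h '' L ∈ 𝓕

end Manifold

/-! ### The model pictures in the square `(-1, 1)²`, punctured at the origin -/

/-- Vertical lines, the one through the origin being cut into two halves. -/
def verticals : Set (Set (ℝ × ℝ)) :=
  {L | (∃ a ∈ Ioo (-1 : ℝ) 1, a ≠ 0 ∧ L = {a} ×ˢ Ioo (-1) 1) ∨
    L = {0} ×ˢ Ioo (0 : ℝ) 1 ∨ L = {0} ×ˢ Ioo (-1 : ℝ) 0}

/-- Horizontal lines, the one through the origin being cut into two halves. -/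
def horizontals : Set (Set (ℝ × ℝ)) := {L | Prod.swap '' L ∈ verticals}

/-- The foliation with a saddle-node at the origin. On the left there is a parabolic sector
`|y| ≤ -x` whose lines all end at the origin, and which is bounded by two separatrices
(`m = ±1`); on the right one separatrix ends at the origin; these three separatrices bound two
hyperbolic sectors, filled by the lines that pass above and below the origin. -/
def saddleNodeLines : Set (Set (ℝ × ℝ)) :=
  {L | (∃ m ∈ Icc (-1 : ℝ) 1, L = (fun t : ℝ => (-t, m * t)) '' Ioo 0 1) ∨
    L = Ioo (0 : ℝ) 1 ×ˢ {0} ∨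
    (∃ a ∈ Ioo (0 : ℝ) 1, L = (fun t : ℝ => (t, a + max (-t) 0)) '' Ioo (a - 1) 1) ∨
    (∃ a ∈ Ioo (0 : ℝ) 1, L = (fun t : ℝ => (t, -(a + max (-t) 0))) '' Ioo (a - 1) 1)}

/-- The net made of a saddle-node foliation and a foliation crossing it. -/
def saddleNodeNet : Set (Set (ℝ × ℝ)) := saddleNodeLines ∪ verticals

/-- The trivial net. -/
def trivialNet : Set (Set (ℝ × ℝ)) := horizontals ∪ verticals

end Axial

end

noncomputable section

namespace Axial

local notation "ℝ²" => ℝ × ℝ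
local notation "𝐃" => fderiv ℝ

section

/-! ### Slope fields with an isolated singularity and their leaves -/

/-- A bounded slope field `y' = P x y` on the plane, continuous and locally Lipschitz in `y` away
from the origin. -/
structure SlopeField (κ : ℝ) (P : ℝ → ℝ → ℝ) : Prop where
  nonneg : 0 ≤ κ
  lt_one : κ < 1
  bound : ∀ x y, |P x y| ≤ κ
  cont : ∀ x y, (x ≠ 0 ∨ y ≠ 0) → ContinuousAt (Function.uncurry P) (x, y)
  lip : ∀ δ > 0, ∃ K : NNReal, ∀ x y z,
    (δ ≤ |x| ∨ (δ ≤ y ∧ δ ≤ z) ∨ (y ≤ -δ ∧ z ≤ -δ)) → |P x y - P x z| ≤ K * |y - z|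

/-- A complete leaf of a slope field: a Lipschitz graph that solves the equation away from the
origin. -/
structure IsLeaf (κ : ℝ) (P : ℝ → ℝ → ℝ) (η : ℝ → ℝ) : Prop where
  lip : ∀ x y, |η x - η y| ≤ κ * |x - y|
  deriv : ∀ x, (x ≠ 0 ∨ η x ≠ 0) → HasDerivAt η (P x (η x)) x

variable {κ : ℝ} {P : ℝ → ℝ → ℝ} {η ζ : ℝ → ℝ}

theorem continuous_of_abs_sub_le (h : ∀ x y, |η x - η y| ≤ κ * |x - y|) : Continuous η :=
  (LipschitzWith.of_dist_le_mul (K := κ.toNNReal) fun x y => (h x y).trans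
    (mul_le_mul_of_nonneg_right (Real.le_coe_toNNReal κ) (abs_nonneg _))).continuous

theorem IsLeaf.continuous (h : IsLeaf κ P η) : Continuous η := continuous_of_abs_sub_le h.lip

/-- Cutting the slope field off near the vertical axis gives equations with complete solutions. -/
theorem SlopeField.exists_approx (hP : SlopeField κ P) (x₀ y₀ : ℝ) (n : ℕ) :
    ∃ η : ℝ → ℝ, η x₀ = y₀ ∧ (∀ x ∈ Icc (x₀ - n) (x₀ + n), ∀ y ∈ Icc (x₀ - n) (x₀ + n),
      |η x - η y| ≤ κ * |x - y|) ∧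
      ∀ x ∈ Ioo (x₀ - n) (x₀ + n), 2 ≤ n * |x| → HasDerivAt η (P x (η x)) x := by
  set ψ : ℝ → ℝ := fun x => max 0 (min 1 (n * |x| - 1)) with hψ
  have ψ0 : ∀ x, 0 ≤ ψ x := fun x => le_max_left _ _
  have ψ1 : ∀ x, ψ x ≤ 1 := fun x => max_le zero_le_one (min_le_left _ _)
  have ψc : Continuous ψ := by fun_prop
  obtain ⟨K, hK⟩ := hP.lip (1 / (n + 1)) (by positivity)
  have bd : ∀ x y, |ψ x * P x y| ≤ κ := fun x y => by
    rw [abs_mul, abs_of_nonneg (ψ0 x)]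
    nlinarith [hP.bound x y, ψ0 x, ψ1 x, abs_nonneg (P x y)]
  have hmem : x₀ ∈ Icc (x₀ - n) (x₀ + n) := by constructor <;> simp
  have hpl : IsPicardLindelof (fun x y => ψ x * P x y) (⟨x₀, hmem⟩ : Icc (x₀ - n) (x₀ + n)) y₀
      (⟨κ * n, mul_nonneg hP.nonneg (Nat.cast_nonneg n)⟩) 0 ⟨κ, hP.nonneg⟩ K := by
    refine ⟨fun t _ => ?_, fun y _ => ?_, fun t _ y _ => bd t y, ?_⟩
    · refine LipschitzWith.lipschitzOnWith (LipschitzWith.of_dist_le_mul fun y y' => ?_)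
      rw [Real.dist_eq, Real.dist_eq, ← mul_sub, abs_mul, abs_of_nonneg (ψ0 t)]
      by_cases ht : 1 / ((n : ℝ) + 1) ≤ |t|
      · have := hK t y y' (Or.inl ht)
        nlinarith [ψ0 t, ψ1 t, abs_nonneg (P t y - P t y')]
      · have : ψ t = 0 := by
          refine max_eq_left ((min_le_right _ _).trans ?_)
          push Not at ht
          rw [lt_div_iff₀ (by positivity)] at ht
          nlinarith [abs_nonneg t]
        rw [this]; simp only [zero_mul]; positivity
    · refine Continuous.continuousOn (continuous_iff_continuousAt.2 fun x => ?_)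
      by_cases hx : x = 0
      · have h0 : (fun x => ψ x * P x y) =ᶠ[𝓝 x] fun _ => 0 := by
          have : ∀ᶠ t in 𝓝 x, (n : ℝ) * |t| < 1 := by
            have hc : Continuous fun t : ℝ => (n : ℝ) * |t| := by fun_prop
            exact hc.continuousAt.eventually_lt continuousAt_const (by simp [hx])
          filter_upwards [this] with t ht
          have : ψ t = 0 := max_eq_left ((min_le_right _ _).trans (by linarith))
          rw [this, zero_mul]
        exact continuousAt_const.congr h0.symm
      · have := (hP.cont x y (Or.inl hx)).comp
          (f := fun x : ℝ => (x, y)) (by fun_prop : ContinuousAt (fun x : ℝ => (x, y)) x)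
        exact ψc.continuousAt.mul this
    · simp only [add_sub_cancel_left, sub_sub_cancel, max_self, NNReal.coe_zero, sub_zero]
      exact le_rfl
  obtain ⟨η, h0, hη⟩ := hpl.exists_eq_forall_mem_Icc_hasDerivWithinAt₀
  refine ⟨η, h0, fun x hx y hy => ?_, fun x hx hn => ?_⟩
  · have := (convex_Icc (x₀ - (n : ℝ)) (x₀ + n)).norm_image_sub_le_of_norm_hasDerivWithin_le
      hη (fun t _ => bd t (η t)) hy hx
    simpa [Real.norm_eq_abs] using this
  · have := (hη x (Ioo_subset_Icc_self hx)).hasDerivAt (Icc_mem_nhds hx.1 hx.2)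
    have h1 : ψ x = 1 := by grind
    simpa [h1] using this

/-- Through every point of the plane passes a complete leaf. -/
theorem SlopeField.exists_leaf (hP : SlopeField κ P) (x₀ y₀ : ℝ) :
    ∃ η, IsLeaf κ P η ∧ η x₀ = y₀ := by
  choose f hf0 hflip hfd using hP.exists_approx x₀ y₀
  have hlarge : ∀ x : ℝ, ∀ᶠ n : ℕ in Filter.hyperfilter ℕ, x ∈ Ioo (x₀ - (n : ℝ)) (x₀ + n) := by
    intro x
    have : ∀ᶠ n : ℕ in Filter.atTop, |x - x₀| < n :=
      tendsto_natCast_atTop_atTop.eventually_gt_atTop _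
    refine Nat.hyperfilter_le_atTop ?_
    filter_upwards [this] with n hn
    rw [abs_lt] at hn
    constructor <;> linarith
  have hlim : ∀ x, ∃ y, Filter.Tendsto (fun n => f n x) (Filter.hyperfilter ℕ) (𝓝 y) := by
    intro x
    have hK : IsCompact (Icc (y₀ - κ * |x - x₀|) (y₀ + κ * |x - x₀|)) := isCompact_Icc
    obtain ⟨y, -, hy⟩ := hK.ultrafilter_le_nhds ((Filter.hyperfilter ℕ).map (fun n => f n x)) (by
      rw [Filter.le_principal_iff]
      change ∀ᶠ n in (Filter.hyperfilter ℕ : Filter ℕ), f n x ∈ Icc _ _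
      filter_upwards [hlarge x] with n hn
      have hx0 : x₀ ∈ Icc (x₀ - (n : ℝ)) (x₀ + n) := by constructor <;> simp
      have := hflip n x (Ioo_subset_Icc_self hn) x₀ hx0
      rw [hf0, abs_le] at this
      constructor <;> linarith)
    exact ⟨y, hy⟩
  choose η hη using hlim
  have hlip : ∀ x y, |η x - η y| ≤ κ * |x - y| := fun x y => by
    refine le_of_tendsto ((hη x).sub (hη y)).abs ?_
    filter_upwards [hlarge x, hlarge y] with n hx hy
    exact hflip n x (Ioo_subset_Icc_self hx) y (Ioo_subset_Icc_self hy)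
  have hcont : Continuous η := continuous_of_abs_sub_le hlip
  have hder : ∀ x ≠ 0, HasDerivAt η (P x (η x)) x := by
    intro x hx
    rw [hasDerivAt_iff_isLittleO]
    rw [Asymptotics.isLittleO_iff]
    intro ε hε
    have hc := hP.cont x (η x) (Or.inl hx)
    rw [Metric.continuousAt_iff] at hc
    obtain ⟨δ, hδ, hc⟩ := hc ε hε
    have hxa : 0 < |x| := abs_pos.2 hx
    set ρ := min (δ / 3) (min (|x| / 2) 1) with hρ
    have hρ0 : 0 < ρ := by positivity
    have hρδ : ρ ≤ δ / 3 := min_le_left _ _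
    have hρx : ρ ≤ |x| / 2 := (min_le_right _ _).trans (min_le_left _ _)
    filter_upwards [Metric.ball_mem_nhds x hρ0] with z hz
    have hev : ∀ᶠ n : ℕ in Filter.hyperfilter ℕ,
        ‖(f n z - f n x) - P x (η x) * (z - x)‖ ≤ ε * ‖z - x‖ := by
      have h1 : ∀ᶠ n : ℕ in Filter.hyperfilter ℕ, |f n x - η x| < δ / 3 :=
        (hη x).eventually (Metric.ball_mem_nhds (η x) (by positivity : 0 < δ / 3))
      have h2 : ∀ᶠ n : ℕ in Filter.hyperfilter ℕ, 4 ≤ n * |x| := by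
        have : ∀ᶠ n : ℕ in Filter.atTop, 4 / |x| ≤ n :=
          tendsto_natCast_atTop_atTop.eventually_ge_atTop _
        refine Nat.hyperfilter_le_atTop ?_
        filter_upwards [this] with n hn
        rwa [div_le_iff₀ hxa] at hn
      filter_upwards [h1, h2, hlarge (x - ρ), hlarge (x + ρ)] with n hn1 hn2 hl hr
      have hin : ∀ t ∈ Metric.ball x ρ, t ∈ Ioo (x₀ - (n : ℝ)) (x₀ + n) := by
        intro t ht
        rw [Metric.mem_ball, Real.dist_eq, abs_lt] at ht
        exact ⟨by linarith [hl.1], by linarith [hr.2]⟩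
      have hd : ∀ t ∈ Metric.ball x ρ,
          HasDerivWithinAt (fun t => f n t - P x (η x) * t) (P t (f n t) - P x (η x))
            (Metric.ball x ρ) t := by
        intro t ht
        have ht' := hin t ht
        rw [Metric.mem_ball, Real.dist_eq] at ht
        have : |x| / 2 ≤ |t| := by grind
        have h3 := hfd n t ht' (by nlinarith [Nat.cast_nonneg (α := ℝ) n])
        have h4 : HasDerivAt (fun t => P x (η x) * t) (P x (η x)) t := by
          simpa using (hasDerivAt_id t).const_mul (P x (η x))
        exact (h3.sub h4).hasDerivWithinAt
      have hb : ∀ t ∈ Metric.ball x ρ, ‖P t (f n t) - P x (η x)‖ ≤ ε := by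
        intro t ht
        have h5 := hflip n t (Ioo_subset_Icc_self (hin t ht)) x
          (Ioo_subset_Icc_self (hin x (Metric.mem_ball_self hρ0)))
        rw [Metric.mem_ball, Real.dist_eq] at ht
        have : dist (t, f n t) (x, η x) < δ := by
          rw [Prod.dist_eq, Real.dist_eq, Real.dist_eq]
          have := abs_sub_le (f n t) (f n x) (η x)
          exact max_lt (by linarith) (by nlinarith [hP.lt_one, abs_nonneg (t - x)])
        exact (hc this).le
      have := (convex_ball x ρ).norm_image_sub_le_of_norm_hasDerivWithin_le hd hb
        (Metric.mem_ball_self hρ0) hz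
      rwa [show f n z - P x (η x) * z - (f n x - P x (η x) * x)
        = f n z - f n x - P x (η x) * (z - x) by ring] at this
    have hl : Filter.Tendsto (fun n => ‖(f n z - f n x) - P x (η x) * (z - x)‖)
        (Filter.hyperfilter ℕ) (𝓝 ‖(η z - η x) - P x (η x) * (z - x)‖) :=
      (((hη z).sub (hη x)).sub_const _).norm
    have := le_of_tendsto hl hev
    simpa [mul_comm] using this
  refine ⟨η, ⟨hlip, fun x hx => ?_⟩, ?_⟩
  · by_cases h0 : x = 0
    · subst h0
      have hc : ContinuousAt (fun x => P x (η x)) 0 :=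
        (hP.cont 0 (η 0) hx).comp (f := fun x => (x, η x)) (by fun_prop)
      exact hasDerivAt_of_hasDerivAt_of_ne (g := fun x => P x (η x)) (fun y hy => hder y hy)
        hcont.continuousAt hc
    · exact hder x h0
  · refine tendsto_nhds_unique (hη x₀) ?_
    simp only [hf0]
    exact tendsto_const_nhds

end

section

variable {κ : ℝ} {P : ℝ → ℝ → ℝ} {η ζ : ℝ → ℝ}

theorem SlopeField.lipschitz_near (hP : SlopeField κ P) {x₁ y₁ : ℝ} (h : x₁ ≠ 0 ∨ y₁ ≠ 0) :
    ∃ K : NNReal, ∃ s ∈ 𝓝 y₁, ∀ᶠ x in 𝓝 x₁, LipschitzOnWith K (P x) s := by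
  by_cases hx : x₁ = 0
  · have hy : y₁ ≠ 0 := h.resolve_left (not_not.2 hx)
    obtain ⟨K, hK⟩ := hP.lip (|y₁| / 2) (by positivity)
    rcases lt_or_gt_of_ne hy with hy | hy
    · refine ⟨K, Iic (-(|y₁| / 2)), Iic_mem_nhds (by rw [abs_of_neg hy]; linarith), ?_⟩
      exact .of_forall fun x => LipschitzOnWith.of_dist_le_mul fun y hy y' hy' =>
        hK x y y' (Or.inr (Or.inr ⟨hy, hy'⟩))
    · refine ⟨K, Ici (|y₁| / 2), Ici_mem_nhds (by rw [abs_of_pos hy]; linarith), ?_⟩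
      exact .of_forall fun x => LipschitzOnWith.of_dist_le_mul fun y hy y' hy' =>
        hK x y y' (Or.inr (Or.inl ⟨hy, hy'⟩))
  · obtain ⟨K, hK⟩ := hP.lip (|x₁| / 2) (by positivity)
    refine ⟨K, univ, Filter.univ_mem, ?_⟩
    have : ∀ᶠ x in 𝓝 x₁, |x₁| / 2 < |x| :=
      continuousAt_const.eventually_lt continuous_abs.continuousAt
        (by have := abs_pos.2 hx; linarith)
    filter_upwards [this] with x hx
    refine LipschitzOnWith.of_dist_le_mul fun y _ y' _ => ?_
    exact hK x y y' (Or.inl hx.le)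

/-- A curve tangent to the slope field that meets a leaf stays in it. -/
theorem SlopeField.curve_mem_leaf (hP : SlopeField κ P) (hζ : IsLeaf κ P ζ) {x y x' : ℝ → ℝ}
    {I : Set ℝ} (hI : IsOpen I) (hIc : IsPreconnected I)
    (hx : ∀ t ∈ I, HasDerivAt x (x' t) t) (hx' : ContinuousOn x' I)
    (hy : ∀ t ∈ I, HasDerivAt y (P (x t) (y t) * x' t) t)
    (h0 : ∀ t ∈ I, x t ≠ 0 ∨ y t ≠ 0) {t₀ : ℝ} (ht₀ : t₀ ∈ I) (h : y t₀ = ζ (x t₀)) :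
    ∀ t ∈ I, y t = ζ (x t) := by
  have key : ∀ t₁ ∈ I, y t₁ = ζ (x t₁) → t₁ ∈ interior {t | y t = ζ (x t)} := by
    intro t₁ ht₁ h₁
    obtain ⟨K, s, hs, hK⟩ := hP.lipschitz_near (h0 t₁ ht₁)
    have hIn : I ∈ 𝓝 t₁ := hI.mem_nhds ht₁
    have hxc : ContinuousAt x t₁ := (hx t₁ ht₁).continuousAt
    have hyc : ContinuousAt y t₁ := (hy t₁ ht₁).continuousAt
    have hζc : ContinuousAt (fun t => ζ (x t)) t₁ := hζ.continuous.continuousAt.comp hxc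
    have hx'c : ContinuousAt x' t₁ := hx'.continuousAt hIn
    obtain ⟨C, hC⟩ : ∃ C : NNReal, ∀ᶠ t in 𝓝 t₁, ‖x' t‖ ≤ C := by
      refine ⟨⟨‖x' t₁‖ + 1, by positivity⟩, ?_⟩
      filter_upwards [hx'c.norm.eventually_lt (continuousAt_const (y := ‖x' t₁‖ + 1)) (by simp)]
        with t ht using ht.le
    have hne : ∀ᶠ t in 𝓝 t₁, x t ≠ 0 ∨ ζ (x t) ≠ 0 := by
      rcases h0 t₁ ht₁ with h2 | h2
      · filter_upwards [hxc.eventually_ne h2] with t ht using Or.inl ht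
      · rw [h₁] at h2
        filter_upwards [hζc.eventually_ne h2] with t ht using Or.inr ht
    have := ODE_solution_unique_of_eventually (v := fun t Y => P (x t) Y * x' t) (s := fun _ => s)
      (K := K * C) (f := y) (g := fun t => ζ (x t)) (t₀ := t₁) ?_ ?_ ?_ h₁
    · rw [mem_interior_iff_mem_nhds]
      exact this
    · filter_upwards [hxc.eventually hK, hC] with t hKt hCt
      refine LipschitzOnWith.of_dist_le_mul fun Y hY Y' hY' => ?_
      rw [Real.dist_eq, ← sub_mul, abs_mul]
      have h3 := hKt.dist_le_mul Y hY Y' hY'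
      rw [Real.dist_eq] at h3
      rw [Real.norm_eq_abs] at hCt
      calc |P (x t) Y - P (x t) Y'| * |x' t| ≤ (K * dist Y Y') * C := by gcongr
        _ = _ := by push_cast; ring
    · filter_upwards [hIn, hyc.eventually hs] with t ht hts
      exact ⟨hy t ht, hts⟩
    · rw [h₁] at hs
      filter_upwards [hIn, hne, hζc.eventually hs] with t ht hnt hts
      refine ⟨?_, hts⟩
      exact (hζ.deriv (x t) hnt).comp t (hx t ht)
  have hsub : I ⊆ interior {t | y t = ζ (x t)} := by
    refine hIc.subset_of_closure_inter_subset isOpen_interior ⟨t₀, ht₀, key t₀ ht₀ h⟩ ?_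
    rintro t ⟨htc, htI⟩
    refine key t htI ?_
    by_contra hne
    have hd : ContinuousAt (fun t => y t - ζ (x t)) t :=
      (hy t htI).continuousAt.sub (hζ.continuous.continuousAt.comp (hx t htI).continuousAt)
    exact mem_closure_iff_frequently.1 (closure_mono interior_subset htc)
      ((hd.eventually_ne (sub_ne_zero.2 hne)).mono fun t' ht' he => ht' (sub_eq_zero.2 he))
  exact fun t ht => (hsub.trans interior_subset ht :)

theorem IsLeaf.eqOn_of_ne (hP : SlopeField κ P) (hη : IsLeaf κ P η) (hζ : IsLeaf κ P ζ)
    {I : Set ℝ} (hI : IsOpen I) (hIc : IsPreconnected I) (h0 : ∀ t ∈ I, t ≠ 0 ∨ η t ≠ 0)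
    {x₀ : ℝ} (hx₀ : x₀ ∈ I) (h : η x₀ = ζ x₀) : ∀ x ∈ I, η x = ζ x :=
  hP.curve_mem_leaf hζ (x := id) (x' := fun _ => 1) hI hIc (fun t _ => hasDerivAt_id t)
    continuousOn_const (fun t ht => by simpa using hη.deriv t (h0 t ht)) h0 hx₀ h

theorem IsLeaf.eqOn_nonneg (hP : SlopeField κ P) (hη : IsLeaf κ P η) (hζ : IsLeaf κ P ζ)
    {x₀ : ℝ} (hx₀ : 0 < x₀) (h : η x₀ = ζ x₀) {x : ℝ} (hx : 0 ≤ x) : η x = ζ x := by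
  have h1 : EqOn η ζ (Ioi 0) := hη.eqOn_of_ne hP hζ isOpen_Ioi isPreconnected_Ioi
    (fun t ht => Or.inl (ne_of_gt ht)) hx₀ h
  have := h1.closure hη.continuous hζ.continuous
  rw [closure_Ioi] at this
  exact this hx

theorem IsLeaf.eqOn_nonpos (hP : SlopeField κ P) (hη : IsLeaf κ P η) (hζ : IsLeaf κ P ζ)
    {x₀ : ℝ} (hx₀ : x₀ < 0) (h : η x₀ = ζ x₀) {x : ℝ} (hx : x ≤ 0) : η x = ζ x := by
  have h1 : EqOn η ζ (Iio 0) := hη.eqOn_of_ne hP hζ isOpen_Iio isPreconnected_Iio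
    (fun t ht => Or.inl (ne_of_lt ht)) hx₀ h
  have := h1.closure hη.continuous hζ.continuous
  rw [closure_Iio] at this
  exact this hx

theorem IsLeaf.apply_zero_eq (hP : SlopeField κ P) (hη : IsLeaf κ P η) (hζ : IsLeaf κ P ζ)
    {x₀ : ℝ} (h : η x₀ = ζ x₀) : η 0 = ζ 0 := by
  rcases lt_trichotomy x₀ 0 with h0 | h0 | h0
  · exact hη.eqOn_nonpos hP hζ h0 h le_rfl
  · rwa [h0] at h
  · exact hη.eqOn_nonneg hP hζ h0 h le_rfl

theorem IsLeaf.eq_of_apply_zero_ne (hP : SlopeField κ P) (hη : IsLeaf κ P η) (hζ : IsLeaf κ P ζ)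
    (h0 : η 0 ≠ 0) {x₀ : ℝ} (h : η x₀ = ζ x₀) : η = ζ := by
  funext x
  exact hη.eqOn_of_ne hP hζ isOpen_univ isPreconnected_univ (by grind) (mem_univ x₀) h x
    (mem_univ x)

theorem exists_eq_of_lt_of_lt (hη : Continuous η) (hζ : Continuous ζ) {x y : ℝ} (h : η x < ζ x)
    (h' : ζ y < η y) : ∃ z ∈ uIcc x y, η z = ζ z := by
  have hc : ContinuousOn (fun t => η t - ζ t) (uIcc x y) := (hη.sub hζ).continuousOn
  have := intermediate_value_uIcc hc
  have h0 : (0 : ℝ) ∈ uIcc (η x - ζ x) (η y - ζ y) := by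
    rw [mem_uIcc]; left; constructor <;> linarith
  obtain ⟨z, hz, hz0⟩ := this h0
  exact ⟨z, hz, by simpa [sub_eq_zero] using hz0⟩

theorem IsLeaf.apply_zero_le (hP : SlopeField κ P) (hη : IsLeaf κ P η) (hζ : IsLeaf κ P ζ)
    {x₀ : ℝ} (h : η x₀ < ζ x₀) : η 0 ≤ ζ 0 := by
  by_contra! hc
  obtain ⟨z, -, hz⟩ := exists_eq_of_lt_of_lt hη.continuous hζ.continuous h hc
  exact hc.ne' (hη.apply_zero_eq hP hζ hz)

theorem IsLeaf.apply_zero_lt (hP : SlopeField κ P) (hη : IsLeaf κ P η) (hζ : IsLeaf κ P ζ)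
    {x₀ : ℝ} (h : η x₀ < ζ x₀) (h0 : η 0 ≠ 0 ∨ ζ 0 ≠ 0) : η 0 < ζ 0 := by
  refine lt_of_le_of_ne (hη.apply_zero_le hP hζ h) fun he => ?_
  rw [hη.eq_of_apply_zero_ne hP hζ (by grind) he] at h
  exact lt_irrefl _ h

/-- A chosen leaf through the point `(x, y)`. -/
def SlopeField.leaf (hP : SlopeField κ P) (x y : ℝ) : ℝ → ℝ := (hP.exists_leaf x y).choose

theorem SlopeField.isLeaf_leaf (hP : SlopeField κ P) (x y : ℝ) : IsLeaf κ P (hP.leaf x y) :=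
  (hP.exists_leaf x y).choose_spec.1

theorem SlopeField.leaf_apply (hP : SlopeField κ P) (x y : ℝ) : hP.leaf x y x = y :=
  (hP.exists_leaf x y).choose_spec.2

/-- The height at which the leaf through `(x, y)` crosses the vertical axis. -/
def SlopeField.label (hP : SlopeField κ P) (x y : ℝ) : ℝ := hP.leaf x y 0

theorem SlopeField.label_leaf (hP : SlopeField κ P) (hη : IsLeaf κ P η) (x : ℝ) :
    hP.label x (η x) = η 0 :=
  (hP.isLeaf_leaf x (η x)).apply_zero_eq hP hη (hP.leaf_apply x (η x))

theorem SlopeField.label_zero (hP : SlopeField κ P) (y : ℝ) : hP.label 0 y = y := hP.leaf_apply 0 y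

theorem SlopeField.abs_label_sub_le (hP : SlopeField κ P) (x y : ℝ) :
    |hP.label x y - y| ≤ κ * |x| := by
  have := (hP.isLeaf_leaf x y).lip 0 x
  rwa [hP.leaf_apply, zero_sub, abs_neg] at this

theorem SlopeField.label_le_of_lt (hP : SlopeField κ P) (hη : IsLeaf κ P η) {x y : ℝ}
    (h : η x < y) : η 0 ≤ hP.label x y :=
  hη.apply_zero_le hP (hP.isLeaf_leaf x y) (by rwa [hP.leaf_apply])

theorem SlopeField.le_label_of_lt (hP : SlopeField κ P) (hη : IsLeaf κ P η) {x y : ℝ}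
    (h : y < η x) : hP.label x y ≤ η 0 :=
  (hP.isLeaf_leaf x y).apply_zero_le hP hη (by rwa [hP.leaf_apply])

theorem SlopeField.lt_label_iff (hP : SlopeField κ P) (hη : IsLeaf κ P η) (h0 : η 0 ≠ 0)
    (x y : ℝ) : η 0 < hP.label x y ↔ η x < y := by
  have h1 := hP.le_label_of_lt hη (x := x) (y := y)
  have h2 := hP.label_leaf hη x
  have h3 := fun h : η x < y =>
    hη.apply_zero_lt hP (hP.isLeaf_leaf x y) (by rwa [hP.leaf_apply]) (Or.inl h0)
  grind [label]

theorem SlopeField.label_lt_iff (hP : SlopeField κ P) (hη : IsLeaf κ P η) (h0 : η 0 ≠ 0)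
    (x y : ℝ) : hP.label x y < η 0 ↔ y < η x := by
  have h1 := hP.label_le_of_lt hη (x := x) (y := y)
  have h2 := hP.label_leaf hη x
  have h3 := fun h : y < η x =>
    (hP.isLeaf_leaf x y).apply_zero_lt hP hη (by rwa [hP.leaf_apply]) (Or.inr h0)
  grind [label]

theorem SlopeField.continuous_label (hP : SlopeField κ P) :
    Continuous fun z : ℝ² => hP.label z.1 z.2 := by
  have hup : ∀ γ ≠ 0, IsOpen {z : ℝ² | γ < hP.label z.1 z.2} := by
    intro γ hγ
    have hl := hP.isLeaf_leaf 0 γ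
    have h0 : hP.leaf 0 γ 0 = γ := hP.leaf_apply 0 γ
    have := fun z : ℝ² => hP.lt_label_iff hl (by rwa [h0]) z.1 z.2
    simp only [h0] at this
    simp only [this]
    exact isOpen_lt (hl.continuous.comp continuous_fst) continuous_snd
  have hdn : ∀ γ ≠ 0, IsOpen {z : ℝ² | hP.label z.1 z.2 < γ} := by
    intro γ hγ
    have hl := hP.isLeaf_leaf 0 γ
    have h0 : hP.leaf 0 γ 0 = γ := hP.leaf_apply 0 γ
    have := fun z : ℝ² => hP.label_lt_iff hl (by rwa [h0]) z.1 z.2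
    simp only [h0] at this
    simp only [this]
    exact isOpen_lt continuous_snd (hl.continuous.comp continuous_fst)
  refine continuous_iff_continuousAt.2 fun z => ?_
  rw [ContinuousAt, tendsto_order]
  constructor
  · intro a ha
    obtain ⟨γ, hγ, hγ0⟩ : ∃ γ, (a ≤ γ ∧ γ < hP.label z.1 z.2) ∧ γ ≠ 0 :=
      ⟨if a = 0 then hP.label z.1 z.2 / 2 else a, by grind⟩
    filter_upwards [(hup γ hγ0).mem_nhds hγ.2] with w hw using hγ.1.trans_lt hw
  · intro a ha
    obtain ⟨γ, hγ, hγ0⟩ : ∃ γ, (γ ≤ a ∧ hP.label z.1 z.2 < γ) ∧ γ ≠ 0 :=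
      ⟨if a = 0 then hP.label z.1 z.2 / 2 else a, by grind⟩
    filter_upwards [(hdn γ hγ0).mem_nhds hγ.2] with w hw using hw.trans_le hγ.1

/-- Leaves through the origin are unique on the right. -/
def UniqueRight (κ : ℝ) (P : ℝ → ℝ → ℝ) : Prop :=
  ∀ η ζ, IsLeaf κ P η → IsLeaf κ P ζ → η 0 = 0 → ζ 0 = 0 → ∀ x, 0 ≤ x → η x = ζ x

/-- Leaves through the origin are unique on the left. -/
def UniqueLeft (κ : ℝ) (P : ℝ → ℝ → ℝ) : Prop :=
  ∀ η ζ, IsLeaf κ P η → IsLeaf κ P ζ → η 0 = 0 → ζ 0 = 0 → ∀ x, x ≤ 0 → η x = ζ x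

theorem IsLeaf.eq_of_unique (hP : SlopeField κ P) (hr : UniqueRight κ P) (hl : UniqueLeft κ P)
    (hη : IsLeaf κ P η) (hζ : IsLeaf κ P ζ) {x₀ : ℝ} (h : η x₀ = ζ x₀) : η = ζ := by
  by_cases h0 : η 0 = 0
  · have h0' : ζ 0 = 0 := by rw [← hη.apply_zero_eq hP hζ h, h0]
    funext x
    rcases le_total 0 x with hx | hx
    · exact hr η ζ hη hζ h0 h0' x hx
    · exact hl η ζ hη hζ h0 h0' x hx
  · exact hη.eq_of_apply_zero_ne hP hζ h0 h

theorem SlopeField.lt_label_of_lt (hP : SlopeField κ P) (hr : UniqueRight κ P)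
    (hl : UniqueLeft κ P) (hη : IsLeaf κ P η) {x y : ℝ} (h : η x < y) : η 0 < hP.label x y := by
  refine lt_of_le_of_ne (hP.label_le_of_lt hη h) fun he => ?_
  have := hη.eq_of_unique hP hr hl (hP.isLeaf_leaf x y) he
  rw [this, hP.leaf_apply] at h
  exact lt_irrefl _ h

/-- A leaf of a slope field `y' = P x y` crosses a leaf of a slope field `x' = Q y x`. -/
theorem exists_crossing {Q : ℝ → ℝ → ℝ} {ξ : ℝ → ℝ} (hP : SlopeField κ P) (hη : IsLeaf κ P η)
    (hξ : IsLeaf κ Q ξ) : ∃ x, ξ (η x) = x := by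
  have hc : Continuous fun x => x - ξ (η x) := continuous_id.sub (hξ.continuous.comp hη.continuous)
  set C := |ξ 0| + |η 0| with hC
  have h0 := hP.nonneg
  have h1 := hP.lt_one
  have hb : ∀ x, |ξ (η x)| ≤ C + κ * |x| := by
    intro x
    have e1 := hξ.lip (η x) 0
    have e2 := hη.lip x 0
    rw [sub_zero] at e1 e2
    have : κ * |η x| ≤ |η x| := by nlinarith [abs_nonneg (η x)]
    grind
  set X := C / (1 - κ) with hX
  have hC0 : 0 ≤ C := by positivity
  have hX0 : 0 ≤ X := div_nonneg hC0 (by linarith)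
  have hXC : C + κ * X = X := by rw [hX]; field_simp [(by linarith : (1 - κ) ≠ 0)]; ring
  have hr := hb X
  have hl := hb (-X)
  rw [abs_neg] at hl
  rw [abs_of_nonneg hX0, hXC, abs_le] at hr hl
  have := intermediate_value_Icc (by linarith : -X ≤ X) hc.continuousOn
  obtain ⟨x, -, hx⟩ := this (show (0 : ℝ) ∈ Icc _ _ from ⟨by linarith, by linarith⟩)
  exact ⟨x, by simp only at hx; linarith⟩

end

section

variable {κ : ℝ} {P Q : ℝ → ℝ → ℝ} {η ζ ξ : ℝ → ℝ}

/-! ### Homeomorphisms straightening two transverse foliations -/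

theorem crossing_unique (hP : SlopeField κ P) (hη : IsLeaf κ P η) (hξ : IsLeaf κ Q ξ) {x z : ℝ}
    (hx : ξ (η x) = x) (hz : ξ (η z) = z) : x = z := by
  have h1 := hξ.lip (η x) (η z)
  rw [hx, hz] at h1
  by_contra hne
  nlinarith [hP.nonneg, hP.lt_one, abs_pos.2 (sub_ne_zero.2 hne), hη.lip x z,
    abs_nonneg (η x - η z)]

/-- A continuous bijection of the plane which does not contract too much at infinity is a
homeomorphism. -/
theorem exists_homeomorph_of_bijective {f : ℝ² → ℝ²} (hc : Continuous f)
    (hb : Function.Bijective f) {C : ℝ} (hC0 : 0 < C) (hC : ∀ z, ‖z‖ ≤ C * ‖f z‖) :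
    ∃ h : ℝ² ≃ₜ ℝ², ∀ z, h z = f z := by
  have : IsProperMap f := by
    rw [isProperMap_iff_tendsto_cocompact, ← Metric.cobounded_eq_cocompact,
      ← tendsto_norm_atTop_iff_cobounded]
    refine ⟨hc, Filter.tendsto_atTop_mono (fun z => ?_)
      (tendsto_norm_cobounded_atTop.const_mul_atTop (inv_pos.2 hC0))⟩
    rw [inv_mul_le_iff₀ hC0]
    exact hC z
  exact ⟨(Equiv.ofBijective f hb).toHomeomorphOfContinuousClosed hc this.isClosedMap, fun z => rfl⟩

theorem norm_le_of_labels (hP : SlopeField κ P) (hQ : SlopeField κ Q) (z : ℝ²) {r : ℝ}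
    (h1 : |hQ.label z.2 z.1| ≤ r) (h2 : |hP.label z.1 z.2| ≤ r) : ‖z‖ ≤ (1 - κ)⁻¹ * r := by
  have hk := hP.lt_one
  have h0 := hP.nonneg
  have e1 := hP.abs_label_sub_le z.1 z.2
  have e2 := hQ.abs_label_sub_le z.2 z.1
  have a1 : |z.2| ≤ r + κ * |z.1| := by grind
  have a2 : |z.1| ≤ r + κ * |z.2| := by grind
  rw [le_inv_mul_iff₀ (by linarith), Prod.norm_def, Real.norm_eq_abs, Real.norm_eq_abs]
  rcases max_cases |z.1| |z.2| with ⟨h, h'⟩ | ⟨h, h'⟩ <;> rw [h] <;> nlinarith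

/-- Points on a common leaf of the first field and a common leaf of the second field agree. -/
theorem eq_of_mem_leaves (hP : SlopeField κ P) (hη : IsLeaf κ P η) (hξ : IsLeaf κ Q ξ)
    {z w : ℝ²} (h1 : z.2 = η z.1) (h2 : w.2 = η w.1) (h3 : z.1 = ξ z.2) (h4 : w.1 = ξ w.2) :
    z = w := by
  have := crossing_unique hP hη hξ (x := z.1) (z := w.1) (by rw [← h1, ← h3])
    (by rw [← h2, ← h4])
  exact Prod.ext this (by rw [h1, h2, this])

theorem exists_homeomorph_labels (hP : SlopeField κ P) (hPr : UniqueRight κ P)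
    (hPl : UniqueLeft κ P) (hQ : SlopeField κ Q) (hQr : UniqueRight κ Q) (hQl : UniqueLeft κ Q) :
    ∃ h : ℝ² ≃ₜ ℝ², ∀ z, h z = (hQ.label z.2 z.1, hP.label z.1 z.2) := by
  refine exists_homeomorph_of_bijective (f := fun z => (hQ.label z.2 z.1, hP.label z.1 z.2))
    ?_ ⟨?_, ?_⟩ (inv_pos.2 (sub_pos.2 hP.lt_one)) ?_
  · exact (hQ.continuous_label.comp continuous_swap).prodMk hP.continuous_label
  · intro z w h
    simp only [Prod.mk.injEq] at h
    have e1 := (hP.isLeaf_leaf z.1 z.2).eq_of_unique hP hPr hPl (hP.isLeaf_leaf w.1 w.2) h.2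
    have e2 := (hQ.isLeaf_leaf z.2 z.1).eq_of_unique hQ hQr hQl (hQ.isLeaf_leaf w.2 w.1) h.1
    refine eq_of_mem_leaves hP (hP.isLeaf_leaf z.1 z.2) (hQ.isLeaf_leaf z.2 z.1)
      (hP.leaf_apply _ _).symm ?_ (hQ.leaf_apply _ _).symm ?_
    · rw [e1, hP.leaf_apply]
    · rw [e2, hQ.leaf_apply]
  · rintro ⟨a, c⟩
    obtain ⟨x, hx⟩ := exists_crossing hP (hP.isLeaf_leaf 0 c) (hQ.isLeaf_leaf 0 a)
    refine ⟨(x, hP.leaf 0 c x), ?_⟩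
    simp only
    rw [hP.label_leaf (hP.isLeaf_leaf 0 c), hP.leaf_apply]
    have := hQ.label_leaf (hQ.isLeaf_leaf 0 a) (hP.leaf 0 c x)
    rw [hx, hQ.leaf_apply] at this
    rw [this]
  · intro z
    exact norm_le_of_labels hP hQ z (norm_fst_le (hQ.label z.2 z.1, hP.label z.1 z.2))
      (norm_snd_le (hQ.label z.2 z.1, hP.label z.1 z.2))

/-- The position, between `-1` and `1`, of the leaf through `(x, y)` relative to the leaves that
end at the origin from the left and cross the line `x = -1` at heights in `[lo, hi]`. -/
def SlopeField.spread (hP : SlopeField κ P) (lo hi x y : ℝ) : ℝ :=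
  max (-1) (min 1 ((2 * hP.leaf x y (-1) - lo - hi) / (hi - lo)))

theorem SlopeField.label_mono (hP : SlopeField κ P) (x : ℝ) : Monotone (hP.label x) := by
  intro y y' h
  rcases h.lt_or_eq with h | rfl
  · exact hP.label_le_of_lt (hP.isLeaf_leaf x y) (by rwa [hP.leaf_apply])
  · rfl

/-- The heights at `x = -1` of the leaves through the origin form an interval. -/
theorem SlopeField.exists_Icc_label_eq_zero (hP : SlopeField κ P) (hη : IsLeaf κ P η)
    (hζ : IsLeaf κ P ζ) (hη0 : η 0 = 0) (hζ0 : ζ 0 = 0) (h : η (-1) < ζ (-1)) :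
    ∃ lo hi, lo < hi ∧ ∀ y, hP.label (-1) y = 0 ↔ y ∈ Icc lo hi := by
  set Z := {y | hP.label (-1) y = 0} with hZ
  have hcl : IsClosed Z := isClosed_eq
    (hP.continuous_label.comp (by fun_prop : Continuous fun y : ℝ => ((-1 : ℝ), y))) continuous_const
  have hbd : Z ⊆ Icc (-κ) κ := by
    intro y hy
    have := hP.abs_label_sub_le (-1) y
    rw [show hP.label (-1) y = 0 from hy] at this
    simp only [zero_sub, abs_neg, abs_one, mul_one] at this
    exact abs_le.1 this
  have hKc : IsCompact Z := isCompact_Icc.of_isClosed_subset hcl hbd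
  have h1 : η (-1) ∈ Z := by rw [hZ, mem_ofPred_eq, hP.label_leaf hη, hη0]
  have h2 : ζ (-1) ∈ Z := by rw [hZ, mem_ofPred_eq, hP.label_leaf hζ, hζ0]
  have hm := hP.label_mono (-1)
  refine ⟨sInf Z, sSup Z, ?_, fun y => ⟨fun hy => ⟨csInf_le hKc.bddBelow hy,
    le_csSup hKc.bddAbove hy⟩, fun hy => le_antisymm ?_ ?_⟩⟩
  · exact (csInf_le hKc.bddBelow h1).trans_lt (h.trans_le (le_csSup hKc.bddAbove h2))
  · exact (hm hy.2).trans_eq (hKc.sSup_mem ⟨_, h1⟩)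
  · exact (hKc.sInf_mem ⟨_, h1⟩ : _ = _).symm.trans_le (hm hy.1)

section Saddle

variable {lo hi : ℝ}

theorem SlopeField.spread_mem (hP : SlopeField κ P) (x y : ℝ) :
    hP.spread lo hi x y ∈ Icc (-1 : ℝ) 1 :=
  ⟨le_max_left _ _, max_le (by norm_num) (min_le_left _ _)⟩

theorem SlopeField.label_leaf_neg_one (hP : SlopeField κ P) (x y : ℝ) :
    hP.label (-1) (hP.leaf x y (-1)) = hP.label x y :=
  hP.label_leaf (hP.isLeaf_leaf x y) (-1)

theorem SlopeField.spread_of_pos (hlh : lo < hi) (hP : SlopeField κ P)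
    (hI : ∀ y, hP.label (-1) y = 0 ↔ y ∈ Icc lo hi) {x y : ℝ} (h : 0 < hP.label x y) :
    hP.spread lo hi x y = 1 := by
  rw [← hP.label_leaf_neg_one] at h
  have hgt : hi ≤ hP.leaf x y (-1) := by
    by_contra! hc
    have := hP.label_mono (-1) hc.le
    grind
  have : 1 ≤ (2 * hP.leaf x y (-1) - lo - hi) / (hi - lo) := by
    rw [le_div_iff₀ (by linarith)]; linarith
  grind [spread]

theorem SlopeField.spread_of_neg (hlh : lo < hi) (hP : SlopeField κ P)
    (hI : ∀ y, hP.label (-1) y = 0 ↔ y ∈ Icc lo hi) {x y : ℝ} (h : hP.label x y < 0) :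
    hP.spread lo hi x y = -1 := by
  rw [← hP.label_leaf_neg_one] at h
  have hgt : hP.leaf x y (-1) ≤ lo := by
    by_contra! hc
    have := hP.label_mono (-1) hc.le
    grind
  have : (2 * hP.leaf x y (-1) - lo - hi) / (hi - lo) ≤ -1 := by
    rw [div_le_iff₀ (by linarith)]; linarith
  grind [spread]

theorem SlopeField.spread_of_zero (hlh : lo < hi) (hP : SlopeField κ P)
    (hI : ∀ y, hP.label (-1) y = 0 ↔ y ∈ Icc lo hi) {x y : ℝ} (h : hP.label x y = 0) :
    hP.spread lo hi x y = (2 * hP.leaf x y (-1) - lo - hi) / (hi - lo) := by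
  rw [← hP.label_leaf_neg_one, hI] at h
  have h1 : (2 * hP.leaf x y (-1) - lo - hi) / (hi - lo) ≤ 1 := by
    rw [div_le_iff₀ (by linarith)]; linarith [h.2]
  have h2 : -1 ≤ (2 * hP.leaf x y (-1) - lo - hi) / (hi - lo) := by
    rw [le_div_iff₀ (by linarith)]; linarith [h.1]
  rw [spread, min_eq_right h1, max_eq_right h2]

theorem SlopeField.leaf_neg_one_lt_iff (hP : SlopeField κ P) (hη : IsLeaf κ P η) {x : ℝ}
    (hx : x < 0) (y : ℝ) : hP.leaf x y (-1) < η (-1) ↔ y < η x := by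
  have hl := hP.isLeaf_leaf x y
  have he := hP.leaf_apply x y
  have key : ∀ z ∈ uIcc (-1) x, z < 0 := fun z hz => by
    rcases mem_uIcc.1 hz with h | h <;> linarith [h.2]
  constructor
  · intro h
    by_contra! hc
    rcases hc.lt_or_eq with hc | hc
    · obtain ⟨z, hz, hzz⟩ := exists_eq_of_lt_of_lt hl.continuous hη.continuous h (y := x)
        (by rwa [he])
      exact h.ne (hl.eqOn_nonpos hP hη (key z hz) hzz (by norm_num))
    · exact h.ne (hl.eqOn_nonpos hP hη hx (by rw [he, hc]) (by norm_num))
  · intro h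
    by_contra! hc
    rcases hc.lt_or_eq with hc | hc
    · obtain ⟨z, hz, hzz⟩ := exists_eq_of_lt_of_lt hη.continuous hl.continuous hc (y := x)
        (by rwa [he])
      have := hη.eqOn_nonpos hP hl (key z hz) hzz hx.le
      rw [he] at this; exact h.ne' this
    · have := hη.eqOn_nonpos hP hl (by norm_num) hc hx.le
      rw [he] at this; exact h.ne' this

theorem SlopeField.lt_leaf_neg_one_iff (hP : SlopeField κ P) (hη : IsLeaf κ P η) {x : ℝ}
    (hx : x < 0) (y : ℝ) : η (-1) < hP.leaf x y (-1) ↔ η x < y := by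
  have h1 := hP.leaf_neg_one_lt_iff hη hx y
  have he := hP.leaf_apply x y
  have hl := hP.isLeaf_leaf x y
  have h2 : hP.leaf x y (-1) = η (-1) ↔ y = η x :=
    ⟨fun h => he.symm.trans (hl.eqOn_nonpos hP hη (by norm_num) h hx.le),
      fun h => hl.eqOn_nonpos hP hη hx (he.trans h) (by norm_num)⟩
  grind

theorem SlopeField.continuousAt_leaf_neg_one (hP : SlopeField κ P) {z : ℝ²} (hz : z.1 < 0) :
    ContinuousAt (fun w : ℝ² => hP.leaf w.1 w.2 (-1)) z := by
  have hneg : ∀ᶠ w : ℝ² in 𝓝 z, w.1 < 0 := continuousAt_fst.eventually_lt continuousAt_const hz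
  rw [ContinuousAt, tendsto_order]
  constructor
  · intro a ha
    have hl := hP.isLeaf_leaf (-1) a
    have he := hP.leaf_apply (-1) a
    rw [← he] at ha ⊢
    have h1 := (hP.lt_leaf_neg_one_iff hl hz z.2).1 ha
    have : ∀ᶠ w : ℝ² in 𝓝 z, hP.leaf (-1) a w.1 < w.2 :=
      (hl.continuous.comp continuous_fst).continuousAt.eventually_lt continuousAt_snd h1
    filter_upwards [hneg, this] with w hw1 hw2
    exact (hP.lt_leaf_neg_one_iff hl hw1 w.2).2 hw2
  · intro a ha
    have hl := hP.isLeaf_leaf (-1) a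
    have he := hP.leaf_apply (-1) a
    rw [← he] at ha ⊢
    have h1 := (hP.leaf_neg_one_lt_iff hl hz z.2).1 ha
    have : ∀ᶠ w : ℝ² in 𝓝 z, w.2 < hP.leaf (-1) a w.1 :=
      continuousAt_snd.eventually_lt (hl.continuous.comp continuous_fst).continuousAt h1
    filter_upwards [hneg, this] with w hw1 hw2
    exact (hP.leaf_neg_one_lt_iff hl hw1 w.2).2 hw2

theorem SlopeField.abs_le_of_label_eq_zero (hP : SlopeField κ P) {x y : ℝ}
    (h : hP.label x y = 0) : |y| ≤ κ * |x| := by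
  have := hP.abs_label_sub_le x y
  rwa [h, zero_sub, abs_neg] at this

theorem SlopeField.label_pos_of_abs_le (hQ : SlopeField κ Q) {x y : ℝ} (h : |y| ≤ κ * |x|)
    (hx : 0 < x) : 0 < hQ.label y x := by
  rw [abs_of_pos hx] at h
  nlinarith [hQ.nonneg, hQ.lt_one, abs_nonneg y, (abs_le.1 (hQ.abs_label_sub_le y x)).1]

theorem SlopeField.label_neg_of_abs_le (hQ : SlopeField κ Q) {x y : ℝ} (h : |y| ≤ κ * |x|)
    (hx : x < 0) : hQ.label y x < 0 := by
  rw [abs_of_neg hx] at h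
  nlinarith [hQ.nonneg, hQ.lt_one, abs_nonneg y, (abs_le.1 (hQ.abs_label_sub_le y x)).2]

/-- On the leaves through the origin the label of the transverse field has the sign of `x`. -/
theorem label_sign_of_label_eq_zero (hP : SlopeField κ P) (hQ : SlopeField κ Q) {x y : ℝ}
    (h : hP.label x y = 0) :
    (hQ.label y x < 0 ↔ x < 0) ∧ (0 < hQ.label y x ↔ 0 < x) ∧ (x = 0 → y = 0) := by
  have ha := hP.abs_le_of_label_eq_zero h
  have e0 : x = 0 → y = 0 := fun hx => by
    rw [hx, abs_zero, mul_zero] at ha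
    exact abs_nonpos_iff.1 ha
  have h1 := hQ.label_neg_of_abs_le ha
  have h2 := hQ.label_pos_of_abs_le ha
  have h3 := hQ.label_zero 0
  grind

/-- The second coordinate straightening a saddle-node foliation. -/
def saddleHeight (hP : SlopeField κ P) (hQ : SlopeField κ Q) (lo hi : ℝ) (z : ℝ²) : ℝ :=
  hP.label z.1 z.2 + max (-(hQ.label z.2 z.1)) 0 * hP.spread lo hi z.1 z.2

theorem continuous_saddleHeight (hlh : lo < hi) (hP : SlopeField κ P) (hQ : SlopeField κ Q)
    (hI : ∀ y, hP.label (-1) y = 0 ↔ y ∈ Icc lo hi) :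
    Continuous (saddleHeight hP hQ lo hi) := by
  have hQc : Continuous fun z : ℝ² => hQ.label z.2 z.1 :=
    hQ.continuous_label.comp continuous_swap
  refine hP.continuous_label.add (continuous_iff_continuousAt.2 fun z => ?_)
  have hmc : Continuous fun z : ℝ² => max (-(hQ.label z.2 z.1)) 0 := by fun_prop
  by_cases ha : hQ.label z.2 z.1 < 0
  · refine hmc.continuousAt.mul ?_
    rcases lt_trichotomy (hP.label z.1 z.2) 0 with hc | hc | hc
    · have : (fun w : ℝ² => hP.spread lo hi w.1 w.2) =ᶠ[𝓝 z] fun _ => -1 := by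
        filter_upwards [hP.continuous_label.continuousAt.eventually_lt continuousAt_const hc]
          with w hw using hP.spread_of_neg hlh hI hw
      exact continuousAt_const.congr this.symm
    · have hx := (label_sign_of_label_eq_zero hP hQ hc).1.1 ha
      have := hP.continuousAt_leaf_neg_one hx
      unfold SlopeField.spread
      fun_prop
    · have : (fun w : ℝ² => hP.spread lo hi w.1 w.2) =ᶠ[𝓝 z] fun _ => 1 := by
        filter_upwards [continuousAt_const.eventually_lt hP.continuous_label.continuousAt hc]
          with w hw using hP.spread_of_pos hlh hI hw
      exact continuousAt_const.congr this.symm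
  · have h0 : max (-(hQ.label z.2 z.1)) 0 = 0 := max_eq_right (by linarith)
    rw [ContinuousAt, h0, zero_mul]
    refine squeeze_zero_norm (a := fun w : ℝ² => max (-(hQ.label w.2 w.1)) 0) (fun w => ?_) ?_
    · rw [norm_mul, Real.norm_eq_abs, abs_of_nonneg (le_max_right _ _)]
      have := abs_le.2 (hP.spread_mem (lo := lo) (hi := hi) w.1 w.2)
      rw [Real.norm_eq_abs]
      nlinarith [le_max_right (-(hQ.label w.2 w.1)) 0]
    · have := hmc.tendsto z
      rwa [h0] at this

/-- The label of the leaf is determined by the straightened coordinates. -/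
def saddleLabel (w : ℝ²) : ℝ := max (w.2 - max (-w.1) 0) 0 + min (w.2 + max (-w.1) 0) 0

theorem saddleLabel_eq (hlh : lo < hi) (hP : SlopeField κ P) (hQ : SlopeField κ Q)
    (hI : ∀ y, hP.label (-1) y = 0 ↔ y ∈ Icc lo hi) (z : ℝ²) :
    saddleLabel (hQ.label z.2 z.1, saddleHeight hP hQ lo hi z) = hP.label z.1 z.2 := by
  have hs := hP.spread_mem (lo := lo) (hi := hi) z.1 z.2
  have h1 := hP.spread_of_neg hlh hI (x := z.1) (y := z.2)
  have h2 := hP.spread_of_pos hlh hI (x := z.1) (y := z.2)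
  have hn : 0 ≤ max (-(hQ.label z.2 z.1)) 0 := le_max_right _ _
  have h3 := mul_le_of_le_one_right hn hs.2
  have h4 := mul_le_mul_of_nonneg_left hs.1 hn
  simp only [saddleLabel, saddleHeight]
  grind

theorem abs_saddleLabel_le (w : ℝ²) : |saddleLabel w| ≤ |w.2| := by grind [saddleLabel]

/-- Points with the same label and, in the parabolic sector, the same relative position lie on a
common leaf. -/
theorem exists_common_leaf (hlh : lo < hi) (hP : SlopeField κ P) (hQ : SlopeField κ Q) (hPr : UniqueRight κ P)
    (hI : ∀ y, hP.label (-1) y = 0 ↔ y ∈ Icc lo hi) {z w : ℝ²}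
    (hc : hP.label z.1 z.2 = hP.label w.1 w.2)
    (ha : hP.label z.1 z.2 = 0 → (hQ.label z.2 z.1 < 0 ∧ hQ.label w.2 w.1 < 0 ∧
      hP.spread lo hi z.1 z.2 = hP.spread lo hi w.1 w.2) ∨
      (0 ≤ hQ.label z.2 z.1 ∧ 0 ≤ hQ.label w.2 w.1)) :
    w.2 = hP.leaf z.1 z.2 w.1 := by
  have hz := hP.isLeaf_leaf z.1 z.2
  have hw := hP.isLeaf_leaf w.1 w.2
  by_cases h0 : hP.label z.1 z.2 = 0
  · have sz := label_sign_of_label_eq_zero hP hQ h0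
    have sw := label_sign_of_label_eq_zero hP hQ (hc ▸ h0)
    rcases ha h0 with ⟨h1, h2, h3⟩ | ⟨h1, h2⟩
    · rw [hP.spread_of_zero hlh hI h0, hP.spread_of_zero hlh hI (hc ▸ h0),
        div_left_inj' (by linarith)] at h3
      have h4 : hP.leaf z.1 z.2 (-1) = hP.leaf w.1 w.2 (-1) := by linarith
      have := hz.eqOn_nonpos hP hw (by norm_num) h4 (sw.1.1 h2).le
      rw [this, hP.leaf_apply]
    · rw [hPr _ _ hz hw h0 (hc.symm.trans h0) w.1 (by grind), hP.leaf_apply]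
  · have := hz.eq_of_apply_zero_ne hP hw h0 hc
    rw [this, hP.leaf_apply]

theorem exists_homeomorph_saddle (hlh : lo < hi) (hP : SlopeField κ P) (hPr : UniqueRight κ P)
    (hQ : SlopeField κ Q) (hQr : UniqueRight κ Q) (hQl : UniqueLeft κ Q)
    (hI : ∀ y, hP.label (-1) y = 0 ↔ y ∈ Icc lo hi) :
    ∃ h : ℝ² ≃ₜ ℝ², ∀ z, h z = (hQ.label z.2 z.1, saddleHeight hP hQ lo hi z) := by
  refine exists_homeomorph_of_bijective
    (f := fun z => (hQ.label z.2 z.1, saddleHeight hP hQ lo hi z)) ?_ ⟨?_, ?_⟩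
    (inv_pos.2 (sub_pos.2 hP.lt_one)) ?_
  · exact (hQ.continuous_label.comp continuous_swap).prodMk (continuous_saddleHeight hlh hP hQ hI)
  · intro z w h
    have hc : hP.label z.1 z.2 = hP.label w.1 w.2 := by
      rw [← saddleLabel_eq hlh hP hQ hI z, ← saddleLabel_eq hlh hP hQ hI w]
      exact congrArg saddleLabel h
    simp only [Prod.mk.injEq] at h
    obtain ⟨h1, h2⟩ := h
    have e2 := (hQ.isLeaf_leaf z.2 z.1).eq_of_unique hQ hQr hQl (hQ.isLeaf_leaf w.2 w.1) h1
    have hcl : w.2 = hP.leaf z.1 z.2 w.1 := by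
      refine exists_common_leaf hlh hP hQ hPr hI hc fun h0 => ?_
      rcases lt_or_ge (hQ.label z.2 z.1) 0 with hn | hn
      · left
        refine ⟨hn, h1 ▸ hn, ?_⟩
        unfold saddleHeight at h2
        rw [← hc, ← h1, max_eq_left (by linarith)] at h2
        have : -hQ.label z.2 z.1 ≠ 0 := by linarith
        exact mul_left_cancel₀ this (by linarith)
      · exact Or.inr ⟨hn, h1 ▸ hn⟩
    refine eq_of_mem_leaves hP (hP.isLeaf_leaf z.1 z.2) (hQ.isLeaf_leaf z.2 z.1)
      (hP.leaf_apply _ _).symm hcl (hQ.leaf_apply _ _).symm ?_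
    rw [e2, hQ.leaf_apply]
  · rintro ⟨a, Y⟩
    have key : ∀ η : ℝ → ℝ, IsLeaf κ P η →
        (∀ x, hQ.label (η x) x = a → saddleHeight hP hQ lo hi (x, η x) = Y) →
        ∃ z : ℝ², (hQ.label z.2 z.1, saddleHeight hP hQ lo hi z) = (a, Y) := by
      intro η hη hY
      obtain ⟨x, hx⟩ := exists_crossing hP hη (hQ.isLeaf_leaf 0 a)
      have := hQ.label_leaf (hQ.isLeaf_leaf 0 a) (η x)
      rw [hx, hQ.leaf_apply] at this
      exact ⟨(x, η x), Prod.ext this (hY x this)⟩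
    set n := max (-a) 0 with hn
    have hn0 : 0 ≤ n := le_max_right _ _
    rcases lt_or_ge n Y with h1 | h1
    · refine key (hP.leaf 0 (Y - n)) (hP.isLeaf_leaf _ _) fun x hx => ?_
      have hc : hP.label x (hP.leaf 0 (Y - n) x) = Y - n := by
        rw [hP.label_leaf (hP.isLeaf_leaf _ _), hP.leaf_apply]
      simp only [saddleHeight]
      rw [hP.spread_of_pos hlh hI (by rw [hc]; linarith), hc, hx, ← hn]; ring
    rcases lt_or_ge Y (-n) with h2 | h2
    · refine key (hP.leaf 0 (Y + n)) (hP.isLeaf_leaf _ _) fun x hx => ?_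
      have hc : hP.label x (hP.leaf 0 (Y + n) x) = Y + n := by
        rw [hP.label_leaf (hP.isLeaf_leaf _ _), hP.leaf_apply]
      simp only [saddleHeight]
      rw [hP.spread_of_neg hlh hI (by rw [hc]; linarith), hc, hx, ← hn]; ring
    rcases lt_or_ge a 0 with h3 | h3
    · have hna : n = -a := max_eq_left (by linarith)
      set y := (lo + hi) / 2 + (hi - lo) / 2 * (Y / n) with hy
      have hn1 : 0 < n := by linarith
      have b1 : Y / n ≤ 1 := by rw [div_le_iff₀ hn1]; linarith
      have b2 : -1 ≤ Y / n := by rw [le_div_iff₀ hn1]; linarith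
      have hyI : y ∈ Icc lo hi := by constructor <;> nlinarith
      have hy0 : hP.leaf (-1) y 0 = 0 := (hI y).2 hyI
      refine key (hP.leaf (-1) y) (hP.isLeaf_leaf _ _) fun x hx => ?_
      have hc : hP.label x (hP.leaf (-1) y x) = 0 := by rw [hP.label_leaf (hP.isLeaf_leaf _ _), hy0]
      have hx0 := (label_sign_of_label_eq_zero hP hQ hc).1.1 (hx ▸ h3)
      have hl : hP.leaf x (hP.leaf (-1) y x) (-1) = y := by
        rw [(hP.isLeaf_leaf x _).eqOn_nonpos hP (hP.isLeaf_leaf (-1) y) hx0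
          (hP.leaf_apply _ _) (by norm_num), hP.leaf_apply]
      simp only [saddleHeight]
      rw [hP.spread_of_zero hlh hI hc, hc, hx, ← hn, hl, hy]
      have : hi - lo ≠ 0 := by linarith
      field_simp
      ring
    · have hna : n = 0 := max_eq_right (by linarith)
      have hY : Y = 0 := by linarith
      refine key (hP.leaf 0 0) (hP.isLeaf_leaf _ _) fun x hx => ?_
      have hc : hP.label x (hP.leaf 0 0 x) = 0 := by
        rw [hP.label_leaf (hP.isLeaf_leaf _ _), hP.leaf_apply]
      simp only [saddleHeight]
      rw [hc, hx, ← hn, hna, hY]; ring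
  · intro z
    refine norm_le_of_labels hP hQ z (norm_fst_le (hQ.label z.2 z.1, saddleHeight hP hQ lo hi z)) ?_
    rw [← saddleLabel_eq hlh hP hQ hI z]
    exact (abs_saddleLabel_le _).trans (norm_snd_le (hQ.label z.2 z.1, saddleHeight hP hQ lo hi z))

end Saddle

end

section

variable {κ : ℝ} {P Q : ℝ → ℝ → ℝ} {η ζ ξ : ℝ → ℝ}

/-! ### Arcs of a net and the model pictures -/

/-- The vector `v` at `z` is tangent to one of two transverse slope fields. -/
def NetDirection (P Q : ℝ → ℝ → ℝ) (z v : ℝ²) : Prop :=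
  v ≠ 0 ∧ (v.2 = P z.1 z.2 * v.1 ∨ v.1 = Q z.2 z.1 * v.2)

/-- `L` is a regular arc in `U` tangent to one of two transverse slope fields. -/
def IsNetArc (P Q : ℝ → ℝ → ℝ) (U L : Set ℝ²) : Prop :=
  ∃ c : ℝ → ℝ², ContDiffOn ℝ 1 c (Ioo 0 1) ∧ L = c '' Ioo 0 1 ∧
    ∀ t ∈ Ioo (0 : ℝ) 1, c t ∈ U ∧ c t ≠ 0 ∧ NetDirection P Q (c t) (deriv c t)

theorem hasDerivAt_swap_comp {c : ℝ → ℝ²} {c' : ℝ²} {t : ℝ} (h : HasDerivAt c c' t) :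
    HasDerivAt (fun t => (c t).swap) c'.swap t :=
  (ContinuousLinearEquiv.prodComm ℝ ℝ ℝ).toContinuousLinearMap.hasFDerivAt.comp_hasDerivAt t h

theorem IsNetArc.swap {U L : Set ℝ²} (h : IsNetArc P Q U L) :
    IsNetArc Q P (Prod.swap ⁻¹' U) (Prod.swap ⁻¹' L) := by
  obtain ⟨c, hc, hL, h⟩ := h
  refine ⟨fun t => (c t).swap, ?_, ?_, fun t ht => ?_⟩
  · exact (ContinuousLinearEquiv.prodComm ℝ ℝ ℝ).contDiff.comp_contDiffOn hc
  · rw [hL, ← image_swap_eq_preimage_swap, image_image]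
  · obtain ⟨h1, h2, h3, h4⟩ := h t ht
    have hd : DifferentiableAt ℝ c t :=
      (hc.differentiableOn one_ne_zero).differentiableAt (isOpen_Ioo.mem_nhds ht)
    rw [(hasDerivAt_swap_comp hd.hasDerivAt).deriv]
    exact ⟨by simpa using h1, fun h0 => h2 (by simpa using congrArg Prod.swap h0),
      fun h0 => h3 (by simpa using congrArg Prod.swap h0), h4.symm⟩

theorem IsLeaf.isNetArc (hP : SlopeField κ P) (hη : IsLeaf κ P η) {U : Set ℝ²} {x₁ x₂ : ℝ}
    (hx : x₁ < x₂) (h : ∀ x ∈ Ioo x₁ x₂, (x, η x) ∈ U ∧ ((x, η x) : ℝ²) ≠ 0) :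
    IsNetArc P Q U ((fun x => (x, η x)) '' Ioo x₁ x₂) := by
  have h0 : ∀ x ∈ Ioo x₁ x₂, x ≠ 0 ∨ η x ≠ 0 := fun x hx => by
    by_contra! hc
    exact (h x hx).2 (Prod.ext hc.1 hc.2)
  set σ : ℝ → ℝ := fun t => x₁ + (x₂ - x₁) * t with hσ
  have hσm : ∀ t ∈ Ioo (0 : ℝ) 1, σ t ∈ Ioo x₁ x₂ := fun t ht => by
    constructor <;> simp only [hσ] <;> nlinarith [ht.1, ht.2]
  have hσd : ∀ t, HasDerivAt σ (x₂ - x₁) t := fun t => by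
    have := ((hasDerivAt_id t).const_mul (x₂ - x₁)).const_add x₁
    rwa [mul_one] at this
  have hηC : ContDiffOn ℝ 1 η (Ioo x₁ x₂) := by
    rw [show (1 : WithTop ℕ∞) = 0 + 1 by simp, contDiffOn_succ_iff_deriv_of_isOpen isOpen_Ioo]
    refine ⟨fun x hx => (hη.deriv x (h0 x hx)).differentiableAt.differentiableWithinAt, by simp, ?_⟩
    rw [contDiffOn_zero]
    have : ContinuousOn (fun x => P x (η x)) (Ioo x₁ x₂) := fun x hx =>
      ((hP.cont x (η x) (h0 x hx)).comp (f := fun x => (x, η x))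
        (continuous_id.prodMk hη.continuous).continuousAt).continuousWithinAt
    exact this.congr fun x hx => (hη.deriv x (h0 x hx)).deriv
  refine ⟨fun t => (σ t, η (σ t)), ?_, ?_, fun t ht => ⟨(h _ (hσm t ht)).1, (h _ (hσm t ht)).2, ?_⟩⟩
  · have hσC : ContDiffOn ℝ 1 σ (Ioo 0 1) := by fun_prop
    exact hσC.prodMk (hηC.comp hσC hσm)
  · ext z
    constructor
    · rintro ⟨x, hx, rfl⟩
      refine ⟨(x - x₁) / (x₂ - x₁), ⟨div_pos (by linarith [hx.1]) (by linarith),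
        (div_lt_one (by linarith)).2 (by linarith [hx.2])⟩, ?_⟩
      have : σ ((x - x₁) / (x₂ - x₁)) = x := by grind
      simp only [this]
    · rintro ⟨t, ht, rfl⟩
      exact ⟨σ t, hσm t ht, rfl⟩
  · have hd := (hσd t).prodMk ((hη.deriv _ (h0 _ (hσm t ht))).comp t (hσd t))
    have hd' : _root_.deriv (fun t => (σ t, η (σ t))) t = (x₂ - x₁, P (σ t) (η (σ t)) * (x₂ - x₁)) :=
      hd.deriv
    rw [hd']
    exact ⟨fun h => (sub_pos.2 hx).ne' (congrArg Prod.fst h), Or.inl rfl⟩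

/-- Curves tangent to the first of two slope fields are contained in leaves. -/
theorem exists_leaf_of_curve (hP : SlopeField κ P) {c : ℝ → ℝ²}
    (hc : ContDiffOn ℝ 1 c (Ioo 0 1)) (h0 : ∀ t ∈ Ioo (0 : ℝ) 1, c t ≠ 0)
    (hd : ∀ t ∈ Ioo (0 : ℝ) 1, (deriv c t).2 = P (c t).1 (c t).2 * (deriv c t).1) :
    ∃ η, IsLeaf κ P η ∧ (∀ t ∈ Ioo (0 : ℝ) 1, (c t).2 = η (c t).1) ∧
      (η 0 = 0 → (∀ t ∈ Ioo (0 : ℝ) 1, 0 < (c t).1) ∨ ∀ t ∈ Ioo (0 : ℝ) 1, (c t).1 < 0) := by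
  have hcd : ∀ t ∈ Ioo (0 : ℝ) 1, HasDerivAt c (deriv c t) t := fun t ht =>
    ((hc.differentiableOn one_ne_zero).differentiableAt (isOpen_Ioo.mem_nhds ht)).hasDerivAt
  have hm : (1 / 2 : ℝ) ∈ Ioo (0 : ℝ) 1 := by constructor <;> norm_num
  have hη := hP.isLeaf_leaf (c (1 / 2)).1 (c (1 / 2)).2
  have hdc : ContinuousOn (deriv c) (Ioo 0 1) := hc.continuousOn_deriv_of_isOpen isOpen_Ioo le_rfl
  have key := hP.curve_mem_leaf hη (x := fun t => (c t).1) (y := fun t => (c t).2)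
    (x' := fun t => (deriv c t).1) isOpen_Ioo isPreconnected_Ioo
    (fun t ht => (hasFDerivAt_fst (p := c t)).comp_hasDerivAt t (hcd t ht)) hdc.fst
    (fun t ht => hd t ht ▸ (hasFDerivAt_snd (p := c t)).comp_hasDerivAt t (hcd t ht))
    (fun t ht => by
      by_contra! hcon
      exact h0 t ht (Prod.ext hcon.1 hcon.2)) hm (hP.leaf_apply _ _).symm
  refine ⟨_, hη, key, fun hz => ?_⟩
  by_contra! hcon
  obtain ⟨⟨s, hs, hs'⟩, ⟨t, ht, ht'⟩⟩ := hcon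
  obtain ⟨u, hu, hu'⟩ := isPreconnected_Ioo.intermediate_value hs ht hc.continuousOn.fst ⟨hs', ht'⟩
  exact h0 u hu (Prod.ext hu' ((key u hu).trans ((congrArg _ hu').trans hz)))

theorem IsNetArc.exists_leaf (hP : SlopeField κ P) (hQ : SlopeField κ Q) {U L : Set ℝ²}
    (h : IsNetArc P Q U L) :
    (∃ η, IsLeaf κ P η ∧ (∀ z ∈ L, z.2 = η z.1) ∧
      (η 0 = 0 → (∀ z ∈ L, 0 < z.1) ∨ ∀ z ∈ L, z.1 < 0)) ∨
    (∃ ξ, IsLeaf κ Q ξ ∧ (∀ z ∈ L, z.1 = ξ z.2) ∧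
      (ξ 0 = 0 → (∀ z ∈ L, 0 < z.2) ∨ ∀ z ∈ L, z.2 < 0)) := by
  obtain ⟨c, hc, hL, h⟩ := h
  have hk := hP.lt_one
  have hpos : ∀ v : ℝ², v ≠ 0 → 0 < |v.1| ∨ 0 < |v.2| := fun v hv => by
    by_contra! hcon
    exact hv (Prod.ext (abs_nonpos_iff.1 hcon.1) (abs_nonpos_iff.1 hcon.2))
  have hdc : ContinuousOn (deriv c) (Ioo 0 1) := hc.continuousOn_deriv_of_isOpen isOpen_Ioo le_rfl
  have hlt : ∀ {p u v : ℝ}, |p| ≤ κ → 0 < |u| ∨ 0 < |v| → v = p * u → |v| < |u| := by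
    intro p u v h1 h2 he
    have h3 : |v| ≤ κ * |u| := by
      rw [he, abs_mul]; exact mul_le_mul_of_nonneg_right h1 (abs_nonneg _)
    rcases h2 with h2 | h2
    · exact h3.trans_lt (mul_lt_of_lt_one_left h2 hk)
    · by_contra! hcon
      nlinarith [hP.nonneg, abs_nonneg u]
  have hH := fun t ht => hlt (hP.bound (c t).1 (c t).2) (hpos _ (h t ht).2.2.1)
  have hV := fun t ht => hlt (hQ.bound (c t).2 (c t).1) (hpos _ (h t ht).2.2.1).symm
  have hdiff : ContinuousOn (fun t => |(deriv c t).1| - |(deriv c t).2|) (Ioo 0 1) :=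
    hdc.fst.abs.sub hdc.snd.abs
  have hor : (∀ t ∈ Ioo (0 : ℝ) 1, |(deriv c t).2| < |(deriv c t).1|) ∨
      ∀ t ∈ Ioo (0 : ℝ) 1, |(deriv c t).1| < |(deriv c t).2| := by
    by_contra! hcon
    obtain ⟨⟨s, hs, hs'⟩, ⟨t, ht, ht'⟩⟩ := hcon
    obtain ⟨u, hu, hu'⟩ := isPreconnected_Ioo.intermediate_value hs ht hdiff
      ⟨sub_nonpos.2 hs', sub_nonneg.2 ht'⟩
    rcases (h u hu).2.2.2 with he | he
    · linarith [hH u hu he]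
    · linarith [hV u hu he]
  rcases hor with hor | hor
  · left
    obtain ⟨η, hη, h1, h2⟩ := exists_leaf_of_curve hP hc (fun t ht => (h t ht).2.1) fun t ht =>
      ((h t ht).2.2.2).resolve_right fun he => absurd (hV t ht he) (not_lt.2 (hor t ht).le)
    refine ⟨η, hη, ?_, fun h0 => ?_⟩ <;> simp only [hL, forall_mem_image]
    exacts [h1, h2 h0]
  · right
    have hcs : ContDiffOn ℝ 1 (fun t => (c t).swap) (Ioo 0 1) :=
      (ContinuousLinearEquiv.prodComm ℝ ℝ ℝ).contDiff.comp_contDiffOn hc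
    obtain ⟨ξ, hξ, h1, h2⟩ := exists_leaf_of_curve hQ hcs
      (fun t ht h0 => (h t ht).2.1 (by simpa using congrArg Prod.swap h0)) fun t ht => by
      have hd : DifferentiableAt ℝ c t :=
        (hc.differentiableOn one_ne_zero).differentiableAt (isOpen_Ioo.mem_nhds ht)
      rw [(hasDerivAt_swap_comp hd.hasDerivAt).deriv]
      exact ((h t ht).2.2.2).resolve_left fun he => absurd (hH t ht he) (not_lt.2 (hor t ht).le)
    refine ⟨ξ, hξ, ?_, fun h0 => ?_⟩ <;> simp only [hL, forall_mem_image]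
    exacts [h1, h2 h0]

/-- The open square. -/
def square : Set ℝ² := Ioo (-1) 1 ×ˢ Ioo (-1) 1

theorem mem_square {w : ℝ²} : w ∈ square ↔ (-1 < w.1 ∧ w.1 < 1) ∧ (-1 < w.2 ∧ w.2 < 1) := Iff.rfl

/-- If a homeomorphism carries arcs into the lines of a family without inclusions, and carries the
lines of the family back to arcs, then it carries maximal arcs onto lines. -/
theorem maximal_isNetArc_iff {𝓕 : Set (Set ℝ²)} {h : ℝ² ≃ₜ ℝ²} {U : Set ℝ²}
    (harc : ∀ F ∈ 𝓕, IsNetArc P Q U (h ⁻¹' F))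
    (hcov : ∀ L, IsNetArc P Q U L → ∃ F ∈ 𝓕, L ⊆ h ⁻¹' F)
    (hanti : ∀ F ∈ 𝓕, ∀ F' ∈ 𝓕, F ⊆ F' → F = F') (L : Set ℝ²) :
    Maximal (IsNetArc P Q U) L ↔ h '' L ∈ 𝓕 := by
  constructor
  · intro hL
    obtain ⟨F, hF, hLF⟩ := hcov L hL.1
    rwa [subset_antisymm hLF (hL.2 (harc F hF) hLF), image_preimage_eq _ h.surjective]
  · intro hL
    have he : h ⁻¹' (h '' L) = L := preimage_image_eq _ h.injective
    refine ⟨he ▸ harc _ hL, fun L' hL' hle => ?_⟩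
    obtain ⟨F, hF, hLF⟩ := hcov L' hL'
    rwa [← hanti _ hL F hF (image_subset_iff.2 (hle.trans hLF)), he] at hLF

theorem antichain_of_transverse {A V : Set (Set ℝ²)}
    (hA : ∀ F ∈ A, ∀ F' ∈ A, ∀ w ∈ F, w ∈ F' → F = F')
    (hV : ∀ F ∈ V, ∀ F' ∈ V, ∀ w ∈ F, w ∈ F' → F = F')
    (hA2 : ∀ F ∈ A, ∃ w ∈ F, ∃ w' ∈ F, w.1 ≠ w'.1)
    (hAi : ∀ F ∈ A, InjOn Prod.fst F)
    (hV2 : ∀ F ∈ V, ∃ w ∈ F, ∃ w' ∈ F, w ≠ w')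
    (hVc : ∀ F ∈ V, ∀ w ∈ F, ∀ w' ∈ F, w.1 = w'.1) :
    ∀ F ∈ A ∪ V, ∀ F' ∈ A ∪ V, F ⊆ F' → F = F' := by
  rintro F (hF | hF) F' (hF' | hF') hs
  · obtain ⟨w, hw, -⟩ := hA2 F hF
    exact hA F hF F' hF' w hw (hs hw)
  · obtain ⟨w, hw, w', hw', hne⟩ := hA2 F hF
    exact absurd (hVc F' hF' w (hs hw) w' (hs hw')) hne
  · obtain ⟨w, hw, w', hw', hne⟩ := hV2 F hF
    exact absurd (hAi F' hF' (hs hw) (hs hw') (hVc F hF w hw w' hw')) hne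
  · obtain ⟨w, hw, -⟩ := hV2 F hF
    exact hV F hF F' hF' w hw (hs hw)

/-! #### Vertical lines -/

theorem mem_verticals_iff {F : Set ℝ²} : F ∈ verticals ↔
    ∃ a lo hi : ℝ, a ∈ Ioo (-1 : ℝ) 1 ∧ lo < hi ∧ F = {a} ×ˢ Ioo lo hi ∧
      ((a ≠ 0 ∧ lo = -1 ∧ hi = 1) ∨ (a = 0 ∧ lo = 0 ∧ hi = 1) ∨ (a = 0 ∧ lo = -1 ∧ hi = 0)) := by
  constructor
  · rintro (⟨a, ha, ha0, rfl⟩ | rfl | rfl)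
    · exact ⟨a, -1, 1, ha, by grind⟩
    · exact ⟨0, 0, 1, by simp⟩
    · exact ⟨0, -1, 0, by simp⟩
  · rintro ⟨a, lo, hi, ha, -, rfl, ⟨h0, rfl, rfl⟩ | ⟨rfl, rfl, rfl⟩ | ⟨rfl, rfl, rfl⟩⟩
    · exact Or.inl ⟨a, ha, h0, rfl⟩
    · exact Or.inr (Or.inl rfl)
    · exact Or.inr (Or.inr rfl)

theorem verticals_eq_of_mem : ∀ F ∈ verticals, ∀ F' ∈ verticals, ∀ w ∈ F, w ∈ F' → F = F' := by
  intro F hF F' hF' w hw hw'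
  rw [mem_verticals_iff] at hF hF'
  obtain ⟨a, lo, hi, -, -, rfl, h⟩ := hF
  obtain ⟨a', lo', hi', -, -, rfl, h'⟩ := hF'
  grind

theorem verticals_fst : ∀ F ∈ verticals, ∀ w ∈ F, ∀ w' ∈ F, w.1 = w'.1 := by
  intro F hF w hw w' hw'
  rw [mem_verticals_iff] at hF
  obtain ⟨a, lo, hi, -, -, rfl, h⟩ := hF
  exact (mem_singleton_iff.1 hw.1).trans (mem_singleton_iff.1 hw'.1).symm

theorem verticals_two : ∀ F ∈ verticals, ∃ w ∈ F, ∃ w' ∈ F, w.2 ≠ w'.2 := by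
  intro F hF
  rw [mem_verticals_iff] at hF
  obtain ⟨a, lo, hi, -, hlt, rfl, h⟩ := hF
  refine ⟨(a, lo + (hi - lo) / 3), ⟨rfl, ?_, ?_⟩, (a, lo + (hi - lo) / 2), ⟨rfl, ?_, ?_⟩, ?_⟩ <;>
    simp only <;> linarith

/-- A homeomorphism of the plane whose first coordinate labels the leaves of the slope field
`x' = Q y x` and whose second coordinate increases along them. -/
structure Straightens (hQ : SlopeField κ Q) (h : ℝ² ≃ₜ ℝ²) : Prop where
  zero : h 0 = 0
  fst : ∀ z, (h z).1 = hQ.label z.2 z.1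
  mono : ∀ ξ, IsLeaf κ Q ξ → StrictMono fun y => (h (ξ y, y)).2

theorem mem_leaf_of_label (hQ : SlopeField κ Q) (hQr : UniqueRight κ Q) (hQl : UniqueLeft κ Q)
    (hξ : IsLeaf κ Q ξ) {z : ℝ²} (hz : hQ.label z.2 z.1 = ξ 0) : z.1 = ξ z.2 := by
  have := (hQ.isLeaf_leaf z.2 z.1).eq_of_unique hQ hQr hQl hξ hz
  rw [← this, hQ.leaf_apply]

theorem Straightens.isNetArc_vertical {hQ : SlopeField κ Q} {h : ℝ² ≃ₜ ℝ²}
    (hs : Straightens hQ h) (hQr : UniqueRight κ Q) (hQl : UniqueLeft κ Q) :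
    ∀ F ∈ verticals, IsNetArc P Q (h ⁻¹' square) (h ⁻¹' F) := by
  intro F hF
  rw [mem_verticals_iff] at hF
  obtain ⟨a, lo, hi, ha, hlt, rfl, hcase⟩ := hF
  set ξ := hQ.leaf 0 a with hξdef
  have hξ : IsLeaf κ Q ξ := hQ.isLeaf_leaf 0 a
  have hξ0 : ξ 0 = a := hQ.leaf_apply 0 a
  have hfst : ∀ y, (h (ξ y, y)).1 = a := fun y => by rw [hs.fst, hQ.label_leaf hξ, hξ0]
  have hon : ∀ z, (h z).1 = a → z.1 = ξ z.2 := fun z hz =>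
    mem_leaf_of_label hQ hQr hQl hξ (by rw [← hs.fst, hz, hξ0])
  have hex : ∀ b, ∃ y, (h (ξ y, y)).2 = b := fun b =>
    ⟨(h.symm (a, b)).2, by rw [← hon _ (by rw [h.apply_symm_apply])]; simp⟩
  obtain ⟨y₁, hy₁⟩ := hex lo
  obtain ⟨y₂, hy₂⟩ := hex hi
  have hm := hs.mono ξ hξ
  have hy : y₁ < y₂ := hm.lt_iff_lt.1 (by simp only [hy₁, hy₂]; exact hlt)
  have hmem : ∀ y, y ∈ Ioo y₁ y₂ ↔ (h (ξ y, y)).2 ∈ Ioo lo hi := fun y => by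
    rw [mem_Ioo, mem_Ioo, ← hy₁, ← hy₂]
    exact and_congr hm.lt_iff_lt.symm hm.lt_iff_lt.symm
  have hset : h ⁻¹' ({a} ×ˢ Ioo lo hi) = Prod.swap ⁻¹' ((fun y => (y, ξ y)) '' Ioo y₁ y₂) := by
    ext z
    constructor
    · rintro ⟨h1, h2⟩
      have h3 := hon z h1
      refine ⟨z.2, (hmem _).2 ?_, Prod.ext rfl h3.symm⟩
      rw [← h3]; exact h2
    · rintro ⟨y, hy, hz⟩
      have : z = (ξ y, y) := by rw [← Prod.swap_swap z, ← hz]; rfl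
      rw [this]
      exact ⟨hfst y, (hmem y).1 hy⟩
  rw [hset]
  have hsq : ∀ y ∈ Ioo y₁ y₂, h (ξ y, y) ∈ square ∧ h (ξ y, y) ≠ 0 := by
    intro y hy
    have h2 := (hmem y).1 hy
    have h1 := hfst y
    refine ⟨⟨h1 ▸ ha, by grind⟩, fun h0 => ?_⟩
    rw [h0] at h1 h2
    simp only [Prod.fst_zero, Prod.snd_zero] at h1 h2
    grind
  have := (hξ.isNetArc (Q := P) (U := Prod.swap ⁻¹' (h ⁻¹' square)) hQ hy fun y hy =>
    ⟨(hsq y hy).1, fun h0 => (hsq y hy).2 (by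
      have : ((ξ y, y) : ℝ²) = 0 := congrArg Prod.swap h0
      rw [this, hs.zero])⟩).swap
  exact this

theorem Straightens.exists_vertical {hQ : SlopeField κ Q} {h : ℝ² ≃ₜ ℝ²}
    (hs : Straightens hQ h) {L : Set ℝ²} (hL : L ⊆ h ⁻¹' square) (hne : L.Nonempty)
    (hξ : IsLeaf κ Q ξ) (h1 : ∀ z ∈ L, z.1 = ξ z.2)
    (h2 : ξ 0 = 0 → (∀ z ∈ L, 0 < z.2) ∨ ∀ z ∈ L, z.2 < 0) : ∃ F ∈ verticals, L ⊆ h ⁻¹' F := by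
  have hfst : ∀ z ∈ L, (h z).1 = ξ 0 := fun z hz => by rw [hs.fst, h1 z hz, hQ.label_leaf hξ]
  have hm := hs.mono ξ hξ
  obtain ⟨w, hw⟩ := hne
  have ha : ξ 0 ∈ Ioo (-1 : ℝ) 1 := by rw [← hfst w hw]; exact (hL hw).1
  by_cases h0 : ξ 0 = 0
  · have e0 : (h (ξ 0, 0)).2 = 0 := by rw [h0, Prod.mk_zero_zero, hs.zero]; rfl
    rcases h2 h0 with h3 | h3
    · refine ⟨{0} ×ˢ Ioo (0 : ℝ) 1, Or.inr (Or.inl rfl), fun z hz => ⟨?_, ?_, (hL hz).2.2⟩⟩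
      · rw [hfst z hz, h0]; rfl
      · have := hm (h3 z hz)
        simp only at this
        rwa [e0, ← h1 z hz] at this
    · refine ⟨{0} ×ˢ Ioo (-1 : ℝ) 0, Or.inr (Or.inr rfl), fun z hz => ⟨?_, (hL hz).2.1, ?_⟩⟩
      · rw [hfst z hz, h0]; rfl
      · have := hm (h3 z hz)
        simp only at this
        rwa [e0, ← h1 z hz] at this
  · exact ⟨{ξ 0} ×ˢ Ioo (-1) 1, Or.inl ⟨ξ 0, ha, h0, rfl⟩, fun z hz => ⟨hfst z hz, (hL hz).2⟩⟩

theorem IsNetArc.subset {U L : Set ℝ²} (h : IsNetArc P Q U L) : L ⊆ U := by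
  obtain ⟨c, -, rfl, h⟩ := h
  rintro _ ⟨t, ht, rfl⟩
  exact (h t ht).1

theorem IsNetArc.nonempty {U L : Set ℝ²} (h : IsNetArc P Q U L) : L.Nonempty := by
  obtain ⟨c, -, rfl, -⟩ := h
  exact ⟨_, mem_image_of_mem c (show (1 / 2 : ℝ) ∈ Ioo (0 : ℝ) 1 by constructor <;> norm_num)⟩

/-- Moving up along a transverse leaf means moving above the leaves. -/
theorem leaf_lt_of_lt (hP : SlopeField κ P) (hη : IsLeaf κ P η) (hξ : IsLeaf κ Q ξ) {y₁ y₂ : ℝ}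
    (h : y₁ < y₂) (h1 : η (ξ y₁) = y₁) : η (ξ y₂) < y₂ := by
  have e1 := hη.lip (ξ y₂) (ξ y₁)
  have e2 := hξ.lip y₂ y₁
  rw [h1] at e1
  rw [abs_of_pos (sub_pos.2 h)] at e2
  nlinarith [hP.lt_one, abs_nonneg (ξ y₂ - ξ y₁), le_abs_self (η (ξ y₂) - y₁)]

/-! #### The trivial net -/

theorem exists_trivialNet (hP : SlopeField κ P) (hPr : UniqueRight κ P) (hPl : UniqueLeft κ P)
    (hQ : SlopeField κ Q) (hQr : UniqueRight κ Q) (hQl : UniqueLeft κ Q) :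
    ∃ h : ℝ² ≃ₜ ℝ², h 0 = 0 ∧ (∀ z, h z ∈ square → ‖z‖ ≤ (1 - κ)⁻¹) ∧
      ∀ L, Maximal (IsNetArc P Q (h ⁻¹' square)) L ↔ h '' L ∈ trivialNet := by
  obtain ⟨h, hh⟩ := exists_homeomorph_labels hP hPr hPl hQ hQr hQl
  have h00 : h 0 = 0 := by
    rw [hh]
    exact Prod.ext (hQ.label_zero 0) (hP.label_zero 0)
  have hsV : Straightens hQ h := by
    refine ⟨h00, fun z => by rw [hh], fun ξ hξ y₁ y₂ hy => ?_⟩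
    simp only [hh]
    exact hP.lt_label_of_lt hPr hPl (hP.isLeaf_leaf (ξ y₁) y₁)
      (leaf_lt_of_lt hP (hP.isLeaf_leaf (ξ y₁) y₁) hξ hy (hP.leaf_apply _ _))
  set k : ℝ² ≃ₜ ℝ² := ((Homeomorph.prodComm ℝ ℝ).trans h).trans (Homeomorph.prodComm ℝ ℝ)
    with hk
  have hkz : ∀ z, k z = (h z.swap).swap := fun z => rfl
  have hsH : Straightens hP k := by
    refine ⟨by rw [hkz]; simp [h00], fun z => by rw [hkz, hh]; rfl, fun η hη y₁ y₂ hy => ?_⟩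
    simp only [hkz, hh]
    exact hQ.lt_label_of_lt hQr hQl (hQ.isLeaf_leaf (η y₁) y₁)
      (leaf_lt_of_lt hQ (hQ.isLeaf_leaf (η y₁) y₁) hη hy (hQ.leaf_apply _ _))
  have hpre : ∀ F : Set ℝ², Prod.swap ⁻¹' (k ⁻¹' (Prod.swap '' F)) = h ⁻¹' F := by
    intro F
    ext z
    simp only [mem_preimage, hkz, Prod.swap_swap, image_swap_eq_preimage_swap]
  have hsqs : Prod.swap '' square = square := by
    rw [image_swap_eq_preimage_swap]
    ext w
    simp only [mem_preimage, mem_square, Prod.fst_swap, Prod.snd_swap]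
    tauto
  refine ⟨h, h00, fun z hz => ?_, maximal_isNetArc_iff ?_ ?_ ?_⟩
  · have h1 : |hQ.label z.2 z.1| ≤ 1 := by
      have := hz.1; rw [hh] at this; exact abs_le.2 ⟨this.1.le, this.2.le⟩
    have h2 : |hP.label z.1 z.2| ≤ 1 := by
      have := hz.2; rw [hh] at this; exact abs_le.2 ⟨this.1.le, this.2.le⟩
    simpa using norm_le_of_labels hP hQ z h1 h2
  · rintro F (hF | hF)
    · have := (hsH.isNetArc_vertical (P := Q) hPr hPl _ hF).swap
      rw [hpre] at this
      rwa [← hsqs, hpre] at this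
    · exact hsV.isNetArc_vertical hQr hQl F hF
  · intro L hL
    rcases hL.exists_leaf hP hQ with ⟨η, hη, h1, h2⟩ | ⟨ξ, hξ, h1, h2⟩
    · obtain ⟨F, hF, hLF⟩ := hsH.exists_vertical (L := Prod.swap ⁻¹' L) (fun z hz => by
        have := hL.subset hz
        rw [← hpre, hsqs] at this
        simpa using this) (hL.nonempty.preimage Prod.swap_surjective) hη
        (fun z hz => h1 _ hz) (fun h0 => (h2 h0).imp (fun h3 z hz => h3 _ hz) fun h3 z hz => h3 _ hz)
      refine ⟨Prod.swap ⁻¹' F, Or.inl ?_, fun z hz => ?_⟩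
      · change Prod.swap '' _ ∈ verticals
        rwa [image_preimage_eq _ Prod.swap_surjective]
      · have : z.swap ∈ Prod.swap ⁻¹' L := by simpa using hz
        have := hLF this
        simpa [hkz] using this
    · obtain ⟨F, hF, hLF⟩ := hsV.exists_vertical hL.subset hL.nonempty hξ h1 h2
      exact ⟨F, Or.inr hF, hLF⟩
  · have hsm : ∀ {F : Set ℝ²} {w : ℝ²}, w ∈ F → w.swap ∈ Prod.swap '' F :=
      fun hw => mem_image_of_mem _ hw
    refine antichain_of_transverse ?_ verticals_eq_of_mem ?_ ?_ ?_ verticals_fst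
    · intro F hF F' hF' w hw hw'
      exact image_injective.2 Prod.swap_injective
        (verticals_eq_of_mem _ hF _ hF' w.swap (hsm hw) (hsm hw'))
    · intro F hF
      obtain ⟨_, ⟨w, hw, rfl⟩, _, ⟨w', hw', rfl⟩, hne⟩ := verticals_two _ hF
      exact ⟨w, hw, w', hw', hne⟩
    · intro F hF w hw w' hw' he
      exact Prod.ext he (verticals_fst _ hF _ (hsm hw) _ (hsm hw'))
    · intro F hF
      obtain ⟨w, hw, w', hw', hne⟩ := verticals_two F hF
      exact ⟨w, hw, w', hw', fun h => hne (by rw [h])⟩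

end

section

variable {κ : ℝ} {P Q : ℝ → ℝ → ℝ} {η ζ ξ : ℝ → ℝ}

/-! #### The saddle-node net -/

/-- The lines of the saddle-node foliation as graphs over intervals. -/
theorem mem_saddleNodeLines_iff {F : Set ℝ²} : F ∈ saddleNodeLines ↔
    (∃ m ∈ Icc (-1 : ℝ) 1, F = {w | w.1 ∈ Ioo (-1 : ℝ) 0 ∧ w.2 = -(m * w.1)}) ∨
    F = {w | w.1 ∈ Ioo (0 : ℝ) 1 ∧ w.2 = 0} ∨
    (∃ a ∈ Ioo (0 : ℝ) 1, F = {w | w.1 ∈ Ioo (a - 1) 1 ∧ w.2 = a + max (-w.1) 0}) ∨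
    (∃ a ∈ Ioo (0 : ℝ) 1, F = {w | w.1 ∈ Ioo (a - 1) 1 ∧ w.2 = -(a + max (-w.1) 0)}) := by
  have e1 : ∀ m : ℝ, (fun t : ℝ => (-t, m * t)) '' Ioo 0 1
      = {w : ℝ² | w.1 ∈ Ioo (-1 : ℝ) 0 ∧ w.2 = -(m * w.1)} := by
    refine fun m => Set.ext fun w => ⟨?_, fun h => ⟨-w.1, ?_⟩⟩ <;> grind
  have e2 : (Ioo (0 : ℝ) 1 ×ˢ {(0 : ℝ)} : Set ℝ²) = {w | w.1 ∈ Ioo (0 : ℝ) 1 ∧ w.2 = 0} := by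
    ext w; simp
  have e3 : ∀ (f : ℝ → ℝ) (I : Set ℝ), (fun t : ℝ => (t, f t)) '' I
      = {w : ℝ² | w.1 ∈ I ∧ w.2 = f w.1} := by
    refine fun f I => Set.ext fun w => ⟨?_, fun h => ⟨w.1, ?_⟩⟩ <;> grind
  simp only [saddleNodeLines, e1, e2, fun a => e3 (fun t => a + max (-t) 0),
    fun a => e3 (fun t => -(a + max (-t) 0)), mem_ofPred_eq]

/-- Every line of the saddle-node foliation is a fibre of the label together with the slope. -/
theorem saddleNodeLines_fibre {F : Set ℝ²} (hF : F ∈ saddleNodeLines) :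
    ∃ k l : ℝ, F = {w | w ∈ square ∧ w ≠ 0 ∧ saddleLabel w = k ∧
      (if saddleLabel w = 0 then (if w.1 < 0 then -w.2 / w.1 else 2) else 0) = l} := by
  rcases mem_saddleNodeLines_iff.1 hF with ⟨m, hm, rfl⟩ | rfl | ⟨a, ha, rfl⟩ | ⟨a, ha, rfl⟩
  · refine ⟨0, m, ?_⟩
    ext ⟨x, y⟩
    simp only [mem_ofPred_eq, mem_square, mem_Ioo, ne_eq, Prod.mk_eq_zero]
    constructor
    · rintro ⟨h1, h2⟩
      have hb : |y| ≤ -x := by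
        rw [h2, abs_le]
        constructor <;> nlinarith [h1.2, hm.1, hm.2]
      have hd : -y / x = m := by rw [h2]; field_simp [ne_of_lt h1.2]
      grind [saddleLabel]
    · rintro ⟨hsq, hw, h0, h1⟩
      have hm2 := hm.2
      have : x < 0 := by grind
      have : -y = m * x := by rw [if_pos h0, if_pos this, div_eq_iff this.ne] at h1; exact h1
      grind
  · refine ⟨0, 2, ?_⟩
    ext ⟨x, y⟩
    simp only [mem_ofPred_eq, mem_square, mem_Ioo, ne_eq, Prod.mk_eq_zero]
    constructor
    · grind [saddleLabel]
    · rintro ⟨hsq, hw, h0, h1⟩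
      rcases lt_or_ge x 0 with hn | hn
      · rw [if_pos h0, if_pos hn, div_eq_iff hn.ne] at h1
        grind [saddleLabel]
      · grind [saddleLabel]
  · refine ⟨a, 0, ?_⟩
    ext ⟨x, y⟩
    simp only [mem_ofPred_eq, mem_square, mem_Ioo, ne_eq, Prod.mk_eq_zero]
    grind [saddleLabel]
  · refine ⟨-a, 0, ?_⟩
    ext ⟨x, y⟩
    simp only [mem_ofPred_eq, mem_square, mem_Ioo, ne_eq, Prod.mk_eq_zero]
    grind [saddleLabel]

theorem saddleNodeLines_eq_of_mem :
    ∀ F ∈ saddleNodeLines, ∀ F' ∈ saddleNodeLines, ∀ w ∈ F, w ∈ F' → F = F' := by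
  intro F hF F' hF' w hw hw'
  obtain ⟨k, l, rfl⟩ := saddleNodeLines_fibre hF
  obtain ⟨k', l', rfl⟩ := saddleNodeLines_fibre hF'
  rw [← hw.2.2.1, ← hw.2.2.2, ← hw'.2.2.1, ← hw'.2.2.2]

theorem saddleNodeLines_injOn : ∀ F ∈ saddleNodeLines, InjOn Prod.fst F := by
  intro F hF w hw w' hw' he
  rcases mem_saddleNodeLines_iff.1 hF with ⟨m, hm, rfl⟩ | rfl | ⟨a, ha, rfl⟩ | ⟨a, ha, rfl⟩ <;>
  exact Prod.ext he (by rw [hw.2, hw'.2]; try rw [he])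

theorem saddleNodeLines_two : ∀ F ∈ saddleNodeLines, ∃ w ∈ F, ∃ w' ∈ F, w.1 ≠ w'.1 := by
  intro F hF
  have key : ∀ (f : ℝ → ℝ) (a b : ℝ), a < b → ∃ w ∈ {w : ℝ² | w.1 ∈ Ioo a b ∧ w.2 = f w.1},
      ∃ w' ∈ {w : ℝ² | w.1 ∈ Ioo a b ∧ w.2 = f w.1}, w.1 ≠ w'.1 := by
    intro f a b hab
    refine ⟨(a + (b - a) / 2, f (a + (b - a) / 2)), ⟨⟨?_, ?_⟩, rfl⟩,
      (a + (b - a) / 3, f (a + (b - a) / 3)), ⟨⟨?_, ?_⟩, rfl⟩, ?_⟩ <;> simp only <;> linarith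
  rcases mem_saddleNodeLines_iff.1 hF with ⟨m, hm, rfl⟩ | rfl | ⟨a, ha, rfl⟩ | ⟨a, ha, rfl⟩
  · exact key (fun t => -(m * t)) _ _ (by norm_num)
  · exact key (fun _ => 0) _ _ (by norm_num)
  · exact key (fun t => a + max (-t) 0) _ _ (by linarith [ha.2])
  · exact key (fun t => -(a + max (-t) 0)) _ _ (by linarith [ha.2])

/-- The part of a leaf between two transverse leaves is an arc. -/
theorem isNetArc_between (hP : SlopeField κ P) (hη : IsLeaf κ P η) (hQ : SlopeField κ Q)
    (hQr : UniqueRight κ Q) (hQl : UniqueLeft κ Q) {U : Set ℝ²} {a b : ℝ} (hab : a < b)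
    (hU : ∀ z : ℝ², z.2 = η z.1 → hQ.label z.2 z.1 ∈ Ioo a b → z ∈ U ∧ z ≠ 0) :
    IsNetArc P Q U {z | z.2 = η z.1 ∧ hQ.label z.2 z.1 ∈ Ioo a b} := by
  have hm : StrictMono fun x => hQ.label (η x) x := by
    intro x₁ x₂ hx
    exact hQ.lt_label_of_lt hQr hQl (hQ.isLeaf_leaf (η x₁) x₁)
      (leaf_lt_of_lt hQ (hQ.isLeaf_leaf (η x₁) x₁) hη hx (hQ.leaf_apply _ _))
  have hex : ∀ c, ∃ x, hQ.label (η x) x = c := by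
    intro c
    obtain ⟨x, hx⟩ := exists_crossing hP hη (hQ.isLeaf_leaf 0 c)
    have := hQ.label_leaf (hQ.isLeaf_leaf 0 c) (η x)
    rw [hx, hQ.leaf_apply] at this
    exact ⟨x, this⟩
  obtain ⟨x₁, hx₁⟩ := hex a
  obtain ⟨x₂, hx₂⟩ := hex b
  have hmem : ∀ x, x ∈ Ioo x₁ x₂ ↔ hQ.label (η x) x ∈ Ioo a b := fun x => by
    rw [mem_Ioo, mem_Ioo, ← hx₁, ← hx₂]
    exact and_congr hm.lt_iff_lt.symm hm.lt_iff_lt.symm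
  have hx : x₁ < x₂ := hm.lt_iff_lt.1 (by simp only [hx₁, hx₂]; exact hab)
  have hset : {z : ℝ² | z.2 = η z.1 ∧ hQ.label z.2 z.1 ∈ Ioo a b}
      = (fun x => (x, η x)) '' Ioo x₁ x₂ := by
    ext z
    constructor
    · rintro ⟨h1, h2⟩
      rw [h1] at h2
      exact ⟨z.1, (hmem _).2 h2, Prod.ext rfl h1.symm⟩
    · rintro ⟨x, hx, rfl⟩
      exact ⟨rfl, (hmem x).1 hx⟩
  rw [hset]
  exact hη.isNetArc hP hx fun x hx => hU (x, η x) rfl ((hmem x).1 hx)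

theorem exists_saddleNodeNet (hP : SlopeField κ P) (hPr : UniqueRight κ P)
    (hη : IsLeaf κ P η) (hζ : IsLeaf κ P ζ) (hη0 : η 0 = 0) (hζ0 : ζ 0 = 0)
    (hηζ : η (-1) < ζ (-1))
    (hQ : SlopeField κ Q) (hQr : UniqueRight κ Q) (hQl : UniqueLeft κ Q) :
    ∃ h : ℝ² ≃ₜ ℝ², h 0 = 0 ∧ (∀ z, h z ∈ square → ‖z‖ ≤ (1 - κ)⁻¹) ∧
      ∀ L, Maximal (IsNetArc P Q (h ⁻¹' square)) L ↔ h '' L ∈ saddleNodeNet := by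
  have s0 : ∀ w : ℝ², 0 < w.1 → (w.2 = 0 ↔ saddleLabel w = 0) := by grind [saddleLabel]
  have s1 : ∀ w : ℝ², |w.2| ≤ -w.1 → saddleLabel w = 0 := by grind [saddleLabel]
  have s2 : ∀ (w : ℝ²) (a : ℝ), 0 < a → (w.2 = a + max (-w.1) 0 ↔ saddleLabel w = a) ∧
      (w.2 = -(a + max (-w.1) 0) ↔ saddleLabel w = -a) := by grind [saddleLabel]
  have s3 : ∀ w ∈ square, ∀ a : ℝ, 0 < a → (w.2 = a + max (-w.1) 0 ∨ w.2 = -(a + max (-w.1) 0)) →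
      a < 1 ∧ w.1 ∈ Ioo (a - 1) 1 := by grind [mem_square]
  obtain ⟨lo, hi, hlh, hI⟩ := hP.exists_Icc_label_eq_zero hη hζ hη0 hζ0 hηζ
  obtain ⟨h, hh⟩ := exists_homeomorph_saddle hlh hP hPr hQ hQr hQl hI
  have hlab : ∀ z, saddleLabel (h z) = hP.label z.1 z.2 := fun z => by
    rw [hh, saddleLabel_eq hlh hP hQ hI]
  have hfst : ∀ z, (h z).1 = hQ.label z.2 z.1 := fun z => by rw [hh]
  have hsnd : ∀ z, (h z).2 = saddleHeight hP hQ lo hi z := fun z => by rw [hh]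
  have h00 : h 0 = 0 := by
    rw [hh]
    refine Prod.ext (hQ.label_zero 0) ?_
    simp only [saddleHeight, Prod.fst_zero, Prod.snd_zero, hP.label_zero, hQ.label_zero, neg_zero,
      max_self, zero_mul, add_zero]
  have hs : Straightens hQ h := by
    refine ⟨h00, hfst, fun ξ hξ y₁ y₂ hy => ?_⟩
    have hlt := leaf_lt_of_lt hP (hP.isLeaf_leaf (ξ y₁) y₁) hξ hy (hP.leaf_apply _ _)
    have hc := hP.label_le_of_lt (hP.isLeaf_leaf (ξ y₁) y₁) hlt
    change hP.label (ξ y₁) y₁ ≤ hP.label (ξ y₂) y₂ at hc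
    have ha : hQ.label y₁ (ξ y₁) = hQ.label y₂ (ξ y₂) := by rw [hQ.label_leaf hξ, hQ.label_leaf hξ]
    refine lt_of_le_of_ne ?_ fun he => ?_
    · simp only [hsnd, saddleHeight]
      rw [ha]
      refine add_le_add hc ?_
      rcases lt_or_ge (hQ.label y₂ (ξ y₂)) 0 with hn | hn
      · refine mul_le_mul_of_nonneg_left ?_ (le_max_right _ _)
        have b1 := hP.spread_mem (lo := lo) (hi := hi) (ξ y₁) y₁
        have b2 := hP.spread_mem (lo := lo) (hi := hi) (ξ y₂) y₂
        rcases lt_or_ge (hP.label (ξ y₁) y₁) 0 with h1 | h1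
        · rw [hP.spread_of_neg hlh hI h1]; exact b2.1
        rcases lt_or_ge 0 (hP.label (ξ y₂) y₂) with h2 | h2
        · rw [hP.spread_of_pos hlh hI h2]; exact b1.2
        have c1 : hP.label (ξ y₁) y₁ = 0 := le_antisymm (hc.trans h2) h1
        have c2 : hP.label (ξ y₂) y₂ = 0 := le_antisymm h2 (h1.trans hc)
        rw [hP.spread_of_zero hlh hI c1, hP.spread_of_zero hlh hI c2]
        have hx2 : ξ y₂ < 0 := (label_sign_of_label_eq_zero hP hQ c2).1.1 hn
        have := (hP.lt_leaf_neg_one_iff (hP.isLeaf_leaf (ξ y₁) y₁) hx2 y₂).2 hlt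
        have hpos : 0 < hi - lo := by linarith
        gcongr
      · rw [max_eq_right (by linarith), zero_mul, zero_mul]
    · have : h (ξ y₁, y₁) = h (ξ y₂, y₂) := Prod.ext (by rw [hfst, hfst]; exact ha) he
      exact hy.ne (congrArg Prod.snd (h.injective this))
  -- points of a leaf, in straightened coordinates
  have hleaf_ne : ∀ {η' : ℝ → ℝ}, IsLeaf κ P η' → η' 0 ≠ 0 → ∀ z, z.2 = η' z.1 ↔
      saddleLabel (h z) = η' 0 := by
    intro η' hη' h0 z
    rw [hlab]
    refine ⟨fun hz => by rw [hz, hP.label_leaf hη'], fun hz => ?_⟩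
    rw [hη'.eq_of_apply_zero_ne hP (hP.isLeaf_leaf z.1 z.2) h0 hz.symm, hP.leaf_apply]
  have hright : ∀ {η' : ℝ → ℝ}, IsLeaf κ P η' → η' 0 = 0 → ∀ z, 0 < (h z).1 →
      (z.2 = η' z.1 ↔ (h z).2 = 0) := by
    intro η' hη' h0 z hz
    rw [s0 _ hz, hlab]
    refine ⟨fun hze => by rw [hze, hP.label_leaf hη', h0], fun hc => ?_⟩
    have hx := (label_sign_of_label_eq_zero hP hQ hc).2.1.1 (hfst z ▸ hz)
    rw [hPr η' _ hη' (hP.isLeaf_leaf z.1 z.2) h0 hc z.1 hx.le, hP.leaf_apply]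
  have hleft : ∀ {η' : ℝ → ℝ}, IsLeaf κ P η' → η' 0 = 0 → ∀ z, (h z).1 < 0 →
      (z.2 = η' z.1 ↔ (h z).2 = -((2 * η' (-1) - lo - hi) / (hi - lo) * (h z).1)) := by
    intro η' hη' h0 z hz
    have hmax : max (-(h z).1) 0 = -(h z).1 := max_eq_left (by linarith)
    have hmem : η' (-1) ∈ Icc lo hi := by rw [← hI, hP.label_leaf hη', h0]
    have hpos : 0 < hi - lo := by linarith
    constructor
    · intro hze
      have hc : hP.label z.1 z.2 = 0 := by rw [hze, hP.label_leaf hη', h0]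
      have hx : z.1 < 0 := (label_sign_of_label_eq_zero hP hQ hc).1.1 (by rwa [← hfst])
      have hl : hP.leaf z.1 z.2 (-1) = η' (-1) :=
        (hP.isLeaf_leaf z.1 z.2).eqOn_nonpos hP hη' hx (by rw [hP.leaf_apply, hze]) (by norm_num)
      rw [hsnd, saddleHeight, hP.spread_of_zero hlh hI hc, hc, hl, ← hfst, hmax]
      ring
    · intro hze
      have hb : |(h z).2| ≤ -(h z).1 := by
        rw [hze, abs_neg, abs_mul, abs_of_neg hz]
        refine mul_le_of_le_one_left (by linarith) ?_
        rw [abs_le, le_div_iff₀ hpos, div_le_iff₀ hpos]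
        constructor <;> linarith [hmem.1, hmem.2]
      have hc : hP.label z.1 z.2 = 0 := by rw [← hlab, s1 _ hb]
      have hx : z.1 < 0 := (label_sign_of_label_eq_zero hP hQ hc).1.1 (by rwa [← hfst])
      rw [hsnd, saddleHeight, hP.spread_of_zero hlh hI hc, hc, ← hfst, hmax, zero_add,
        mul_comm, ← mul_neg] at hze
      have h1 := mul_right_cancel₀ (by linarith : -(h z).1 ≠ 0) hze
      rw [div_left_inj' hpos.ne'] at h1
      have h2 : η' (-1) = hP.leaf z.1 z.2 (-1) := by linarith
      rw [hη'.eqOn_nonpos hP (hP.isLeaf_leaf z.1 z.2) (by norm_num) h2 hx.le, hP.leaf_apply]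
  refine ⟨h, h00, fun z hz => ?_, maximal_isNetArc_iff ?_ ?_ ?_⟩
  · have h1 : |hQ.label z.2 z.1| ≤ 1 := by
      have := hz.1; rw [hfst] at this; exact abs_le.2 ⟨this.1.le, this.2.le⟩
    have h2 : |hP.label z.1 z.2| ≤ 1 := by
      rw [← hlab]
      exact (abs_saddleLabel_le _).trans (abs_le.2 ⟨hz.2.1.le, hz.2.2.le⟩)
    simpa using norm_le_of_labels hP hQ z h1 h2
  · rintro F (hF | hF)
    · have hprop : F ⊆ square ∧ 0 ∉ F := by
        obtain ⟨k, l, rfl⟩ := saddleNodeLines_fibre hF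
        exact ⟨fun w hw => hw.1, fun hw => hw.2.1 rfl⟩
      have key : ∀ (η' : ℝ → ℝ) (a b : ℝ), IsLeaf κ P η' → a < b →
          (∀ z, h z ∈ F ↔ z.2 = η' z.1 ∧ (h z).1 ∈ Ioo a b) →
          IsNetArc P Q (h ⁻¹' square) (h ⁻¹' F) := by
        intro η' a b hη' hab hz
        have he : h ⁻¹' F = {z | z.2 = η' z.1 ∧ hQ.label z.2 z.1 ∈ Ioo a b} := by
          ext z
          rw [mem_preimage, hz, hfst]
          rfl
        rw [he]
        refine isNetArc_between hP hη' hQ hQr hQl hab fun z h1 h2 => ?_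
        have hzF : h z ∈ F := (hz z).2 ⟨h1, by rwa [hfst]⟩
        exact ⟨hprop.1 hzF, fun h0 => hprop.2 (by rw [h0, h00] at hzF; exact hzF)⟩
      rcases mem_saddleNodeLines_iff.1 hF with ⟨m, hm, rfl⟩ | rfl | ⟨a, ha, rfl⟩ | ⟨a, ha, rfl⟩
      · set y := (lo + hi) / 2 + (hi - lo) / 2 * m with hy
        have hpos : 0 < hi - lo := by linarith
        have hyI : y ∈ Icc lo hi := by constructor <;> nlinarith [hm.1, hm.2]
        have hy0 : hP.leaf (-1) y 0 = 0 := (hI y).2 hyI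
        have hym : (2 * hP.leaf (-1) y (-1) - lo - hi) / (hi - lo) = m := by
          rw [hP.leaf_apply, hy]; field_simp; ring
        refine key (hP.leaf (-1) y) (-1) 0 (hP.isLeaf_leaf _ _) (by norm_num) fun z => ?_
        rw [mem_ofPred_eq, and_comm]
        exact and_congr_left fun h1 => by rw [hleft (hP.isLeaf_leaf _ _) hy0 z h1.2, hym]
      · refine key (hP.leaf 0 0) 0 1 (hP.isLeaf_leaf _ _) (by norm_num) fun z => ?_
        rw [mem_ofPred_eq, and_comm]
        exact and_congr_left fun h1 => (hright (hP.isLeaf_leaf _ _) (hP.leaf_apply 0 0) z h1.1).symm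
      · refine key (hP.leaf 0 a) (a - 1) 1 (hP.isLeaf_leaf _ _) (by linarith [ha.2]) fun z => ?_
        rw [mem_ofPred_eq, hleaf_ne (hP.isLeaf_leaf _ _) (by rw [hP.leaf_apply]; exact ha.1.ne'),
          hP.leaf_apply, (s2 _ _ ha.1).1, and_comm]
      · refine key (hP.leaf 0 (-a)) (a - 1) 1 (hP.isLeaf_leaf _ _) (by linarith [ha.2]) fun z => ?_
        rw [mem_ofPred_eq, hleaf_ne (hP.isLeaf_leaf _ _) (by rw [hP.leaf_apply]; linarith [ha.1]),
          hP.leaf_apply, (s2 _ _ ha.1).2, and_comm]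
    · exact hs.isNetArc_vertical hQr hQl F hF
  · intro L hL
    rcases hL.exists_leaf hP hQ with ⟨η', hη', h1, h2⟩ | ⟨ξ, hξ, h1, h2⟩
    · obtain ⟨w, hw⟩ := hL.nonempty
      have hsq : ∀ z ∈ L, h z ∈ square := fun z hz => hL.subset hz
      suffices ∃ F ∈ saddleNodeLines, L ⊆ h ⁻¹' F by
        obtain ⟨F, hF, hLF⟩ := this
        exact ⟨F, Or.inl hF, hLF⟩
      rcases lt_trichotomy (η' 0) 0 with h0 | h0 | h0
      · have hp := neg_pos.2 h0
        have heq := fun z hz =>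
          (s2 (h z) _ hp).2.2 (((hleaf_ne hη' h0.ne z).1 (h1 z hz)).trans (neg_neg _).symm)
        have hb := fun z hz => s3 (h z) (hsq z hz) _ hp (Or.inr (heq z hz))
        exact ⟨_, mem_saddleNodeLines_iff.2 (Or.inr (Or.inr (Or.inr
          ⟨-η' 0, ⟨hp, (hb w hw).1⟩, rfl⟩))), fun z hz => ⟨(hb z hz).2, heq z hz⟩⟩
      · rcases h2 h0 with h3 | h3
        · have hpos : ∀ z ∈ L, 0 < (h z).1 := fun z hz => by
            rw [hfst]
            exact (label_sign_of_label_eq_zero hP hQ (by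
              rw [h1 z hz, hP.label_leaf hη', h0])).2.1.2 (h3 z hz)
          exact ⟨_, mem_saddleNodeLines_iff.2 (Or.inr (Or.inl rfl)), fun z hz =>
            ⟨⟨hpos z hz, (hsq z hz).1.2⟩, (hright hη' h0 z (hpos z hz)).1 (h1 z hz)⟩⟩
        · have hneg : ∀ z ∈ L, (h z).1 < 0 := fun z hz => by
            rw [hfst]
            exact (label_sign_of_label_eq_zero hP hQ (by
              rw [h1 z hz, hP.label_leaf hη', h0])).1.2 (h3 z hz)
          have hmem : η' (-1) ∈ Icc lo hi := by rw [← hI, hP.label_leaf hη', h0]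
          have hpos : 0 < hi - lo := by linarith
          refine ⟨_, mem_saddleNodeLines_iff.2 (Or.inl
            ⟨(2 * η' (-1) - lo - hi) / (hi - lo), ⟨?_, ?_⟩, rfl⟩), fun z hz =>
            ⟨⟨(hsq z hz).1.1, hneg z hz⟩, (hleft hη' h0 z (hneg z hz)).1 (h1 z hz)⟩⟩
          · rw [le_div_iff₀ hpos]; linarith [hmem.1]
          · rw [div_le_iff₀ hpos]; linarith [hmem.2]
      · have heq := fun z hz => (s2 (h z) _ h0).1.2 ((hleaf_ne hη' h0.ne' z).1 (h1 z hz))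
        have hb := fun z hz => s3 (h z) (hsq z hz) _ h0 (Or.inl (heq z hz))
        exact ⟨_, mem_saddleNodeLines_iff.2 (Or.inr (Or.inr (Or.inl
          ⟨η' 0, ⟨h0, (hb w hw).1⟩, rfl⟩))), fun z hz => ⟨(hb z hz).2, heq z hz⟩⟩
    · obtain ⟨F, hF, hLF⟩ := hs.exists_vertical hL.subset hL.nonempty hξ h1 h2
      exact ⟨F, Or.inr hF, hLF⟩
  · refine antichain_of_transverse saddleNodeLines_eq_of_mem verticals_eq_of_mem
      saddleNodeLines_two saddleNodeLines_injOn ?_ verticals_fst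
    intro F hF
    obtain ⟨w, hw, w', hw', hne⟩ := verticals_two F hF
    exact ⟨w, hw, w', hw', fun h => hne (by rw [h])⟩

end

section

variable {κ : ℝ} {P Q : ℝ → ℝ → ℝ} {η ζ ξ : ℝ → ℝ}

/-! ### Slope fields defined near the origin -/

/-- A slope field of class `C¹` in a punctured neighbourhood of the origin, bounded by `κ < 1`. -/
structure LocalSlope (κ R : ℝ) (p : ℝ → ℝ → ℝ) : Prop where
  nonneg : 0 ≤ κ
  lt_one : κ < 1
  bound : ∀ x y, |x| ≤ R → |y| ≤ R → |p x y| ≤ κ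
  contDiffAt : ∀ x y, |x| ≤ R → |y| ≤ R → (x ≠ 0 ∨ y ≠ 0) →
    ContDiffAt ℝ 1 (Function.uncurry p) (x, y)

/-- Truncation to the interval `[-R, R]`. -/
def clamp (R x : ℝ) : ℝ := max (-R) (min R x)

theorem abs_clamp_le {R : ℝ} (hR : 0 ≤ R) (x : ℝ) : |clamp R x| ≤ R := by grind [clamp]

theorem clamp_of_abs_le {R x : ℝ} (h : |x| ≤ R) : clamp R x = x := by grind [clamp]

theorem continuous_clamp (R : ℝ) : Continuous (clamp R) := by unfold clamp; fun_prop

theorem abs_clamp_sub_le (R x y : ℝ) : |clamp R x - clamp R y| ≤ |x - y| := by grind [clamp]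

theorem le_clamp {R δ x : ℝ} (hδ : δ ≤ R) (h : δ ≤ x) : δ ≤ clamp R x := by grind [clamp]

theorem clamp_le {R δ x : ℝ} (hδ : δ ≤ R) (h : x ≤ -δ) : clamp R x ≤ -δ := by grind [clamp]

theorem le_abs_clamp {R δ x : ℝ} (hδ : δ ≤ R) (h : δ ≤ |x|) : δ ≤ |clamp R x| := by grind [clamp]

theorem clamp_ne_zero {R x : ℝ} (hR : 0 < R) (h : x ≠ 0) : clamp R x ≠ 0 := by grind [clamp]

/-- The partial derivative of a slope field along the fibres. -/
def slopeDeriv (p : ℝ → ℝ → ℝ) (x y : ℝ) : ℝ := 𝐃 (Function.uncurry p) (x, y) (0, 1)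

theorem hasDerivAt_slope {p : ℝ → ℝ → ℝ} {x y : ℝ}
    (h : ContDiffAt ℝ 1 (Function.uncurry p) (x, y)) :
    HasDerivAt (fun y => p x y) (slopeDeriv p x y) y := by
  have h1 : HasFDerivAt (Function.uncurry p) _ (x, y) :=
    (h.differentiableAt one_ne_zero).hasFDerivAt
  have h2 : HasDerivAt (fun y : ℝ => (x, y)) (0, 1) y :=
    (hasDerivAt_const y x).prodMk (hasDerivAt_id y)
  exact h1.comp_hasDerivAt y h2

theorem LocalSlope.exists_lipschitz {R : ℝ} {p : ℝ → ℝ → ℝ} (hp : LocalSlope κ R p)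
    {C D : Set ℝ} (hC : IsCompact C) (hD : IsCompact D) (hDc : Convex ℝ D)
    (hCR : ∀ x ∈ C, |x| ≤ R) (hDR : ∀ y ∈ D, |y| ≤ R)
    (h0 : ∀ x ∈ C, ∀ y ∈ D, x ≠ 0 ∨ y ≠ 0) :
    ∃ K : NNReal, ∀ x ∈ C, ∀ y ∈ D, ∀ y' ∈ D, |p x y - p x y'| ≤ K * |y - y'| := by
  have hcont : ContinuousOn (fun z : ℝ² => slopeDeriv p z.1 z.2) (C ×ˢ D) := by
    intro z hz
    have := hp.contDiffAt z.1 z.2 (hCR _ hz.1) (hDR _ hz.2) (h0 _ hz.1 _ hz.2)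
    have h1 : ContinuousAt (𝐃 (Function.uncurry p)) z := this.continuousAt_fderiv one_ne_zero
    exact (h1.clm_apply continuousAt_const).continuousWithinAt
  obtain ⟨K, hK⟩ := (hC.prod hD).exists_bound_of_continuousOn hcont
  refine ⟨K.toNNReal, fun x hx y hy y' hy' => ?_⟩
  have := hDc.norm_image_sub_le_of_norm_hasDerivWithin_le (f := fun y => p x y)
    (f' := fun y => slopeDeriv p x y) (C := K.toNNReal)
    (fun t ht => (hasDerivAt_slope
      (hp.contDiffAt x t (hCR x hx) (hDR t ht) (h0 x hx t ht))).hasDerivWithinAt)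
    (fun t ht => (hK (x, t) ⟨hx, ht⟩).trans (Real.le_coe_toNNReal K)) hy' hy
  simpa [Real.norm_eq_abs] using this

/-- Truncation and rescaling turn a local slope field into a global one. -/
theorem LocalSlope.slopeField {R ε : ℝ} {p : ℝ → ℝ → ℝ} (hp : LocalSlope κ R p) (hR : 0 < R)
    (hε : 0 < ε) : SlopeField κ fun x y => p (clamp R (ε * x)) (clamp R (ε * y)) := by
  have hne : ∀ x y : ℝ, (x ≠ 0 ∨ y ≠ 0) → clamp R (ε * x) ≠ 0 ∨ clamp R (ε * y) ≠ 0 :=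
    fun x y h => h.imp (fun h => clamp_ne_zero hR (mul_ne_zero hε.ne' h))
      fun h => clamp_ne_zero hR (mul_ne_zero hε.ne' h)
  have habs := fun x => abs_clamp_le hR.le (x := x)
  refine ⟨hp.nonneg, hp.lt_one, fun x y => hp.bound _ _ (habs _) (habs _), fun x y h => ?_,
    fun δ hδ => ?_⟩
  · have h1 := (hp.contDiffAt _ _ (habs _) (habs _) (hne x y h)).continuousAt
    exact h1.comp (f := fun z : ℝ² => (clamp R (ε * z.1), clamp R (ε * z.2))) (x := (x, y))
      (((continuous_clamp R).comp (continuous_const.mul continuous_fst)).prodMk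
        ((continuous_clamp R).comp (continuous_const.mul continuous_snd))).continuousAt
  · set δ' := min (ε * δ) R with hδ'
    have hδ0 : 0 < δ' := lt_min (by positivity) hR
    have hδR : δ' ≤ R := min_le_right _ _
    obtain ⟨K₁, hK₁⟩ := hp.exists_lipschitz (C := Icc δ' R ∪ Icc (-R) (-δ')) (D := Icc (-R) R)
      (isCompact_Icc.union isCompact_Icc) isCompact_Icc (convex_Icc _ _)
      (by grind) (fun y hy => abs_le.2 hy) (by grind)
    obtain ⟨K₂, hK₂⟩ := hp.exists_lipschitz (C := Icc (-R) R) (D := Icc δ' R)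
      isCompact_Icc isCompact_Icc (convex_Icc _ _) (by grind) (by grind) (by grind)
    obtain ⟨K₃, hK₃⟩ := hp.exists_lipschitz (C := Icc (-R) R) (D := Icc (-R) (-δ'))
      isCompact_Icc isCompact_Icc (convex_Icc _ _) (by grind) (by grind) (by grind)
    refine ⟨(K₁ + K₂ + K₃) * ε.toNNReal, fun x y y' h => ?_⟩
    have hin := fun x => abs_le.1 (habs x)
    have hcl : |clamp R (ε * y) - clamp R (ε * y')| ≤ ε * |y - y'| := by
      refine (abs_clamp_sub_le _ _ _).trans (le_of_eq ?_)
      rw [← mul_sub, abs_mul, abs_of_pos hε]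
    have hfin : ∀ K : NNReal, K ≤ K₁ + K₂ + K₃ →
        |p (clamp R (ε * x)) (clamp R (ε * y)) - p (clamp R (ε * x)) (clamp R (ε * y'))|
          ≤ K * |clamp R (ε * y) - clamp R (ε * y')| →
        |p (clamp R (ε * x)) (clamp R (ε * y)) - p (clamp R (ε * x)) (clamp R (ε * y'))|
          ≤ ((K₁ + K₂ + K₃) * ε.toNNReal : NNReal) * |y - y'| := by
      intro K hK h
      refine h.trans ?_
      have : (K : ℝ) ≤ (K₁ + K₂ + K₃ : NNReal) := by exact_mod_cast hK
      calc (K : ℝ) * |clamp R (ε * y) - clamp R (ε * y')|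
          ≤ (K₁ + K₂ + K₃ : NNReal) * (ε * |y - y'|) := by gcongr
        _ = _ := by rw [NNReal.coe_mul, Real.coe_toNNReal ε hε.le]; ring
    have hmul : ∀ t : ℝ, δ ≤ t → δ' ≤ ε * t := fun t ht =>
      (min_le_left _ _).trans (mul_le_mul_of_nonneg_left ht hε.le)
    have k1 : K₁ ≤ K₁ + K₂ + K₃ := by rw [add_assoc]; exact le_self_add
    have k2 : K₂ ≤ K₁ + K₂ + K₃ := le_add_right le_add_self
    have k3 : K₃ ≤ K₁ + K₂ + K₃ := le_add_self
    rcases h with h | ⟨h, h'⟩ | ⟨h, h'⟩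
    · refine hfin K₁ k1 (hK₁ _ ?_ _ (hin _) _ (hin _))
      have := le_abs_clamp (R := R) (x := ε * x) hδR (by
        rw [abs_mul, abs_of_pos hε]; exact hmul _ h)
      rcases le_abs.1 this with h | h
      · exact Or.inl ⟨h, (hin _).2⟩
      · exact Or.inr ⟨(hin _).1, by linarith⟩
    · exact hfin K₂ k2 (hK₂ _ (hin _) _ ⟨le_clamp hδR (hmul _ h), (hin _).2⟩
        _ ⟨le_clamp hδR (hmul _ h'), (hin _).2⟩)
    · have e : ∀ t : ℝ, t ≤ -δ → ε * t ≤ -δ' := fun t ht => by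
        have := hmul (-t) (by linarith)
        linarith
      have hz := clamp_le hδR (e _ h')
      exact hfin K₃ k3 (hK₃ _ (hin _) _ ⟨(hin _).1, clamp_le hδR (e _ h)⟩ _ ⟨(hin _).1, hz⟩)

/-- A leaf reflected in the vertical axis. -/
theorem IsLeaf.reflect (hη : IsLeaf κ P η) : IsLeaf κ (fun x y => -P (-x) y) fun x => η (-x) := by
  refine ⟨fun x y => ?_, fun x hx => ?_⟩
  · have := hη.lip (-x) (-y)
    rwa [neg_sub_neg, abs_sub_comm y x] at this
  · have h1 := hη.deriv (-x) (hx.imp neg_ne_zero.2 id)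
    have := h1.comp x (hasDerivAt_neg x)
    rwa [mul_neg_one] at this

theorem UniqueRight.of_reflect (h : UniqueRight κ fun x y => -P (-x) y) : UniqueLeft κ P := by
  intro η ζ hη hζ h0 h0' x hx
  have := h _ _ hη.reflect hζ.reflect (by simpa using h0) (by simpa using h0') (-x) (by linarith)
  simpa using this

/-- A one-sided Lipschitz condition on the cone `|y| ≤ κ x` gives uniqueness to the right. -/
theorem uniqueRight_of_lipschitz (hP : SlopeField κ P) {K r : ℝ} (hr : 0 < r)
    (h : ∀ x y y', 0 < x → x ≤ r → y ≤ y' → |y| ≤ κ * x → |y'| ≤ κ * x →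
      P x y' - P x y ≤ K * (y' - y)) : UniqueRight κ P := by
  have key : ∀ η ζ, IsLeaf κ P η → IsLeaf κ P ζ → η 0 = 0 → ζ 0 = 0 → ¬ η r < ζ r := by
    intro η ζ hη hζ h0 h0' hlt
    have hpos : ∀ x, 0 < x → η x < ζ x := by
      intro x hx
      by_contra! hc
      rcases hc.lt_or_eq with hc | hc
      · obtain ⟨z, hz, hzz⟩ := exists_eq_of_lt_of_lt hη.continuous hζ.continuous hlt hc
        exact hlt.ne (hη.eqOn_nonneg hP hζ (by grind [mem_uIcc]) hzz hr.le)
      · exact hlt.ne (hη.eqOn_nonneg hP hζ hx hc.symm hr.le)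
    have hcone : ∀ η : ℝ → ℝ, IsLeaf κ P η → η 0 = 0 → ∀ x, 0 < x → |η x| ≤ κ * x := by
      intro η hη h0 x hx
      have := hη.lip x 0
      rwa [h0, sub_zero, sub_zero, abs_of_pos hx] at this
    set g : ℝ → ℝ := fun x => (ζ x - η x) * Real.exp (-K * x) with hg
    have hgc : Continuous g := by have := hη.continuous; have := hζ.continuous; fun_prop
    have hanti : AntitoneOn g (Icc 0 r) := by
      have hd : ∀ x ∈ interior (Icc 0 r), HasDerivAt g _ x := fun x hx => by
        rw [interior_Icc] at hx
        exact ((hζ.deriv x (Or.inl hx.1.ne')).sub (hη.deriv x (Or.inl hx.1.ne'))).mul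
          ((hasDerivAt_id x).const_mul (-K)).exp
      refine antitoneOn_of_hasDerivWithinAt_nonpos (convex_Icc 0 r) hgc.continuousOn
        (fun x hx => (hd x hx).hasDerivWithinAt) fun x hx => ?_
      rw [interior_Icc] at hx
      have h5 := h x (η x) (ζ x) hx.1 hx.2.le (hpos x hx.1).le (hcone η hη h0 x hx.1)
        (hcone ζ hζ h0' x hx.1)
      have h6 := Real.exp_pos (-K * x)
      simp only [Pi.sub_apply, id]
      nlinarith
    have h1 := hanti (left_mem_Icc.2 hr.le) (right_mem_Icc.2 hr.le) hr.le
    simp only [hg, h0, h0', sub_self, zero_mul] at h1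
    linarith [mul_pos (sub_pos.2 (hpos r hr)) (Real.exp_pos (-K * r))]
  intro η ζ hη hζ h0 h0' x hx
  have h1 := key η ζ hη hζ h0 h0'
  have h2 := key ζ η hζ hη h0' h0
  exact hη.eqOn_nonneg hP hζ hr (le_antisymm (not_lt.1 h2) (not_lt.1 h1)) hx

theorem LocalSlope.sub_le_of_deriv_le {R K : ℝ} {p : ℝ → ℝ → ℝ} (hp : LocalSlope κ R p) {x y y' : ℝ}
    (hx : x ≠ 0) (hxR : |x| ≤ R) (hyy : y ≤ y') (hy : |y| ≤ R) (hy' : |y'| ≤ R)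
    (h : ∀ t ∈ Icc y y', slopeDeriv p x t ≤ K) : p x y' - p x y ≤ K * (y' - y) := by
  have hin : ∀ t ∈ Icc y y', |t| ≤ R := fun t ht =>
    abs_le.2 ⟨(abs_le.1 hy).1.trans ht.1, ht.2.trans (abs_le.1 hy').2⟩
  have hd : ∀ t ∈ Icc y y', HasDerivAt (fun y => p x y) (slopeDeriv p x t) t := fun t ht =>
    hasDerivAt_slope (hp.contDiffAt x t hxR (hin t ht) (Or.inl hx))
  refine (convex_Icc y y').image_sub_le_mul_sub_of_deriv_le
    (fun t ht => (hd t ht).continuousAt.continuousWithinAt)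
    (fun t ht => (hd t (interior_subset ht)).differentiableAt.differentiableWithinAt)
    (fun t ht => ?_) y (left_mem_Icc.2 hyy) y' (right_mem_Icc.2 hyy) hyy
  rw [(hd t (interior_subset ht)).deriv]
  exact h t (interior_subset ht)

theorem LocalSlope.uniqueRight {R ε K r : ℝ} {p : ℝ → ℝ → ℝ} (hp : LocalSlope κ R p) (hR : 0 < R)
    (hε : 0 < ε) (hr : 0 < r)
    (h : ∀ x y, 0 < x → x ≤ r → |y| ≤ κ * x → slopeDeriv p x y ≤ K) :
    UniqueRight κ fun x y => p (clamp R (ε * x)) (clamp R (ε * y)) := by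
  set ρ := min r R with hρ
  have hρ0 : 0 < ρ := lt_min hr hR
  refine uniqueRight_of_lipschitz (hp.slopeField hR hε) (K := ε * K) (r := ρ / ε)
    (div_pos hρ0 hε) fun x y y' hx hxr hyy hy hy' => ?_
  have hx1 : 0 < ε * x := mul_pos hε hx
  have hx2 : ε * x ≤ ρ := by rw [le_div_iff₀ hε] at hxr; linarith
  have hk := hp.lt_one
  have hsc : ∀ y : ℝ, |y| ≤ κ * x → |ε * y| ≤ κ * (ε * x) := fun y hy => by
    rw [abs_mul, abs_of_pos hε]
    calc ε * |y| ≤ ε * (κ * x) := mul_le_mul_of_nonneg_left hy hε.le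
      _ = _ := by ring
  have hlt : κ * (ε * x) ≤ ε * x := mul_le_of_le_one_left hx1.le hk.le
  have hb : ∀ y : ℝ, |y| ≤ κ * x → |ε * y| ≤ R := fun y hy =>
    (hsc y hy).trans (hlt.trans (hx2.trans (min_le_right _ _)))
  have hxR : |ε * x| ≤ R := by rw [abs_of_pos hx1]; exact hx2.trans (min_le_right _ _)
  rw [clamp_of_abs_le hxR, clamp_of_abs_le (hb y hy), clamp_of_abs_le (hb y' hy')]
  have := hp.sub_le_of_deriv_le (K := K) hx1.ne' hxR
    (mul_le_mul_of_nonneg_left hyy hε.le) (hb y hy) (hb y' hy') fun t ht => by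
      refine h _ t hx1 (hx2.trans (min_le_left _ _)) (abs_le.2 ⟨?_, ?_⟩)
      · exact (abs_le.1 (hsc y hy)).1.trans ht.1
      · exact ht.2.trans (abs_le.1 (hsc y' hy')).2
  linarith

theorem LocalSlope.reflect {R : ℝ} {p : ℝ → ℝ → ℝ} (hp : LocalSlope κ R p) :
    LocalSlope κ R fun x y => -p (-x) y := by
  refine ⟨hp.nonneg, hp.lt_one, fun x y hx hy => ?_, fun x y hx hy h => ?_⟩
  · rw [abs_neg]; exact hp.bound _ _ (by rwa [abs_neg]) hy
  · have h1 := hp.contDiffAt (-x) y (by rwa [abs_neg]) hy (h.imp neg_ne_zero.2 id)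
    have h2 : ContDiffAt ℝ 1 (fun z : ℝ² => (-z.1, z.2)) (x, y) := by fun_prop
    exact (ContDiffAt.comp (x, y) h1 h2).neg

theorem slopeDeriv_reflect {p : ℝ → ℝ → ℝ} {x y : ℝ}
    (h : ContDiffAt ℝ 1 (Function.uncurry p) (-x, y))
    (h' : ContDiffAt ℝ 1 (Function.uncurry fun x y => -p (-x) y) (x, y)) :
    slopeDeriv (fun x y => -p (-x) y) x y = -slopeDeriv p (-x) y :=
  (hasDerivAt_slope h').unique (hasDerivAt_slope h).neg

theorem clamp_neg (R : ℝ) (hR : 0 ≤ R) (x : ℝ) : clamp R (-x) = -clamp R x := by grind [clamp]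

theorem LocalSlope.uniqueLeft {R ε K r : ℝ} {p : ℝ → ℝ → ℝ} (hp : LocalSlope κ R p) (hR : 0 < R)
    (hε : 0 < ε) (hr : 0 < r)
    (h : ∀ x y, 0 < x → x ≤ r → |y| ≤ κ * x → -slopeDeriv p (-x) y ≤ K) :
    UniqueLeft κ fun x y => p (clamp R (ε * x)) (clamp R (ε * y)) := by
  refine UniqueRight.of_reflect ?_
  have := hp.reflect.uniqueRight (K := K) hR hε (lt_min hr hR) (fun x y hx hxr hy => by
    have hxR : |x| ≤ R := by rw [abs_of_pos hx]; exact hxr.trans (min_le_right _ _)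
    have hyR : |y| ≤ R := hy.trans ((mul_le_of_le_one_left hx.le hp.lt_one.le).trans
      (hxr.trans (min_le_right _ _)))
    rw [slopeDeriv_reflect (hp.contDiffAt _ _ (by rwa [abs_neg]) hyR (Or.inl (by linarith)))
      (hp.reflect.contDiffAt x y hxR hyR (Or.inl hx.ne'))]
    exact h x y hx (hxr.trans (min_le_left _ _)) hy)
  have he : (fun x y => -p (clamp R (ε * -x)) (clamp R (ε * y)))
      = fun x y => -p (-clamp R (ε * x)) (clamp R (ε * y)) := by
    funext x y
    rw [mul_neg, clamp_neg R hR.le]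
  rw [he]
  exact this

/-- A trapped wedge to the left of the origin contains several leaves ending at the origin. -/
theorem exists_two_leaves (hP : SlopeField κ P) {m r : ℝ} (hm : 0 < m) (hr : 0 < r)
    (hup : ∀ x, -r ≤ x → x < 0 → P x (-m * x) < -m) (hdn : ∀ x, -r ≤ x → x < 0 → m < P x (m * x)) :
    ∃ η ζ, IsLeaf κ P η ∧ IsLeaf κ P ζ ∧ η 0 = 0 ∧ ζ 0 = 0 ∧ η (-1) < ζ (-1) := by
  have key : ∀ η, IsLeaf κ P η → |η (-r)| ≤ m * r → η 0 = 0 := by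
    intro η hη h0
    obtain ⟨hl, hu⟩ := abs_le.1 h0
    have h1 : ∀ f f' : ℝ → ℝ, Continuous f → (∀ t < 0, HasDerivAt f (f' t) t) → f (-r) ≤ m * r →
        (∀ t, -r ≤ t → t < 0 → f t = -m * t → f' t < -m) → f 0 ≤ 0 := by
      intro f f' hf hd hr0 hb
      have hc : Continuous fun x : ℝ => -m * x := by fun_prop
      have hle : ∀ᶠ x in 𝓝[<] (0 : ℝ), f x ≤ -m * x := by
        filter_upwards [Ico_mem_nhdsLT (by linarith : -r < 0)] with x hx
        exact image_le_of_deriv_right_lt_deriv_boundary (a := -r) (b := x) (B := fun t => -m * t)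
          (B' := fun _ => -m) hf.continuousOn (fun t ht => (hd t (ht.2.trans hx.2)).hasDerivWithinAt) (by linarith)
          (fun t => by simpa using (hasDerivAt_id t).const_mul (-m))
          (fun t ht => hb t ht.1 (ht.2.trans hx.2)) (right_mem_Icc.2 hx.1)
      simpa using le_of_tendsto_of_tendsto ((hf.tendsto 0).mono_left nhdsWithin_le_nhds)
        ((hc.tendsto 0).mono_left nhdsWithin_le_nhds) hle
    have u := h1 η _ hη.continuous (fun t ht => hη.deriv t (Or.inl ht.ne)) hu
      fun t ht ht' he => by rw [he]; exact hup t ht ht'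
    have l := h1 (fun t => -η t) _ hη.continuous.neg (fun t ht => (hη.deriv t (Or.inl ht.ne)).neg)
      (by linarith) fun t ht ht' he => by rw [show η t = m * t by linarith]; linarith [hdn t ht ht']
    linarith
  have hmr : 0 < m * r := mul_pos hm hr
  have hη := hP.isLeaf_leaf (-r) (-(m * r))
  have hζ := hP.isLeaf_leaf (-r) (m * r)
  have eη := hP.leaf_apply (-r) (-(m * r))
  have eζ := hP.leaf_apply (-r) (m * r)
  refine ⟨_, _, hη, hζ, key _ hη (by rw [eη, abs_neg, abs_of_pos hmr]),
    key _ hζ (by rw [eζ, abs_of_pos hmr]), ?_⟩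
  have := (hP.leaf_neg_one_lt_iff hζ (by linarith : -r < 0) (-(m * r))).2 (by rw [eζ]; linarith)
  exact this

/-! ### Nets of local slope fields -/

theorem IsNetArc.image_smul {p q : ℝ → ℝ → ℝ} {ε : ℝ} (hε : ε ≠ 0) {U L V : Set ℝ²}
    (hUV : ∀ z ∈ U, ε • z ∈ V)
    (hp : ∀ z ∈ U, P z.1 z.2 = p (ε * z.1) (ε * z.2))
    (hq : ∀ z ∈ U, Q z.2 z.1 = q (ε * z.2) (ε * z.1)) (h : IsNetArc P Q U L) :
    IsNetArc p q V ((fun z => ε • z) '' L) := by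
  obtain ⟨c, hc, rfl, h⟩ := h
  refine ⟨fun t => ε • c t, hc.const_smul ε, by rw [image_image], fun t ht => ?_⟩
  obtain ⟨h1, h2, h3, h4⟩ := h t ht
  have hd : DifferentiableAt ℝ c t :=
    (hc.differentiableOn one_ne_zero).differentiableAt (isOpen_Ioo.mem_nhds ht)
  have hd' : deriv (fun t => ε • c t) t = ε • deriv c t := (hd.hasDerivAt.const_smul ε).deriv
  refine ⟨hUV _ h1, smul_ne_zero hε h2, ?_⟩
  rw [hd']
  refine ⟨smul_ne_zero hε h3, ?_⟩
  simp only [Prod.smul_fst, Prod.smul_snd, smul_eq_mul]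
  rw [← hp _ h1, ← hq _ h1]
  exact h4.imp (fun h => by rw [h]; ring) fun h => by rw [h]; ring

/-- Transfer of a description of maximal arcs from the rescaled, truncated fields to the original
ones. -/
theorem exists_local_net {R : ℝ} {p q : ℝ → ℝ → ℝ} {𝓕 : Set (Set ℝ²)}
    (hR : 0 < R) (hk : κ < 1)
    (hex : ∃ h : ℝ² ≃ₜ ℝ², h 0 = 0 ∧ (∀ z, h z ∈ square → ‖z‖ ≤ (1 - κ)⁻¹) ∧
      ∀ L, Maximal (IsNetArc (fun x y => p (clamp R (R * (1 - κ) * x)) (clamp R (R * (1 - κ) * y)))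
        (fun x y => q (clamp R (R * (1 - κ) * x)) (clamp R (R * (1 - κ) * y)))
        (h ⁻¹' square)) L ↔ h '' L ∈ 𝓕) :
    ∃ h : ℝ² ≃ₜ ℝ², h 0 = 0 ∧ (∀ z, h z ∈ square → ‖z‖ ≤ R) ∧
      ∀ L, Maximal (IsNetArc p q (h ⁻¹' square)) L ↔ h '' L ∈ 𝓕 := by
  set ε := R * (1 - κ) with hεd
  have hε : 0 < ε := mul_pos hR (by linarith)
  obtain ⟨h, h0, hb, hL⟩ := hex
  set s : ℝ² ≃ₜ ℝ² := Homeomorph.smulOfNeZero ε⁻¹ (inv_ne_zero hε.ne') with hs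
  have hsz : ∀ z, s z = ε⁻¹ • z := fun z => rfl
  have hεs : ∀ z, ε • s z = z := fun z => by rw [hsz, smul_inv_smul₀ hε.ne']
  have hnorm : ∀ z, h (s z) ∈ square → ‖z‖ ≤ R := fun z hz => by
    have h1 := hb _ hz
    rw [← hεs z, norm_smul, Real.norm_eq_abs, abs_of_pos hε]
    calc ε * ‖s z‖ ≤ ε * (1 - κ)⁻¹ := mul_le_mul_of_nonneg_left h1 hε.le
      _ = R := by rw [hεd, mul_assoc, mul_inv_cancel₀ (by linarith), mul_one]
  have hcl : ∀ z, h (s z) ∈ square → clamp R z.1 = z.1 ∧ clamp R z.2 = z.2 := fun z hz =>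
    ⟨clamp_of_abs_le ((norm_fst_le z).trans (hnorm z hz)),
      clamp_of_abs_le ((norm_snd_le z).trans (hnorm z hz))⟩
  set P := (fun x y => p (clamp R (ε * x)) (clamp R (ε * y))) with hPd
  set Q := (fun x y => q (clamp R (ε * x)) (clamp R (ε * y))) with hQd
  have harc : ∀ L, IsNetArc p q ((s.trans h) ⁻¹' square) L ↔ IsNetArc P Q (h ⁻¹' square) (s '' L) := by
    intro L
    constructor
    · intro hA
      refine hA.image_smul (inv_ne_zero hε.ne') (fun z hz => hz) (fun z hz => ?_) fun z hz => ?_ <;>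
      simp only [hPd, hQd, mul_inv_cancel_left₀ hε.ne', hcl z hz]
    · intro hA
      have hcl' : ∀ z, h z ∈ square → clamp R (ε * z.1) = ε * z.1 ∧ clamp R (ε * z.2) = ε * z.2 := by
        intro z hz
        have : h (s (ε • z)) ∈ square := by rwa [hsz, inv_smul_smul₀ hε.ne']
        exact hcl _ this
      have := hA.image_smul (p := p) (q := q) (V := (s.trans h) ⁻¹' square) hε.ne'
        (fun z hz => by
          change h (s (ε • z)) ∈ square
          rwa [hsz, inv_smul_smul₀ hε.ne']) (fun z hz => by
          simp only [hPd]; rw [(hcl' z hz).1, (hcl' z hz).2]) fun z hz => by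
          simp only [hQd]; rw [(hcl' z hz).1, (hcl' z hz).2]
      rw [image_image] at this
      simpa only [hεs, image_id'] using this
  refine ⟨s.trans h, ?_, hnorm, fun L => ?_⟩
  · change h (s 0) = 0
    rw [hsz, smul_zero, h0]
  · have : (s.trans h) '' L = h '' (s '' L) := by rw [image_image]; rfl
    rw [this, ← hL]
    constructor
    · intro hm
      refine ⟨(harc L).1 hm.1, fun L' hL' hle => ?_⟩
      have e : s '' (s ⁻¹' L') = L' := image_preimage_eq _ s.surjective
      have h1 : IsNetArc p q ((s.trans h) ⁻¹' square) (s ⁻¹' L') := (harc _).2 (by rwa [e])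
      have h2 := hm.2 h1 (image_subset_iff.1 hle)
      rw [← e]
      exact image_mono h2
    · intro hm
      refine ⟨(harc L).2 hm.1, fun L' hL' hle => ?_⟩
      have h2 := hm.2 ((harc L').1 hL') (image_mono hle)
      exact (image_subset_image_iff s.injective).1 h2

end

section

open Filter Asymptotics

/-! ### Second-order Taylor expansions -/

section Jets

variable {V : Type*} [NormedAddCommGroup V] [NormedSpace ℝ V]

theorem isLittleO_pow_succ_of_fderiv {g : V → ℝ} {n : ℕ} (hg : ∀ᶠ z in 𝓝 0, DifferentiableAt ℝ g z)
    (h0 : g 0 = 0) (hd : (fun z => 𝐃 g z) =o[𝓝 0] fun z => ‖z‖ ^ n) :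
    g =o[𝓝 0] fun z => ‖z‖ ^ (n + 1) := by
  rw [isLittleO_iff] at hd ⊢
  intro c hc
  obtain ⟨r, hr, hb⟩ := Metric.eventually_nhds_iff_ball.1 (hg.and (hd hc))
  filter_upwards [Metric.ball_mem_nhds (0 : V) hr] with z hz
  have hball : ∀ w ∈ Metric.closedBall (0 : V) ‖z‖, w ∈ Metric.ball (0 : V) r := fun w hw => by
    rw [mem_closedBall_zero_iff] at hw
    rw [mem_ball_zero_iff] at hz ⊢
    exact hw.trans_lt hz
  have := (convex_closedBall (0 : V) ‖z‖).norm_image_sub_le_of_norm_fderiv_le (f := g)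
    (C := c * ‖z‖ ^ n) (x := 0) (y := z) (fun w hw => (hb w (hball w hw)).1)
    (fun w hw => (hb w (hball w hw)).2.trans (by
      rw [norm_pow, norm_norm]
      rw [mem_closedBall_zero_iff] at hw
      gcongr)) (by simp) (by simp)
  rw [h0, sub_zero, sub_zero] at this
  rw [norm_pow, norm_norm, pow_succ, ← mul_assoc]
  exact this

theorem isLittleO_jet_two {f : V → ℝ} (hf : ContDiffAt ℝ 2 f 0) :
    (fun z => f z - f 0 - 𝐃 f 0 z - 1 / 2 * 𝐃 (𝐃 f) 0 z z)
      =o[𝓝 0] fun z => ‖z‖ ^ 2 := by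
  set b := 𝐃 (𝐃 f) 0 with hb
  have hsymm : ∀ v w, b v w = b w v := fun v w => (hf.isSymmSndFDerivAt (by simp)) v w
  have hdf : ContDiffAt ℝ 1 (𝐃 f) 0 := hf.fderiv_right (m := 1) (by norm_num)
  have hev : ∀ᶠ z in 𝓝 (0 : V), DifferentiableAt ℝ f z :=
    (hf.eventually (by simp)).mono fun z hz => hz.differentiableAt (by norm_num)
  have hq : ∀ z, HasFDerivAt (fun z => (1 / 2 : ℝ) * b z z) (b z) z := fun z => by
    have h1 : HasFDerivAt (fun z => b z z) (b z + b.flip z) z := by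
      have := (b.hasFDerivAt (x := z)).clm_apply (hasFDerivAt_id z)
      refine this.congr_fderiv ?_
      ext w
      simp
    refine (h1.const_mul (1 / 2 : ℝ)).congr_fderiv ?_
    ext w
    simp only [smul_apply, add_apply, ContinuousLinearMap.flip_apply, smul_eq_mul, hsymm w z]
    ring
  have hg : ∀ z, DifferentiableAt ℝ f z →
      HasFDerivAt (fun z => f z - f 0 - 𝐃 f 0 z - 1 / 2 * b z z)
        (𝐃 f z - 𝐃 f 0 - b z) z := fun z hz =>
    ((hz.hasFDerivAt.sub_const _).sub (𝐃 f 0).hasFDerivAt).sub (hq z)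
  refine isLittleO_pow_succ_of_fderiv (n := 1) (hev.mono fun z hz => (hg z hz).differentiableAt)
    (by simp) ?_
  have hlo := (hdf.differentiableAt (by norm_num)).hasFDerivAt.isLittleO
  simp only [sub_zero] at hlo
  have he : (fun z => 𝐃 (fun z => f z - f 0 - 𝐃 f 0 z - 1 / 2 * b z z) z)
      =ᶠ[𝓝 0] fun z => 𝐃 f z - 𝐃 f 0 - b z := hev.mono fun z hz => (hg z hz).fderiv
  refine he.trans_isLittleO (hlo.trans_isBigO ?_)
  simp only [pow_one]
  exact (isBigO_refl _ _).norm_right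

theorem exists_abs_sub_le_sq {f : V → ℝ} (hf : ContDiffAt ℝ 2 f 0) (h0 : f 0 = 0) :
    ∃ K > 0, ∀ᶠ z in 𝓝 0, |f z - 𝐃 f 0 z| ≤ K * ‖z‖ ^ 2 := by
  have h := (isLittleO_jet_two hf).bound one_pos
  refine ⟨1 + ‖𝐃 (𝐃 f) 0‖, by positivity, h.mono fun z hz => ?_⟩
  rw [h0, sub_zero, one_mul, Real.norm_eq_abs, norm_pow, norm_norm] at hz
  have h2 := (𝐃 (𝐃 f) 0).le_opNorm₂ z z
  rw [Real.norm_eq_abs] at h2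
  have h3 := abs_sub_abs_le_abs_sub (f z - 𝐃 f 0 z) (1 / 2 * 𝐃 (𝐃 f) 0 z z)
  rw [abs_mul, abs_of_pos (by norm_num : (0 : ℝ) < 1 / 2)] at h3
  nlinarith [abs_nonneg (𝐃 (𝐃 f) 0 z z)]

theorem exists_abs_fderiv_sub_le {f : V → ℝ} (hf : ContDiffAt ℝ 2 f 0) :
    ∃ K > 0, ∀ᶠ z in 𝓝 0, ∀ v, |𝐃 f z v - 𝐃 f 0 v| ≤ K * ‖z‖ * ‖v‖ := by
  have hdf : ContDiffAt ℝ 1 (𝐃 f) 0 := hf.fderiv_right (m := 1) (by norm_num)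
  obtain ⟨K, hK, h⟩ := (hdf.differentiableAt (by norm_num)).isBigO_sub.exists_pos
  refine ⟨K, hK, h.bound.mono fun z hz v => ?_⟩
  rw [sub_zero] at hz
  have := (𝐃 f z - 𝐃 f 0).le_opNorm v
  rw [Real.norm_eq_abs, sub_apply] at this
  exact this.trans (mul_le_mul_of_nonneg_right hz (norm_nonneg v))

end Jets

theorem abs_mul_le {a b p q : ℝ} (ha : |a| ≤ p) (hb : |b| ≤ q) : |a * b| ≤ p * q :=
  (abs_mul a b).trans_le (mul_le_mul ha hb (abs_nonneg _) ((abs_nonneg _).trans ha))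

theorem norm_sq_le (z : ℝ²) : ‖z‖ ^ 2 ≤ z.1 ^ 2 + z.2 ^ 2 := by
  rcases le_total ‖z.1‖ ‖z.2‖ with h | h
  · rw [Prod.norm_def, max_eq_right h, Real.norm_eq_abs, sq_abs]
    nlinarith [sq_nonneg z.1]
  · rw [Prod.norm_def, max_eq_left h, Real.norm_eq_abs, sq_abs]
    nlinarith [sq_nonneg z.2]

theorem exists_quadratic_lower_bound {f : ℝ² → ℝ} (hf : ContDiffAt ℝ 2 f 0) (h0 : f 0 = 0)
    (h1 : 𝐃 f 0 = 0) (h2 : 0 < 𝐃 (𝐃 f) 0 (1, 0) (1, 0)) :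
    ∃ c > 0, ∃ K > 0, ∀ᶠ z in 𝓝 0, c * z.1 ^ 2 - K * z.2 ^ 2 ≤ f z := by
  set b := 𝐃 (𝐃 f) 0 with hb
  set u := b (1, 0) (1, 0) with hu
  set s := b (1, 0) (0, 1) + b (0, 1) (1, 0) with hs
  set w := b (0, 1) (0, 1) with hw
  have hbz : ∀ z : ℝ², b z z = u * z.1 ^ 2 + s * (z.1 * z.2) + w * z.2 ^ 2 := fun z => by
    have hz : z = z.1 • ((1, 0) : ℝ²) + z.2 • ((0, 1) : ℝ²) := by ext <;> simp
    conv_lhs => rw [hz]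
    simp only [map_add, map_smul, add_apply, smul_apply, smul_eq_mul, hu, hs, hw]
    ring
  have h := (isLittleO_jet_two hf).bound (by positivity : 0 < u / 8)
  refine ⟨u / 4, by positivity, u / 8 + s ^ 2 / (2 * u) + |w| / 2, by positivity,
    h.mono fun z hz => ?_⟩
  rw [h0, h1, zero_apply, sub_zero, sub_zero, Real.norm_eq_abs, norm_pow,
    norm_norm, ← hb, hbz] at hz
  have hz' := (abs_le.1 hz).1
  have hn := norm_sq_le z
  have hxy : -(s * (z.1 * z.2)) ≤ u / 4 * z.1 ^ 2 + s ^ 2 / u * z.2 ^ 2 := by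
    have h4 : 0 ≤ (u / 2 * z.1 + s * z.2) ^ 2 / u := by positivity
    have h5 : (u / 2 * z.1 + s * z.2) ^ 2 / u
        = u / 4 * z.1 ^ 2 + s * (z.1 * z.2) + s ^ 2 / u * z.2 ^ 2 := by
      field_simp; ring
    linarith
  have hw' : -(|w| * z.2 ^ 2) ≤ w * z.2 ^ 2 := by nlinarith [neg_abs_le w, sq_nonneg z.2]
  have h6 : s ^ 2 / (2 * u) * z.2 ^ 2 = 1 / 2 * (s ^ 2 / u * z.2 ^ 2) := by field_simp
  nlinarith [mul_le_mul_of_nonneg_left hn (by positivity : 0 ≤ u / 8)]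

end

section

open Filter Asymptotics

/-- A pair of functions with proportional differentials at the origin, along whose common kernel
the second differential of the combination killing the first differentials is positive. -/
structure SaddleNodeGerm (A B : ℝ² → ℝ) (α β : ℝ) : Prop where
  contDiffA : ContDiffAt ℝ 2 A 0
  contDiffB : ContDiffAt ℝ 2 B 0
  zeroA : A 0 = 0
  zeroB : B 0 = 0
  fderivA : ∀ v, 𝐃 A 0 v = α * v.2
  fderivB : ∀ v, 𝐃 B 0 v = β * v.2
  pos : 0 < α
  snd_pos : 0 < 𝐃 (𝐃 B) 0 (1, 0) (1, 0)
    - β / α * 𝐃 (𝐃 A) 0 (1, 0) (1, 0)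

structure GermBounds (A B : ℝ² → ℝ) (α β c K : ℝ) (z : ℝ²) : Prop where
  contDiffA : ContDiffAt ℝ 1 A z
  contDiffB : ContDiffAt ℝ 1 B z
  valA : |A z - α * z.2| ≤ K * ‖z‖ ^ 2
  valB : |B z - β * z.2| ≤ K * ‖z‖ ^ 2
  fderivA : ∀ v, |𝐃 A z v - α * v.2| ≤ K * ‖z‖ * ‖v‖
  fderivB : ∀ v, |𝐃 B z v - β * v.2| ≤ K * ‖z‖ * ‖v‖
  lower : c * z.1 ^ 2 - K * z.2 ^ 2 ≤ B z - β / α * A z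

namespace SaddleNodeGerm

variable {A B : ℝ² → ℝ} {α β : ℝ}

theorem exists_bounds (h : SaddleNodeGerm A B α β) :
    ∃ c > 0, ∃ K > 0, ∀ᶠ z in 𝓝 0, GermBounds A B α β c K z := by
  have hdA : ContDiffAt ℝ 1 (𝐃 A) 0 := h.contDiffA.fderiv_right (m := 1) (by norm_num)
  have hdB : ContDiffAt ℝ 1 (𝐃 B) 0 := h.contDiffB.fderiv_right (m := 1) (by norm_num)
  have eA : ∀ᶠ z in 𝓝 (0 : ℝ²), ContDiffAt ℝ 1 A z :=
    (h.contDiffA.eventually (by simp)).mono fun z hz => hz.of_le (by norm_num)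
  have eB : ∀ᶠ z in 𝓝 (0 : ℝ²), ContDiffAt ℝ 1 B z :=
    (h.contDiffB.eventually (by simp)).mono fun z hz => hz.of_le (by norm_num)
  obtain ⟨K₁, hK₁, h₁⟩ := exists_abs_sub_le_sq h.contDiffA h.zeroA
  obtain ⟨K₂, hK₂, h₂⟩ := exists_abs_sub_le_sq h.contDiffB h.zeroB
  obtain ⟨K₃, hK₃, h₃⟩ := exists_abs_fderiv_sub_le h.contDiffA
  obtain ⟨K₄, hK₄, h₄⟩ := exists_abs_fderiv_sub_le h.contDiffB
  set f : ℝ² → ℝ := fun z => B z - β / α * A z with hf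
  have hfd : ∀ z, ContDiffAt ℝ 1 A z → ContDiffAt ℝ 1 B z →
      𝐃 f z = 𝐃 B z - (β / α) • 𝐃 A z := fun z hA hB =>
    ((hB.differentiableAt one_ne_zero).hasFDerivAt.sub
      ((hA.differentiableAt one_ne_zero).hasFDerivAt.const_mul (β / α))).fderiv
  have hfev : 𝐃 f =ᶠ[𝓝 0] fun z => 𝐃 B z - (β / α) • 𝐃 A z := by
    filter_upwards [eA, eB] with z hA hB using hfd z hA hB
  have hf2 : 𝐃 (𝐃 f) 0
      = 𝐃 (𝐃 B) 0 - (β / α) • 𝐃 (𝐃 A) 0 := by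
    rw [hfev.fderiv_eq]
    exact ((hdB.differentiableAt one_ne_zero).hasFDerivAt.sub
      ((hdA.differentiableAt one_ne_zero).hasFDerivAt.const_smul (β / α))).fderiv
  obtain ⟨c, hc, K₅, hK₅, h₅⟩ := exists_quadratic_lower_bound (f := f)
    (h.contDiffB.sub (contDiffAt_const.mul h.contDiffA)) (by simp [hf, h.zeroA, h.zeroB])
    (by
      rw [hfev.self_of_nhds]
      refine ContinuousLinearMap.ext fun v => ?_
      simp only [sub_apply, smul_apply, h.fderivA, h.fderivB, smul_eq_mul, zero_apply]
      field_simp [h.pos.ne']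
      ring)
    (by
      rw [hf2]
      simpa using h.snd_pos)
  refine ⟨c, hc, K₁ + K₂ + K₃ + K₄ + K₅, by positivity, ?_⟩
  filter_upwards [eA, eB, h₁, h₂, h₃, h₄, h₅] with z eA eB h₁ h₂ h₃ h₄ h₅
  have hn := norm_nonneg z
  refine ⟨eA, eB, ?_, ?_, fun v => ?_, fun v => ?_, ?_⟩
  · rw [← h.fderivA]
    exact h₁.trans (mul_le_mul_of_nonneg_right (by linarith) (sq_nonneg _))
  · rw [← h.fderivB]
    exact h₂.trans (mul_le_mul_of_nonneg_right (by linarith) (sq_nonneg _))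
  · rw [← h.fderivA]
    exact (h₃ v).trans (mul_le_mul_of_nonneg_right
      (mul_le_mul_of_nonneg_right (by linarith) hn) (norm_nonneg v))
  · rw [← h.fderivB]
    exact (h₄ v).trans (mul_le_mul_of_nonneg_right
      (mul_le_mul_of_nonneg_right (by linarith) hn) (norm_nonneg v))
  · have : K₅ * z.2 ^ 2 ≤ (K₁ + K₂ + K₃ + K₄ + K₅) * z.2 ^ 2 :=
      mul_le_mul_of_nonneg_right (by linarith) (sq_nonneg _)
    change _ ≤ f z
    linarith

theorem eventually_norm_le {ε : ℝ} (hε : 0 < ε) : ∀ᶠ z in 𝓝 (0 : ℝ²), ‖z‖ ≤ ε := by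
  filter_upwards [Metric.closedBall_mem_nhds (0 : ℝ²) hε] with z hz using
    mem_closedBall_zero_iff.1 hz

theorem norm_le_of_cone {M : ℝ} {z : ℝ²} (hM : 0 ≤ M) (hz : |z.1| ≤ M * |z.2|) :
    ‖z‖ ≤ (1 + M) * |z.2| := by
  rw [Prod.norm_def]
  have := abs_nonneg z.2
  exact max_le (by rw [Real.norm_eq_abs]; linarith)
    (by rw [Real.norm_eq_abs]; nlinarith)

theorem abs_snd_le_of_cone (h : SaddleNodeGerm A B α β) {M : ℝ} (hM : 0 ≤ M) :
    ∀ᶠ z in 𝓝 (0 : ℝ²), |z.1| ≤ M * |z.2| → |z.2| ≤ 2 / α * |A z| := by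
  obtain ⟨c, hc, K, hK, hb⟩ := h.exists_bounds
  have hα := h.pos
  filter_upwards [hb, eventually_norm_le (ε := α / (2 * K * (1 + M))) (by positivity)]
    with z hz hn hcone
  have h1 := norm_le_of_cone hM hcone
  have h2 : K * ‖z‖ ^ 2 ≤ α / 2 * |z.2| := by
    rw [le_div_iff₀ (by positivity)] at hn
    nlinarith [norm_nonneg z, abs_nonneg z.2, mul_nonneg hK.le (norm_nonneg z),
      mul_le_mul_of_nonneg_left h1 (mul_nonneg hK.le (norm_nonneg z))]
  have h3 := abs_sub_abs_le_abs_sub (α * z.2) (A z)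
  rw [abs_sub_comm, abs_mul, abs_of_pos hα] at h3
  rw [div_mul_eq_mul_div, le_div_iff₀ hα]
  linarith [hz.valA]

theorem exists_slope_bound {c K : ℝ} (hc : 0 < c) (hK : 0 < K) :
    ∃ M > 0, ∀ x y : ℝ, ¬|x| ≤ M * |y| → K * y ^ 2 < c * x ^ 2 := by
  refine ⟨√(K / c), Real.sqrt_pos.2 (by positivity), fun x y hxy => ?_⟩
  rw [not_le] at hxy
  have h := pow_lt_pow_left₀ hxy (by positivity) two_ne_zero
  rw [mul_pow, Real.sq_sqrt (by positivity), sq_abs, sq_abs, div_mul_eq_mul_div,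
    div_lt_iff₀ hc] at h
  linarith

/-- The values `B - iA` avoid a sector around the negative half-axis. -/
theorem exists_sector (h : SaddleNodeGerm A B α β) :
    ∃ K ≥ 0, ∀ᶠ z in 𝓝 (0 : ℝ²), z ≠ 0 → -(K * |A z|) ≤ B z ∧ (A z = 0 → 0 < B z) := by
  obtain ⟨c, hc, K, hK, hb⟩ := h.exists_bounds
  have hα := h.pos
  obtain ⟨M, hM, hcone⟩ := exists_slope_bound hc hK
  refine ⟨|β / α| + K * 2 / α, by positivity, ?_⟩
  filter_upwards [hb, h.abs_snd_le_of_cone hM.le, eventually_norm_le one_pos] with z hz hA hn hz0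
  have hba : -(|β / α| * |A z|) ≤ β / α * A z := by rw [← abs_mul]; exact neg_abs_le _
  have hl := hz.lower
  have hy : |z.2| ≤ 1 := (norm_snd_le z).trans hn
  by_cases hc1 : |z.1| ≤ M * |z.2|
  · have h1 := hA hc1
    have h2 : K * z.2 ^ 2 ≤ K * 2 / α * |A z| := by
      have h4 : z.2 ^ 2 ≤ |z.2| := by rw [← sq_abs]; nlinarith [abs_nonneg z.2]
      calc K * z.2 ^ 2 ≤ K * (2 / α * |A z|) := mul_le_mul_of_nonneg_left (h4.trans h1) hK.le
        _ = _ := by ring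
    refine ⟨by nlinarith [sq_nonneg z.1], fun h0 => ?_⟩
    rw [h0, abs_zero, mul_zero, abs_nonpos_iff] at h1
    rw [h1, abs_zero, mul_zero] at hc1
    exact absurd (Prod.ext (abs_nonpos_iff.1 hc1) h1) hz0
  · have h1 := hcone _ _ hc1
    refine ⟨?_, fun h0 => ?_⟩
    · have : 0 ≤ K * 2 / α * |A z| := by positivity
      linarith
    · rw [h0] at hl; linarith

theorem exists_cross_le (h : SaddleNodeGerm A B α β) : ∃ K ≥ 0, ∀ᶠ z in 𝓝 (0 : ℝ²), ∀ v,
      |A z * 𝐃 B z v - B z * 𝐃 A z v| ≤ K * ‖z‖ ^ 2 * ‖v‖ := by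
  obtain ⟨c, hc, K, hK, hb⟩ := h.exists_bounds
  refine ⟨2 * K * (|α| + |β| + K), by positivity, ?_⟩
  filter_upwards [hb, eventually_norm_le one_pos] with z hz hn v
  have hv := abs_mul_le (le_refl |α|) (norm_snd_le v)
  have hw := abs_mul_le (le_refl |β|) (norm_snd_le v)
  have hKv : K * ‖z‖ * ‖v‖ ≤ K * ‖v‖ := by nlinarith [mul_nonneg hK.le (norm_nonneg v)]
  have fA : |𝐃 A z v| ≤ (|α| + K) * ‖v‖ := by
    linarith [abs_sub_abs_le_abs_sub (𝐃 A z v) (α * v.2), hz.fderivA v]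
  have fB : |𝐃 B z v| ≤ (|β| + K) * ‖v‖ := by
    linarith [abs_sub_abs_le_abs_sub (𝐃 B z v) (β * v.2), hz.fderivB v]
  have h1 := abs_le.1 (abs_mul_le hz.valA fB)
  have h2 := abs_le.1 (abs_mul_le hz.valB fA)
  have h3 := abs_le.1 (abs_mul_le (abs_mul_le (le_refl |α|) (norm_snd_le z)) (hz.fderivB v))
  have h4 := abs_le.1 (abs_mul_le (abs_mul_le (le_refl |β|) (norm_snd_le z)) (hz.fderivA v))
  rw [abs_le]
  constructor <;> nlinarith

/-- The angular derivative in cones transverse to the critical direction. -/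
theorem exists_cross_le_of_cone (h : SaddleNodeGerm A B α β) {M : ℝ} (hM : 0 ≤ M) :
    ∃ K ≥ 0, ∀ᶠ z in 𝓝 (0 : ℝ²), |z.1| ≤ M * |z.2| → ∀ v,
      |A z * 𝐃 B z v - B z * 𝐃 A z v| ≤ K * ‖v‖ * (A z ^ 2 + B z ^ 2) := by
  obtain ⟨K, hK, hb⟩ := h.exists_cross_le
  have hα := h.pos
  refine ⟨K * (1 + M) ^ 2 * 4 / α ^ 2, by positivity, ?_⟩
  filter_upwards [hb, h.abs_snd_le_of_cone hM] with z hz hA hcone v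
  have h2 : ‖z‖ ^ 2 ≤ (1 + M) ^ 2 * 4 / α ^ 2 * A z ^ 2 := by
    have h4 : ‖z‖ ≤ (1 + M) * (2 / α * |A z|) :=
      (norm_le_of_cone hM hcone).trans (mul_le_mul_of_nonneg_left (hA hcone) (by positivity))
    calc ‖z‖ ^ 2 ≤ ((1 + M) * (2 / α * |A z|)) ^ 2 := pow_le_pow_left₀ (norm_nonneg z) h4 2
      _ = (1 + M) ^ 2 * 4 / α ^ 2 * |A z| ^ 2 := by field_simp; ring
      _ = _ := by rw [sq_abs]
  calc _ ≤ K * ‖z‖ ^ 2 * ‖v‖ := hz v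
    _ ≤ K * ((1 + M) ^ 2 * 4 / α ^ 2 * A z ^ 2) * ‖v‖ :=
        mul_le_mul_of_nonneg_right (mul_le_mul_of_nonneg_left h2 hK) (norm_nonneg v)
    _ = K * (1 + M) ^ 2 * 4 / α ^ 2 * ‖v‖ * A z ^ 2 := by ring
    _ ≤ _ := mul_le_mul_of_nonneg_left (by nlinarith [sq_nonneg (B z)]) (by positivity)

/-- The angular derivative transverse to the critical direction is bounded above. -/
theorem exists_cross_snd_le (h : SaddleNodeGerm A B α β) : ∃ K ≥ 0, ∀ᶠ z in 𝓝 (0 : ℝ²),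
      A z * 𝐃 B z (0, 1) - B z * 𝐃 A z (0, 1) ≤ K * (A z ^ 2 + B z ^ 2) := by
  obtain ⟨c, hc, K, hK, hb⟩ := h.exists_bounds
  have hα := h.pos
  set ε := α * c / 4 with hε
  have hε0 : 0 < ε := by positivity
  set L := K * (|α| + |β|) with hL
  have hlow : ∃ K' > 0, ∀ᶠ z in 𝓝 (0 : ℝ²),
      A z * 𝐃 B z (0, 1) - B z * 𝐃 A z (0, 1) ≤ K' * z.2 ^ 2 - ε * z.1 ^ 2 := by
    refine ⟨α * K + L ^ 2 / (4 * ε) + 2 * ε, by positivity, ?_⟩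
    filter_upwards [hb, eventually_norm_le (ε := ε / (2 * K ^ 2)) (by positivity)] with z hz hn
    have fa : |𝐃 A z (0, 1) - α| ≤ K * ‖z‖ := by
      simpa [Prod.norm_def] using hz.fderivA (0, 1)
    have fb : |𝐃 B z (0, 1) - β| ≤ K * ‖z‖ := by
      simpa [Prod.norm_def] using hz.fderivB (0, 1)
    have h3 := abs_le.1 (abs_mul_le hz.valA fb)
    have h4 := abs_le.1 (abs_mul_le hz.valB fa)
    have h5 := abs_le.1 (abs_mul_le (abs_mul α z.2).le fb)
    have h6 := abs_le.1 (abs_mul_le (abs_mul β z.2).le fa)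
    have h7 : 2 * ((K * ‖z‖ ^ 2) * (K * ‖z‖)) ≤ ε * ‖z‖ ^ 2 := by
      rw [le_div_iff₀ (by positivity)] at hn
      nlinarith [mul_le_mul_of_nonneg_right hn (sq_nonneg ‖z‖)]
    have h9 : L * (|z.2| * ‖z‖) ≤ ε * ‖z‖ ^ 2 + L ^ 2 / (4 * ε) * z.2 ^ 2 := by
      have p0 : 0 ≤ (2 * ε * ‖z‖ - L * |z.2|) ^ 2 / (4 * ε) := by positivity
      have p1 : (2 * ε * ‖z‖ - L * |z.2|) ^ 2 / (4 * ε)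
          = ε * ‖z‖ ^ 2 - L * (|z.2| * ‖z‖) + L ^ 2 / (4 * ε) * |z.2| ^ 2 := by
        field_simp; ring
      rw [sq_abs] at p1
      linarith
    have h11 := mul_le_mul_of_nonneg_left hz.lower hα.le
    have h12 : α * (B z - β / α * A z) = α * B z - β * A z := by field_simp
    have h13 := mul_le_mul_of_nonneg_left (norm_sq_le z) hε0.le
    have h14 : L * (|z.2| * ‖z‖) = |α| * |z.2| * (K * ‖z‖) + |β| * |z.2| * (K * ‖z‖) := by
      rw [hL]; ring
    have h15 : α * (c * z.1 ^ 2) = 4 * ε * z.1 ^ 2 := by rw [hε]; ring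
    nlinarith [sq_nonneg z.1]
  obtain ⟨K', hK', hlow⟩ := hlow
  obtain ⟨M, hM, hcone⟩ := exists_slope_bound hε0 hK'
  refine ⟨K' * 4 / α ^ 2, by positivity, ?_⟩
  filter_upwards [hlow, h.abs_snd_le_of_cone hM.le] with z hz hA
  by_cases hc1 : |z.1| ≤ M * |z.2|
  · have h2 : z.2 ^ 2 ≤ 4 / α ^ 2 * A z ^ 2 := by
      rw [← sq_abs, ← sq_abs (A z)]
      exact (pow_le_pow_left₀ (abs_nonneg _) (hA hc1) 2).trans_eq (by ring)
    calc _ ≤ K' * z.2 ^ 2 - ε * z.1 ^ 2 := hz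
      _ ≤ K' * z.2 ^ 2 := by nlinarith [sq_nonneg z.1]
      _ ≤ K' * (4 / α ^ 2 * A z ^ 2) := mul_le_mul_of_nonneg_left h2 hK'.le
      _ = K' * 4 / α ^ 2 * A z ^ 2 := by ring
      _ ≤ _ := mul_le_mul_of_nonneg_left (by nlinarith [sq_nonneg (B z)]) (by positivity)
  · have h1 := hcone _ _ hc1
    have : 0 ≤ K' * 4 / α ^ 2 * (A z ^ 2 + B z ^ 2) := by positivity
    linarith

end SaddleNodeGerm

end

section

open Filter Asymptotics Complex

/-! ### The tangent of a quarter of the argument -/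

def quarterTan (w : ℂ) : ℝ := Real.tan (arg w / 4)

theorem quarterTan_zero : quarterTan 0 = 0 := by simp [quarterTan]

theorem quarterTan_smul {s : ℝ} (hs : 0 < s) (w : ℂ) : quarterTan (s * w) = quarterTan w := by
  rw [quarterTan, arg_real_mul w hs, quarterTan]

theorem abs_arg_div_four_lt {w : ℂ} (hw : w ∈ slitPlane) : |arg w / 4| < Real.pi / 4 := by
  have h1 : |arg w| < Real.pi := by
    refine lt_of_le_of_ne (abs_arg_le_pi w) fun h => ?_
    rcases (abs_eq Real.pi_pos.le).1 h with h | h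
    · exact (mem_slitPlane_iff_arg.1 hw).1 h
    · exact (neg_pi_lt_arg w).ne' h
  rw [abs_div, abs_of_pos (by norm_num : (0 : ℝ) < 4)]
  linarith

theorem cos_arg_div_four_pos {w : ℂ} (hw : w ∈ slitPlane) : 0 < Real.cos (arg w / 4) := by
  have h := abs_lt.1 (abs_arg_div_four_lt hw)
  have := Real.pi_pos
  exact Real.cos_pos_of_mem_Ioo ⟨by linarith, by linarith⟩

theorem abs_quarterTan_lt_one {w : ℂ} (hw : w ∈ slitPlane) : |quarterTan w| < 1 := by
  have h := abs_lt.1 (abs_arg_div_four_lt hw)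
  have := Real.pi_pos
  rw [abs_lt, ← Real.tan_pi_div_four, ← Real.tan_neg]
  exact ⟨Real.tan_lt_tan_of_lt_of_lt_pi_div_two (by linarith) (by linarith) h.1,
    Real.tan_lt_tan_of_lt_of_lt_pi_div_two (by linarith) (by linarith) h.2⟩

theorem quarterTan_neg_of_im_neg {w : ℂ} (hw : w.im < 0) : quarterTan w < 0 := by
  have h : arg w < 0 := arg_neg_iff.2 hw
  have := neg_pi_lt_arg w
  have := Real.pi_pos
  exact Real.tan_neg_of_neg_of_pi_div_two_lt (by linarith) (by linarith)

theorem quarterTan_pos_of_im_pos {w : ℂ} (hw : 0 < w.im) : 0 < quarterTan w := by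
  have h : 0 < arg w := lt_of_le_of_ne (arg_nonneg_iff.2 hw.le) fun h =>
    hw.ne' ((arg_eq_zero_iff.1 h.symm).2)
  have := arg_le_pi w
  have := Real.pi_pos
  exact Real.tan_pos_of_pos_of_lt_pi_div_two (by linarith) (by linarith)

theorem exists_eq_quarterTan_pow {w : ℂ} (hw : w ∈ slitPlane) :
    ∃ s > 0, w = (s : ℝ) * (1 + quarterTan w * I) ^ 4 := by
  have hc := cos_arg_div_four_pos hw
  set ψ := arg w / 4 with hψ
  refine ⟨‖w‖ * Real.cos ψ ^ 4, mul_pos (norm_pos_iff.2 (slitPlane_ne_zero hw)) (pow_pos hc 4), ?_⟩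
  have h1 : (Real.cos ψ : ℂ) * (1 + quarterTan w * I) = cexp (ψ * I) := by
    rw [exp_mul_I, ← ofReal_cos, ← ofReal_sin, quarterTan, ← hψ, Real.tan_eq_sin_div_cos]
    push_cast
    have : (Real.cos ψ : ℂ) ≠ 0 := by exact_mod_cast hc.ne'
    push_cast at this
    field_simp
  have h2 : cexp (ψ * I) ^ 4 = cexp (arg w * I) := by
    rw [← Complex.exp_nat_mul]
    congr 1
    rw [hψ]; push_cast; ring
  conv_lhs => rw [← norm_mul_exp_arg_mul_I w, ← h2, ← h1]
  push_cast
  ring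

theorem contDiffAt_quarterTan {w : ℂ} (hw : w ∈ slitPlane) {n : ℕ∞ω} :
    ContDiffAt ℝ n quarterTan w := by
  have h1 : ContDiffAt ℝ n Complex.log w := ((contDiffAt_log (n := n) hw).restrict_scalars ℝ)
  have h2 : ContDiffAt ℝ n (fun w => arg w / 4) w := by
    have : (fun w => arg w / 4) = fun w => imCLM (Complex.log w) / 4 := by funext w; simp [log_im]
    rw [this]
    exact (imCLM.contDiff.contDiffAt.comp w h1).div_const 4
  exact (Real.contDiffAt_tan.2 (cos_arg_div_four_pos hw).ne').comp w h2

/-- On a closed sector that avoids the negative half-axis the tangents are bounded away from 1. -/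
theorem exists_abs_quarterTan_le {K : ℝ} (hK : 0 ≤ K) : ∃ κ, 0 ≤ κ ∧ κ < 1 ∧ ∀ w : ℂ, -(K * |w.im|) ≤ w.re →
    (w.im = 0 → 0 < w.re) → |quarterTan w| ≤ κ := by
  set S : Set ℂ := Metric.sphere 0 1 ∩ {w | -(K * |w.im|) ≤ w.re} with hS
  have hSc : IsCompact S := (isCompact_sphere 0 1).inter_right (isClosed_le (by fun_prop) (by fun_prop))
  have hslit : ∀ w : ℂ, w ≠ 0 → -(K * |w.im|) ≤ w.re → w ∈ slitPlane := fun w h0 h => by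
    rw [mem_slitPlane_iff]
    by_cases hi : w.im = 0
    · left
      rw [hi, abs_zero, mul_zero, neg_zero] at h
      exact lt_of_le_of_ne h fun hr => h0 (Complex.ext hr.symm hi)
    · exact Or.inr hi
  have hSs : ∀ w ∈ S, w ∈ slitPlane := fun w hw => hslit w (fun h => by
    have := hw.1; rw [h] at this; simp at this) hw.2
  have hne : S.Nonempty := ⟨I, by simp, by simpa using hK⟩
  obtain ⟨w₀, hw₀, hmax⟩ := hSc.exists_isMaxOn hne (f := fun w => |quarterTan w|)
    fun w hw => ((contDiffAt_quarterTan (n := 0) (hSs w hw)).continuousAt.abs).continuousWithinAt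
  refine ⟨|quarterTan w₀|, abs_nonneg _, abs_quarterTan_lt_one (hSs _ hw₀), fun w h1 h2 => ?_⟩
  have hw0 : w ≠ 0 := fun h => by simp [h] at h2
  have hn : 0 < ‖w‖ := norm_pos_iff.2 hw0
  have hmem : ((‖w‖⁻¹ : ℝ) : ℂ) * w ∈ S := by
    refine ⟨by simp [hn.ne'], ?_⟩
    simp only [mem_ofPred_eq, re_ofReal_mul, im_ofReal_mul, abs_mul, abs_inv, abs_norm]
    have := mul_le_mul_of_nonneg_left h1 (inv_pos.2 hn).le
    linarith
  have := hmax hmem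
  rw [mem_ofPred_eq] at this
  change |quarterTan _| ≤ _ at this
  rwa [quarterTan_smul (inv_pos.2 hn)] at this

section
variable {V : Type*} [NormedAddCommGroup V] [NormedSpace ℝ V]

theorem hasFDerivAt_quarterTan {A B : V → ℝ} {z : V} (hA : DifferentiableAt ℝ A z)
    (hB : DifferentiableAt ℝ B z) (hw : (⟨B z, -A z⟩ : ℂ) ∈ slitPlane) :
    HasFDerivAt (fun z => quarterTan ⟨B z, -A z⟩)
      (((1 + quarterTan ⟨B z, -A z⟩ ^ 2) / 4 / (A z ^ 2 + B z ^ 2)) •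
        (A z • 𝐃 B z - B z • 𝐃 A z)) z := by
  set w : ℂ := ⟨B z, -A z⟩ with hwd
  have hN : HasFDerivAt (fun z => (⟨B z, -A z⟩ : ℂ))
      ((𝐃 B z).smulRight (1 : ℂ) - (𝐃 A z).smulRight I) z := by
    have : (fun z => (⟨B z, -A z⟩ : ℂ)) = fun z => B z • (1 : ℂ) - A z • I := by
      funext z; apply Complex.ext <;> simp
    rw [this]
    exact (hB.hasFDerivAt.smul_const 1).sub (hA.hasFDerivAt.smul_const I)
  have hlog := (hasStrictDerivAt_log hw).hasDerivAt.hasFDerivAt.restrictScalars ℝ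
  have h1 := hlog.comp z hN
  have h2 := (imCLM.hasFDerivAt.comp z h1).const_mul (1 / 4 : ℝ)
  have h3 := (Real.hasDerivAt_tan (cos_arg_div_four_pos hw).ne').hasFDerivAt
  have he : (fun z => quarterTan ⟨B z, -A z⟩)
      = Real.tan ∘ fun z => (1 / 4 : ℝ) * (imCLM ∘ Complex.log ∘ fun z => (⟨B z, -A z⟩ : ℂ)) z := by
    funext z
    simp only [Function.comp, imCLM_apply, log_im, quarterTan]
    congr 1; ring
  rw [he]
  have harg : arg w / 4 = 1 / 4 * (imCLM ∘ Complex.log ∘ fun z => (⟨B z, -A z⟩ : ℂ)) z := by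
    simp only [Function.comp, imCLM_apply, log_im, ← hwd]; ring
  rw [harg] at h3
  have h4 := HasFDerivAt.comp z h3 h2
  rw [← harg] at h4
  refine h4.congr_fderiv ?_
  ext v
  have hsec : 1 + quarterTan w ^ 2 = 1 / Real.cos (arg w / 4) ^ 2 := by
    rw [quarterTan, Real.tan_eq_sin_div_cos]
    have := (cos_arg_div_four_pos hw).ne'
    field_simp
    rw [Real.cos_sq_add_sin_sq]
  have hns : normSq w = A z ^ 2 + B z ^ 2 := by simp [normSq_apply, hwd]; ring
  have hns0 : A z ^ 2 + B z ^ 2 ≠ 0 := by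
    rw [← hns]; exact (normSq_pos.2 (slitPlane_ne_zero hw)).ne'
  simp only [hsec]
  simp [inv_re, inv_im, hns]
  simp only [hwd]
  field_simp
end

end

section

open Filter Asymptotics

/-! ### Slopes that are fractional linear in a given slope -/

theorem quotient_bounds {n₁ n₂ d₁ d₂ T σ κ₀ κ δ : ℝ} (hσ : σ = 1 ∨ σ = -1)
    (h1 : |n₁| ≤ δ) (h2 : |n₂ - σ| ≤ δ) (h3 : |d₁ - 1| ≤ δ) (h4 : |d₂| ≤ δ) (hT : |T| ≤ κ₀)
    (hκ₀ : κ₀ < 1) (hκ : κ ≤ 1) (hδ : 4 * δ ≤ κ - κ₀) (hδ' : δ ≤ 1 / 8) :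
    1 / 2 ≤ d₁ + d₂ * T ∧ |(n₁ + n₂ * T) / (d₁ + d₂ * T)| ≤ κ ∧
      0 ≤ σ * ((n₂ * d₁ - n₁ * d₂) / (d₁ + d₂ * T) ^ 2) ∧
      σ * ((n₂ * d₁ - n₁ * d₂) / (d₁ + d₂ * T) ^ 2) ≤ 8 := by
  have hδ0 : 0 ≤ δ := (abs_nonneg _).trans h1
  have hκ0 := (abs_nonneg T).trans hT
  have hdT := abs_le.1 (abs_mul_le h4 (hT.trans hκ₀.le))
  have hden : 1 - 2 * δ ≤ d₁ + d₂ * T := by linarith [(abs_le.1 h3).1]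
  have hpos : 1 / 2 ≤ d₁ + d₂ * T := by linarith
  have hnT : |n₂ * T| ≤ κ₀ + δ := by
    have : |n₂| ≤ 1 + δ := by rcases hσ with rfl | rfl <;> grind
    nlinarith [abs_mul_le this hT]
  have hnum : |n₁ + n₂ * T| ≤ κ₀ + 2 * δ := (abs_add_le _ _).trans (by linarith)
  have hJ : -(1 / 2) ≤ σ * (n₂ * d₁ - n₁ * d₂) - 1 ∧ σ * (n₂ * d₁ - n₁ * d₂) - 1 ≤ 1 / 2 := by
    have b1 := abs_le.1 (abs_mul_le h2 (by grind : |d₁| ≤ 9 / 8))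
    have b2 := abs_le.1 (abs_mul_le h1 (h4.trans hδ'))
    have h3 := abs_le.1 h3
    rcases hσ with rfl | rfl <;> constructor <;> linarith
  refine ⟨hpos, ?_, ?_, ?_⟩
  · rw [abs_div, abs_of_pos (by linarith : 0 < d₁ + d₂ * T), div_le_iff₀ (by linarith)]
    nlinarith
  · rw [← mul_div_assoc]
    exact div_nonneg (by linarith) (sq_nonneg _)
  · rw [← mul_div_assoc, div_le_iff₀ (by positivity)]
    nlinarith

theorem hasFDerivAt_div {f g : ℝ² → ℝ} {f' g' : ℝ² →L[ℝ] ℝ} {z : ℝ²}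
    (hf : HasFDerivAt f f' z) (hg : HasFDerivAt g g' z) (h0 : g z ≠ 0) :
    HasFDerivAt (fun z => f z / g z) ((g z)⁻¹ • f' - (f z / g z ^ 2) • g') z := by
  simp only [div_eq_mul_inv]
  refine (hf.mul ((hasDerivAt_inv h0).comp_hasFDerivAt z hg)).congr_fderiv ?_
  ext <;> simp <;> field_simp <;> ring

theorem quotient_estimates {n₁ n₂ d₁ d₂ T : ℝ² → ℝ} {σ κ₀ κ : ℝ} (hσ : σ = 1 ∨ σ = -1)
    (cn₁ : ContDiffAt ℝ 1 n₁ 0) (cn₂ : ContDiffAt ℝ 1 n₂ 0) (cd₁ : ContDiffAt ℝ 1 d₁ 0)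
    (cd₂ : ContDiffAt ℝ 1 d₂ 0) (zn₁ : n₁ 0 = 0) (zn₂ : n₂ 0 = σ) (zd₁ : d₁ 0 = 1) (zd₂ : d₂ 0 = 0)
    (hT : ∀ᶠ z in 𝓝 0, |T z| ≤ κ₀) (hκ₀ : κ₀ < κ) (hκ : κ ≤ 1) :
    ∃ K ≥ 0, ∀ᶠ z in 𝓝 0, 1 / 2 ≤ d₁ z + d₂ z * T z ∧
      |(n₁ z + n₂ z * T z) / (d₁ z + d₂ z * T z)| ≤ κ ∧
      (ContDiffAt ℝ 1 T z → ContDiffAt ℝ 1 (fun z => (n₁ z + n₂ z * T z) / (d₁ z + d₂ z * T z)) z) ∧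
      (DifferentiableAt ℝ T z → ∃ j, 0 ≤ j ∧ j ≤ 8 ∧ ∀ v,
        |𝐃 (fun z => (n₁ z + n₂ z * T z) / (d₁ z + d₂ z * T z)) z v
          - σ * j * 𝐃 T z v| ≤ K * ‖v‖) := by
  set δ := min ((κ - κ₀) / 4) (1 / 8) with hδd
  have hδ : 0 < δ := lt_min (by linarith) (by norm_num)
  have small : ∀ f : ℝ² → ℝ, ContDiffAt ℝ 1 f 0 → ∀ᶠ z in 𝓝 0, |f z - f 0| ≤ δ := by
    intro f hf
    filter_upwards [hf.continuousAt.eventually (Metric.closedBall_mem_nhds (f 0) hδ)] with z hz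
    rwa [← Real.dist_eq]
  have dbound : ∀ f : ℝ² → ℝ, ContDiffAt ℝ 1 f 0 →
      ∀ᶠ z in 𝓝 0, ∀ v, |𝐃 f z v| ≤ (‖𝐃 f 0‖ + 1) * ‖v‖ := by
    intro f hf
    have h1 : ContinuousAt (fun z => ‖𝐃 f z‖) 0 :=
      (hf.fderiv_right (m := 0) (by norm_num)).continuousAt.norm
    filter_upwards [h1.eventually (Iio_mem_nhds (lt_add_one ‖𝐃 f 0‖))] with z hz v
    exact ((𝐃 f z).le_opNorm v).trans (mul_le_mul_of_nonneg_right (le_of_lt hz) (norm_nonneg v))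
  have evc : ∀ f : ℝ² → ℝ, ContDiffAt ℝ 1 f 0 → ∀ᶠ z in 𝓝 0, ContDiffAt ℝ 1 f z :=
    fun f hf => hf.eventually (by simp)
  set k₁ := ‖𝐃 n₁ 0‖ + 1
  set k₂ := ‖𝐃 n₂ 0‖ + 1
  set k₃ := ‖𝐃 d₁ 0‖ + 1
  set k₄ := ‖𝐃 d₂ 0‖ + 1
  refine ⟨2 * (k₁ + k₂) + 2 * (k₃ + k₄), by positivity, ?_⟩
  filter_upwards [small _ cn₁, small _ cn₂, small _ cd₁, small _ cd₂, dbound _ cn₁, dbound _ cn₂,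
    dbound _ cd₁, dbound _ cd₂, evc _ cn₁, evc _ cn₂, evc _ cd₁, evc _ cd₂, hT]
    with z s1 s2 s3 s4 b1 b2 b3 b4 e1 e2 e3 e4 hT
  rw [zn₁, sub_zero] at s1
  rw [zn₂] at s2
  rw [zd₁] at s3
  rw [zd₂, sub_zero] at s4
  obtain ⟨q1, q2, q3, q4⟩ := quotient_bounds hσ s1 s2 s3 s4 hT (by linarith) hκ
    (by linarith [min_le_left ((κ - κ₀) / 4) (1 / 8)]) (min_le_right _ _)
  have hden : d₁ z + d₂ z * T z ≠ 0 := by linarith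
  refine ⟨q1, q2, fun hc => (e1.add (e2.mul hc)).div (e3.add (e4.mul hc)) hden, fun hd => ?_⟩
  refine ⟨σ * ((n₂ z * d₁ z - n₁ z * d₂ z) / (d₁ z + d₂ z * T z) ^ 2), q3, q4, fun v => ?_⟩
  have dn : HasFDerivAt (fun z => n₁ z + n₂ z * T z) _ z :=
    (e1.differentiableAt one_ne_zero).hasFDerivAt.add
      ((e2.differentiableAt one_ne_zero).hasFDerivAt.mul hd.hasFDerivAt)
  have dd : HasFDerivAt (fun z => d₁ z + d₂ z * T z) _ z :=
    (e3.differentiableAt one_ne_zero).hasFDerivAt.add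
      ((e4.differentiableAt one_ne_zero).hasFDerivAt.mul hd.hasFDerivAt)
  have hq := (hasFDerivAt_div dn dd hden).fderiv
  have hT1 : |T z| ≤ 1 := hT.trans (by linarith)
  have m : ∀ s t q : ℝ, |t| ≤ q → |s| ≤ 1 → |s * t| ≤ q := fun s t q ht hs => by
    rw [abs_mul]; nlinarith [abs_nonneg s, abs_nonneg t]
  set N := n₁ z + n₂ z * T z with hN
  set D := d₁ z + d₂ z * T z with hD
  set g := N / D with hg
  have hg1 : |g| ≤ 1 := q2.trans hκ
  have hσσ : σ * σ = 1 := by rcases hσ with rfl | rfl <;> norm_num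
  have e : 𝐃 (fun z => (n₁ z + n₂ z * T z) / (d₁ z + d₂ z * T z)) z v
      - σ * (σ * ((n₂ z * d₁ z - n₁ z * d₂ z) / D ^ 2)) * 𝐃 T z v
      = D⁻¹ * ((𝐃 n₁ z v + T z * 𝐃 n₂ z v)
        - g * (𝐃 d₁ z v + T z * 𝐃 d₂ z v)) := by
    rw [hq]
    simp only [add_apply, sub_apply, smul_apply, smul_eq_mul]
    rw [← mul_assoc σ σ, hσσ, hg]
    field_simp
    rw [hN, hD]
    ring
  rw [e, abs_mul, abs_inv, abs_of_pos (by linarith : 0 < D)]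
  have hDi : D⁻¹ ≤ 2 := by rw [inv_le_comm₀ (by linarith) (by norm_num)]; linarith
  have c1 := m (T z) _ _ (b2 v) hT1
  have c2 := m (T z) _ _ (b4 v) hT1
  have c3 := m g _ _ ((abs_add_le _ _).trans (add_le_add (b3 v) c2)) hg1
  have c4 := (abs_sub _ _).trans (add_le_add ((abs_add_le _ _).trans (add_le_add (b1 v) c1)) c3)
  have c5 := mul_le_mul hDi c4 (abs_nonneg _) (by norm_num)
  refine c5.trans (le_of_eq (by ring))

end

section

open Filter Asymptotics Complex

/-- The slope `dy/dx` of the directions `v` with `(a v₁ + b v₂) (1 - iT)` real. -/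
def slopeH (a b : ℝ² → ℂ) (T : ℝ² → ℝ) (x y : ℝ) : ℝ :=
  (-(a (x, y)).im + (a (x, y)).re * T (x, y)) / ((b (x, y)).im + -(b (x, y)).re * T (x, y))

/-- The slope `dx/dy` of the directions `v` with `(a v₁ + b v₂) (1 - iT)` imaginary. -/
def slopeV (a b : ℝ² → ℂ) (T : ℝ² → ℝ) (y x : ℝ) : ℝ :=
  (-(b (x, y)).re + -(b (x, y)).im * T (x, y)) / ((a (x, y)).re + (a (x, y)).im * T (x, y))

theorem LocalSlope.mono {κ R R' : ℝ} {p : ℝ → ℝ → ℝ} (h : LocalSlope κ R p) (hR : R' ≤ R) :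
    LocalSlope κ R' p :=
  ⟨h.nonneg, h.lt_one, fun x y hx hy => h.bound x y (hx.trans hR) (hy.trans hR),
    fun x y hx hy => h.contDiffAt x y (hx.trans hR) (hy.trans hR)⟩

theorem netDirection_iff_aux {a b : ℂ} {T p q v₁ v₂ : ℝ} (hb : b.im + -b.re * T ≠ 0)
    (ha : a.re + a.im * T ≠ 0)
    (hp : p = (-a.im + a.re * T) / (b.im + -b.re * T))
    (hq : q = (-b.re + -b.im * T) / (a.re + a.im * T)) :
    (v₂ = p * v₁ ↔ ((a * v₁ + b * v₂) * (1 - T * I)).im = 0) ∧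
      (v₁ = q * v₂ ↔ ((a * v₁ + b * v₂) * (1 - T * I)).re = 0) := by
  have e1 : ((a * v₁ + b * v₂) * (1 - T * I)).im
      = (b.im + -b.re * T) * v₂ - (-a.im + a.re * T) * v₁ := by simp; ring
  have e2 : ((a * v₁ + b * v₂) * (1 - T * I)).re
      = (a.re + a.im * T) * v₁ - (-b.re + -b.im * T) * v₂ := by simp; ring
  rw [e1, e2, hp, hq, div_mul_eq_mul_div, div_mul_eq_mul_div, eq_div_iff hb, eq_div_iff ha,
    sub_eq_zero, sub_eq_zero, mul_comm v₂, mul_comm v₁]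
  exact ⟨Iff.rfl, Iff.rfl⟩

theorem pow_four_pos_iff {w : ℂ} : (∃ s : ℝ, 0 < s ∧ w ^ 4 = s) ↔ w ≠ 0 ∧ (w.im = 0 ∨ w.re = 0) := by
  constructor
  · rintro ⟨s, hs, h⟩
    have hre := congrArg Complex.re h
    have him := congrArg Complex.im h
    have e1 : (w ^ 4).re = w.re ^ 4 - 6 * w.re ^ 2 * w.im ^ 2 + w.im ^ 4 := by
      rw [show w ^ 4 = w * w * w * w by ring]; simp; ring
    have e2 : (w ^ 4).im = 4 * w.re * w.im * (w.re ^ 2 - w.im ^ 2) := by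
      rw [show w ^ 4 = w * w * w * w by ring]; simp; ring
    rw [e1, ofReal_re] at hre
    rw [e2, ofReal_im] at him
    refine ⟨fun h0 => by rw [h0] at hre; simp at hre; linarith, ?_⟩
    rcases mul_eq_zero.1 him with h1 | h1
    · rcases mul_eq_zero.1 h1 with h2 | h2
      · right; linarith
      · left; exact h2
    · have : w.re ^ 2 = w.im ^ 2 := by linarith
      nlinarith [sq_nonneg (w.im ^ 2)]
  · rintro ⟨h0, h | h⟩
    · have hw : w = (w.re : ℂ) := Complex.ext rfl (by simp [h])
      have : w.re ≠ 0 := fun h' => h0 (Complex.ext h' h)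
      exact ⟨w.re ^ 4, by positivity, by conv_lhs => rw [hw]
                                         push_cast; rfl⟩
    · have hw : w = (w.im : ℂ) * I := Complex.ext (by simp [h]) (by simp)
      have : w.im ≠ 0 := fun h' => h0 (Complex.ext h h')
      refine ⟨w.im ^ 4, by positivity, ?_⟩
      conv_lhs => rw [hw, mul_pow, I_pow_four, mul_one]
      push_cast; rfl

theorem pow_four_ray_iff {ζ N : ℂ} (hN : N ∈ slitPlane) : (∃ s : ℝ, 0 < s ∧ ζ ^ 4 = s * N) ↔
      ∃ s : ℝ, 0 < s ∧ (ζ * (1 - quarterTan N * I)) ^ 4 = s := by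
  obtain ⟨ρ, hρ, hNρ⟩ := exists_eq_quarterTan_pow hN
  set T := quarterTan N
  have hk : (1 + (T : ℂ) * I) * (1 - T * I) = ((1 + T ^ 2 : ℝ) : ℂ) := by
    push_cast
    linear_combination (-(T : ℂ) ^ 2) * I_sq
  have hT : 0 < 1 + T ^ 2 := by positivity
  have hc : (ρ * (1 + T ^ 2) ^ 4 : ℝ) ≠ 0 := by positivity
  have h0 : (1 - (T : ℂ) * I) ^ 4 ≠ 0 := by
    refine pow_ne_zero 4 fun h => ?_
    rw [h, mul_zero] at hk
    exact hT.ne' (by exact_mod_cast hk.symm)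
  have key : N * (1 - T * I) ^ 4 = ((ρ * (1 + T ^ 2) ^ 4 : ℝ) : ℂ) := by
    conv_lhs => rw [hNρ]
    rw [mul_assoc, ← mul_pow, hk]
    push_cast; ring
  constructor
  · rintro ⟨s, hs, h⟩
    refine ⟨s * (ρ * (1 + T ^ 2) ^ 4), by positivity, ?_⟩
    rw [mul_pow, h, mul_assoc, key]
    push_cast; ring
  · rintro ⟨s, hs, h⟩
    refine ⟨s / (ρ * (1 + T ^ 2) ^ 4), by positivity, mul_right_cancel₀ h0 ?_⟩
    rw [← mul_pow, h, mul_assoc, key, ← ofReal_mul, div_mul_cancel₀ _ hc]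

theorem netDirection_iff {a b N : ℂ} {p q : ℝ → ℝ → ℝ} {z : ℝ²} (hN : N ∈ slitPlane)
    (hb : b.im + -b.re * quarterTan N ≠ 0) (ha : a.re + a.im * quarterTan N ≠ 0)
    (hp : p z.1 z.2 = (-a.im + a.re * quarterTan N) / (b.im + -b.re * quarterTan N))
    (hq : q z.2 z.1 = (-b.re + -b.im * quarterTan N) / (a.re + a.im * quarterTan N))
    (hpq : |p z.1 z.2| < 1) (hpq' : |q z.2 z.1| < 1) (v : ℝ²) :
    NetDirection p q z v ↔ v ≠ 0 ∧ ∃ s : ℝ, 0 < s ∧ (a * v.1 + b * v.2) ^ 4 = s * N := by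
  obtain ⟨h1, h2⟩ := netDirection_iff_aux (v₁ := v.1) (v₂ := v.2) hb ha hp hq
  rw [pow_four_ray_iff hN, pow_four_pos_iff, NetDirection, ← h1, ← h2]
  refine and_congr_right fun hv => ⟨fun h => ⟨fun h0 => hv ?_, h⟩, fun h => h.2⟩
  rw [h0, zero_im] at h1
  rw [h0, zero_re] at h2
  have e1 := h1.2 rfl
  have e2 := h2.2 rfl
  have h3 : |v.1| = |q z.2 z.1| * (|p z.1 z.2| * |v.1|) := by rw [← abs_mul, ← abs_mul, ← e1, ← e2]
  have h4 : |v.1| = 0 := by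
    have := mul_nonneg (abs_nonneg (p z.1 z.2)) (abs_nonneg v.1)
    nlinarith [abs_nonneg v.1, abs_nonneg (p z.1 z.2), abs_nonneg (q z.2 z.1)]
  have h5 := abs_eq_zero.1 h4
  rw [h5, mul_zero] at e1
  exact Prod.ext h5 e1

theorem fderiv_uncurry_swap (G : ℝ² → ℝ) (z v : ℝ²) :
    𝐃 (Function.uncurry fun y x => G (x, y)) (z.2, z.1) (v.2, v.1) = 𝐃 G z v := by
  have : (Function.uncurry fun y x => G (x, y)) = G ∘ (ContinuousLinearEquiv.prodComm ℝ ℝ ℝ) := rfl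
  rw [this, ContinuousLinearEquiv.comp_right_fderiv]
  rfl

theorem exists_slopes {a b : ℝ² → ℂ} {T : ℝ² → ℝ} {κ₀ : ℝ} (ha : ContDiffAt ℝ 1 a 0)
    (hb : ContDiffAt ℝ 1 b 0) (ha0 : a 0 = 1) (hb0 : b 0 = I) (hκ₀ : 0 ≤ κ₀) (hκ₁ : κ₀ < 1)
    (hT : ∀ᶠ z in 𝓝 0, |T z| ≤ κ₀) (hTc : ∀ᶠ z in 𝓝 0, z ≠ 0 → ContDiffAt ℝ 1 T z) :
    ∃ R > 0, ∃ κ K, 0 ≤ K ∧ LocalSlope κ R (slopeH a b T) ∧ LocalSlope κ R (slopeV a b T) ∧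
      ∀ z : ℝ², ‖z‖ ≤ R → (b z).im + -(b z).re * T z ≠ 0 ∧ (a z).re + (a z).im * T z ≠ 0 ∧
        (z ≠ 0 → (∃ j, 0 ≤ j ∧ j ≤ 8 ∧
            |slopeDeriv (slopeH a b T) z.1 z.2 - j * 𝐃 T z (0, 1)| ≤ K) ∧
          ∃ j, 0 ≤ j ∧ j ≤ 8 ∧
            |slopeDeriv (slopeV a b T) z.2 z.1 + j * 𝐃 T z (1, 0)| ≤ K) := by
  have re1 : ∀ {f : ℝ² → ℂ}, ContDiffAt ℝ 1 f 0 → ContDiffAt ℝ 1 (fun z => (f z).re) 0 :=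
    fun hf => reCLM.contDiff.contDiffAt.comp _ hf
  have im1 : ∀ {f : ℝ² → ℂ}, ContDiffAt ℝ 1 f 0 → ContDiffAt ℝ 1 (fun z => (f z).im) 0 :=
    fun hf => imCLM.contDiff.contDiffAt.comp _ hf
  set κ := (1 + κ₀) / 2 with hκ
  obtain ⟨K₁, hK₁, h₁⟩ := quotient_estimates (σ := 1) (κ₀ := κ₀) (κ := κ) (T := T) (Or.inl rfl)
    (im1 ha).neg (re1 ha) (im1 hb) (re1 hb).neg (by simp [ha0]) (by simp [ha0]) (by simp [hb0])
    (by simp [hb0]) hT (by linarith) (by linarith)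
  obtain ⟨K₂, hK₂, h₂⟩ := quotient_estimates (σ := -1) (κ₀ := κ₀) (κ := κ) (T := T) (Or.inr rfl)
    (re1 hb).neg (im1 hb).neg (re1 ha) (im1 ha) (by simp [hb0]) (by simp [hb0]) (by simp [ha0])
    (by simp [ha0]) hT (by linarith) (by linarith)
  obtain ⟨R, hR, hball⟩ := Metric.nhds_basis_closedBall.eventually_iff.1 ((h₁.and h₂).and hTc)
  have hbox : ∀ z : ℝ², ‖z‖ ≤ R → z ∈ Metric.closedBall (0 : ℝ²) R := fun z hz =>
    mem_closedBall_zero_iff.2 hz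
  have hxy : ∀ x y : ℝ, |x| ≤ R → |y| ≤ R → ‖(x, y)‖ ≤ R := fun x y hx hy => by
    rw [Prod.norm_def]; exact max_le hx hy
  have hne : ∀ x y : ℝ, (x ≠ 0 ∨ y ≠ 0) → (x, y) ≠ 0 := fun x y h h0 => by simp_all
  have hn01 : ‖((0, 1) : ℝ²)‖ = 1 := by simp [Prod.norm_def]
  have hn10 : ‖((1, 0) : ℝ²)‖ = 1 := by simp [Prod.norm_def]
  refine ⟨R, hR, κ, K₁ + K₂, by positivity,
    ⟨by linarith, by linarith, fun x y hx hy => ?_, fun x y hx hy h => ?_⟩,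
    ⟨by linarith, by linarith, fun y x hy hx => ?_, fun y x hy hx h => ?_⟩, fun z hz => ?_⟩
  · exact (hball (hbox _ (hxy x y hx hy))).1.1.2.1
  · obtain ⟨⟨h1, -⟩, h3⟩ := hball (hbox _ (hxy x y hx hy))
    exact h1.2.2.1 (h3 (hne x y h))
  · exact (hball (hbox _ (hxy x y hx hy))).1.2.2.1
  · obtain ⟨⟨-, h2⟩, h3⟩ := hball (hbox _ (hxy x y hx hy))
    have := h2.2.2.1 (h3 (hne x y h.symm))
    exact ContDiffAt.comp (y, x) (g := fun z : ℝ² => (-(b z).re + -(b z).im * T z)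
      / ((a z).re + (a z).im * T z)) this
      (ContinuousLinearEquiv.prodComm ℝ ℝ ℝ).contDiff.contDiffAt
  · obtain ⟨⟨h1, h2⟩, h3⟩ := hball (hbox _ hz)
    refine ⟨by linarith [h1.1], by linarith [h2.1], fun hz0 => ?_⟩
    have hd := (h3 hz0).differentiableAt one_ne_zero
    obtain ⟨j, j0, j8, hj⟩ := h1.2.2.2 hd
    obtain ⟨k, k0, k8, hk⟩ := h2.2.2.2 hd
    refine ⟨⟨j, j0, j8, ?_⟩, k, k0, k8, ?_⟩
    · have := hj (0, 1)
      rw [hn01, one_mul] at this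
      exact this.trans (by linarith)
    · have := hk (1, 0)
      rw [hn10] at this
      have e := fderiv_uncurry_swap (fun z => (-(b z).re + -(b z).im * T z)
        / ((a z).re + (a z).im * T z)) z (1, 0)
      have e' : slopeDeriv (slopeV a b T) z.2 z.1 = 𝐃 (fun z => (-(b z).re + -(b z).im * T z)
        / ((a z).re + (a z).im * T z)) z (1, 0) := e
      rw [e']
      have e2 : ∀ s t : ℝ, s - -1 * k * t = s + k * t := fun s t => by ring
      rw [e2] at this
      exact this.trans (by linarith)

end

section

open Filter Asymptotics Complex

/-- Arcs in `U`, avoiding the origin, whose tangent directions satisfy `Dir`. -/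
def IsDirArc (Dir : ℝ² → ℝ² → Prop) (U L : Set ℝ²) : Prop :=
  ∃ c : ℝ → ℝ², ContDiffOn ℝ 1 c (Ioo 0 1) ∧ L = c '' Ioo 0 1 ∧
    ∀ t ∈ Ioo (0 : ℝ) 1, c t ∈ U ∧ c t ≠ 0 ∧ Dir (c t) (deriv c t)

theorem isDirArc_congr {Dir Dir' : ℝ² → ℝ² → Prop} {U : Set ℝ²}
    (h : ∀ z ∈ U, z ≠ 0 → ∀ v, Dir z v ↔ Dir' z v) : IsDirArc Dir U = IsDirArc Dir' U := by
  funext L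
  refine propext (exists_congr fun c => and_congr_right fun _ => and_congr_right fun _ =>
    forall₂_congr fun t _ => and_congr_right fun hU => and_congr_right fun h0 => h _ hU h0 _)

/-- The net `𝓕` is, near the origin, the family of maximal arcs with directions in `Dir`. -/
def IsLocalNet (Dir : ℝ² → ℝ² → Prop) (𝓕 : Set (Set ℝ²)) : Prop :=
  ∃ R₀ > 0, ∀ R, 0 < R → R ≤ R₀ → ∃ h : ℝ² ≃ₜ ℝ², h 0 = 0 ∧ (∀ z, h z ∈ square → ‖z‖ ≤ R) ∧
    ∀ L, Maximal (IsDirArc Dir (h ⁻¹' square)) L ↔ h '' L ∈ 𝓕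

variable {κ R₀ K r : ℝ} {p q : ℝ → ℝ → ℝ}

theorem LocalSlope.exists_saddleNodeNet {m : ℝ} (hp : LocalSlope κ R₀ p) (hq : LocalSlope κ R₀ q)
    (hR : 0 < R₀) (hr : 0 < r)
    (hpr : ∀ x y, 0 < x → x ≤ r → |y| ≤ κ * x → slopeDeriv p x y ≤ K)
    (hqr : ∀ x y, 0 < x → x ≤ r → |y| ≤ κ * x → slopeDeriv q x y ≤ K)
    (hql : ∀ x y, 0 < x → x ≤ r → |y| ≤ κ * x → -slopeDeriv q (-x) y ≤ K)
    (hm : 0 < m) (hm1 : m ≤ 1) (hup : ∀ x, 0 < x → x ≤ r → p (-x) (m * x) < -m)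
    (hdn : ∀ x, 0 < x → x ≤ r → m < p (-x) (-m * x)) :
    ∃ h : ℝ² ≃ₜ ℝ², h 0 = 0 ∧ (∀ z, h z ∈ square → ‖z‖ ≤ R₀) ∧
      ∀ L, Maximal (IsDirArc (NetDirection p q) (h ⁻¹' square)) L ↔ h '' L ∈ saddleNodeNet := by
  have hε : 0 < R₀ * (1 - κ) := mul_pos hR (by linarith [hp.lt_one])
  refine exists_local_net hR hp.lt_one ?_
  set ε := R₀ * (1 - κ)
  have hP := hp.slopeField hR hε
  set ρ := min r R₀ with hρd
  have hρ : 0 < ρ := lt_min hr hR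
  have hcl : ∀ x, -(ρ / ε) ≤ x → x < 0 → (0 < -(ε * x) ∧ -(ε * x) ≤ r) ∧
      clamp R₀ (ε * x) = ε * x ∧ ∀ s : ℝ, |s| ≤ 1 → clamp R₀ (ε * (s * x)) = ε * (s * x) := by
    intro x h1 h2
    have h3 : -(ε * x) ≤ ρ := by
      have := mul_le_mul_of_nonneg_left h1 hε.le
      rw [mul_neg, mul_div_cancel₀ _ hε.ne'] at this
      linarith
    have h4 : 0 < -(ε * x) := by nlinarith
    have h5 : |ε * x| ≤ R₀ := by rw [abs_of_neg (by linarith)]; exact h3.trans (min_le_right _ _)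
    refine ⟨⟨h4, h3.trans (min_le_left _ _)⟩, clamp_of_abs_le h5, fun s hs => clamp_of_abs_le ?_⟩
    rw [show ε * (s * x) = s * (ε * x) by ring, abs_mul]
    nlinarith [abs_nonneg s, abs_nonneg (ε * x)]
  obtain ⟨η, ζ, hη, hζ, hη0, hζ0, hηζ⟩ := exists_two_leaves hP hm (div_pos hρ hε)
    (fun x h1 h2 => by
      obtain ⟨⟨h3, h4⟩, h5, h6⟩ := hcl x h1 h2
      rw [h5, h6 (-m) (by rw [abs_neg, abs_of_pos hm]; exact hm1)]
      have := hup _ h3 h4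
      rwa [neg_neg, show m * -(ε * x) = ε * (-m * x) by ring] at this)
    (fun x h1 h2 => by
      obtain ⟨⟨h3, h4⟩, h5, h6⟩ := hcl x h1 h2
      rw [h5, h6 m (by rw [abs_of_pos hm]; exact hm1)]
      have := hdn _ h3 h4
      rwa [neg_neg, show -m * -(ε * x) = ε * (m * x) by ring] at this)
  exact Axial.exists_saddleNodeNet hP (hp.uniqueRight hR hε hr hpr) hη hζ hη0 hζ0 hηζ
    (hq.slopeField hR hε) (hq.uniqueRight hR hε hr hqr) (hq.uniqueLeft hR hε hr hql)

theorem LocalSlope.exists_trivialNet (hp : LocalSlope κ R₀ p) (hq : LocalSlope κ R₀ q)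
    (hR : 0 < R₀) (hr : 0 < r)
    (hpr : ∀ x y, 0 < x → x ≤ r → |y| ≤ κ * x → slopeDeriv p x y ≤ K)
    (hpl : ∀ x y, 0 < x → x ≤ r → |y| ≤ κ * x → -slopeDeriv p (-x) y ≤ K)
    (hqr : ∀ x y, 0 < x → x ≤ r → |y| ≤ κ * x → slopeDeriv q x y ≤ K)
    (hql : ∀ x y, 0 < x → x ≤ r → |y| ≤ κ * x → -slopeDeriv q (-x) y ≤ K) :
    ∃ h : ℝ² ≃ₜ ℝ², h 0 = 0 ∧ (∀ z, h z ∈ square → ‖z‖ ≤ R₀) ∧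
      ∀ L, Maximal (IsDirArc (NetDirection p q) (h ⁻¹' square)) L ↔ h '' L ∈ trivialNet := by
  have hε : 0 < R₀ * (1 - κ) := mul_pos hR (by linarith [hp.lt_one])
  exact exists_local_net hR hp.lt_one (Axial.exists_trivialNet (hp.slopeField hR hε)
    (hp.uniqueRight hR hε hr hpr) (hp.uniqueLeft hR hε hr hpl)
    (hq.slopeField hR hε) (hq.uniqueRight hR hε hr hqr) (hq.uniqueLeft hR hε hr hql))

namespace SaddleNodeGerm

variable {A B : ℝ² → ℝ} {α β : ℝ}

/-- Directions `v` for which the fourth power of `a v₁ + b v₂` is a positive multiple of `N`. -/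
def _root_.Axial.quarterDir (a b N : ℝ² → ℂ) (z v : ℝ²) : Prop :=
  v ≠ 0 ∧ ∃ s : ℝ, 0 < s ∧ (a z * v.1 + b z * v.2) ^ 4 = s * N z

theorem exists_tangent_bounds (h : SaddleNodeGerm A B α β) :
    ∃ κ, 0 ≤ κ ∧ κ < 1 ∧ ∀ᶠ z in 𝓝 0, |quarterTan ⟨B z, -A z⟩| ≤ κ ∧
      (z ≠ 0 → (⟨B z, -A z⟩ : ℂ) ∈ slitPlane ∧ ContDiffAt ℝ 1 (fun z => quarterTan ⟨B z, -A z⟩) z ∧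
        ∀ v, 𝐃 (fun z => quarterTan ⟨B z, -A z⟩) z v
          = (1 + quarterTan ⟨B z, -A z⟩ ^ 2) / 4 *
            ((A z * 𝐃 B z v - B z * 𝐃 A z v) / (A z ^ 2 + B z ^ 2))) := by
  obtain ⟨K, hK, hsec⟩ := h.exists_sector
  obtain ⟨κ, h0, h1, hκ⟩ := exists_abs_quarterTan_le hK
  obtain ⟨c, -, C, -, hb⟩ := h.exists_bounds
  refine ⟨κ, h0, h1, ?_⟩
  filter_upwards [hsec, hb] with z hz hb
  by_cases hz0 : z = 0
  · subst hz0
    refine ⟨?_, fun h => absurd rfl h⟩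
    rw [h.zeroA, h.zeroB, neg_zero]
    change |quarterTan 0| ≤ κ
    rwa [quarterTan_zero, abs_zero]
  obtain ⟨s1, s2⟩ := hz hz0
  have hA0 : (-A z = 0 → 0 < B z) := fun h => s2 (neg_eq_zero.1 h)
  refine ⟨hκ ⟨B z, -A z⟩ (by simpa using s1) hA0, fun _ => ?_⟩
  have hslit : (⟨B z, -A z⟩ : ℂ) ∈ slitPlane := by
    rw [mem_slitPlane_iff]
    by_cases hA : -A z = 0
    · exact Or.inl (hA0 hA)
    · exact Or.inr hA
  refine ⟨hslit, ?_, fun v => ?_⟩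
  · have hN : ContDiffAt ℝ 1 (fun z => (⟨B z, -A z⟩ : ℂ)) z := by
      have : (fun z => (⟨B z, -A z⟩ : ℂ)) = fun z => B z • (1 : ℂ) - A z • I := by
        funext z; apply Complex.ext <;> simp
      rw [this]
      exact (hb.contDiffB.smul contDiffAt_const).sub (hb.contDiffA.smul contDiffAt_const)
    exact ContDiffAt.comp z (g := quarterTan) (contDiffAt_quarterTan hslit) hN
  · rw [(hasFDerivAt_quarterTan (hb.contDiffA.differentiableAt one_ne_zero)
      (hb.contDiffB.differentiableAt one_ne_zero) hslit).fderiv]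
    simp only [smul_apply, sub_apply, smul_eq_mul]
    ring

theorem exists_fderiv_tangent_le (h : SaddleNodeGerm A B α β) :
    ∃ K ≥ 0, ∀ᶠ z in 𝓝 (0 : ℝ²), z ≠ 0 →
      𝐃 (fun z => quarterTan ⟨B z, -A z⟩) z (0, 1) ≤ K := by
  obtain ⟨κ, h0, h1, hT⟩ := h.exists_tangent_bounds
  obtain ⟨K, hK, hc⟩ := h.exists_cross_snd_le
  refine ⟨K, hK, ?_⟩
  filter_upwards [hT, hc] with z hT hc hz
  obtain ⟨hs, -, hd⟩ := hT.2 hz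
  rw [hd]
  set t := quarterTan ⟨B z, -A z⟩
  have ht : t ^ 2 ≤ 1 := by rw [← sq_abs]; nlinarith [abs_nonneg t, hT.1]
  have hpos : 0 < A z ^ 2 + B z ^ 2 := by
    have := normSq_pos.2 (slitPlane_ne_zero hs)
    rw [normSq_apply] at this
    simp only at this
    nlinarith
  have h2 : (A z * 𝐃 B z (0, 1) - B z * 𝐃 A z (0, 1)) / (A z ^ 2 + B z ^ 2) ≤ K := by
    rw [div_le_iff₀ hpos]; exact hc
  have h3 : 0 ≤ (1 + t ^ 2) / 4 := by positivity
  calc _ ≤ (1 + t ^ 2) / 4 * K := mul_le_mul_of_nonneg_left h2 h3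
    _ ≤ 1 * K := mul_le_mul_of_nonneg_right (by linarith) hK
    _ = K := one_mul K

theorem exists_abs_fderiv_tangent_le (h : SaddleNodeGerm A B α β) {M : ℝ} (hM : 0 ≤ M) :
    ∃ K ≥ 0, ∀ᶠ z in 𝓝 (0 : ℝ²), z ≠ 0 → |z.1| ≤ M * |z.2| → ∀ v,
      |𝐃 (fun z => quarterTan ⟨B z, -A z⟩) z v| ≤ K * ‖v‖ := by
  obtain ⟨κ, h0, h1, hT⟩ := h.exists_tangent_bounds
  obtain ⟨K, hK, hc⟩ := h.exists_cross_le_of_cone hM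
  refine ⟨K, hK, ?_⟩
  filter_upwards [hT, hc] with z hT hc hz hcone v
  obtain ⟨hs, -, hd⟩ := hT.2 hz
  rw [hd]
  set t := quarterTan ⟨B z, -A z⟩
  have ht : t ^ 2 ≤ 1 := by rw [← sq_abs]; nlinarith [abs_nonneg t, hT.1]
  have hpos : 0 < A z ^ 2 + B z ^ 2 := by
    have := normSq_pos.2 (slitPlane_ne_zero hs)
    rw [normSq_apply] at this
    simp only at this
    nlinarith
  have hKv : 0 ≤ K * ‖v‖ := mul_nonneg hK (norm_nonneg v)
  have h2 : |(A z * 𝐃 B z v - B z * 𝐃 A z v) / (A z ^ 2 + B z ^ 2)| ≤ K * ‖v‖ := by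
    rw [abs_div, abs_of_pos hpos, div_le_iff₀ hpos]; exact hc hcone v
  have h3 : 0 ≤ (1 + t ^ 2) / 4 := by positivity
  rw [abs_mul, abs_of_nonneg h3]
  calc _ ≤ (1 + t ^ 2) / 4 * (K * ‖v‖) := mul_le_mul_of_nonneg_left h2 h3
    _ ≤ 1 * (K * ‖v‖) := mul_le_mul_of_nonneg_right (by linarith) hKv
    _ = K * ‖v‖ := one_mul _

theorem tendsto_tangent (h : SaddleNodeGerm A B α β) {v : ℝ²} (hv : v.2 ≠ 0) :
    Tendsto (fun t : ℝ => quarterTan ⟨B (t • v), -A (t • v)⟩) (𝓝[>] 0)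
      (𝓝 (quarterTan ⟨β * v.2, -(α * v.2)⟩)) := by
  have hα := h.pos
  have ray : ∀ f : ℝ² → ℝ, ContDiffAt ℝ 2 f 0 → f 0 = 0 →
      Tendsto (fun t : ℝ => t⁻¹ * f (t • v)) (𝓝[>] 0) (𝓝 (𝐃 f 0 v)) := by
    intro f hf hf0
    have h1 : HasDerivAt (fun t : ℝ => t • v) v 0 := by
      simpa using (hasDerivAt_id (0 : ℝ)).smul_const v
    have h2 : HasFDerivAt f (𝐃 f 0) ((0 : ℝ) • v) := by
      rw [zero_smul]; exact (hf.differentiableAt (by norm_num)).hasFDerivAt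
    have h3 := (h2.comp_hasDerivAt (0 : ℝ) h1).tendsto_slope_zero_right
    simpa [Function.comp, hf0] using h3
  have hA := ray A h.contDiffA h.zeroA
  have hB := ray B h.contDiffB h.zeroB
  rw [h.fderivA] at hA
  rw [h.fderivB] at hB
  have hslit : (⟨β * v.2, -(α * v.2)⟩ : ℂ) ∈ slitPlane := by
    rw [mem_slitPlane_iff]; right
    simpa using ⟨hα.ne', hv⟩
  have hN : Tendsto (fun t : ℝ => (⟨t⁻¹ * B (t • v), -(t⁻¹ * A (t • v))⟩ : ℂ)) (𝓝[>] 0)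
      (𝓝 ⟨β * v.2, -(α * v.2)⟩) := by
    have he : ∀ x y : ℝ, (⟨x, -y⟩ : ℂ) = x • (1 : ℂ) - y • I := fun x y => by
      apply Complex.ext <;> simp
    simp only [he]
    exact (hB.smul_const _).sub (hA.smul_const _)
  have := ((contDiffAt_quarterTan (n := 0) hslit).continuousAt.tendsto).comp hN
  refine this.congr' ?_
  filter_upwards [self_mem_nhdsWithin] with t ht
  have ht0 : (0 : ℝ) < t := ht
  have e : (⟨t⁻¹ * B (t • v), -(t⁻¹ * A (t • v))⟩ : ℂ)
      = ((t⁻¹ : ℝ) : ℂ) * ⟨B (t • v), -A (t • v)⟩ := by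
    apply Complex.ext
    · rw [re_ofReal_mul]
    · rw [im_ofReal_mul]; simp
  simp only [Function.comp]
  rw [e, quarterTan_smul (inv_pos.2 ht0)]

end SaddleNodeGerm

theorem tendsto_slopeH {a b : ℝ² → ℂ} {T : ℝ² → ℝ} (ha : ContinuousAt a 0)
    (hb : ContinuousAt b 0) (ha0 : a 0 = 1) (hb0 : b 0 = I) {v : ℝ²} {τ : ℝ}
    (hT : Tendsto (fun t : ℝ => T (t • v)) (𝓝[>] 0) (𝓝 τ)) :
    Tendsto (fun t : ℝ => slopeH a b T (t * v.1) (t * v.2)) (𝓝[>] 0) (𝓝 τ) := by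
  have hv : Tendsto (fun t : ℝ => t • v) (𝓝[>] 0) (𝓝 0) := by
    have : Continuous fun t : ℝ => t • v := by fun_prop
    have := this.tendsto 0
    rw [zero_smul] at this
    exact this.mono_left nhdsWithin_le_nhds
  have hA : Tendsto (fun t : ℝ => a (t • v)) (𝓝[>] 0) (𝓝 1) := ha0 ▸ ha.tendsto.comp hv
  have hB : Tendsto (fun t : ℝ => b (t • v)) (𝓝[>] 0) (𝓝 I) := hb0 ▸ hb.tendsto.comp hv
  have re := fun {f : ℝ → ℂ} {w : ℂ} (h : Tendsto f (𝓝[>] 0) (𝓝 w)) =>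
    (continuous_re.tendsto w).comp h
  have im := fun {f : ℝ → ℂ} {w : ℂ} (h : Tendsto f (𝓝[>] 0) (𝓝 w)) =>
    (continuous_im.tendsto w).comp h
  have := ((im hA).neg.add ((re hA).mul hT)).div ((im hB).add ((re hB).neg.mul hT)) (by simp)
  have lim : (-(1 : ℂ).im + (1 : ℂ).re * τ) / (I.im + -I.re * τ) = τ := by simp
  rw [lim] at this
  exact this

end

section

open Filter Asymptotics Complex

namespace SaddleNodeGerm

variable {A B : ℝ² → ℝ} {α β : ℝ} {a b : ℝ² → ℂ}

theorem isLocalNet_saddleNode (h : SaddleNodeGerm A B α β) (ha : ContDiffAt ℝ 1 a 0)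
    (hb : ContDiffAt ℝ 1 b 0) (ha0 : a 0 = 1) (hb0 : b 0 = I) :
    IsLocalNet (quarterDir a b fun z => ⟨B z, -A z⟩) saddleNodeNet := by
  obtain ⟨κ₀, hκ0, hκ1, hT⟩ := h.exists_tangent_bounds
  set T : ℝ² → ℝ := fun z => quarterTan ⟨B z, -A z⟩ with hTd
  obtain ⟨R₁, hR₁, κ, K₁, hK₁, hp, hq, hd⟩ := exists_slopes (T := T) ha hb ha0 hb0 hκ0 hκ1
    (hT.mono fun z hz => hz.1) (hT.mono fun z hz h0 => (hz.2 h0).2.1)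
  obtain ⟨K₂, hK₂, hT₂⟩ := h.exists_fderiv_tangent_le
  obtain ⟨K₃, hK₃, hT₃⟩ := h.exists_abs_fderiv_tangent_le zero_le_one
  have lim_up : ∀ m : ℝ, 0 < m → Tendsto (fun t : ℝ => slopeH a b T (-t) (m * t)) (𝓝[>] 0)
      (𝓝 (quarterTan ⟨β, -α⟩)) := fun m hm => by
    have h1 := h.tendsto_tangent (v := (-1, m)) hm.ne'
    have h2 : (⟨β * m, -(α * m)⟩ : ℂ) = (m : ℂ) * ⟨β, -α⟩ := by
      apply Complex.ext
      · rw [re_ofReal_mul]; ring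
      · rw [im_ofReal_mul]; ring
    simp only [h2, quarterTan_smul hm] at h1
    refine (tendsto_slopeH (T := T) (v := (-1, m)) ha.continuousAt hb.continuousAt ha0 hb0 h1).congr fun t => ?_
    congr 1 <;> ring
  have lim_dn : ∀ m : ℝ, 0 < m → Tendsto (fun t : ℝ => slopeH a b T (-t) (-m * t)) (𝓝[>] 0)
      (𝓝 (quarterTan ⟨-β, α⟩)) := fun m hm => by
    have h1 := h.tendsto_tangent (v := (-1, -m)) (neg_ne_zero.2 hm.ne')
    have h2 : (⟨β * -m, -(α * -m)⟩ : ℂ) = (m : ℂ) * ⟨-β, α⟩ := by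
      apply Complex.ext
      · rw [re_ofReal_mul]; ring
      · rw [im_ofReal_mul]; ring
    simp only [h2, quarterTan_smul hm] at h1
    refine (tendsto_slopeH (T := T) (v := (-1, -m)) ha.continuousAt hb.continuousAt ha0 hb0 h1).congr fun t => ?_
    congr 1 <;> ring
  set τ₀ := quarterTan ⟨β, -α⟩ with hτ₀
  set τ₁ := quarterTan ⟨-β, α⟩ with hτ₁
  have hτ0 : τ₀ < 0 := quarterTan_neg_of_im_neg (by simpa using h.pos)
  have hτ1 : 0 < τ₁ := quarterTan_pos_of_im_pos (by simpa using h.pos)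
  set m := min (min (-τ₀ / 2) (τ₁ / 2)) 1 with hmd
  have hm : 0 < m := lt_min (lt_min (by linarith) (by linarith)) one_pos
  have hm0 : m ≤ -τ₀ / 2 := (min_le_left _ _).trans (min_le_left _ _)
  have hm1 : m ≤ τ₁ / 2 := (min_le_left _ _).trans (min_le_right _ _)
  have ev : ∀ᶠ t in 𝓝[>] (0 : ℝ), slopeH a b T (-t) (m * t) < -m ∧ m < slopeH a b T (-t) (-m * t) :=
    ((lim_up m hm).eventually (Iio_mem_nhds (by linarith))).and
      ((lim_dn m hm).eventually (Ioi_mem_nhds (by linarith)))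
  obtain ⟨r₁, hr₁, hr₁'⟩ := (nhdsGT_basis (0 : ℝ)).eventually_iff.1 ev
  obtain ⟨R₂, hR₂, hR₂'⟩ := Metric.nhds_basis_closedBall.eventually_iff.1 ((hT.and hT₂).and hT₃)
  have hbox : ∀ z : ℝ², ‖z‖ ≤ R₂ → z ∈ Metric.closedBall (0 : ℝ²) R₂ := fun z hz =>
    mem_closedBall_zero_iff.2 hz
  refine ⟨min R₁ R₂, lt_min hR₁ hR₂, fun R hR hRR => ?_⟩
  have hRR₁ := hRR.trans (min_le_left _ _)
  have hRR₂ := hRR.trans (min_le_right _ _)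
  set r := min (r₁ / 2) (min R₁ R₂) with hrd
  have hr : 0 < r := lt_min (half_pos hr₁) (lt_min hR₁ hR₂)
  have hrR₁ : r ≤ R₁ := (min_le_right _ _).trans (min_le_left _ _)
  have hrR₂ : r ≤ R₂ := (min_le_right _ _).trans (min_le_right _ _)
  have hκ := hp.lt_one
  have cone : ∀ x y : ℝ, 0 < x → |y| ≤ κ * x → |y| ≤ x := fun x y hx hy => hy.trans (by nlinarith)
  obtain ⟨g, g0, gR, gL⟩ := (hp.mono hRR₁).exists_saddleNodeNet (hq.mono hRR₁) (K := K₁ + 8 * (K₂ + K₃))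
    hR hr
    (fun x y hx hxr hy => by
      have hyx := cone x y hx hy
      have hn : ‖((x, y) : ℝ²)‖ ≤ x := by
        rw [Prod.norm_def]; exact max_le (by simp [abs_of_pos hx]) hyx
      have hne : ((x, y) : ℝ²) ≠ 0 := fun h0 => hx.ne' (congrArg Prod.fst h0)
      obtain ⟨j, j0, j8, hj⟩ := ((hd _ (hn.trans (hxr.trans hrR₁))).2.2 hne).1
      have hd2 := (hR₂' (hbox _ (hn.trans (hxr.trans hrR₂)))).1.2 hne
      simp only at hj
      nlinarith [(abs_le.1 hj).2, mul_le_mul_of_nonneg_left hd2 j0])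
    (fun y x hy hyr hx => by
      have hxy := cone y x hy hx
      have hn : ‖((x, y) : ℝ²)‖ ≤ y := by
        rw [Prod.norm_def]; exact max_le hxy (by simp [abs_of_pos hy])
      have hne : ((x, y) : ℝ²) ≠ 0 := fun h0 => hy.ne' (congrArg Prod.snd h0)
      obtain ⟨j, j0, j8, hj⟩ := ((hd _ (hn.trans (hyr.trans hrR₁))).2.2 hne).2
      have hd2 := (hR₂' (hbox _ (hn.trans (hyr.trans hrR₂)))).2 hne
        (by simpa [abs_of_pos hy] using hxy) (1, 0)
      simp only at hj
      have e1 : ‖((1, 0) : ℝ²)‖ = 1 := by simp [Prod.norm_def]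
      rw [e1, mul_one] at hd2
      nlinarith [(abs_le.1 hj).2, mul_le_mul_of_nonneg_left (abs_le.1 hd2).1 j0])
    (fun y x hy hyr hx => by
      have hxy := cone y x hy hx
      have hn : ‖((x, -y) : ℝ²)‖ ≤ y := by
        rw [Prod.norm_def]; exact max_le hxy (by simp [abs_of_pos hy])
      have hne : ((x, -y) : ℝ²) ≠ 0 := fun h0 => hy.ne' (neg_eq_zero.1 (congrArg Prod.snd h0))
      obtain ⟨j, j0, j8, hj⟩ := ((hd _ (hn.trans (hyr.trans hrR₁))).2.2 hne).2
      have hd2 := (hR₂' (hbox _ (hn.trans (hyr.trans hrR₂)))).2 hne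
        (by simpa [abs_of_pos hy] using hxy) (1, 0)
      simp only at hj
      have e1 : ‖((1, 0) : ℝ²)‖ = 1 := by simp [Prod.norm_def]
      rw [e1, mul_one] at hd2
      nlinarith [(abs_le.1 hj).1, mul_le_mul_of_nonneg_left (abs_le.1 hd2).2 j0])
    hm (min_le_right _ _)
    (fun x hx hxr => (hr₁' ⟨hx, by have := hxr.trans (min_le_left _ _); linarith⟩).1)
    (fun x hx hxr => (hr₁' ⟨hx, by have := hxr.trans (min_le_left _ _); linarith⟩).2)
  refine ⟨g, g0, gR, fun L => ?_⟩
  rw [← gL L]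
  have : IsDirArc (quarterDir a b fun z => ⟨B z, -A z⟩) (g ⁻¹' square)
      = IsDirArc (NetDirection (slopeH a b T) (slopeV a b T)) (g ⁻¹' square) :=
    isDirArc_congr fun z hz hz0 v => by
      have hzR := gR z hz
      obtain ⟨d1, d2, -⟩ := hd z (hzR.trans hRR₁)
      have hs := ((hR₂' (hbox z (hzR.trans hRR₂))).1.1.2 hz0).1
      exact (netDirection_iff hs d1 d2 rfl rfl
        ((hp.bound _ _ ((norm_fst_le z).trans (hzR.trans hRR₁))
          ((norm_snd_le z).trans (hzR.trans hRR₁))).trans_lt hκ)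
        ((hq.bound _ _ ((norm_snd_le z).trans (hzR.trans hRR₁))
          ((norm_fst_le z).trans (hzR.trans hRR₁))).trans_lt hκ) v).symm
  rw [this]

/-- The plane map `(u, w) ↦ (u - w, u + w)`: a rotation by an eighth of a turn, up to a factor. -/
def _root_.Axial.eighthTurn : ℝ² →L[ℝ] ℝ² :=
  (ContinuousLinearMap.fst ℝ ℝ ℝ - ContinuousLinearMap.snd ℝ ℝ ℝ).prod
    (ContinuousLinearMap.fst ℝ ℝ ℝ + ContinuousLinearMap.snd ℝ ℝ ℝ)

theorem _root_.Axial.eighthTurn_apply (z : ℝ²) : eighthTurn z = (z.1 - z.2, z.1 + z.2) := rfl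

theorem _root_.Axial.eighthTurn_cone {κ : ℝ} {z : ℝ²} (hκ : κ < 1) (hκ0 : 0 ≤ κ)
    (h : |z.2| ≤ κ * |z.1| ∨ |z.1| ≤ κ * |z.2|) :
    |(eighthTurn z).1| ≤ (1 + κ) / (1 - κ) * |(eighthTurn z).2| := by
  have h1 : 0 < 1 - κ := by linarith
  rw [eighthTurn_apply, div_mul_eq_mul_div, le_div_iff₀ h1]
  simp only
  have key : ∀ s t : ℝ, |t| ≤ κ * |s| → |s - t| * (1 - κ) ≤ (1 + κ) * |s + t| := fun s t hst => by
    have h2 : |s - t| ≤ (1 + κ) * |s| := (abs_sub s t).trans (by linarith)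
    have h3 : (1 - κ) * |s| ≤ |s + t| := by
      have := abs_sub_abs_le_abs_sub s (-t)
      rw [abs_neg, sub_neg_eq_add] at this
      linarith
    nlinarith [abs_nonneg s]
  rcases h with h | h
  · exact key _ _ h
  · have := key _ _ h
    rwa [abs_sub_comm, add_comm z.2] at this

theorem isLocalNet_trivial (h : SaddleNodeGerm A B α β) (ha : ContDiffAt ℝ 1 a 0)
    (hb : ContDiffAt ℝ 1 b 0) (ha0 : a 0 = 1) (hb0 : b 0 = I) :
    IsLocalNet (quarterDir a b fun z => ⟨B (eighthTurn z), -A (eighthTurn z)⟩) trivialNet := by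
  obtain ⟨κ₀, hκ0, hκ1, hT⟩ := h.exists_tangent_bounds
  set T₀ : ℝ² → ℝ := fun z => quarterTan ⟨B z, -A z⟩ with hT₀d
  set T : ℝ² → ℝ := fun z => T₀ (eighthTurn z) with hTd
  have hlim : Tendsto eighthTurn (𝓝 (0 : ℝ²)) (𝓝 0) := by
    have := eighthTurn.continuous.tendsto 0
    rwa [map_zero] at this
  have hne0 : ∀ z, z ≠ 0 → eighthTurn z ≠ 0 := fun z hz h0 => hz (by
    rw [eighthTurn_apply] at h0
    have h1 : z.1 - z.2 = 0 := congrArg Prod.fst h0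
    have h2 : z.1 + z.2 = 0 := congrArg Prod.snd h0
    exact Prod.ext (by simp; linarith) (by simp; linarith))
  have hT' := hlim.eventually hT
  have hTc : ∀ᶠ z in 𝓝 (0 : ℝ²), z ≠ 0 → ContDiffAt ℝ 1 T z := hT'.mono fun z hz h0 =>
    ContDiffAt.comp z (g := T₀) ((hz.2 (hne0 z h0)).2.1) eighthTurn.contDiff.contDiffAt
  obtain ⟨R₁, hR₁, κ, K₁, hK₁, hp, hq, hd⟩ := exists_slopes (T := T) ha hb ha0 hb0 hκ0 hκ1
    (hT'.mono fun z hz => hz.1) hTc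
  have hκ := hp.lt_one
  have hκ' := hp.nonneg
  obtain ⟨K₃, hK₃, hT₃⟩ := h.exists_abs_fderiv_tangent_le (M := (1 + κ) / (1 - κ))
    (div_nonneg (by linarith) (by linarith))
  set K₄ := K₃ * ‖eighthTurn‖ with hK₄d
  have hK₄ : 0 ≤ K₄ := by positivity
  have hder : ∀ᶠ z in 𝓝 (0 : ℝ²), z ≠ 0 → (|z.2| ≤ κ * |z.1| ∨ |z.1| ≤ κ * |z.2|) → ∀ v,
      |𝐃 T z v| ≤ K₄ * ‖v‖ := by
    filter_upwards [hlim.eventually hT₃, hT'] with z h3 hz h0 hcone v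
    have hdiff := ((hz.2 (hne0 z h0)).2.1).differentiableAt one_ne_zero
    have hc : 𝐃 T z = (𝐃 T₀ (eighthTurn z)).comp eighthTurn :=
      (hdiff.hasFDerivAt.comp z eighthTurn.hasFDerivAt).fderiv
    rw [hc]
    have := h3 (hne0 z h0) (eighthTurn_cone hκ hκ' hcone) (eighthTurn v)
    calc _ ≤ K₃ * ‖eighthTurn v‖ := this
      _ ≤ K₃ * (‖eighthTurn‖ * ‖v‖) := mul_le_mul_of_nonneg_left (eighthTurn.le_opNorm v) hK₃
      _ = _ := by rw [hK₄d]; ring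
  obtain ⟨R₂, hR₂, hR₂'⟩ := Metric.nhds_basis_closedBall.eventually_iff.1 (hT'.and hder)
  have hbox : ∀ z : ℝ², ‖z‖ ≤ R₂ → z ∈ Metric.closedBall (0 : ℝ²) R₂ := fun z hz =>
    mem_closedBall_zero_iff.2 hz
  refine ⟨min R₁ R₂, lt_min hR₁ hR₂, fun R hR hRR => ?_⟩
  have hRR₁ := hRR.trans (min_le_left _ _)
  have hRR₂ := hRR.trans (min_le_right _ _)
  have e10 : ‖((1, 0) : ℝ²)‖ = 1 := by simp [Prod.norm_def]
  have e01 : ‖((0, 1) : ℝ²)‖ = 1 := by simp [Prod.norm_def]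
  have main : ∀ z : ℝ², z ≠ 0 → ‖z‖ ≤ R → (|z.2| ≤ κ * |z.1| ∨ |z.1| ≤ κ * |z.2|) →
      |slopeDeriv (slopeH a b T) z.1 z.2| ≤ K₁ + 8 * K₄ ∧
      |slopeDeriv (slopeV a b T) z.2 z.1| ≤ K₁ + 8 * K₄ := by
    intro z hz0 hzR hcone
    have hde := (hR₂' (hbox z (hzR.trans hRR₂))).2 hz0 hcone
    obtain ⟨⟨j, j0, j8, hj⟩, k, k0, k8, hk⟩ := (hd z (hzR.trans hRR₁)).2.2 hz0
    have d1 := hde (0, 1)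
    have d2 := hde (1, 0)
    rw [e01, mul_one] at d1
    rw [e10, mul_one] at d2
    have m1 : |j * 𝐃 T z (0, 1)| ≤ 8 * K₄ := by
      rw [abs_mul, abs_of_nonneg j0]; exact mul_le_mul j8 d1 (abs_nonneg _) (by norm_num)
    have m2 : |k * 𝐃 T z (1, 0)| ≤ 8 * K₄ := by
      rw [abs_mul, abs_of_nonneg k0]; exact mul_le_mul k8 d2 (abs_nonneg _) (by norm_num)
    rw [abs_le] at hj hk m1 m2
    constructor <;> rw [abs_le] <;> constructor <;> linarith [hj.1, hj.2, hk.1, hk.2, m1.1, m1.2]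
  have cone : ∀ x y : ℝ, 0 < x → x ≤ R → |y| ≤ κ * x → ∀ s : ℝ, |s| = x →
      ((s, y) : ℝ²) ≠ 0 ∧ ‖((s, y) : ℝ²)‖ ≤ R ∧ |y| ≤ κ * |s| ∧
      ((y, s) : ℝ²) ≠ 0 ∧ ‖((y, s) : ℝ²)‖ ≤ R := by
    intro x y hx hxR hy s hs
    have hyx : |y| ≤ x := hy.trans (by nlinarith)
    have hs0 : s ≠ 0 := fun h => by rw [h, abs_zero] at hs; linarith
    refine ⟨fun h => hs0 (congrArg Prod.fst h), ?_, by rwa [hs], fun h => hs0 (congrArg Prod.snd h),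
      ?_⟩
    · rw [Prod.norm_def]; exact max_le (hs.le.trans hxR) (hyx.trans hxR)
    · rw [Prod.norm_def]; exact max_le (hyx.trans hxR) (hs.le.trans hxR)
  obtain ⟨g, g0, gR, gL⟩ := (hp.mono hRR₁).exists_trivialNet (hq.mono hRR₁) (K := K₁ + 8 * K₄)
    hR hR
    (fun x y hx hxr hy => by
      obtain ⟨c1, c2, c3, c4, c5⟩ := cone x y hx hxr hy x (abs_of_pos hx)
      exact (abs_le.1 (main _ c1 c2 (Or.inl c3)).1).2)
    (fun x y hx hxr hy => by
      obtain ⟨c1, c2, c3, c4, c5⟩ := cone x y hx hxr hy (-x) (by rw [abs_neg, abs_of_pos hx])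
      linarith [(abs_le.1 (main _ c1 c2 (Or.inl c3)).1).1])
    (fun x y hx hxr hy => by
      obtain ⟨c1, c2, c3, c4, c5⟩ := cone x y hx hxr hy x (abs_of_pos hx)
      exact (abs_le.1 (main _ c4 c5 (Or.inr c3)).2).2)
    (fun x y hx hxr hy => by
      obtain ⟨c1, c2, c3, c4, c5⟩ := cone x y hx hxr hy (-x) (by rw [abs_neg, abs_of_pos hx])
      linarith [(abs_le.1 (main _ c4 c5 (Or.inr c3)).2).1])
  refine ⟨g, g0, gR, fun L => ?_⟩
  rw [← gL L]
  have : IsDirArc (quarterDir a b fun z => ⟨B (eighthTurn z), -A (eighthTurn z)⟩) (g ⁻¹' square)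
      = IsDirArc (NetDirection (slopeH a b T) (slopeV a b T)) (g ⁻¹' square) :=
    isDirArc_congr fun z hz hz0 v => by
      have hzR := gR z hz
      obtain ⟨d1, d2, -⟩ := hd z (hzR.trans hRR₁)
      have hs := ((hR₂' (hbox z (hzR.trans hRR₂))).1.2 (hne0 z hz0)).1
      exact (netDirection_iff hs d1 d2 rfl rfl
        ((hp.bound _ _ ((norm_fst_le z).trans (hzR.trans hRR₁))
          ((norm_snd_le z).trans (hzR.trans hRR₁))).trans_lt hκ)
        ((hq.bound _ _ ((norm_snd_le z).trans (hzR.trans hRR₁))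
          ((norm_fst_le z).trans (hzR.trans hRR₁))).trans_lt hκ) v).symm
  rw [this]

end SaddleNodeGerm

end

section

open Filter Complex

/-! ### The ellipse of curvature in complex notation -/

section Algebra

variable {V : Type*} [NormedAddCommGroup V] [InnerProductSpace ℝ V]

theorem norm_sq_combination (a b c : ℝ) (u v w : V) :
    ‖a • u + b • v + c • w‖ ^ 2 = a ^ 2 * ⟪u, u⟫ + 2 * (a * b) * ⟪u, v⟫ + 2 * (a * c) * ⟪u, w⟫
      + b ^ 2 * ⟪v, v⟫ + 2 * (b * c) * ⟪v, w⟫ + c ^ 2 * ⟪w, w⟫ := by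
  rw [← real_inner_self_eq_norm_sq]
  simp only [inner_add_left, inner_add_right, real_inner_smul_left, real_inner_smul_right]
  rw [real_inner_comm u v, real_inner_comm u w, real_inner_comm v w]
  ring

/-- The coefficients `a₀`, `a₁` as functions of the two fundamental forms. -/
def coeff0 (E F G ee ef eg ff fg : ℝ) : ℝ :=
  4 * F * (E * G - 2 * F ^ 2) * ee - 4 * E * (E * G - 4 * F ^ 2) * ef + 4 * E ^ 3 * fg
    - 4 * E ^ 2 * F * eg - 8 * E ^ 2 * F * ff

def coeff1 (E F G ee ef eg ff gg : ℝ) : ℝ :=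
  4 * G * (E * G - 4 * F ^ 2) * ee + 32 * E * F * G * ef + 4 * E ^ 3 * gg - 8 * E ^ 2 * G * eg
    - 16 * E ^ 2 * G * ff

theorem deviation_identity (E F G x y ee ef eg ff fg gg s t u a b : ℝ)
    (ha : a = coeff0 E F G ee ef eg ff fg) (hb : b = coeff1 E F G ee ef eg ff gg)
    (hs : s = 2 * (E * G - F ^ 2) * x ^ 2 - (E * x ^ 2 + 2 * F * (x * y) + G * y ^ 2) * G)
    (ht : t = 4 * (E * G - F ^ 2) * (x * y) + 2 * (E * x ^ 2 + 2 * F * (x * y) + G * y ^ 2) * F)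
    (hu : u = 2 * (E * G - F ^ 2) * y ^ 2 - (E * x ^ 2 + 2 * F * (x * y) + G * y ^ 2) * E) :
    2 * E ^ 4 * (s ^ 2 * ee + 2 * (s * t) * ef + 2 * (s * u) * eg + t ^ 2 * ff + 2 * (t * u) * fg
        + u ^ 2 * gg)
      = (2 * ((E * G - 2 * F ^ 2) ^ 2 * ee + 2 * ((E * G - 2 * F ^ 2) * (2 * E * F)) * ef
          + 2 * ((E * G - 2 * F ^ 2) * -E ^ 2) * eg + (2 * E * F) ^ 2 * ff
          + 2 * ((2 * E * F) * -E ^ 2) * fg + (-E ^ 2) ^ 2 * gg) - (E * b - 4 * F * a) / 4)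
          * (E * (E * x ^ 2 + 2 * F * (x * y) + G * y ^ 2)) ^ 2
        + ((E * b - 4 * F * a) / 4 * ((E * x + F * y) ^ 4
            - 6 * (E * x + F * y) ^ 2 * ((E * G - F ^ 2) * y ^ 2) + ((E * G - F ^ 2) * y ^ 2) ^ 2)
          - a * ((E * G - F ^ 2) * (4 * (E * x + F * y) * y
            * ((E * x + F * y) ^ 2 - (E * G - F ^ 2) * y ^ 2)))) := by
  subst ha hb hs ht hu
  unfold coeff0 coeff1
  ring

/-- The complex number `ζ` attached to a tangent vector. -/
def zeta (E F D x y : ℝ) : ℂ := ⟨E * x + F * y, D * y⟩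

theorem zeta_pow_re (E F D x y : ℝ) : (zeta E F D x y ^ 4).re
    = (E * x + F * y) ^ 4 - 6 * (E * x + F * y) ^ 2 * (D * y) ^ 2 + (D * y) ^ 4 := by
  rw [show zeta E F D x y ^ 4 = zeta E F D x y * zeta E F D x y * zeta E F D x y * zeta E F D x y
    by ring]
  simp only [zeta, mul_re, mul_im]
  ring

theorem zeta_pow_im (E F D x y : ℝ) : (zeta E F D x y ^ 4).im
    = 4 * (E * x + F * y) * (D * y) * ((E * x + F * y) ^ 2 - (D * y) ^ 2) := by
  rw [show zeta E F D x y ^ 4 = zeta E F D x y * zeta E F D x y * zeta E F D x y * zeta E F D x y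
    by ring]
  simp only [zeta, mul_re, mul_im]
  ring

theorem normSq_zeta {E F G D : ℝ} (hD : D ^ 2 = E * G - F ^ 2) (x y : ℝ) :
    normSq (zeta E F D x y) = E * (E * x ^ 2 + 2 * F * (x * y) + G * y ^ 2) := by
  rw [normSq_apply]
  simp only [zeta]
  linear_combination y ^ 2 * hD

/-- The quantity `N` whose argument is four times the angle of the axial directions. -/
def axialN (E F D a b : ℝ) : ℂ := ⟨(E * b - 4 * F * a) / 4, -(D * a)⟩

theorem rescale_identity {E D q S k ρ : ℝ} (hE : E ≠ 0) (hD : D ≠ 0) (hq : q ≠ 0)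
    (h : 2 * E ^ 4 * S = k * (E * q) ^ 2 + ρ) :
    (2 * D ^ 2 * q)⁻¹ ^ 2 * S = k / (8 * E ^ 2 * D ^ 4) + ρ / (8 * E ^ 2 * D ^ 4 * (E * q) ^ 2) := by
  field_simp
  linear_combination 4 * h

theorem exists_deviation_eq {E F G D a b : ℝ} (e f g : V) (hE : E ≠ 0) (hD0 : D ≠ 0)
    (hD : D ^ 2 = E * G - F ^ 2)
    (ha : a = coeff0 E F G ⟪e, e⟫ ⟪e, f⟫ ⟪e, g⟫ ⟪f, f⟫ ⟪f, g⟫)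
    (hb : b = coeff1 E F G ⟪e, e⟫ ⟪e, f⟫ ⟪e, g⟫ ⟪f, f⟫ ⟪g, g⟫) :
    ∃ k, ∀ x y : ℝ, zeta E F D x y ≠ 0 → ‖(E * x ^ 2 + 2 * F * (x * y) + G * y ^ 2)⁻¹ •
          (x ^ 2 • e + (2 * (x * y)) • f + y ^ 2 • g)
          - (2 * (E * G - F ^ 2))⁻¹ • (E • g - (2 * F) • f + G • e)‖ ^ 2
        = k + (axialN E F D a b * (starRingEnd ℂ) (zeta E F D x y ^ 4)).re
          / (8 * E ^ 2 * D ^ 4 * normSq (zeta E F D x y) ^ 2) := by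
  refine ⟨(2 * ((E * G - 2 * F ^ 2) ^ 2 * ⟪e, e⟫ + 2 * ((E * G - 2 * F ^ 2) * (2 * E * F)) * ⟪e, f⟫
          + 2 * ((E * G - 2 * F ^ 2) * -E ^ 2) * ⟪e, g⟫ + (2 * E * F) ^ 2 * ⟪f, f⟫
          + 2 * ((2 * E * F) * -E ^ 2) * ⟪f, g⟫ + (-E ^ 2) ^ 2 * ⟪g, g⟫) - (E * b - 4 * F * a) / 4)
          / (8 * E ^ 2 * D ^ 4), fun x y hz => ?_⟩
  set q := E * x ^ 2 + 2 * F * (x * y) + G * y ^ 2 with hq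
  have hn := normSq_zeta hD x y
  rw [← hq] at hn
  have hq0 : q ≠ 0 := fun h => by
    rw [h, mul_zero] at hn
    exact hz (normSq_eq_zero.1 hn)
  have hv : q⁻¹ • (x ^ 2 • e + (2 * (x * y)) • f + y ^ 2 • g)
      - (2 * (E * G - F ^ 2))⁻¹ • (E • g - (2 * F) • f + G • e)
      = (2 * D ^ 2 * q)⁻¹ • ((2 * (E * G - F ^ 2) * x ^ 2 - q * G) • e
        + (4 * (E * G - F ^ 2) * (x * y) + 2 * q * F) • f
        + (2 * (E * G - F ^ 2) * y ^ 2 - q * E) • g) := by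
    rw [← hD]
    match_scalars <;> field_simp <;> ring
  rw [hv, norm_smul, mul_pow, norm_sq_combination, hn]
  have key := deviation_identity E F G x y ⟪e, e⟫ ⟪e, f⟫ ⟪e, g⟫ ⟪f, f⟫ ⟪f, g⟫ ⟪g, g⟫ _ _ _ a b
    ha hb rfl rfl rfl
  rw [← hq] at key
  have hre : (axialN E F D a b * (starRingEnd ℂ) (zeta E F D x y ^ 4)).re
      = (E * b - 4 * F * a) / 4 * ((E * x + F * y) ^ 4
            - 6 * (E * x + F * y) ^ 2 * ((E * G - F ^ 2) * y ^ 2) + ((E * G - F ^ 2) * y ^ 2) ^ 2)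
          - a * ((E * G - F ^ 2) * (4 * (E * x + F * y) * y
            * ((E * x + F * y) ^ 2 - (E * G - F ^ 2) * y ^ 2))) := by
    rw [mul_re, conj_re, conj_im, zeta_pow_re, zeta_pow_im, ← hD]
    simp only [axialN]
    ring
  rw [← hre] at key
  rw [Real.norm_eq_abs, sq_abs]
  exact rescale_identity hE hD0 hq0 key
end Algebra

/-! ### Extrema of the angular function -/

def angular (N ζ : ℂ) : ℝ := (N * (starRingEnd ℂ) (ζ ^ 4)).re / normSq ζ ^ 2

theorem norm_pow_four (ζ : ℂ) : ‖ζ ^ 4‖ = normSq ζ ^ 2 := by rw [norm_pow, normSq_eq_norm_sq]; ring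

theorem angular_le (N : ℂ) {ζ : ℂ} (hζ : ζ ≠ 0) : angular N ζ ≤ ‖N‖ := by
  have h0 : 0 < normSq ζ ^ 2 := pow_pos (normSq_pos.2 hζ) 2
  rw [angular, div_le_iff₀ h0, ← norm_pow_four, ← norm_conj (ζ ^ 4), ← norm_mul]
  exact re_le_norm _

theorem angular_eq_norm_iff {N ζ : ℂ} (hN : N ≠ 0) (hζ : ζ ≠ 0) :
    angular N ζ = ‖N‖ ↔ ∃ s : ℝ, 0 < s ∧ ζ ^ 4 = s * N := by
  have h0 : 0 < normSq ζ ^ 2 := pow_pos (normSq_pos.2 hζ) 2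
  constructor
  · intro h
    rw [angular, div_eq_iff h0.ne', ← norm_pow_four, ← norm_conj (ζ ^ 4), ← norm_mul,
      re_eq_norm] at h
    set w := N * (starRingEnd ℂ) (ζ ^ 4) with hw
    have hw0 : w ≠ 0 := mul_ne_zero hN ((map_ne_zero _).2 (pow_ne_zero 4 hζ))
    have hre : 0 < w.re := lt_of_le_of_ne (Complex.nonneg_iff.1 h).1 fun h' =>
      hw0 (Complex.ext h'.symm (Complex.nonneg_iff.1 h).2.symm)
    have hwr : w = (w.re : ℂ) := Complex.ext rfl (by simpa using (Complex.nonneg_iff.1 h).2.symm)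
    refine ⟨normSq (ζ ^ 4) / w.re, div_pos (normSq_pos.2 (pow_ne_zero 4 hζ)) hre, ?_⟩
    have h1 : N * normSq (ζ ^ 4) = w.re * ζ ^ 4 := by rw [← hwr, hw, normSq_eq_conj_mul_self]; ring
    have h2 : (w.re : ℂ) ≠ 0 := by exact_mod_cast hre.ne'
    push_cast
    rw [div_mul_eq_mul_div, eq_div_iff h2]
    linear_combination -h1
  · rintro ⟨s, hs, h⟩
    have h1 : N * (starRingEnd ℂ) (ζ ^ 4) = ((s * normSq N : ℝ) : ℂ) := by
      rw [h, map_mul, conj_ofReal]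
      push_cast
      rw [normSq_eq_conj_mul_self]; ring
    have h2 : normSq ζ ^ 2 = s * ‖N‖ := by
      rw [← norm_pow_four, h, norm_mul, norm_real, Real.norm_eq_abs, abs_of_pos hs]
    rw [angular, h1, ofReal_re, h2, normSq_eq_norm_sq]
    have := norm_pos_iff.2 hN
    field_simp

theorem angular_neg (N ζ : ℂ) : angular (-N) ζ = -angular N ζ := by
  rw [angular, angular, neg_mul, neg_re, neg_div]

theorem exists_angular_eq {N : ℂ} (hN : N ≠ 0) : ∃ ζ ≠ 0, angular N ζ = ‖N‖ := by
  obtain ⟨ζ, hζ⟩ := IsAlgClosed.exists_pow_nat_eq N (n := 4) (by norm_num)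
  have h0 : ζ ≠ 0 := fun h => hN (by rw [← hζ, h]; simp)
  exact ⟨ζ, h0, (angular_eq_norm_iff hN h0).2 ⟨1, one_pos, by rw [hζ]; simp⟩⟩

/-- Directions that maximize a quantity depending on the angular function. -/
theorem angular_maximal_iff {ι : Type*} {z : ι → ℂ} {P : ι → Prop} {d : ι → ℝ} {N : ℂ} {k c : ℝ}
    (hN : N ≠ 0) (hc : 0 < c) (hz : ∀ i, P i ↔ z i ≠ 0) (hsurj : ∀ ζ, ∃ i, z i = ζ)
    (hd : ∀ i, P i → d i = k + c * angular N (z i)) (i : ι) :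
    (P i ∧ ∀ j, P j → d j ≤ d i) ↔ P i ∧ ∃ s : ℝ, 0 < s ∧ z i ^ 4 = s * N := by
  refine and_congr_right fun hi => ?_
  rw [← angular_eq_norm_iff hN ((hz i).1 hi)]
  constructor
  · intro h
    obtain ⟨ζ, hζ, hζN⟩ := exists_angular_eq hN
    obtain ⟨j, rfl⟩ := hsurj ζ
    have h1 := h j ((hz j).2 hζ)
    rw [hd i hi, hd j ((hz j).2 hζ), hζN] at h1
    refine le_antisymm (angular_le N ((hz i).1 hi)) ?_
    exact le_of_mul_le_mul_left (by linarith) hc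
  · intro h j hj
    rw [hd i hi, hd j hj, h]
    have := mul_le_mul_of_nonneg_left (angular_le N ((hz j).1 hj)) hc.le
    linarith

theorem angular_minimal_iff {ι : Type*} {z : ι → ℂ} {P : ι → Prop} {d : ι → ℝ} {N : ℂ} {k c : ℝ}
    (hN : N ≠ 0) (hc : 0 < c) (hz : ∀ i, P i ↔ z i ≠ 0) (hsurj : ∀ ζ, ∃ i, z i = ζ)
    (hd : ∀ i, P i → d i = k + c * angular N (z i)) (i : ι) :
    (P i ∧ ∀ j, P j → d i ≤ d j) ↔ P i ∧ ∃ s : ℝ, 0 < s ∧ z i ^ 4 = s * -N := by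
  rw [← angular_maximal_iff (d := fun i => -d i) (k := -k) (neg_ne_zero.2 hN) hc hz hsurj
    fun i hi => by rw [hd i hi, angular_neg]; ring]
  simp only [neg_le_neg_iff]

theorem angular_constant_iff {ι : Type*} {z : ι → ℂ} {P : ι → Prop} {d : ι → ℝ} {N : ℂ} {k c : ℝ}
    (hc : 0 < c) (hz : ∀ i, P i ↔ z i ≠ 0) (hsurj : ∀ ζ, ∃ i, z i = ζ)
    (hd : ∀ i, P i → d i = k + c * angular N (z i)) :
    (∀ i j, P i → P j → d i = d j) ↔ N = 0 := by
  constructor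
  · intro h
    by_contra hN
    obtain ⟨ζ, hζ, hζN⟩ := exists_angular_eq hN
    obtain ⟨ξ, hξ, hξN⟩ := exists_angular_eq (neg_ne_zero.2 hN)
    obtain ⟨i, rfl⟩ := hsurj ζ
    obtain ⟨j, rfl⟩ := hsurj ξ
    have h1 := h i j ((hz i).2 hζ) ((hz j).2 hξ)
    rw [hd i ((hz i).2 hζ), hd j ((hz j).2 hξ), hζN] at h1
    rw [angular_neg, norm_neg] at hξN
    have h2 := norm_pos_iff.2 hN
    have h3 : c * ‖N‖ = c * angular N (z j) := by linarith
    have h4 := mul_left_cancel₀ hc.ne' h3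
    linarith
  · rintro rfl i j hi hj
    rw [hd i hi, hd j hj]
    simp [angular]

end

section

open Filter

theorem plane_eq (v : Plane) : v = v 0 • e 0 + v 1 • e 1 := by
  ext i
  fin_cases i <;> simp [e]

theorem e_zero_zero : (e 0) 0 = 1 := by simp [e]
theorem e_zero_one : (e 0) 1 = 0 := by simp [e]
theorem e_one_zero : (e 1) 0 = 0 := by simp [e]
theorem e_one_one : (e 1) 1 = 1 := by simp [e]

variable {X : Plane → Space4} {z : Plane}

theorem firstForm_eq (X : Plane → Space4) (z v w : Plane) :
    firstForm X z v w = cE X z * (v 0 * w 0) + cF X z * (v 0 * w 1 + v 1 * w 0)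
      + cG X z * (v 1 * w 1) := by
  rw [cE, cF, cG, firstForm, firstForm, firstForm, firstForm]
  conv_lhs => rw [plane_eq v, plane_eq w]
  simp only [map_add, map_smul, inner_add_left, inner_add_right, real_inner_smul_left,
    real_inner_smul_right]
  rw [real_inner_comm (𝐃 X z (e 0)) (𝐃 X z (e 1))]
  ring

theorem secondForm_add_smul (X : Plane → Space4) (z v w : Plane) :
    secondForm X z v w = (v 0 * w 0) • ve X z + (v 0 * w 1) • vf X z
      + (v 1 * w 0) • secondForm X z (e 1) (e 0) + (v 1 * w 1) • vg X z := by
  rw [ve, vf, vg, secondForm, secondForm, secondForm, secondForm, secondForm]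
  conv_lhs => rw [plane_eq v, plane_eq w]
  simp only [map_add, map_smul, add_apply, smul_apply]
  module

theorem secondForm_comm (hX : ContDiffAt ℝ 2 X z) (v w : Plane) :
    secondForm X z v w = secondForm X z w v := by
  rw [secondForm, secondForm, (hX.isSymmSndFDerivAt (by simp)) v w]

theorem secondForm_self (hX : ContDiffAt ℝ 2 X z) (v : Plane) :
    secondForm X z v v = (v 0 ^ 2) • ve X z + (2 * (v 0 * v 1)) • vf X z
      + (v 1 ^ 2) • vg X z := by
  rw [secondForm_add_smul, secondForm_comm hX (e 1) (e 0), ← vf]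
  module

/-- Correction term in the inner product of two projections to a normal plane. -/
def gram (E F G x₁ x₂ y₁ y₂ : ℝ) : ℝ :=
  (G * (x₁ * y₁) - F * (x₁ * y₂ + x₂ * y₁) + E * (x₂ * y₂)) / (E * G - F ^ 2)

theorem inner_secondForm (h : cE X z * cG X z - cF X z ^ 2 ≠ 0) (u v u' v' : Plane) :
    ⟪secondForm X z u v, secondForm X z u' v'⟫
      = ⟪𝐃 (𝐃 X) z u v, 𝐃 (𝐃 X) z u' v'⟫
        - gram (cE X z) (cF X z) (cG X z)
          ⟪𝐃 (𝐃 X) z u v, 𝐃 X z (e 0)⟫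
          ⟪𝐃 (𝐃 X) z u v, 𝐃 X z (e 1)⟫
          ⟪𝐃 (𝐃 X) z u' v', 𝐃 X z (e 0)⟫
          ⟪𝐃 (𝐃 X) z u' v', 𝐃 X z (e 1)⟫ := by
  set x := 𝐃 (𝐃 X) z u v
  set y := 𝐃 (𝐃 X) z u' v'
  set T := 𝐃 X z with hT
  set E := cE X z with hE
  set F := cF X z with hF
  set G := cG X z with hG
  have iE : ⟪T (e 0), T (e 0)⟫ = E := rfl
  have iF : ⟪T (e 0), T (e 1)⟫ = F := rfl
  have iF' : ⟪T (e 1), T (e 0)⟫ = F := by rw [real_inner_comm, iF]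
  have iG : ⟪T (e 1), T (e 1)⟫ = G := rfl
  set K := LinearMap.range T.toLinearMap
  have proj : ∀ x : Space4, Kᗮ.starProjection x
      = x - T (((G * ⟪x, T (e 0)⟫ - F * ⟪x, T (e 1)⟫) / (E * G - F ^ 2)) • e 0
        + ((E * ⟪x, T (e 1)⟫ - F * ⟪x, T (e 0)⟫) / (E * G - F ^ 2)) • e 1) := fun x => by
    refine Submodule.eq_starProjection_of_mem_orthogonal ?_ ?_
    · rw [Submodule.mem_orthogonal]
      rintro _ ⟨w, rfl⟩
      change ⟪T w, _⟫ = 0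
      rw [plane_eq w]
      simp only [map_add, map_smul, inner_add_left, inner_add_right, inner_sub_right,
        real_inner_smul_left, real_inner_smul_right, iE, iF, iF', iG,
        real_inner_comm x (T (e 0)), real_inner_comm x (T (e 1))]
      obtain ⟨Δ, hΔ⟩ : ∃ Δ, Δ = E * G - F ^ 2 := ⟨_, rfl⟩
      rw [← hΔ] at h ⊢
      field_simp
      linear_combination (w 0 * ⟪x, T (e 0)⟫ + w 1 * ⟪x, T (e 1)⟫) * hΔ
    · rw [sub_sub_cancel]
      refine Submodule.le_orthogonal_orthogonal K ⟨_, rfl⟩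
  have hx : secondForm X z u v = Kᗮ.starProjection x := rfl
  have hy : secondForm X z u' v' = Kᗮ.starProjection y := rfl
  rw [hx, hy, Submodule.inner_starProjection_left_eq_right,
    show Kᗮ.starProjection (Kᗮ.starProjection y) = Kᗮ.starProjection y from
      DFunLike.congr_fun Kᗮ.isIdempotentElem_starProjection y, proj y]
  simp only [map_add, map_smul, inner_add_right, inner_sub_right, real_inner_smul_right, gram]
  ring

/-! ### The angular form of the deviation for a parametrized surface -/

/-- The area element. -/
def cD (X : Plane → Space4) (z : Plane) : ℝ := √(cE X z * cG X z - cF X z ^ 2)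

/-- The linear form `ζ` that is conformal for the first fundamental form. -/
def zetaForm (X : Plane → Space4) (z v : Plane) : ℂ := zeta (cE X z) (cF X z) (cD X z) (v 0) (v 1)

/-- The function whose argument is four times the angle of the principal axial directions. -/
def axialForm (X : Plane → Space4) (z : Plane) : ℂ :=
  axialN (cE X z) (cF X z) (cD X z) (a0 X z) (a1 X z)

theorem zetaForm_eq_zero_iff (hE : cE X z ≠ 0) (hD : cD X z ≠ 0) (v : Plane) :
    zetaForm X z v = 0 ↔ v = 0 := by
  constructor
  · intro h
    have h1 : cD X z * v 1 = 0 := congrArg Complex.im h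
    have h2 : cE X z * v 0 + cF X z * v 1 = 0 := congrArg Complex.re h
    have h3 : v 1 = 0 := (mul_eq_zero.1 h1).resolve_left hD
    rw [h3, mul_zero, add_zero] at h2
    have h4 := (mul_eq_zero.1 h2).resolve_left hE
    rw [plane_eq v, h3, h4]; simp
  · rintro rfl
    simp only [zetaForm, zeta, PiLp.zero_apply, mul_zero, add_zero]
    rfl

theorem exists_zetaForm_eq (hE : cE X z ≠ 0) (hD : cD X z ≠ 0) (ζ : ℂ) :
    ∃ v, zetaForm X z v = ζ := by
  refine ⟨((ζ.re - cF X z * (ζ.im / cD X z)) / cE X z) • e 0 + (ζ.im / cD X z) • e 1, ?_⟩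
  apply Complex.ext <;> simp [zetaForm, zeta, e] <;> field_simp <;> ring

theorem exists_deviation_eq_angular (hX : ContDiffAt ℝ 2 X z) (hE : 0 < cE X z)
    (hΔ : 0 < cE X z * cG X z - cF X z ^ 2) :
    ∃ k c, 0 < c ∧ ∀ v, v ≠ 0 →
      deviation X z v = k + c * angular (axialForm X z) (zetaForm X z v) := by
  have hD : 0 < cD X z := Real.sqrt_pos.2 hΔ
  have hDD : cD X z ^ 2 = cE X z * cG X z - cF X z ^ 2 := Real.sq_sqrt hΔ.le
  obtain ⟨k, hk⟩ := exists_deviation_eq (a := a0 X z) (b := a1 X z) (ve X z) (vf X z) (vg X z)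
    hE.ne' hD.ne' hDD rfl rfl
  refine ⟨k, (8 * cE X z ^ 2 * cD X z ^ 4)⁻¹, by positivity, fun v hv => ?_⟩
  have h := hk (v 0) (v 1) (fun h => hv ((zetaForm_eq_zero_iff hE.ne' hD.ne' v).1 h))
  rw [deviation, normalCurv, meanCurv, secondForm_self hX, firstForm_eq]
  rw [show cE X z * (v 0 * v 0) + cF X z * (v 0 * v 1 + v 1 * v 0) + cG X z * (v 1 * v 1)
    = cE X z * v 0 ^ 2 + 2 * cF X z * (v 0 * v 1) + cG X z * v 1 ^ 2 by ring, h, angular]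
  simp only [axialForm, zetaForm]
  rw [div_eq_mul_inv, div_eq_mul_inv, mul_inv]
  ring

theorem quartic_eq (hΔ : 0 < cE X z * cG X z - cF X z ^ 2) (v : Plane) :
    (zetaForm X z v ^ 4 * (starRingEnd ℂ) (axialForm X z)).im
      = cE X z * cD X z * quartic X z v := by
  have hDD : cD X z ^ 2 = cE X z * cG X z - cF X z ^ 2 := Real.sq_sqrt hΔ.le
  rw [Complex.mul_im, Complex.conj_re, Complex.conj_im, zetaForm, zeta_pow_re, zeta_pow_im,
    axialForm]
  simp only [axialN, quartic]
  have hD4 : cD X z ^ 4 = (cE X z * cG X z - cF X z ^ 2) ^ 2 := by rw [← hDD]; ring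
  generalize cD X z = D at *
  generalize cE X z = E at *
  generalize cF X z = F at *
  generalize cG X z = G at *
  generalize a0 X z = a at *
  generalize a1 X z = b at *
  have h5 : D ^ 5 = D * (E * G - F ^ 2) ^ 2 := by rw [← hD4]; ring
  have h3 : D ^ 3 = D * (E * G - F ^ 2) := by rw [← hDD]; ring
  ring_nf
  rw [h5, h3]
  ring

theorem deviation_maximal_iff (hX : ContDiffAt ℝ 2 X z) (hE : 0 < cE X z)
    (hΔ : 0 < cE X z * cG X z - cF X z ^ 2) (hN : axialForm X z ≠ 0) (v : Plane) :
    (v ≠ 0 ∧ ∀ w, w ≠ 0 → deviation X z w ≤ deviation X z v) ↔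
      v ≠ 0 ∧ ∃ s : ℝ, 0 < s ∧ zetaForm X z v ^ 4 = s * axialForm X z := by
  have hD : 0 < cD X z := Real.sqrt_pos.2 hΔ
  obtain ⟨k, c, hc, h⟩ := exists_deviation_eq_angular hX hE hΔ
  exact angular_maximal_iff hN hc (fun v => (zetaForm_eq_zero_iff hE.ne' hD.ne' v).not.symm)
    (exists_zetaForm_eq hE.ne' hD.ne') h v

theorem deviation_minimal_iff (hX : ContDiffAt ℝ 2 X z) (hE : 0 < cE X z)
    (hΔ : 0 < cE X z * cG X z - cF X z ^ 2) (hN : axialForm X z ≠ 0) (v : Plane) :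
    (v ≠ 0 ∧ ∀ w, w ≠ 0 → deviation X z v ≤ deviation X z w) ↔
      v ≠ 0 ∧ ∃ s : ℝ, 0 < s ∧ zetaForm X z v ^ 4 = s * -axialForm X z := by
  have hD : 0 < cD X z := Real.sqrt_pos.2 hΔ
  obtain ⟨k, c, hc, h⟩ := exists_deviation_eq_angular hX hE hΔ
  exact angular_minimal_iff hN hc (fun v => (zetaForm_eq_zero_iff hE.ne' hD.ne' v).not.symm)
    (exists_zetaForm_eq hE.ne' hD.ne') h v

theorem deviation_constant_iff (hX : ContDiffAt ℝ 2 X z) (hE : 0 < cE X z)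
    (hΔ : 0 < cE X z * cG X z - cF X z ^ 2) :
    (∀ v w, v ≠ 0 → w ≠ 0 → deviation X z v = deviation X z w) ↔ axialForm X z = 0 := by
  have hD : 0 < cD X z := Real.sqrt_pos.2 hΔ
  obtain ⟨k, c, hc, h⟩ := exists_deviation_eq_angular hX hE hΔ
  exact angular_constant_iff hc (fun v => (zetaForm_eq_zero_iff hE.ne' hD.ne' v).not.symm)
    (exists_zetaForm_eq hE.ne' hD.ne') h

end

section

open Filter

/-! ### First jets at the origin -/

/-- Equality of first jets at the origin. -/
def JetEq (f g : Plane → ℝ) : Prop :=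
  f 0 = g 0 ∧ ∃ L : Plane →L[ℝ] ℝ, HasFDerivAt f L 0 ∧ HasFDerivAt g L 0

namespace JetEq

variable {f g f' g' : Plane → ℝ}

theorem refl (h : DifferentiableAt ℝ f 0) : JetEq f f := ⟨rfl, _, h.hasFDerivAt, h.hasFDerivAt⟩

theorem add (h : JetEq f g) (h' : JetEq f' g') :
    JetEq (fun z => f z + f' z) fun z => g z + g' z := by
  obtain ⟨h0, L, h1, h2⟩ := h
  obtain ⟨h0', L', h1', h2'⟩ := h'
  exact ⟨by simp only [h0, h0'], _, h1.add h1', h2.add h2'⟩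

theorem sub (h : JetEq f g) (h' : JetEq f' g') :
    JetEq (fun z => f z - f' z) fun z => g z - g' z := by
  obtain ⟨h0, L, h1, h2⟩ := h
  obtain ⟨h0', L', h1', h2'⟩ := h'
  exact ⟨by simp only [h0, h0'], _, h1.sub h1', h2.sub h2'⟩

theorem mul (h : JetEq f g) (h' : JetEq f' g') :
    JetEq (fun z => f z * f' z) fun z => g z * g' z := by
  obtain ⟨h0, L, h1, h2⟩ := h
  obtain ⟨h0', L', h1', h2'⟩ := h'
  refine ⟨by simp only [h0, h0'], _, h1.mul h1', (h2.mul h2').congr_fderiv ?_⟩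
  rw [h0, h0']

theorem const (c : ℝ) : JetEq (fun _ => c) fun _ => c := refl (differentiableAt_const c)

theorem const_mul (c : ℝ) (h : JetEq f g) : JetEq (fun z => c * f z) fun z => c * g z :=
  (const c).mul h

theorem sq (h : JetEq f g) : JetEq (fun z => f z ^ 2) fun z => g z ^ 2 := by
  simpa only [pow_two] using h.mul h

theorem cube (h : JetEq f g) : JetEq (fun z => f z ^ 3) fun z => g z ^ 3 := by
  simpa only [pow_succ, pow_zero, one_mul] using (h.mul h).mul h

theorem mul_zero_of_zero (hf : DifferentiableAt ℝ f 0) (hg : DifferentiableAt ℝ g 0) (hf0 : f 0 = 0)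
    (hg0 : g 0 = 0) : JetEq (fun z => f z * g z) fun _ => 0 := by
  refine ⟨by simp [hf0], 0, (hf.hasFDerivAt.mul hg.hasFDerivAt).congr_fderiv ?_,
    hasFDerivAt_const 0 0⟩
  rw [hf0, hg0]; simp

theorem trans {k : Plane → ℝ} (h : JetEq f g) (h' : JetEq g k) : JetEq f k := by
  obtain ⟨h0, L, h1, h2⟩ := h
  obtain ⟨h0', L', h1', h2'⟩ := h'
  refine ⟨h0.trans h0', L, h1, ?_⟩
  rw [h2.unique h1']; exact h2'

theorem of_eventuallyEq (h : f =ᶠ[𝓝 0] g) (hg : DifferentiableAt ℝ g 0) : JetEq f g :=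
  ⟨h.self_of_nhds, _, hg.hasFDerivAt.congr_of_eventuallyEq h, hg.hasFDerivAt⟩

theorem fderiv_eq (h : JetEq f g) : 𝐃 f 0 = 𝐃 g 0 := by
  obtain ⟨-, L, h1, h2⟩ := h
  rw [h1.fderiv, h2.fderiv]

end JetEq

/-- A parametrization in which the coordinates are orthonormal to first order at the origin. -/
structure NormalAtZero (X : Plane → Space4) : Prop where
  contDiffAt : ContDiffAt ℝ 4 X 0
  inner_fst : ∀ v w, ⟪𝐃 X 0 v, 𝐃 X 0 w⟫ = v 0 * w 0 + v 1 * w 1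
  inner_snd : ∀ u v w, ⟪𝐃 (𝐃 X) 0 u v, 𝐃 X 0 w⟫ = 0

namespace NormalAtZero

variable {X : Plane → Space4}

theorem contDiffAt_fderiv (h : NormalAtZero X) (v : Plane) :
    ContDiffAt ℝ 3 (fun z => 𝐃 X z v) 0 :=
  (h.contDiffAt.fderiv_right (m := 3) (by norm_num)).clm_apply contDiffAt_const

theorem contDiffAt_snd (h : NormalAtZero X) (u v : Plane) :
    ContDiffAt ℝ 2 (fun z => 𝐃 (𝐃 X) z u v) 0 :=
  (((h.contDiffAt.fderiv_right (m := 3) (by norm_num)).fderiv_right (m := 2)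
    (by norm_num)).clm_apply contDiffAt_const).clm_apply contDiffAt_const

theorem contDiffAt_firstForm (h : NormalAtZero X) (v w : Plane) :
    ContDiffAt ℝ 2 (fun z => firstForm X z v w) 0 :=
  ((h.contDiffAt_fderiv v).inner ℝ (h.contDiffAt_fderiv w)).of_le (by norm_num)

theorem jet_firstForm (h : NormalAtZero X) (v w : Plane) :
    JetEq (fun z => firstForm X z v w) fun _ => v 0 * w 0 + v 1 * w 1 := by
  have hd : ∀ v, HasFDerivAt (fun z => 𝐃 X z v) ((𝐃 (𝐃 X) 0).flip v) 0 :=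
    fun v => by
    have h1 := ((h.contDiffAt.fderiv_right (m := 3) (by norm_num)).differentiableAt
      (by norm_num)).hasFDerivAt
    refine (h1.clm_apply (hasFDerivAt_const v 0)).congr_fderiv ?_
    ext; simp
  refine ⟨h.inner_fst v w, 0, ((hd v).inner ℝ (hd w)).congr_fderiv ?_, hasFDerivAt_const _ _⟩
  ext u
  simp only [ContinuousLinearMap.coe_comp, Function.comp_apply, ContinuousLinearMap.prod_apply,
    fderivInnerCLM_apply, ContinuousLinearMap.flip_apply, h.inner_snd,
    zero_apply, add_zero, real_inner_comm (𝐃 (𝐃 X) 0 u w)]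

theorem jet_cE (h : NormalAtZero X) : JetEq (cE X) fun _ => 1 := by
  have := h.jet_firstForm (e 0) (e 0)
  simp only [e_zero_zero, e_zero_one, mul_one, mul_zero, add_zero] at this
  exact this

theorem jet_cF (h : NormalAtZero X) : JetEq (cF X) fun _ => 0 := by
  have := h.jet_firstForm (e 0) (e 1)
  simp only [e_zero_zero, e_zero_one, e_one_zero, e_one_one, mul_one, mul_zero, add_zero] at this
  exact this

theorem jet_cG (h : NormalAtZero X) : JetEq (cG X) fun _ => 1 := by
  have := h.jet_firstForm (e 1) (e 1)
  simp only [e_one_zero, e_one_one, mul_one, mul_zero, zero_add] at this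
  exact this

theorem contDiffAt_cE (h : NormalAtZero X) : ContDiffAt ℝ 2 (cE X) 0 := h.contDiffAt_firstForm _ _
theorem contDiffAt_cF (h : NormalAtZero X) : ContDiffAt ℝ 2 (cF X) 0 := h.contDiffAt_firstForm _ _
theorem contDiffAt_cG (h : NormalAtZero X) : ContDiffAt ℝ 2 (cG X) 0 := h.contDiffAt_firstForm _ _

theorem contDiffAt_disc (h : NormalAtZero X) :
    ContDiffAt ℝ 2 (fun z => cE X z * cG X z - cF X z ^ 2) 0 :=
  (h.contDiffAt_cE.mul h.contDiffAt_cG).sub (h.contDiffAt_cF.pow 2)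

theorem disc_zero (h : NormalAtZero X) : cE X 0 * cG X 0 - cF X 0 ^ 2 = 1 := by
  rw [h.jet_cE.1, h.jet_cF.1, h.jet_cG.1]; norm_num

theorem eventually_pos (h : NormalAtZero X) :
    ∀ᶠ z in 𝓝 0, 0 < cE X z ∧ 0 < cE X z * cG X z - cF X z ^ 2 :=
  (h.contDiffAt_cE.continuousAt.eventually (Ioi_mem_nhds (by rw [h.jet_cE.1]; norm_num))).and
    (h.contDiffAt_disc.continuousAt.eventually (Ioi_mem_nhds
      (by change 0 < cE X 0 * cG X 0 - cF X 0 ^ 2; rw [h.disc_zero]; norm_num)))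

/-- The inner products of second derivatives. -/
def sndInner (X : Plane → Space4) (u v u' v' z : Plane) : ℝ :=
  ⟪𝐃 (𝐃 X) z u v, 𝐃 (𝐃 X) z u' v'⟫

theorem inner_secondForm_eq (h : NormalAtZero X) (u v u' v' : Plane) :
    (fun z => ⟪secondForm X z u v, secondForm X z u' v'⟫) =ᶠ[𝓝 0] fun z =>
      sndInner X u v u' v' z - gram (cE X z) (cF X z) (cG X z)
          ⟪𝐃 (𝐃 X) z u v, 𝐃 X z (e 0)⟫
          ⟪𝐃 (𝐃 X) z u v, 𝐃 X z (e 1)⟫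
          ⟪𝐃 (𝐃 X) z u' v', 𝐃 X z (e 0)⟫
          ⟪𝐃 (𝐃 X) z u' v', 𝐃 X z (e 1)⟫ :=
  h.eventually_pos.mono fun _ hz => inner_secondForm hz.2.ne' u v u' v'

theorem contDiffAt_sndInner (h : NormalAtZero X) (u v u' v' : Plane) :
    ContDiffAt ℝ 2 (sndInner X u v u' v') 0 :=
  (h.contDiffAt_snd u v).inner ℝ (h.contDiffAt_snd u' v')

theorem contDiffAt_mixed (h : NormalAtZero X) (u v w : Plane) :
    ContDiffAt ℝ 2 (fun z => ⟪𝐃 (𝐃 X) z u v, 𝐃 X z w⟫) 0 :=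
  (h.contDiffAt_snd u v).inner ℝ ((h.contDiffAt_fderiv w).of_le (by norm_num))

theorem contDiffAt_inner_secondForm (h : NormalAtZero X) (u v u' v' : Plane) :
    ContDiffAt ℝ 2 (fun z => ⟪secondForm X z u v, secondForm X z u' v'⟫) 0 := by
  refine ContDiffAt.congr_of_eventuallyEq ?_ (h.inner_secondForm_eq u v u' v')
  unfold gram
  have m := h.contDiffAt_mixed
  refine (h.contDiffAt_sndInner u v u' v').sub (ContDiffAt.div ?_ h.contDiffAt_disc
    (by rw [h.disc_zero]; norm_num))
  exact ((h.contDiffAt_cG.mul ((m _ _ _).mul (m _ _ _))).sub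
    (h.contDiffAt_cF.mul (((m _ _ _).mul (m _ _ _)).add ((m _ _ _).mul (m _ _ _))))).add
    (h.contDiffAt_cE.mul ((m _ _ _).mul (m _ _ _)))

theorem jet_inner_secondForm (h : NormalAtZero X) (u v u' v' : Plane) :
    JetEq (fun z => ⟪secondForm X z u v, secondForm X z u' v'⟫) (sndInner X u v u' v') := by
  have m : ∀ u v w, DifferentiableAt ℝ
      (fun z => ⟪𝐃 (𝐃 X) z u v, 𝐃 X z w⟫) 0 := fun u v w =>
    (h.contDiffAt_mixed u v w).differentiableAt (by norm_num)
  have hs := JetEq.refl ((h.contDiffAt_sndInner u v u' v').differentiableAt (by norm_num))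
  have z1 := fun w w' => JetEq.mul_zero_of_zero (m u v w) (m u' v' w') (h.inner_snd u v w)
    (h.inner_snd u' v' w')
  have hinv : JetEq (fun z => (cE X z * cG X z - cF X z ^ 2)⁻¹)
      (fun z => (cE X z * cG X z - cF X z ^ 2)⁻¹) :=
    JetEq.refl ((h.contDiffAt_disc.inv (by rw [h.disc_zero]; norm_num)).differentiableAt
      (by norm_num))
  have key := hs.sub ((((h.jet_cG.mul (z1 (e 0) (e 0))).sub
    (h.jet_cF.mul ((z1 (e 0) (e 1)).add (z1 (e 1) (e 0))))).add
    (h.jet_cE.mul (z1 (e 1) (e 1)))).mul hinv)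
  simp only [mul_zero, add_zero, sub_zero, zero_mul] at key
  refine JetEq.trans (JetEq.of_eventuallyEq (h.inner_secondForm_eq u v u' v') ?_) ?_
  · refine (ContDiffAt.congr_of_eventuallyEq (h.contDiffAt_inner_secondForm u v u' v')
      (h.inner_secondForm_eq u v u' v').symm).differentiableAt (by norm_num)
  · exact key

theorem contDiffAt_a0 (h : NormalAtZero X) : ContDiffAt ℝ 2 (a0 X) 0 := by
  have c := fun u v u' v' => h.contDiffAt_inner_secondForm u v u' v'
  have hE := h.contDiffAt_cE
  have hF := h.contDiffAt_cF
  have hG := h.contDiffAt_cG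
  refine ((((((contDiffAt_const.mul hF).mul ((hE.mul hG).sub (contDiffAt_const.mul (hF.pow 2)))).mul
    (c _ _ _ _)).sub (((contDiffAt_const.mul hE).mul ((hE.mul hG).sub
      (contDiffAt_const.mul (hF.pow 2)))).mul (c _ _ _ _))).add
    ((contDiffAt_const.mul (hE.pow 3)).mul (c _ _ _ _))).sub
    (((contDiffAt_const.mul (hE.pow 2)).mul hF).mul (c _ _ _ _))).sub
    (((contDiffAt_const.mul (hE.pow 2)).mul hF).mul (c _ _ _ _))

theorem contDiffAt_a1 (h : NormalAtZero X) : ContDiffAt ℝ 2 (a1 X) 0 := by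
  have c := fun u v u' v' => h.contDiffAt_inner_secondForm u v u' v'
  have hE := h.contDiffAt_cE
  have hF := h.contDiffAt_cF
  have hG := h.contDiffAt_cG
  refine ((((((contDiffAt_const.mul hG).mul ((hE.mul hG).sub (contDiffAt_const.mul (hF.pow 2)))).mul
    (c _ _ _ _)).add ((((contDiffAt_const.mul hE).mul hF).mul hG).mul (c _ _ _ _))).add
    ((contDiffAt_const.mul (hE.pow 3)).mul (c _ _ _ _))).sub
    (((contDiffAt_const.mul (hE.pow 2)).mul hG).mul (c _ _ _ _))).sub
    (((contDiffAt_const.mul (hE.pow 2)).mul hG).mul (c _ _ _ _))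

theorem jet_a0 (h : NormalAtZero X) : JetEq (a0 X) fun z =>
    4 * (sndInner X (e 0) (e 1) (e 1) (e 1) z - sndInner X (e 0) (e 0) (e 0) (e 1) z) := by
  have c := fun u v u' v' => h.jet_inner_secondForm u v u' v'
  have hE := h.jet_cE
  have hF := h.jet_cF
  have hG := h.jet_cG
  have := ((((((hF.const_mul 4).mul ((hE.mul hG).sub (hF.sq.const_mul 2))).mul
    (c (e 0) (e 0) (e 0) (e 0))).sub (((hE.const_mul 4).mul ((hE.mul hG).sub
      (hF.sq.const_mul 4))).mul (c (e 0) (e 0) (e 0) (e 1)))).add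
    ((hE.cube.const_mul 4).mul (c (e 0) (e 1) (e 1) (e 1)))).sub
    (((hE.sq.const_mul 4).mul hF).mul (c (e 0) (e 0) (e 1) (e 1)))).sub
    (((hE.sq.const_mul 8).mul hF).mul (c (e 0) (e 1) (e 0) (e 1)))
  refine this.trans ?_
  convert JetEq.refl (f := fun z => 4 * (sndInner X (e 0) (e 1) (e 1) (e 1) z
    - sndInner X (e 0) (e 0) (e 0) (e 1) z)) ?_ using 1
  · funext z; ring
  · exact (((h.contDiffAt_sndInner _ _ _ _).sub (h.contDiffAt_sndInner _ _ _ _)).differentiableAt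
      (by norm_num)).const_mul 4

theorem jet_a1 (h : NormalAtZero X) : JetEq (a1 X) fun z =>
    4 * (sndInner X (e 0) (e 0) (e 0) (e 0) z + sndInner X (e 1) (e 1) (e 1) (e 1) z
      - 2 * sndInner X (e 0) (e 0) (e 1) (e 1) z - 4 * sndInner X (e 0) (e 1) (e 0) (e 1) z) := by
  have c := fun u v u' v' => h.jet_inner_secondForm u v u' v'
  have hE := h.jet_cE
  have hF := h.jet_cF
  have hG := h.jet_cG
  have := ((((((hG.const_mul 4).mul ((hE.mul hG).sub (hF.sq.const_mul 4))).mul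
    (c (e 0) (e 0) (e 0) (e 0))).add ((((hE.const_mul 32).mul hF).mul hG).mul
      (c (e 0) (e 0) (e 0) (e 1)))).add
    ((hE.cube.const_mul 4).mul (c (e 1) (e 1) (e 1) (e 1)))).sub
    (((hE.sq.const_mul 8).mul hG).mul (c (e 0) (e 0) (e 1) (e 1)))).sub
    (((hE.sq.const_mul 16).mul hG).mul (c (e 0) (e 1) (e 0) (e 1)))
  refine this.trans ?_
  convert JetEq.refl (f := fun z => 4 * (sndInner X (e 0) (e 0) (e 0) (e 0) z
    + sndInner X (e 1) (e 1) (e 1) (e 1) z - 2 * sndInner X (e 0) (e 0) (e 1) (e 1) z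
    - 4 * sndInner X (e 0) (e 1) (e 0) (e 1) z)) ?_ using 1
  · funext z; ring
  · have s := fun u v u' v' => (h.contDiffAt_sndInner u v u' v').differentiableAt
      (by norm_num : (2 : ℕ∞ω) ≠ 0)
    exact ((((s _ _ _ _).add (s _ _ _ _)).sub ((s _ _ _ _).const_mul 2)).sub
      ((s _ _ _ _).const_mul 4)).const_mul 4

end NormalAtZero

end

section

open Filter

/-! ### Monge charts -/

theorem fderiv_component {X : Plane → Space4} {z : Plane} (h : DifferentiableAt ℝ X z) (v : Plane)
    (i : Fin 4) : (𝐃 X z v) i = 𝐃 (fun z => X z i) z v := by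
  have := ((PiLp.proj 2 (fun _ : Fin 4 => ℝ) i : Space4 →L[ℝ] ℝ).hasFDerivAt.comp z
    h.hasFDerivAt).fderiv
  have e : (fun z => X z i) = (PiLp.proj 2 (fun _ : Fin 4 => ℝ) i : Space4 →L[ℝ] ℝ) ∘ X := rfl
  rw [e, this]
  rfl

theorem fderiv_fderiv_apply {V W : Type*} [NormedAddCommGroup V] [NormedSpace ℝ V]
    [NormedAddCommGroup W] [NormedSpace ℝ W] {f : V → W} {z : V} (h : ContDiffAt ℝ 2 f z)
    (u v : V) :
    𝐃 (fun z => 𝐃 f z v) z u = 𝐃 (𝐃 f) z u v := by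
  have h1 := ((h.fderiv_right (m := 1) (by norm_num)).differentiableAt (by norm_num)).hasFDerivAt
  rw [(h1.clm_apply (hasFDerivAt_const v z)).fderiv]
  simp

section CompLinear

variable {V V' : Type*} [NormedAddCommGroup V] [NormedSpace ℝ V] [NormedAddCommGroup V']
  [NormedSpace ℝ V'] {f : V' → ℝ} {L : V →L[ℝ] V'} {z : V}

theorem fderiv_comp_clm (hf : DifferentiableAt ℝ f (L z)) (v : V) :
    𝐃 (fun z => f (L z)) z v = 𝐃 f (L z) (L v) := by
  have : 𝐃 (fun z => f (L z)) z = (𝐃 f (L z)).comp L :=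
    (hf.hasFDerivAt.comp z L.hasFDerivAt).fderiv
  rw [this]; rfl

theorem fderiv_fderiv_comp_clm (hf : ContDiffAt ℝ 2 f (L z)) (u v : V) :
    𝐃 (𝐃 fun z => f (L z)) z u v = 𝐃 (𝐃 f) (L z) (L u) (L v) := by
  have hc : ContDiffAt ℝ 2 (fun z => f (L z)) z := hf.comp z L.contDiff.contDiffAt
  rw [← fderiv_fderiv_apply hc, ← fderiv_fderiv_apply hf]
  have hev : (fun z => 𝐃 (fun z => f (L z)) z v) =ᶠ[𝓝 z]
      fun z => (fun y => 𝐃 f y (L v)) (L z) := by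
    filter_upwards [(L.continuous.continuousAt (x := z)).eventually (hf.eventually (by simp))]
      with w hw
    exact fderiv_comp_clm (hw.differentiableAt (by norm_num)) v
  rw [hev.fderiv_eq]
  refine fderiv_comp_clm (f := fun y => 𝐃 f y (L v)) ?_ u
  exact (((hf.fderiv_right (m := 1) (by norm_num)).differentiableAt (by norm_num))).clm_apply
      (differentiableAt_const _)

end CompLinear

theorem fderiv_fderiv_component {X : Plane → Space4} {z : Plane} (h : ContDiffAt ℝ 2 X z)
    (u v : Plane) (i : Fin 4) :
    (𝐃 (𝐃 X) z u v) i = 𝐃 (𝐃 fun z => X z i) z u v := by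
  have hi : ContDiffAt ℝ 2 (fun z => X z i) z := contDiffAt_euclidean.1 h i
  have h1 : DifferentiableAt ℝ (fun z => 𝐃 X z v) z :=
    (((h.fderiv_right (m := 1) (by norm_num)).differentiableAt (by norm_num))).clm_apply
      (differentiableAt_const v)
  rw [← fderiv_fderiv_apply h, ← fderiv_fderiv_apply hi]
  have h2 := ((PiLp.proj 2 (fun _ : Fin 4 => ℝ) i : Space4 →L[ℝ] ℝ).hasFDerivAt.comp z
    h1.hasFDerivAt).fderiv
  have h3 : (fun z => 𝐃 (fun z => X z i) z v) =ᶠ[𝓝 z]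
      (PiLp.proj 2 (fun _ : Fin 4 => ℝ) i : Space4 →L[ℝ] ℝ) ∘ fun z => 𝐃 X z v := by
    filter_upwards [h.eventually (by simp)] with w hw
    rw [← fderiv_component (hw.differentiableAt (by norm_num))]
    rfl
  rw [h3.fderiv_eq, h2]
  rfl

section Monge

variable {R S : Plane → ℝ}

theorem contDiffAt_monge {n : ℕ∞ω} {z : Plane} (hR : ContDiffAt ℝ n R z) (hS : ContDiffAt ℝ n S z) :
    ContDiffAt ℝ n (monge R S) z := by
  rw [contDiffAt_euclidean]
  intro i
  have hp : ∀ i : Fin 2, ContDiffAt ℝ n (fun z : Plane => z i) z := fun i =>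
    (PiLp.proj 2 (fun _ : Fin 2 => ℝ) i : Plane →L[ℝ] ℝ).contDiff.contDiffAt
  fin_cases i
  · exact hp 0
  · exact hp 1
  · exact hR
  · exact hS

theorem fderiv_coord (i : Fin 2) (z : Plane) : 𝐃 (fun z : Plane => z i) z
    = (PiLp.proj 2 (fun _ : Fin 2 => ℝ) i : Plane →L[ℝ] ℝ) :=
  (PiLp.proj 2 (fun _ : Fin 2 => ℝ) i : Plane →L[ℝ] ℝ).hasFDerivAt.fderiv

theorem fderiv_fderiv_coord (i : Fin 2) (z : Plane) :
    𝐃 (𝐃 fun z : Plane => z i) z = 0 := by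
  have : (𝐃 fun z : Plane => z i)
      = fun _ => (PiLp.proj 2 (fun _ : Fin 2 => ℝ) i : Plane →L[ℝ] ℝ) := funext (fderiv_coord i)
  rw [this]; simp

theorem space4_inner (u v : Space4) : ⟪u, v⟫ = u 0 * v 0 + u 1 * v 1 + u 2 * v 2 + u 3 * v 3 := by
  simp [PiLp.inner_apply, Fin.sum_univ_four, mul_comm]

theorem inner_fderiv_monge {z : Plane} (hX : DifferentiableAt ℝ (monge R S) z) (v w : Plane) :
    ⟪𝐃 (monge R S) z v, 𝐃 (monge R S) z w⟫ = v 0 * w 0 + v 1 * w 1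
      + 𝐃 R z v * 𝐃 R z w + 𝐃 S z v * 𝐃 S z w := by
  rw [space4_inner]
  simp only [fderiv_component hX]
  change 𝐃 (fun z : Plane => z 0) z v * 𝐃 (fun z : Plane => z 0) z w
    + 𝐃 (fun z : Plane => z 1) z v * 𝐃 (fun z : Plane => z 1) z w
    + 𝐃 R z v * 𝐃 R z w + 𝐃 S z v * 𝐃 S z w = _
  rw [fderiv_coord, fderiv_coord]
  rfl

theorem inner_snd_monge {z : Plane} (hX : ContDiffAt ℝ 2 (monge R S) z) (u v u' v' : Plane) :
    ⟪𝐃 (𝐃 (monge R S)) z u v, 𝐃 (𝐃 (monge R S)) z u' v'⟫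
      = 𝐃 (𝐃 R) z u v * 𝐃 (𝐃 R) z u' v'
        + 𝐃 (𝐃 S) z u v * 𝐃 (𝐃 S) z u' v' := by
  rw [space4_inner]
  simp only [fderiv_fderiv_component hX]
  change 𝐃 (𝐃 fun z : Plane => z 0) z u v
      * 𝐃 (𝐃 fun z : Plane => z 0) z u' v'
    + 𝐃 (𝐃 fun z : Plane => z 1) z u v
      * 𝐃 (𝐃 fun z : Plane => z 1) z u' v'
    + 𝐃 (𝐃 R) z u v * 𝐃 (𝐃 R) z u' v'
    + 𝐃 (𝐃 S) z u v * 𝐃 (𝐃 S) z u' v' = _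
  rw [fderiv_fderiv_coord, fderiv_fderiv_coord]
  simp

theorem normalAtZero_monge (hR : ContDiffAt ℝ 4 R 0) (hS : ContDiffAt ℝ 4 S 0)
    (hR' : 𝐃 R 0 = 0) (hS' : 𝐃 S 0 = 0) : NormalAtZero (monge R S) := by
  have hX := contDiffAt_monge hR hS
  have hXd := hX.differentiableAt (by norm_num)
  refine ⟨hX, fun v w => ?_, fun u v w => ?_⟩
  · rw [inner_fderiv_monge hXd, hR', hS']
    simp
  · rw [space4_inner]
    simp only [fderiv_fderiv_component (hX.of_le (by norm_num)), fderiv_component hXd]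
    change 𝐃 (𝐃 fun z : Plane => z 0) 0 u v * 𝐃 (fun z : Plane => z 0) 0 w
      + 𝐃 (𝐃 fun z : Plane => z 1) 0 u v * 𝐃 (fun z : Plane => z 1) 0 w
      + 𝐃 (𝐃 R) 0 u v * 𝐃 R 0 w
      + 𝐃 (𝐃 S) 0 u v * 𝐃 S 0 w = _
    rw [fderiv_fderiv_coord, fderiv_fderiv_coord, hR', hS']
    simp

/-- The rotation of the coordinates as a linear map. -/
def rotL (θ : ℝ) : Plane →L[ℝ] Plane := LinearMap.toContinuousLinearMap
    { toFun := rot θ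
      map_add' := fun v w => by ext i; fin_cases i <;> simp [rot] <;> ring
      map_smul' := fun c v => by ext i; fin_cases i <;> simp [rot] <;> ring }

theorem rotL_apply (θ : ℝ) (z : Plane) : rotL θ z = rot θ z := rfl

theorem rot_e_zero (θ : ℝ) : rotL θ (e 0) = Real.cos θ • e 0 + (-Real.sin θ) • e 1 := by
  rw [rotL_apply]; ext i; fin_cases i <;> simp [rot, e]

theorem rot_e_one (θ : ℝ) : rotL θ (e 1) = Real.sin θ • e 0 + Real.cos θ • e 1 := by
  rw [rotL_apply]; ext i; fin_cases i <;> simp [rot, e]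

theorem contDiffAt_comp_rot {n : ℕ∞ω} (hR : ContDiffAt ℝ n R 0) (θ : ℝ) :
    ContDiffAt ℝ n (R ∘ rot θ) 0 := by
  refine ContDiffAt.comp (0 : Plane) (f := rot θ) ?_ (rotL θ).contDiff.contDiffAt
  rw [← rotL_apply, map_zero]; exact hR

theorem fderiv_comp_rot {θ : ℝ} {z : Plane} (hR : DifferentiableAt ℝ R (rot θ z)) (v : Plane) :
    𝐃 (R ∘ rot θ) z v = 𝐃 R (rot θ z) (rotL θ v) := fderiv_comp_clm (L := rotL θ) hR v

theorem fderiv_fderiv_comp_rot {θ : ℝ} {z : Plane} (hR : ContDiffAt ℝ 2 R (rot θ z)) (u v : Plane) :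
    𝐃 (𝐃 (R ∘ rot θ)) z u v = 𝐃 (𝐃 R) (rot θ z) (rotL θ u) (rotL θ v) :=
  fderiv_fderiv_comp_clm (L := rotL θ) hR u v

end Monge

/-! ### Third order jets -/

section Jets3

variable {f : Plane → ℝ}

/-- Second partial derivatives. -/
def sndPd (f : Plane → ℝ) (i j : Fin 2) (z : Plane) : ℝ := 𝐃 (𝐃 f) z (e i) (e j)

theorem contDiffAt_sndPd (hf : ContDiffAt ℝ 4 f 0) (i j : Fin 2) : ContDiffAt ℝ 2 (sndPd f i j) 0 :=
  (((hf.fderiv_right (m := 3) (by norm_num)).fderiv_right (m := 2) (by norm_num)).clm_apply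
    contDiffAt_const).clm_apply contDiffAt_const

theorem pd_pd_eq (hf : ContDiffAt ℝ 4 f 0) (i j : Fin 2) : pd i (pd j f) =ᶠ[𝓝 0] sndPd f i j := by
  filter_upwards [hf.eventually (by simp)] with z hz
  exact fderiv_fderiv_apply (hz.of_le (by norm_num)) (e i) (e j)

theorem sndPd_comm (hf : ContDiffAt ℝ 4 f 0) (i j : Fin 2) : sndPd f i j =ᶠ[𝓝 0] sndPd f j i := by
  filter_upwards [hf.eventually (by simp)] with z hz
  exact (hz.of_le (by norm_num : (2 : ℕ∞ω) ≤ 4)).isSymmSndFDerivAt (by simp) (e i) (e j)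

theorem pd_sndPd_comm (hf : ContDiffAt ℝ 4 f 0) (i j k : Fin 2) :
    𝐃 (sndPd f i j) 0 (e k) = 𝐃 (sndPd f k j) 0 (e i) := by
  have hp : ContDiffAt ℝ 2 (pd j f) 0 :=
    ((hf.fderiv_right (m := 3) (by norm_num)).clm_apply contDiffAt_const).of_le (by norm_num)
  rw [← (pd_pd_eq hf i j).fderiv_eq, ← (pd_pd_eq hf k j).fderiv_eq]
  change 𝐃 (fun z => 𝐃 (pd j f) z (e i)) 0 (e k)
    = 𝐃 (fun z => 𝐃 (pd j f) z (e k)) 0 (e i)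
  rw [fderiv_fderiv_apply hp, fderiv_fderiv_apply hp]
  exact hp.isSymmSndFDerivAt (by simp) _ _

theorem jet_two (hf : ContDiffAt ℝ 4 f 0) : jet f 2 0 = sndPd f 0 0 0 ∧ jet f 1 1 = sndPd f 0 1 0 ∧
    jet f 0 2 = sndPd f 1 1 0 :=
  ⟨(pd_pd_eq hf 0 0).self_of_nhds, (pd_pd_eq hf 0 1).self_of_nhds, (pd_pd_eq hf 1 1).self_of_nhds⟩

theorem fderiv_sndPd (hf : ContDiffAt ℝ 4 f 0) (u : Plane) :
    𝐃 (sndPd f 0 0) 0 u = u 0 * jet f 3 0 + u 1 * jet f 2 1 ∧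
    𝐃 (sndPd f 0 1) 0 u = u 0 * jet f 2 1 + u 1 * jet f 1 2 ∧
    𝐃 (sndPd f 1 1) 0 u = u 0 * jet f 1 2 + u 1 * jet f 0 3 := by
  have j30 : 𝐃 (sndPd f 0 0) 0 (e 0) = jet f 3 0 := by
    rw [← (pd_pd_eq hf 0 0).fderiv_eq]; rfl
  have j21 : 𝐃 (sndPd f 0 1) 0 (e 0) = jet f 2 1 := by
    rw [← (pd_pd_eq hf 0 1).fderiv_eq]; rfl
  have j12 : 𝐃 (sndPd f 1 1) 0 (e 0) = jet f 1 2 := by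
    rw [← (pd_pd_eq hf 1 1).fderiv_eq]; rfl
  have j03 : 𝐃 (sndPd f 1 1) 0 (e 1) = jet f 0 3 := by
    rw [← (pd_pd_eq hf 1 1).fderiv_eq]; rfl
  have j21' : 𝐃 (sndPd f 0 0) 0 (e 1) = jet f 2 1 := by
    rw [pd_sndPd_comm hf, (sndPd_comm hf 1 0).fderiv_eq, j21]
  have j12' : 𝐃 (sndPd f 0 1) 0 (e 1) = jet f 1 2 := by rw [pd_sndPd_comm hf, j12]
  have hu : ∀ L : Plane →L[ℝ] ℝ, L u = u 0 * L (e 0) + u 1 * L (e 1) := fun L => by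
    conv_lhs => rw [plane_eq u]
    simp
  rw [hu, hu, hu, j30, j21, j12, j03, j21', j12']
  exact ⟨rfl, rfl, rfl⟩

end Jets3

end

section

open Filter

/-- The first jets of the coefficients of the axial lines at an axiumbilic point of the kind under
study. -/
structure AxialGerm (X : Plane → Space4) (α β : ℝ) : Prop extends NormalAtZero X where
  zero0 : a0 X 0 = 0
  zero1 : a1 X 0 = 0
  fderiv0 : ∀ v, 𝐃 (a0 X) 0 v = α * v 1
  fderiv1 : ∀ v, 𝐃 (a1 X) 0 v = β * v 1
  ne_zero : α ≠ 0

/-- The mixed second derivative and the difference of the pure ones in rotated coordinates. -/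
def mixedRot (c s p₀ p₁ p₂ : ℝ) : ℝ := c * s * p₀ + (c ^ 2 - s ^ 2) * p₁ - c * s * p₂

def diffRot (c s p₀ p₁ p₂ : ℝ) : ℝ := (s ^ 2 - c ^ 2) * p₀ + 4 * (c * s) * p₁ + (c ^ 2 - s ^ 2) * p₂

theorem rotated_snd {f : Plane → ℝ} (hf : ContDiffAt ℝ 4 f 0) (θ : ℝ) : ∀ᶠ z in 𝓝 0,
      𝐃 (𝐃 (f ∘ rot θ)) z (e 0) (e 1) = mixedRot (Real.cos θ) (Real.sin θ)
        (sndPd f 0 0 (rot θ z)) (sndPd f 0 1 (rot θ z)) (sndPd f 1 1 (rot θ z)) ∧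
      𝐃 (𝐃 (f ∘ rot θ)) z (e 1) (e 1) - 𝐃 (𝐃 (f ∘ rot θ)) z (e 0) (e 0)
        = diffRot (Real.cos θ) (Real.sin θ)
        (sndPd f 0 0 (rot θ z)) (sndPd f 0 1 (rot θ z)) (sndPd f 1 1 (rot θ z)) := by
  have hrot : Tendsto (rot θ) (𝓝 0) (𝓝 0) := by
    have := (rotL θ).continuous.tendsto 0
    rwa [map_zero] at this
  filter_upwards [hrot.eventually (hf.eventually (by simp)), hrot.eventually (sndPd_comm hf 1 0)]
    with z hz hc
  have h2 := hz.of_le (by norm_num : (2 : ℕ∞ω) ≤ 4)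
  have hc' : 𝐃 (𝐃 f) (rot θ z) (e 1) (e 0)
    = 𝐃 (𝐃 f) (rot θ z) (e 0) (e 1) := hc
  rw [fderiv_fderiv_comp_rot h2, fderiv_fderiv_comp_rot h2, fderiv_fderiv_comp_rot h2, rot_e_zero,
    rot_e_one]
  simp only [map_add, map_smul, add_apply, smul_apply, smul_eq_mul, hc', mixedRot, diffRot, sndPd]
  constructor <;> ring

theorem rotated_jets (c s u₀ u₁ r20 r11 r02 r30 r21 r12 r03 s20 s11 s02 s30 s21 s12 s03 : ℝ)
    (h1 : r11 = -(s02 - s20) / 2) (h2 : s11 = (r02 - r20) / 2)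
    (h3 : s12 - s30 + 2 * r21 = 0) (h4 : s03 - s21 + 2 * r12 = 0) :
    (mixedRot c s r20 r11 r02 * diffRot c s r20 r11 r02
      + mixedRot c s s20 s11 s02 * diffRot c s s20 s11 s02 = 0) ∧
    (diffRot c s r20 r11 r02 ^ 2 - 4 * mixedRot c s r20 r11 r02 ^ 2
      + (diffRot c s s20 s11 s02 ^ 2 - 4 * mixedRot c s s20 s11 s02 ^ 2) = 0) ∧
    (4 * (mixedRot c s (u₀ * r30 + u₁ * r21) (u₀ * r21 + u₁ * r12) (u₀ * r12 + u₁ * r03)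
          * diffRot c s r20 r11 r02
        + mixedRot c s r20 r11 r02
          * diffRot c s (u₀ * r30 + u₁ * r21) (u₀ * r21 + u₁ * r12) (u₀ * r12 + u₁ * r03)
        + (mixedRot c s (u₀ * s30 + u₁ * s21) (u₀ * s21 + u₁ * s12) (u₀ * s12 + u₁ * s03)
          * diffRot c s s20 s11 s02
        + mixedRot c s s20 s11 s02
          * diffRot c s (u₀ * s30 + u₁ * s21) (u₀ * s21 + u₁ * s12) (u₀ * s12 + u₁ * s03)))
      = 2 * ((s02 - s20) * (c ^ 4 - 6 * c ^ 2 * s ^ 2 + s ^ 4)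
          + (r02 - r20) * (4 * c ^ 3 * s - 4 * c * s ^ 3))
        * (u₀ * (2 * s21 - r12 + r30) + u₁ * (2 * s12 - r03 + r21))) ∧
    (4 * (2 * (diffRot c s r20 r11 r02
          * diffRot c s (u₀ * r30 + u₁ * r21) (u₀ * r21 + u₁ * r12) (u₀ * r12 + u₁ * r03))
        - 8 * (mixedRot c s r20 r11 r02
          * mixedRot c s (u₀ * r30 + u₁ * r21) (u₀ * r21 + u₁ * r12) (u₀ * r12 + u₁ * r03))
        + (2 * (diffRot c s s20 s11 s02
          * diffRot c s (u₀ * s30 + u₁ * s21) (u₀ * s21 + u₁ * s12) (u₀ * s12 + u₁ * s03))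
        - 8 * (mixedRot c s s20 s11 s02
          * mixedRot c s (u₀ * s30 + u₁ * s21) (u₀ * s21 + u₁ * s12) (u₀ * s12 + u₁ * s03))))
      = 8 * (-(r02 - r20) * (c ^ 4 - 6 * c ^ 2 * s ^ 2 + s ^ 4)
          + (s02 - s20) * (4 * c ^ 3 * s - 4 * c * s ^ 3))
        * (u₀ * (2 * s21 - r12 + r30) + u₁ * (2 * s12 - r03 + r21))) := by
  have h3' : s30 = s12 + 2 * r21 := by linarith
  have h4' : s21 = s03 + 2 * r12 := by linarith
  subst h1 h2 h3' h4'
  unfold mixedRot diffRot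
  refine ⟨by ring, by ring, by ring, by ring⟩

/-- The coefficients of the axial lines of a rotated Monge chart have proportional differentials. -/
theorem exists_proportional {R S : Plane → ℝ} {θ : ℝ} (hR : ContDiffAt ℝ 4 R 0)
    (hS : ContDiffAt ℝ 4 S 0) (h1 : jet R 1 1 = -(jet S 0 2 - jet S 2 0) / 2)
    (h2 : jet S 1 1 = (jet R 0 2 - jet R 2 0) / 2) (h3 : alpha1 R S = 0) (h4 : alpha3 R S = 0)
    (hX : NormalAtZero (monge (R ∘ rot θ) (S ∘ rot θ))) :
    a0 (monge (R ∘ rot θ) (S ∘ rot θ)) 0 = 0 ∧ a1 (monge (R ∘ rot θ) (S ∘ rot θ)) 0 = 0 ∧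
      ∃ (c₀ c₁ : ℝ) (l : Plane → ℝ),
        (∀ v, 𝐃 (a0 (monge (R ∘ rot θ) (S ∘ rot θ))) 0 v = c₀ * l v) ∧
        ∀ v, 𝐃 (a1 (monge (R ∘ rot θ) (S ∘ rot θ))) 0 v = c₁ * l v := by
  set X := monge (R ∘ rot θ) (S ∘ rot θ) with hXd
  set c := Real.cos θ
  set s := Real.sin θ
  have hrot0 : rot θ 0 = 0 := by rw [← rotL_apply, map_zero]
  set m : (Plane → ℝ) → Plane → ℝ := fun f z => mixedRot c s
        (sndPd f 0 0 (rot θ z)) (sndPd f 0 1 (rot θ z)) (sndPd f 1 1 (rot θ z)) with hm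
  set d : (Plane → ℝ) → Plane → ℝ := fun f z => diffRot c s
        (sndPd f 0 0 (rot θ z)) (sndPd f 0 1 (rot θ z)) (sndPd f 1 1 (rot θ z)) with hd
  have hX2 : ∀ᶠ z in 𝓝 (0 : Plane), ContDiffAt ℝ 2 X z :=
    (hX.contDiffAt.eventually (by simp)).mono fun z hz => hz.of_le (by norm_num)
  have k0 : (fun z => 4 * (NormalAtZero.sndInner X (e 0) (e 1) (e 1) (e 1) z
      - NormalAtZero.sndInner X (e 0) (e 0) (e 0) (e 1) z)) =ᶠ[𝓝 0]
      fun z => 4 * (m R z * d R z + m S z * d S z) := by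
    filter_upwards [hX2, rotated_snd hR θ, rotated_snd hS θ] with z hz r1 r2
    have e1 : m R z = _ := r1.1.symm
    have e2 : d R z = _ := r1.2.symm
    have e3 : m S z = _ := r2.1.symm
    have e4 : d S z = _ := r2.2.symm
    rw [e1, e2, e3, e4]
    unfold NormalAtZero.sndInner
    rw [inner_snd_monge hz, inner_snd_monge hz]
    ring
  have k1 : (fun z => 4 * (NormalAtZero.sndInner X (e 0) (e 0) (e 0) (e 0) z
      + NormalAtZero.sndInner X (e 1) (e 1) (e 1) (e 1) z
      - 2 * NormalAtZero.sndInner X (e 0) (e 0) (e 1) (e 1) z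
      - 4 * NormalAtZero.sndInner X (e 0) (e 1) (e 0) (e 1) z)) =ᶠ[𝓝 0]
      fun z => 4 * (d R z ^ 2 - 4 * m R z ^ 2 + (d S z ^ 2 - 4 * m S z ^ 2)) := by
    filter_upwards [hX2, rotated_snd hR θ, rotated_snd hS θ] with z hz r1 r2
    have e1 : m R z = _ := r1.1.symm
    have e2 : d R z = _ := r1.2.symm
    have e3 : m S z = _ := r2.1.symm
    have e4 : d S z = _ := r2.2.symm
    rw [e1, e2, e3, e4]
    unfold NormalAtZero.sndInner
    rw [inner_snd_monge hz, inner_snd_monge hz, inner_snd_monge hz, inner_snd_monge hz]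
    ring
  have val : ∀ f, ContDiffAt ℝ 4 f 0 → m f 0 = mixedRot c s (jet f 2 0) (jet f 1 1) (jet f 0 2) ∧
      d f 0 = diffRot c s (jet f 2 0) (jet f 1 1) (jet f 0 2) := fun f hf => by
    obtain ⟨j1, j2, j3⟩ := jet_two hf
    simp only [hm, hd, hrot0, j1, j2, j3, and_self]
  have der : ∀ f, ContDiffAt ℝ 4 f 0 → ∃ M D : Plane →L[ℝ] ℝ, HasFDerivAt (m f) M 0 ∧
      HasFDerivAt (d f) D 0 ∧
      ∀ v, M v = mixedRot c s ((rot θ v) 0 * jet f 3 0 + (rot θ v) 1 * jet f 2 1)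
        ((rot θ v) 0 * jet f 2 1 + (rot θ v) 1 * jet f 1 2)
        ((rot θ v) 0 * jet f 1 2 + (rot θ v) 1 * jet f 0 3) ∧
        D v = diffRot c s ((rot θ v) 0 * jet f 3 0 + (rot θ v) 1 * jet f 2 1)
        ((rot θ v) 0 * jet f 2 1 + (rot θ v) 1 * jet f 1 2)
        ((rot θ v) 0 * jet f 1 2 + (rot θ v) 1 * jet f 0 3) := fun f hf => by
    have hp : ∀ i j, HasFDerivAt (fun z => sndPd f i j (rot θ z))
        ((𝐃 (sndPd f i j) 0).comp (rotL θ)) 0 := fun i j => by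
      have h0 : HasFDerivAt (sndPd f i j) (𝐃 (sndPd f i j) 0) (rotL θ 0) := by
        rw [map_zero]
        exact ((contDiffAt_sndPd hf i j).differentiableAt (by norm_num)).hasFDerivAt
      exact h0.comp (0 : Plane) (rotL θ).hasFDerivAt
    refine ⟨_, _, (((hp 0 0).const_mul (c * s)).add ((hp 0 1).const_mul (c ^ 2 - s ^ 2))).sub
      ((hp 1 1).const_mul (c * s)), (((hp 0 0).const_mul (s ^ 2 - c ^ 2)).add
      ((hp 0 1).const_mul (4 * (c * s)))).add ((hp 1 1).const_mul (c ^ 2 - s ^ 2)), fun v => ?_⟩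
    obtain ⟨j1, j2, j3⟩ := fderiv_sndPd hf (rot θ v)
    rw [← j1, ← j2, ← j3]
    exact ⟨rfl, rfl⟩
  obtain ⟨mR, dR⟩ := val R hR
  obtain ⟨mS, dS⟩ := val S hS
  obtain ⟨MR, DR, hMR, hDR, vR⟩ := der R hR
  obtain ⟨MS, DS, hMS, hDS, vS⟩ := der S hS
  have alg := fun u₀ u₁ => rotated_jets c s u₀ u₁ (jet R 2 0) (jet R 1 1) (jet R 0 2) (jet R 3 0)
    (jet R 2 1) (jet R 1 2) (jet R 0 3) (jet S 2 0) (jet S 1 1) (jet S 0 2) (jet S 3 0)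
    (jet S 2 1) (jet S 1 2) (jet S 0 3) h1 h2 h3 h4
  have D0 : HasFDerivAt (fun z => 4 * (m R z * d R z + m S z * d S z)) _ 0 :=
    ((hMR.mul hDR).add (hMS.mul hDS)).const_mul 4
  have D1 : HasFDerivAt (fun z => 4 * (d R z ^ 2 - 4 * m R z ^ 2 + (d S z ^ 2 - 4 * m S z ^ 2))) _ 0 :=
    (((hDR.pow 2).sub ((hMR.pow 2).const_mul 4)).add
      ((hDS.pow 2).sub ((hMS.pow 2).const_mul 4))).const_mul 4
  have J0 := hX.jet_a0.trans (JetEq.of_eventuallyEq k0 D0.differentiableAt)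
  have J1 := hX.jet_a1.trans (JetEq.of_eventuallyEq k1 D1.differentiableAt)
  refine ⟨?_, ?_, 2 * ((jet S 0 2 - jet S 2 0) * (c ^ 4 - 6 * c ^ 2 * s ^ 2 + s ^ 4)
          + (jet R 0 2 - jet R 2 0) * (4 * c ^ 3 * s - 4 * c * s ^ 3)),
    8 * (-(jet R 0 2 - jet R 2 0) * (c ^ 4 - 6 * c ^ 2 * s ^ 2 + s ^ 4)
          + (jet S 0 2 - jet S 2 0) * (4 * c ^ 3 * s - 4 * c * s ^ 3)), fun v => (rot θ v) 0 * (2 * jet S 2 1 - jet R 1 2 + jet R 3 0)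
    + (rot θ v) 1 * (2 * jet S 1 2 - jet R 0 3 + jet R 2 1), fun v => ?_, fun v => ?_⟩
  rotate_left 2
  · rw [J0.fderiv_eq, D0.fderiv, ← (alg _ _).2.2.1]
    simp only [add_apply, smul_apply, smul_eq_mul, mR, mS, dR, dS, (vR v).1, (vR v).2, (vS v).1,
      (vS v).2]
    ring
  · rw [J1.fderiv_eq, D1.fderiv, ← (alg _ _).2.2.2]
    simp only [add_apply, sub_apply, smul_apply, smul_eq_mul, mR, mS, dR, dS, (vR v).1, (vR v).2,
      (vS v).1, (vS v).2]
    ring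
  · rw [J0.1]
    simp only [mR, mS, dR, dS, (alg 0 0).1, mul_zero]
  · rw [J1.1]
    simp only [mR, mS, dR, dS, (alg 0 0).2.1, mul_zero]

theorem axialGerm_of_monge {R S : Plane → ℝ} {θ : ℝ} (hR : ContDiffAt ℝ 4 R 0)
    (hS : ContDiffAt ℝ 4 S 0) (hR' : 𝐃 R 0 = 0) (hS' : 𝐃 S 0 = 0)
    (h1 : jet R 1 1 = -(jet S 0 2 - jet S 2 0) / 2)
    (h2 : jet S 1 1 = (jet R 0 2 - jet R 2 0) / 2) (h3 : alpha1 R S = 0) (h4 : alpha3 R S = 0)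
    (h₁₀ : jet (a0 (monge (R ∘ rot θ) (S ∘ rot θ))) 1 0 = 0)
    (h₀₁ : jet (a0 (monge (R ∘ rot θ) (S ∘ rot θ))) 0 1 ≠ 0) :
    AxialGerm (monge (R ∘ rot θ) (S ∘ rot θ)) (jet (a0 (monge (R ∘ rot θ) (S ∘ rot θ))) 0 1)
      (jet (a1 (monge (R ∘ rot θ) (S ∘ rot θ))) 0 1) := by
  have hrot0 : rot θ 0 = 0 := by rw [← rotL_apply, map_zero]
  have flat : ∀ f : Plane → ℝ, ContDiffAt ℝ 4 f 0 → 𝐃 f 0 = 0 →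
      𝐃 (f ∘ rot θ) 0 = 0 := fun f hf hf' => by
    ext v
    rw [fderiv_comp_rot (by rw [hrot0]; exact hf.differentiableAt (by norm_num)), hrot0, hf']
    rfl
  have hX := normalAtZero_monge (contDiffAt_comp_rot hR θ) (contDiffAt_comp_rot hS θ)
    (flat R hR hR') (flat S hS hS')
  obtain ⟨z0, z1, c₀, c₁, l, hl0, hl1⟩ := exists_proportional hR hS h1 h2 h3 h4 hX
  set X := monge (R ∘ rot θ) (S ∘ rot θ)
  have e10 : jet (a0 X) 1 0 = 𝐃 (a0 X) 0 (e 0) := rfl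
  have e01 : jet (a0 X) 0 1 = 𝐃 (a0 X) 0 (e 1) := rfl
  have f01 : jet (a1 X) 0 1 = 𝐃 (a1 X) 0 (e 1) := rfl
  have hlin : ∀ (L : Plane →L[ℝ] ℝ) v, L v = v 0 * L (e 0) + v 1 * L (e 1) := fun L v => by
    conv_lhs => rw [plane_eq v]
    simp
  have hc0 : c₀ ≠ 0 := fun h => h₀₁ (by rw [e01, hl0, h, zero_mul])
  have hl : l (e 0) = 0 := by
    rw [e10, hl0] at h₁₀
    exact (mul_eq_zero.1 h₁₀).resolve_left hc0
  refine ⟨hX, z0, z1, fun v => ?_, fun v => ?_, h₀₁⟩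
  · rw [hlin _ v, ← e10, h₁₀, ← e01]; ring
  · rw [hlin _ v, hl1 (e 0), hl, ← f01]; ring

theorem chi_eq {X : Plane → Space4} {α β : ℝ} (h : AxialGerm X α β) :
    chi X = 𝐃 (𝐃 (a1 X)) 0 (e 0) (e 0)
      - 𝐃 (𝐃 (a0 X)) 0 (e 0) (e 0) * β / α := by
  have e01 : jet (a0 X) 0 1 = α := by
    change 𝐃 (a0 X) 0 (e 1) = α
    rw [h.fderiv0, e_one_one, mul_one]
  have f01 : jet (a1 X) 0 1 = β := by
    change 𝐃 (a1 X) 0 (e 1) = β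
    rw [h.fderiv1, e_one_one, mul_one]
  rw [chi, e01, f01, ← fderiv_fderiv_apply h.contDiffAt_a0, ← fderiv_fderiv_apply h.contDiffAt_a1]
  rfl

end

section

open Filter

/-! ### Second derivatives of products -/

section Products

variable {V : Type*} [NormedAddCommGroup V] [NormedSpace ℝ V]

theorem fderiv_fderiv_mul {f g : V → ℝ} {z : V} (hf : ContDiffAt ℝ 2 f z) (hg : ContDiffAt ℝ 2 g z)
    (u v : V) : 𝐃 (𝐃 fun z => f z * g z) z u v
      = f z * 𝐃 (𝐃 g) z u v + g z * 𝐃 (𝐃 f) z u v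
        + 𝐃 f z u * 𝐃 g z v + 𝐃 g z u * 𝐃 f z v := by
  have d1 : ∀ {h : V → ℝ}, ContDiffAt ℝ 2 h z → DifferentiableAt ℝ (fun z => 𝐃 h z v) z :=
    fun hh => (((hh.fderiv_right (m := 1) (by norm_num)).differentiableAt (by norm_num))).clm_apply
      (differentiableAt_const v)
  have ev : (fun z => 𝐃 (fun z => f z * g z) z v) =ᶠ[𝓝 z]
      fun z => f z * 𝐃 g z v + g z * 𝐃 f z v := by
    filter_upwards [hf.eventually (by simp), hg.eventually (by simp)] with y hy hy'
    rw [((hy.differentiableAt (by norm_num)).hasFDerivAt.fun_mul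
      (hy'.differentiableAt (by norm_num)).hasFDerivAt).fderiv]
    simp
  have d0 : ∀ {h : V → ℝ}, ContDiffAt ℝ 2 h z → HasFDerivAt h (𝐃 h z) z :=
    fun hh => (hh.differentiableAt (by norm_num)).hasFDerivAt
  rw [← fderiv_fderiv_apply (hf.mul hg), ev.fderiv_eq,
    (((d0 hf).fun_mul (d1 hg).hasFDerivAt).fun_add ((d0 hg).fun_mul (d1 hf).hasFDerivAt)).fderiv]
  simp only [add_apply, smul_apply, smul_eq_mul, fderiv_fderiv_apply hf, fderiv_fderiv_apply hg]
  ring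

theorem fderiv_comp_fst {f : V → ℝ} {m : V × ℝ} (hf : DifferentiableAt ℝ f m.1) :
    HasFDerivAt (fun m : V × ℝ => f m.1) ((𝐃 f m.1).comp (ContinuousLinearMap.fst ℝ V ℝ)) m :=
  hf.hasFDerivAt.comp m hasFDerivAt_fst

theorem contDiffAt_comp_fst {n : ℕ∞ω} {f : V → ℝ} {m : V × ℝ} (hf : ContDiffAt ℝ n f m.1) :
    ContDiffAt ℝ n (fun m : V × ℝ => f m.1) m := hf.comp m contDiffAt_fst

theorem fderiv_fderiv_comp_fst {f : V → ℝ} {m : V × ℝ} (hf : ContDiffAt ℝ 2 f m.1) (u v : V × ℝ) :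
    𝐃 (𝐃 fun m : V × ℝ => f m.1) m u v = 𝐃 (𝐃 f) m.1 u.1 v.1 :=
  fderiv_fderiv_comp_clm (L := ContinuousLinearMap.fst ℝ V ℝ) hf u v

end Products

/-! ### The two quartics spanning the Lie-Cartan function -/

/-- The coefficient of `a₀` in the quartic form. -/
def cosForm (X : Plane → Space4) (z w : Plane) : ℝ :=
  cE X z ^ 3 * w 0 ^ 4 - 6 * (cG X z * cE X z ^ 2) * (w 0 ^ 2 * w 1 ^ 2)
    - 8 * (cE X z * cF X z * cG X z) * (w 0 * w 1 ^ 3)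
    + cG X z * (cE X z * cG X z - 4 * cF X z ^ 2) * w 1 ^ 4

/-- The coefficient of `a₁` in the quartic form. -/
def sinForm (X : Plane → Space4) (z w : Plane) : ℝ :=
  cE X z ^ 3 * (w 0 ^ 3 * w 1) + 3 * (cF X z * cE X z ^ 2) * (w 0 ^ 2 * w 1 ^ 2)
    + cE X z * (4 * cF X z ^ 2 - cE X z * cG X z) * (w 0 * w 1 ^ 3)
    + cF X z * (2 * cF X z ^ 2 - cE X z * cG X z) * w 1 ^ 4

theorem lieCartan_eq (X : Plane → Space4) (w : Plane) (m : Plane × ℝ) :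
    lieCartan X w m = a0 X m.1 * cosForm X m.1 (w + m.2 • J w)
      + a1 X m.1 * sinForm X m.1 (w + m.2 • J w) := by
  unfold lieCartan quartic cosForm sinForm; ring

/-- `Re (w₀ + i w₁)⁴`. -/
def cos4 (w : Plane) : ℝ := w 0 ^ 4 - 6 * (w 0 ^ 2 * w 1 ^ 2) + w 1 ^ 4

/-- `Im (w₀ + i w₁)⁴ / 4`. -/
def sin4 (w : Plane) : ℝ := w 0 ^ 3 * w 1 - w 0 * w 1 ^ 3

theorem cos4_sq_add (w : Plane) : cos4 w ^ 2 + 16 * sin4 w ^ 2 = (w 0 ^ 2 + w 1 ^ 2) ^ 4 := by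
  unfold cos4 sin4; ring

theorem J_zero (w : Plane) : J w 0 = -w 1 := rfl
theorem J_one (w : Plane) : J w 1 = w 0 := rfl

theorem contDiff_affine (w : Plane) (i : Fin 2) {n : ℕ∞ω} :
    ContDiff ℝ n fun m : Plane × ℝ => (w + m.2 • J w) i := by
  change ContDiff ℝ n fun m : Plane × ℝ => w i + m.2 * J w i
  fun_prop

theorem hasFDerivAt_affine (w : Plane) (i : Fin 2) (m : Plane × ℝ) :
    HasFDerivAt (fun m : Plane × ℝ => (w + m.2 • J w) i)
      (J w i • ContinuousLinearMap.snd ℝ Plane ℝ) m := by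
  change HasFDerivAt (fun m : Plane × ℝ => w i + m.2 * J w i) _ m
  exact (hasFDerivAt_snd.mul_const (J w i)).const_add (w i)

namespace NormalAtZero

variable {X : Plane → Space4}

theorem contDiffAt_cosForm (h : NormalAtZero X) (w : Plane) :
    ContDiffAt ℝ 2 (fun m : Plane × ℝ => cosForm X m.1 (w + m.2 • J w)) 0 := by
  have hE := contDiffAt_comp_fst (m := (0 : Plane × ℝ)) h.contDiffAt_cE
  have hF := contDiffAt_comp_fst (m := (0 : Plane × ℝ)) h.contDiffAt_cF
  have hG := contDiffAt_comp_fst (m := (0 : Plane × ℝ)) h.contDiffAt_cG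
  have h0 : ContDiffAt ℝ 2 _ (0 : Plane × ℝ) := (contDiff_affine w 0).contDiffAt
  have h1 : ContDiffAt ℝ 2 _ (0 : Plane × ℝ) := (contDiff_affine w 1).contDiffAt
  unfold cosForm
  exact ((((hE.pow 3).mul (h0.pow 4)).sub ((contDiffAt_const.mul (hG.mul (hE.pow 2))).mul
    ((h0.pow 2).mul (h1.pow 2)))).sub ((contDiffAt_const.mul ((hE.mul hF).mul hG)).mul
    (h0.mul (h1.pow 3)))).add ((hG.mul ((hE.mul hG).sub (contDiffAt_const.mul (hF.pow 2)))).mul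
    (h1.pow 4))

theorem contDiffAt_sinForm (h : NormalAtZero X) (w : Plane) :
    ContDiffAt ℝ 2 (fun m : Plane × ℝ => sinForm X m.1 (w + m.2 • J w)) 0 := by
  have hE := contDiffAt_comp_fst (m := (0 : Plane × ℝ)) h.contDiffAt_cE
  have hF := contDiffAt_comp_fst (m := (0 : Plane × ℝ)) h.contDiffAt_cF
  have hG := contDiffAt_comp_fst (m := (0 : Plane × ℝ)) h.contDiffAt_cG
  have h0 : ContDiffAt ℝ 2 _ (0 : Plane × ℝ) := (contDiff_affine w 0).contDiffAt
  have h1 : ContDiffAt ℝ 2 _ (0 : Plane × ℝ) := (contDiff_affine w 1).contDiffAt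
  unfold sinForm
  exact ((((hE.pow 3).mul ((h0.pow 3).mul h1)).add ((contDiffAt_const.mul (hF.mul (hE.pow 2))).mul
    ((h0.pow 2).mul (h1.pow 2)))).add ((hE.mul ((contDiffAt_const.mul (hF.pow 2)).sub
    (hE.mul hG))).mul (h0.mul (h1.pow 3)))).add ((hF.mul ((contDiffAt_const.mul (hF.pow 2)).sub
    (hE.mul hG))).mul (h1.pow 4))

theorem hasFDerivAt_const_of_jet {f : Plane → ℝ} {c : ℝ} (h : JetEq f fun _ => c) :
    HasFDerivAt (fun m : Plane × ℝ => f m.1) (0 : Plane × ℝ →L[ℝ] ℝ) 0 := by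
  obtain ⟨-, L, h1, h2⟩ := h
  have : L = 0 := h2.unique (hasFDerivAt_const c 0)
  subst this
  have h3 : HasFDerivAt f (0 : Plane →L[ℝ] ℝ) (0 : Plane × ℝ).1 := h1
  exact (h3.comp (0 : Plane × ℝ) hasFDerivAt_fst).congr_fderiv
    (ContinuousLinearMap.zero_comp _)

theorem cosForm_zero (h : NormalAtZero X) (w : Plane) : cosForm X 0 w = cos4 w := by
  rw [cosForm, h.jet_cE.1, h.jet_cF.1, h.jet_cG.1, cos4]; ring

theorem sinForm_zero (h : NormalAtZero X) (w : Plane) : sinForm X 0 w = sin4 w := by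
  rw [sinForm, h.jet_cE.1, h.jet_cF.1, h.jet_cG.1, sin4]; ring

theorem fderiv_cosForm (h : NormalAtZero X) (w : Plane) (u : Plane × ℝ) :
    𝐃 (fun m : Plane × ℝ => cosForm X m.1 (w + m.2 • J w)) 0 u = -16 * sin4 w * u.2 := by
  have hE := hasFDerivAt_const_of_jet h.jet_cE
  have hF := hasFDerivAt_const_of_jet h.jet_cF
  have hG := hasFDerivAt_const_of_jet h.jet_cG
  have h0 := hasFDerivAt_affine w 0 (0 : Plane × ℝ)
  have h1 := hasFDerivAt_affine w 1 (0 : Plane × ℝ)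
  have := ((((hE.pow 3).mul (h0.pow 4)).sub (((hG.mul (hE.pow 2)).const_mul 6).mul
    ((h0.pow 2).mul (h1.pow 2)))).sub ((((hE.mul hF).mul hG).const_mul 8).mul
    (h0.mul (h1.pow 3)))).add ((hG.mul ((hE.mul hG).sub ((hF.pow 2).const_mul 4))).mul
    (h1.pow 4))
  refine (DFunLike.congr_fun this.fderiv u).trans ?_
  simp [h.jet_cE.1, h.jet_cF.1, h.jet_cG.1, sin4, J_zero, J_one]
  ring

theorem fderiv_sinForm (h : NormalAtZero X) (w : Plane) (u : Plane × ℝ) :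
    𝐃 (fun m : Plane × ℝ => sinForm X m.1 (w + m.2 • J w)) 0 u = cos4 w * u.2 := by
  have hE := hasFDerivAt_const_of_jet h.jet_cE
  have hF := hasFDerivAt_const_of_jet h.jet_cF
  have hG := hasFDerivAt_const_of_jet h.jet_cG
  have h0 := hasFDerivAt_affine w 0 (0 : Plane × ℝ)
  have h1 := hasFDerivAt_affine w 1 (0 : Plane × ℝ)
  have := ((((hE.pow 3).mul ((h0.pow 3).mul h1)).add (((hF.mul (hE.pow 2)).const_mul 3).mul
    ((h0.pow 2).mul (h1.pow 2)))).add ((hE.mul (((hF.pow 2).const_mul 4).sub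
    (hE.mul hG))).mul (h0.mul (h1.pow 3)))).add ((hF.mul (((hF.pow 2).const_mul 2).sub
    (hE.mul hG))).mul (h1.pow 4))
  refine (DFunLike.congr_fun this.fderiv u).trans ?_
  simp [h.jet_cE.1, h.jet_cF.1, h.jet_cG.1, cos4, J_zero, J_one]
  ring

end NormalAtZero

namespace AxialGerm

variable {X : Plane → Space4} {α β : ℝ}

theorem contDiffAt_lieCartan (h : AxialGerm X α β) (w : Plane) :
    ContDiffAt ℝ 2 (lieCartan X w) 0 := by
  rw [funext (lieCartan_eq X w)]
  exact ((contDiffAt_comp_fst h.contDiffAt_a0).mul (h.contDiffAt_cosForm w)).add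
    ((contDiffAt_comp_fst h.contDiffAt_a1).mul (h.contDiffAt_sinForm w))

theorem lieCartan_zero (h : AxialGerm X α β) (w : Plane) : lieCartan X w 0 = 0 := by
  rw [lieCartan_eq]
  change a0 X 0 * _ + a1 X 0 * _ = 0
  rw [h.zero0, h.zero1]; ring

theorem hasFDerivAt_a0 (h : AxialGerm X α β) (u : Plane × ℝ) :
    𝐃 (fun m : Plane × ℝ => a0 X m.1) 0 u = α * u.1 1 := by
  rw [(fderiv_comp_fst (h.contDiffAt_a0.differentiableAt (by norm_num))).fderiv]
  exact h.fderiv0 u.1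

theorem hasFDerivAt_a1 (h : AxialGerm X α β) (u : Plane × ℝ) :
    𝐃 (fun m : Plane × ℝ => a1 X m.1) 0 u = β * u.1 1 := by
  rw [(fderiv_comp_fst (h.contDiffAt_a1.differentiableAt (by norm_num))).fderiv]
  exact h.fderiv1 u.1

theorem fderiv_lieCartan (h : AxialGerm X α β) (w : Plane) (u : Plane × ℝ) :
    𝐃 (lieCartan X w) 0 u = (α * cos4 w + β * sin4 w) * u.1 1 := by
  have d : ∀ {f : Plane × ℝ → ℝ}, ContDiffAt ℝ 2 f 0 → HasFDerivAt f (𝐃 f 0) 0 := fun hf =>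
    (hf.differentiableAt (by norm_num)).hasFDerivAt
  have := ((d (contDiffAt_comp_fst (m := (0 : Plane × ℝ)) h.contDiffAt_a0)).mul
    (d (h.contDiffAt_cosForm w))).add
    ((d (contDiffAt_comp_fst (m := (0 : Plane × ℝ)) h.contDiffAt_a1)).mul
    (d (h.contDiffAt_sinForm w)))
  rw [funext (lieCartan_eq X w)]
  refine (DFunLike.congr_fun this.fderiv u).trans ?_
  simp [h.zero0, h.zero1, h.cosForm_zero, h.sinForm_zero, h.hasFDerivAt_a0, h.hasFDerivAt_a1]
  ring

/-- The purely horizontal part of the Hessian. -/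
def baseHess (X : Plane → Space4) (w u v : Plane) : ℝ :=
  cos4 w * 𝐃 (𝐃 (a0 X)) 0 u v + sin4 w * 𝐃 (𝐃 (a1 X)) 0 u v

theorem hess_eq (h : AxialGerm X α β) (w : Plane) (u v : Plane × ℝ) :
    hess X w u v = baseHess X w u.1 v.1
      + (β * cos4 w - 16 * (α * sin4 w)) * (u.1 1 * v.2 + v.1 1 * u.2) := by
  have c0 := contDiffAt_comp_fst (m := (0 : Plane × ℝ)) h.contDiffAt_a0
  have c1 := contDiffAt_comp_fst (m := (0 : Plane × ℝ)) h.contDiffAt_a1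
  have ev : 𝐃 (lieCartan X w) =ᶠ[𝓝 0] fun m =>
      𝐃 (fun m : Plane × ℝ => a0 X m.1 * cosForm X m.1 (w + m.2 • J w)) m
        + 𝐃 (fun m : Plane × ℝ => a1 X m.1 * sinForm X m.1 (w + m.2 • J w)) m := by
    filter_upwards [(c0.mul (h.contDiffAt_cosForm w)).eventually (by simp),
      (c1.mul (h.contDiffAt_sinForm w)).eventually (by simp)] with m h1 h2
    rw [funext (lieCartan_eq X w)]
    exact fderiv_add (h1.differentiableAt (by norm_num)) (h2.differentiableAt (by norm_num))
  have d : ∀ {f : Plane × ℝ → ℝ}, ContDiffAt ℝ 2 f 0 → DifferentiableAt ℝ (𝐃 f) 0 :=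
    fun hf => (hf.fderiv_right (m := 1) (by norm_num)).differentiableAt (by norm_num)
  rw [hess, ev.fderiv_eq, ((d (c0.mul (h.contDiffAt_cosForm w))).hasFDerivAt.fun_add
    (d (c1.mul (h.contDiffAt_sinForm w))).hasFDerivAt).fderiv, add_apply, add_apply,
    fderiv_fderiv_mul c0 (h.contDiffAt_cosForm w), fderiv_fderiv_mul c1 (h.contDiffAt_sinForm w),
    fderiv_fderiv_comp_fst h.contDiffAt_a0, fderiv_fderiv_comp_fst h.contDiffAt_a1,
    h.fderiv_cosForm, h.fderiv_cosForm, h.fderiv_sinForm, h.fderiv_sinForm, h.hasFDerivAt_a0,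
    h.hasFDerivAt_a0, h.hasFDerivAt_a1, h.hasFDerivAt_a1]
  simp only [Prod.fst_zero, Prod.snd_zero, zero_smul, add_zero, h.zero0, h.zero1, h.cosForm_zero,
    h.sinForm_zero, baseHess]
  ring

theorem lieCartanField_zero (h : AxialGerm X α β) (w : Plane) :
    lieCartanField X w 0 = (0, -((α * cos4 w + β * sin4 w) * w 1)) := by
  unfold lieCartanField
  rw [h.fderiv_lieCartan, h.fderiv_lieCartan]
  simp

theorem fderiv_lieCartanField (h : AxialGerm X α β) (w : Plane) (u : Plane × ℝ) :
    𝐃 (lieCartanField X w) 0 u = (((β * cos4 w - 16 * (α * sin4 w)) * u.1 1) • w,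
        -(baseHess X w u.1 w + (β * cos4 w - 16 * (α * sin4 w)) * (w 1 * u.2)
          + (α * cos4 w + β * sin4 w) * (w 0 * u.2))) := by
  have hd := ((h.contDiffAt_lieCartan w).fderiv_right (m := 1) (by norm_num)).differentiableAt
    (by norm_num) |>.hasFDerivAt
  have hw : HasFDerivAt (fun m : Plane × ℝ => w + m.2 • J w)
      ((ContinuousLinearMap.snd ℝ Plane ℝ).smulRight (J w)) 0 :=
    (hasFDerivAt_snd.smul_const (J w)).const_add w
  have h1 := hd.clm_apply (hasFDerivAt_const ((0, 1) : Plane × ℝ) (0 : Plane × ℝ))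
  have h2 := hd.clm_apply (hw.prodMk (hasFDerivAt_const (0 : ℝ) (0 : Plane × ℝ)))
  have h3 := (h1.smul hw).prodMk h2.neg
  refine (DFunLike.congr_fun h3.fderiv u).trans ?_
  have e1 : 𝐃 (𝐃 (lieCartan X w)) 0 u (0, 1)
      = (β * cos4 w - 16 * (α * sin4 w)) * u.1 1 := by
    refine (h.hess_eq w u (0, 1)).trans ?_
    simp [baseHess]
  have e2 : 𝐃 (𝐃 (lieCartan X w)) 0 u (w, 0)
      = baseHess X w u.1 w + (β * cos4 w - 16 * (α * sin4 w)) * (w 1 * u.2) := by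
    refine (h.hess_eq w u (w, 0)).trans ?_
    simp
  ext i
  · simp [e1, h.fderiv_lieCartan]
  · simp [e2, h.fderiv_lieCartan, J_one]
    ring

end AxialGerm

end

section

open Filter

theorem sq_add_sq_pos {w : Plane} (hw : w ≠ 0) : 0 < w 0 ^ 2 + w 1 ^ 2 := by
  by_contra hc
  have h0 : w 0 = 0 := by nlinarith [sq_nonneg (w 0), sq_nonneg (w 1)]
  have h1 : w 1 = 0 := by nlinarith [sq_nonneg (w 0), sq_nonneg (w 1)]
  exact hw (by ext i; fin_cases i <;> simp [h0, h1])

theorem sin4_ne_zero {α β : ℝ} (hα : α ≠ 0) {w : Plane} (hw : w ≠ 0)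
    (hQ : α * cos4 w + β * sin4 w = 0) : sin4 w ≠ 0 := fun hs => by
  have hc : cos4 w = 0 := by
    rw [hs, mul_zero, add_zero] at hQ
    exact (mul_eq_zero.1 hQ).resolve_left hα
  have := cos4_sq_add w
  rw [hc, hs] at this
  have h4 := pow_pos (sq_add_sq_pos hw) 4
  linarith

theorem kappa_ne_zero {α β : ℝ} (hα : α ≠ 0) {w : Plane} (hw : w ≠ 0)
    (hQ : α * cos4 w + β * sin4 w = 0) : β * cos4 w - 16 * (α * sin4 w) ≠ 0 := fun hk => by
  have hs := sin4_ne_zero hα hw hQ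
  have : (β ^ 2 + 16 * α ^ 2) * sin4 w = 0 := by linear_combination β * hQ - α * hk
  have h2 := (mul_eq_zero.1 this).resolve_right hs
  have := sq_pos_of_ne_zero hα
  nlinarith [sq_nonneg β]

theorem exists_root {α β : ℝ} (hα : α ≠ 0) : ∃ w : Plane, w ≠ 0 ∧ α * cos4 w + β * sin4 w = 0 := by
  obtain ⟨ξ, hξ⟩ := IsAlgClosed.exists_pow_nat_eq (⟨β, -(4 * α)⟩ : ℂ) (n := 4) (by norm_num)
  have h1 := congrArg Complex.re hξ
  have h2 := congrArg Complex.im hξ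
  simp only [pow_succ, pow_zero, one_mul, Complex.mul_re, Complex.mul_im] at h1 h2
  refine ⟨!₂[ξ.re, ξ.im], fun h0 => ?_, ?_⟩
  · have r : ξ.re = 0 := congrArg (fun w : Plane => w 0) h0
    have i : ξ.im = 0 := congrArg (fun w : Plane => w 1) h0
    rw [r, i] at h2
    exact hα (by linarith)
  · simp only [cos4, sin4, Matrix.cons_val_zero, Matrix.cons_val_one]
    linear_combination α * h1 + β / 4 * h2

theorem quartic_smul_add (α β x y : ℝ) (w : Plane) :
    α * cos4 (x • w + y • J w) + β * sin4 (x • w + y • J w)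
      = (α * cos4 w + β * sin4 w) * (x ^ 4 - 6 * (x ^ 2 * y ^ 2) + y ^ 4)
        + (β * cos4 w - 16 * (α * sin4 w)) * (x * y * ((x - y) * (x + y))) := by
  simp only [cos4, sin4, PiLp.add_apply, PiLp.smul_apply, smul_eq_mul, J_zero, J_one]
  ring

theorem quartic_smul (α β a : ℝ) (w : Plane) :
    α * cos4 (a • w) + β * sin4 (a • w) = a ^ 4 * (α * cos4 w + β * sin4 w) := by
  simp only [cos4, sin4, PiLp.smul_apply, smul_eq_mul]
  ring

/-- Four lines forming equal angles. -/
def fourLines (w : Plane) (i : Fin 4) : Plane :=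
  (![1, 0, 1, 1] i : ℝ) • w + (![0, 1, 1, -1] i : ℝ) • J w

theorem fourLines_det (w : Plane) (i j : Fin 4) :
    fourLines w i 0 * fourLines w j 1 - fourLines w i 1 * fourLines w j 0
      = (![1, 0, 1, 1] i * ![0, 1, 1, -1] j - ![0, 1, 1, -1] i * ![1, 0, 1, 1] j : ℝ)
        * (w 0 ^ 2 + w 1 ^ 2) := by
  simp only [fourLines, PiLp.add_apply, PiLp.smul_apply, smul_eq_mul, J_zero, J_one]
  ring

theorem fourLines_ne_zero {w : Plane} (hw : w ≠ 0) (i : Fin 4) : fourLines w i ≠ 0 := fun h0 => by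
  have hp := (sq_add_sq_pos hw).ne'
  have h1 := fourLines_det w i 0
  have h2 := fourLines_det w i 1
  rw [h0] at h1 h2
  simp only [PiLp.zero_apply, zero_mul, sub_zero, zero_eq_mul, hp, or_false] at h1 h2
  fin_cases i <;> simp at h1 h2

/-- The zero directions of the quartic form `α Re w⁴ + β Im w⁴ / 4` are four lines forming equal
angles. -/
theorem ncard_zeros {α β : ℝ} (hα : α ≠ 0) :
    {d : ℙ ℝ Plane | α * cos4 d.rep + β * sin4 d.rep = 0}.ncard = 4 := by
  obtain ⟨w, hw, hQ⟩ := exists_root (β := β) hα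
  have hκ := kappa_ne_zero hα hw hQ
  have hp := sq_add_sq_pos hw
  set f : Fin 4 → ℙ ℝ Plane := fun i => Projectivization.mk ℝ _ (fourLines_ne_zero hw i)
  have hinj : Function.Injective f := fun i j hij => by
    obtain ⟨a, ha⟩ := (Projectivization.mk_eq_mk_iff' ℝ _ _ (fourLines_ne_zero hw i)
      (fourLines_ne_zero hw j)).1 hij
    have h1 := fourLines_det w i j
    rw [← ha] at h1
    simp only [PiLp.smul_apply, smul_eq_mul] at h1
    have h2 := (mul_eq_zero.1 (h1.symm.trans (by ring))).resolve_right hp.ne'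
    fin_cases i <;> fin_cases j <;> first | rfl | norm_num at h2
  have hset : {d : ℙ ℝ Plane | α * cos4 d.rep + β * sin4 d.rep = 0} = range f := by
    ext d
    constructor
    · intro hd
      set x := (d.rep 0 * w 0 + d.rep 1 * w 1) / (w 0 ^ 2 + w 1 ^ 2) with hx
      set y := (d.rep 1 * w 0 - d.rep 0 * w 1) / (w 0 ^ 2 + w 1 ^ 2) with hy
      have hxy : d.rep = x • w + y • J w := by
        ext i
        fin_cases i <;> simp [J_zero, J_one, hx, hy] <;> field_simp <;> ring
      have hd' : α * cos4 d.rep + β * sin4 d.rep = 0 := hd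
      rw [hxy, quartic_smul_add, hQ, zero_mul, zero_add] at hd'
      have hprod := (mul_eq_zero.1 hd').resolve_left hκ
      have key : ∀ i : Fin 4, ∀ a : ℝ, a • fourLines w i = d.rep → d ∈ range f := fun i a ha =>
        ⟨i, by
          rw [← Projectivization.mk_rep d]
          exact ((Projectivization.mk_eq_mk_iff' ℝ _ _ d.rep_nonzero
            (fourLines_ne_zero hw i)).2 ⟨a, ha⟩).symm⟩
      rcases mul_eq_zero.1 hprod with h | h
      · rcases mul_eq_zero.1 h with h | h
        · exact key 1 y (by rw [hxy, h]; simp [fourLines])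
        · exact key 0 x (by rw [hxy, h]; simp [fourLines])
      · rcases mul_eq_zero.1 h with h | h
        · exact key 2 x (by rw [hxy, ← sub_eq_zero.1 h]; simp [fourLines])
        · exact key 3 x (by rw [hxy, eq_neg_of_add_eq_zero_right h]; simp [fourLines])
    · rintro ⟨i, rfl⟩
      obtain ⟨a, ha⟩ := Projectivization.exists_smul_eq_mk_rep ℝ _ (fourLines_ne_zero hw i)
      change α * cos4 (Projectivization.mk ℝ _ (fourLines_ne_zero hw i)).rep
        + β * sin4 (Projectivization.mk ℝ _ (fourLines_ne_zero hw i)).rep = 0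
      rw [← ha, Units.smul_def, quartic_smul, fourLines, quartic_smul_add, hQ]
      fin_cases i <;> simp
  rw [hset, ← Nat.card_coe_set_eq, Nat.card_range_of_injective hinj, Nat.card_fin]

/-- The direction of the `x` axis. -/
def axisDir : ℙ ℝ Plane := Projectivization.mk ℝ (e 0) fun h => by
  have := congrArg (fun w : Plane => w 0) h
  simp [e] at this

theorem exists_axisDir_rep : ∃ a : ℝ, a ≠ 0 ∧ axisDir.rep = a • e 0 := by
  obtain ⟨a, ha⟩ := Projectivization.exists_smul_eq_mk_rep ℝ (e 0) (fun h => by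
    have := congrArg (fun w : Plane => w 0) h
    simp [e] at this)
  exact ⟨a, a.ne_zero, ha.symm⟩

theorem eq_axisDir_iff (d : ℙ ℝ Plane) : d = axisDir ↔ d.rep 1 = 0 := by
  constructor
  · rintro rfl
    obtain ⟨a, -, ha⟩ := exists_axisDir_rep
    rw [ha]; simp [e]
  · intro h
    rw [← Projectivization.mk_rep d]
    refine (Projectivization.mk_eq_mk_iff' ℝ _ _ d.rep_nonzero _).2 ⟨d.rep 0, ?_⟩
    ext i; fin_cases i <;> simp [e, h]

namespace AxialGerm

variable {X : Plane → Space4} {α β : ℝ}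

theorem singularDirections_eq (h : AxialGerm X α β) :
    singularDirections X = {d | α * cos4 d.rep + β * sin4 d.rep = 0} := by
  ext d
  change (lieCartan X d.rep 0 = 0 ∧ 𝐃 (lieCartan X d.rep) 0 = 0) ↔
    α * cos4 d.rep + β * sin4 d.rep = 0
  constructor
  · rintro ⟨-, h0⟩
    have := h.fderiv_lieCartan d.rep (e 1, 0)
    rw [h0, e_one_one] at this
    simpa using this.symm
  · intro h0
    refine ⟨h.lieCartan_zero _, ContinuousLinearMap.ext fun u => ?_⟩
    rw [h.fderiv_lieCartan, h0, zero_mul]; rfl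

theorem axisDir_notMem (h : AxialGerm X α β) : axisDir ∉ singularDirections X := by
  rw [h.singularDirections_eq]
  obtain ⟨a, ha0, ha⟩ := exists_axisDir_rep
  change ¬ (α * cos4 axisDir.rep + β * sin4 axisDir.rep = 0)
  rw [ha, quartic_smul]
  simp [cos4, sin4, e, ha0, h.ne_zero]

theorem equilibria_eq (h : AxialGerm X α β) :
    equilibria X = insert axisDir (singularDirections X) := by
  rw [h.singularDirections_eq]
  ext d
  change (lieCartan X d.rep 0 = 0 ∧ lieCartanField X d.rep 0 = 0) ↔
    d = axisDir ∨ α * cos4 d.rep + β * sin4 d.rep = 0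
  rw [h.lieCartanField_zero, eq_axisDir_iff, h.lieCartan_zero, Prod.mk_eq_zero, neg_eq_zero,
    mul_eq_zero, or_comm]
  simp

/-- The transverse part of the Hessian at a singular point. -/
theorem baseHess_axis (h : AxialGerm X α β) {w : Plane} (hQ : α * cos4 w + β * sin4 w = 0) :
    baseHess X w (e 0) (e 0) = sin4 w * chi X := by
  have hα := h.ne_zero
  rw [chi_eq h, baseHess]
  field_simp
  linear_combination 𝐃 (𝐃 (a0 X)) 0 (e 0) (e 0) * hQ

theorem isMorse (h : AxialGerm X α β) (hχ : chi X ≠ 0) {w : Plane} (hw : w ≠ 0)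
    (hQ : α * cos4 w + β * sin4 w = 0) : IsMorse X w := by
  have hκ := kappa_ne_zero h.ne_zero hw hQ
  have hs := sin4_ne_zero h.ne_zero hw hQ
  intro u hu
  have h1 := hu (0, 1)
  have h2 := hu (e 0, 0)
  have h3 := hu (e 1, 0)
  rw [h.hess_eq] at h1 h2 h3
  have u1 : u.1 1 = 0 := by simpa [baseHess, hκ] using h1
  have hu1 : u.1 = u.1 0 • e 0 := by ext i; fin_cases i <;> simp [e, u1]
  have hb : baseHess X w u.1 (e 0) = u.1 0 * (sin4 w * chi X) := by
    rw [← h.baseHess_axis hQ]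
    conv_lhs => rw [hu1]
    simp only [baseHess, map_smul, smul_apply, smul_eq_mul]
    ring
  have u0 : u.1 0 = 0 := by
    rw [hb] at h2
    simpa [u1, hs, hχ, e_zero_one] using h2
  have hz : u.1 = 0 := by rw [hu1, u0, zero_smul]
  have u2 : u.2 = 0 := by
    rw [hz] at h3
    simpa [baseHess, hκ, e_one_one] using h3
  exact Prod.ext hz u2

theorem isConical (h : AxialGerm X α β) (hχ : chi X ≠ 0) {w : Plane} (hw : w ≠ 0)
    (hQ : α * cos4 w + β * sin4 w = 0) : IsConical X w := by
  have hκ := kappa_ne_zero h.ne_zero hw hQ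
  set κ := β * cos4 w - 16 * (α * sin4 w) with hκd
  have key : ∀ c, ∃ u, hess X w u u = c := fun c =>
    ⟨(e 1, (c - baseHess X w (e 1) (e 1)) / (2 * κ)), by
      rw [h.hess_eq, e_one_one, ← hκd]; field_simp; ring⟩
  refine ⟨h.isMorse hχ hw hQ, ?_, ?_⟩
  · obtain ⟨u, hu⟩ := key 1
    exact ⟨u, by rw [hu]; norm_num⟩
  · obtain ⟨u, hu⟩ := key (-1)
    exact ⟨u, by rw [hu]; norm_num⟩

theorem isSaddle (h : AxialGerm X α β) {w : Plane} (hw : w ≠ 0)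
    (hQ : α * cos4 w + β * sin4 w = 0) : IsSaddle X w := by
  have hκ := kappa_ne_zero h.ne_zero hw hQ
  have hs := sin4_ne_zero h.ne_zero hw hQ
  have hw1 : w 1 ≠ 0 := fun h1 => hs (by simp [sin4, h1])
  set κ := β * cos4 w - 16 * (α * sin4 w) with hκd
  refine ⟨by rw [h.lieCartanField_zero, hQ]; simp, κ * w 1, -(κ * w 1),
    (w, -baseHess X w w w / (2 * (κ * w 1))), (e 0, -baseHess X w (e 0) w / (κ * w 1)), ?_, ?_, hw,
    ?_, ?_, ?_, ?_, ?_⟩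
  · have : 0 < (κ * w 1) ^ 2 := by positivity
    nlinarith
  · rw [h.fderiv_lieCartanField, hQ, ← hκd]
    refine Prod.ext rfl ?_
    simp only [Prod.smul_mk, smul_eq_mul]
    field_simp
    ring
  · rw [h.hess_eq, ← hκd]
    field_simp
    ring
  · rw [h.fderiv_lieCartanField, hQ, ← hκd]
    simp [baseHess]
  · rw [h.hess_eq]; simp [baseHess]
  · rw [h.fderiv_lieCartanField, hQ, ← hκd, e_zero_one]
    refine Prod.ext (by simp) ?_
    simp only [Prod.snd_zero]
    field_simp
    ring
  · intro h0
    have := congrArg (fun u : Plane × ℝ => u.1 0) h0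
    simp [e] at this

theorem isTypeE45 (h : AxialGerm X α β) (hχ : chi X ≠ 0) : IsTypeE45 X := by
  rw [IsTypeE45, h.singularDirections_eq]
  exact ⟨ncard_zeros h.ne_zero, fun d hd => h.isMorse hχ d.rep_nonzero hd⟩

end AxialGerm

end

section

open Filter Asymptotics

/-! ### Barriers on the line -/

theorem nonpos_of_deriv_neg {φ φ' : ℝ → ℝ} {a b : ℝ} (hc : ContinuousOn φ (Icc a b))
    (hd : ∀ x ∈ Ioo a b, HasDerivAt φ (φ' x) x) (hn : ∀ x ∈ Ioo a b, 0 < φ x → φ' x < 0)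
    (ha : φ a ≤ 0) : ∀ x ∈ Icc a b, φ x ≤ 0 := by
  intro x hx
  by_contra! hpos
  have hsub : Icc a x ⊆ Icc a b := Icc_subset_Icc_right hx.2
  have hcx := hc.mono hsub
  have hcl : IsClosed (Icc a x ∩ φ ⁻¹' Iic 0) := hcx.preimage_isClosed_of_isClosed isClosed_Icc isClosed_Iic
  obtain ⟨c, ⟨hc1, hc2⟩, hmax⟩ := (isCompact_Icc.of_isClosed_subset hcl inter_subset_left).exists_isGreatest
    ⟨a, ⟨le_rfl, hx.1⟩, ha⟩
  have hcx' : c < x := lt_of_le_of_ne hc1.2 fun h => absurd hc2 (by rw [h]; exact not_le.2 hpos)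
  obtain ⟨ξ, hξ, h⟩ := exists_hasDerivAt_eq_slope φ φ' hcx'
    (hcx.mono (Icc_subset_Icc_left hc1.1))
    fun y hy => hd y ⟨hc1.1.trans_lt hy.1, hy.2.trans_le hx.2⟩
  have hφξ : 0 < φ ξ := by
    by_contra! hle
    exact absurd (hmax ⟨⟨hc1.1.trans hξ.1.le, hξ.2.le⟩, hle⟩) (not_le.2 hξ.1)
  have h1 := hn ξ ⟨hc1.1.trans_lt hξ.1, hξ.2.trans_le hx.2⟩ hφξ
  rw [h, div_neg_iff] at h1
  have hc3 : φ c ≤ 0 := hc2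
  rcases h1 with h1 | h1 <;> linarith

section Barrier

variable {u u' : ℝ → ℝ}

theorem exists_barrier (hc : ∀ᶠ x in 𝓝 (0 : ℝ), ContinuousAt u x) (h0 : u 0 = 0)
    (hd : ∀ᶠ x in 𝓝[≠] (0 : ℝ), HasDerivAt u (u' x) x) {δ c : ℝ} (hδ : 0 < δ) (hc0 : 0 < c)
    (hH : ∀ᶠ x in 𝓝[≠] (0 : ℝ), δ * x ^ 2 < u x → u' x ≤ -c) :
    ∃ ρ > 0, (∀ x, |x| < ρ → ContinuousAt u x) ∧
      (∀ x, x ≠ 0 → |x| < ρ → HasDerivAt u (u' x) x ∧ (δ * x ^ 2 < u x → u' x ≤ -c)) ∧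
      (∀ a, -ρ < a → u a ≤ δ * a ^ 2 → ∀ x, a ≤ x → x ≤ 0 → u x ≤ δ * x ^ 2) ∧
      ∀ x, 0 ≤ x → x < ρ → u x ≤ δ * x ^ 2 := by
  rw [eventually_nhdsWithin_iff] at hd hH
  obtain ⟨ρ₀, hρ₀, hb⟩ := Metric.eventually_nhds_iff.1 (hc.and (hd.and hH))
  simp only [dist_zero_right, Real.norm_eq_abs] at hb
  refine ⟨min ρ₀ (c / (2 * δ)), lt_min hρ₀ (by positivity), ?_⟩
  set ρ := min ρ₀ (c / (2 * δ)) with hρ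
  have hb' : ∀ x, |x| < ρ → ContinuousAt u x ∧ (x ≠ 0 → HasDerivAt u (u' x) x) ∧
      (x ≠ 0 → δ * x ^ 2 < u x → u' x ≤ -c) := fun x hx => hb (hx.trans_le (min_le_left _ _))
  have hinv : ∀ a b, a ≤ b → -ρ < a → b < ρ → (∀ x ∈ Ioo a b, x ≠ 0) → u a ≤ δ * a ^ 2 →
      u b ≤ δ * b ^ 2 := fun a b hab ha hb hne hua => by
    have hlt : ∀ x ∈ Icc a b, |x| < ρ := fun x hx => abs_lt.2 ⟨ha.trans_le hx.1, hx.2.trans_lt hb⟩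
    have := nonpos_of_deriv_neg (φ := fun x => u x - δ * x ^ 2) (φ' := fun x => u' x - δ * (2 * x))
      (fun x hx => ((hb' x (hlt x hx)).1.sub (by fun_prop)).continuousWithinAt)
      (fun x hx => by
        have h1 := (hb' x (hlt x (Ioo_subset_Icc_self hx))).2.1 (hne x hx)
        have h2 : HasDerivAt (fun x : ℝ => x ^ 2) (2 * x) x := by simpa using hasDerivAt_pow 2 x
        exact h1.sub (h2.const_mul δ))
      (fun x hx hp => by
        have hx' := hlt x (Ioo_subset_Icc_self hx)
        have h1 := (hb' x hx').2.2 (hne x hx) (by linarith)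
        have h2 := hx'.trans_le (min_le_right ρ₀ _)
        rw [lt_div_iff₀ (by positivity)] at h2
        have h3 := neg_abs_le x
        nlinarith) (by linarith) b ⟨hab, le_rfl⟩
    linarith
  refine ⟨fun x hx => (hb' x hx).1, fun x h0 hx => ⟨(hb' x hx).2.1 h0, (hb' x hx).2.2 h0⟩,
    fun a ha hua x hax hx => ?_, fun x hx hxρ => ?_⟩
  · exact hinv a x hax ha (hx.trans_lt (lt_min hρ₀ (by positivity)))
      (fun y hy => (hy.2.trans_le hx).ne) hua
  · exact hinv 0 x hx (by rw [neg_lt_zero]; exact lt_min hρ₀ (by positivity)) hxρ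
      (fun y hy => hy.1.ne') (by simp [h0])

/-- A function that decreases at a definite rate wherever it exceeds a multiple of `x²` is
`o(x²)` from above. -/
theorem eventually_le_sq (hc : ∀ᶠ x in 𝓝 (0 : ℝ), ContinuousAt u x) (h0 : u 0 = 0)
    (hd : ∀ᶠ x in 𝓝[≠] (0 : ℝ), HasDerivAt u (u' x) x)
    (hH : ∀ δ > 0, ∃ c > 0, ∀ᶠ x in 𝓝[≠] (0 : ℝ), δ * x ^ 2 < u x → u' x ≤ -c)
    (hK : ∃ᶠ x in 𝓝[<] (0 : ℝ), u x ≤ x ^ 2) {δ : ℝ} (hδ : 0 < δ) :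
    ∀ᶠ x in 𝓝 (0 : ℝ), u x ≤ δ * x ^ 2 := by
  obtain ⟨c₁, hc₁, hH₁⟩ := hH 1 one_pos
  obtain ⟨ρ₁, hρ₁, -, -, hl₁, -⟩ := exists_barrier hc h0 hd one_pos hc₁ hH₁
  obtain ⟨c, hc0, hH'⟩ := hH δ hδ
  obtain ⟨ρ, hρ, hcont, hder, hl, hr⟩ := exists_barrier hc h0 hd hδ hc0 hH'
  obtain ⟨x₁, hx₁, hx₁ρ, hx₁0⟩ := (hK.and_eventually ((eventually_nhdsWithin_of_eventually_nhds
    (Ioi_mem_nhds (neg_lt_zero.2 hρ₁))).and self_mem_nhdsWithin)).exists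
  have hx₁0' : x₁ < 0 := hx₁0
  have hquad : ∀ x, x₁ ≤ x → x ≤ 0 → u x ≤ x ^ 2 := fun x h1 h2 => by
    have := hl₁ x₁ hx₁ρ (by rwa [one_mul]) x h1 h2
    rwa [one_mul] at this
  set x₂ := max x₁ (max (-(ρ / 2)) (-(c / 2))) with hx₂
  have hx₂0 : x₂ < 0 := max_lt hx₁0' (max_lt (by linarith) (by linarith))
  have hx₂ρ : -(ρ / 2) ≤ x₂ := (le_max_left _ _).trans (le_max_right _ _)
  have hx₂c : -(c / 2) ≤ x₂ := (le_max_right _ _).trans (le_max_right _ _)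
  obtain ⟨x₃, h23, h30, hx₃⟩ : ∃ x, x₂ ≤ x ∧ x < 0 ∧ u x ≤ δ * x ^ 2 := by
    by_contra! hno
    obtain ⟨ξ, hξ, h⟩ := exists_hasDerivAt_eq_slope u u' hx₂0
      (fun x hx => (hcont x (by rw [abs_of_nonpos hx.2]; linarith [hx.1])).continuousWithinAt)
      fun x hx => (hder x hx.2.ne (by rw [abs_of_neg hx.2]; linarith [hx.1])).1
    have h1 := (hder ξ hξ.2.ne (by rw [abs_of_neg hξ.2]; linarith [hξ.1])).2
      (hno ξ hξ.1.le hξ.2)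
    rw [h, h0, div_le_iff₀ (by linarith)] at h1
    have h2 := hquad x₂ (le_max_left _ _) hx₂0.le
    nlinarith
  filter_upwards [Ioo_mem_nhds h30 hρ] with x hx
  rcases le_total x 0 with h | h
  · exact hl x₃ (by linarith) hx₃ x hx.1.le h
  · exact hr x h hx.2

theorem isLittleO_sq_of_barriers (hc : ∀ᶠ x in 𝓝 (0 : ℝ), ContinuousAt u x) (h0 : u 0 = 0)
    (hd : ∀ᶠ x in 𝓝[≠] (0 : ℝ), HasDerivAt u (u' x) x)
    (hH : ∀ δ > 0, ∃ c > 0, ∀ᶠ x in 𝓝[≠] (0 : ℝ),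
      (δ * x ^ 2 < u x → u' x ≤ -c) ∧ (u x < -(δ * x ^ 2) → c ≤ u' x))
    (hK : ∃ᶠ x in 𝓝[<] (0 : ℝ), u x ≤ x ^ 2) (hK' : ∃ᶠ x in 𝓝[<] (0 : ℝ), -x ^ 2 ≤ u x) :
    u =o[𝓝 (0 : ℝ)] fun x => x ^ 2 := by
  rw [isLittleO_iff]
  intro δ hδ
  have h1 := eventually_le_sq hc h0 hd (fun δ hδ => by
    obtain ⟨c, hc, h⟩ := hH δ hδ
    exact ⟨c, hc, h.mono fun x hx => hx.1⟩) hK hδ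
  have h2 := eventually_le_sq (u := fun x => -u x) (u' := fun x => -u' x) (hc.mono fun x hx => hx.neg)
    (by simp [h0]) (hd.mono fun x hx => hx.neg) (fun δ hδ => by
    obtain ⟨c, hc, h⟩ := hH δ hδ
    exact ⟨c, hc, h.mono fun x hx hl => by linarith [hx.2 (by linarith)]⟩)
    (hK'.mono fun x hx => by linarith) hδ
  filter_upwards [h1, h2] with x h1 h2
  rw [Real.norm_eq_abs, Real.norm_eq_abs, abs_of_nonneg (sq_nonneg x), abs_le]
  exact ⟨by linarith, h1⟩

variable {f k : ℝ → ℝ} {k₀ : ℝ}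

theorem frequently_le_sq_of_singular_ode (hk₀ : 0 < k₀)
    (hd : ∀ᶠ x in 𝓝[≠] (0 : ℝ), HasDerivAt u (f x - k x / x ^ 2 * u x) x)
    (hf : Tendsto f (𝓝[≠] 0) (𝓝 0)) (hk : Tendsto k (𝓝[≠] 0) (𝓝 k₀)) :
    ∃ᶠ x in 𝓝[<] (0 : ℝ), u x ≤ x ^ 2 := by
  intro hno
  simp only [not_le] at hno
  have hf1 : ∀ᶠ x in 𝓝[≠] (0 : ℝ), f x < k₀ / 4 := hf.eventually (Iio_mem_nhds (by positivity))
  have hk1 : ∀ᶠ x in 𝓝[≠] (0 : ℝ), k₀ / 2 < k x := hk.eventually (Ioi_mem_nhds (by linarith))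
  obtain ⟨a, ha : a < 0, hb⟩ := mem_nhdsLT_iff_exists_Ioo_subset.1
    (((hd.and (hf1.and hk1)).filter_mono (nhdsLT_le_nhdsNE 0)).and hno)
  set κ := k₀ / 4 with hκ
  have hE : ∀ x ∈ Ioo a 0, HasDerivAt (fun x => u x * Real.exp (-(κ / x)))
      ((f x - k x / x ^ 2 * u x) * Real.exp (-(κ / x)) +
        u x * (Real.exp (-(κ / x)) * (κ / x ^ 2))) x := fun x hx => by
    have h1 := ((hasDerivAt_inv hx.2.ne).const_mul κ).neg.exp
    exact (hb hx).1.1.mul (h1.congr_deriv (by simp [div_eq_mul_inv]))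
  have hanti : AntitoneOn (fun x => u x * Real.exp (-(κ / x))) (Ioo a 0) := by
    refine antitoneOn_of_hasDerivWithinAt_nonpos (convex_Ioo a 0)
      (fun x hx => (hE x hx).continuousAt.continuousWithinAt)
      (fun x hx => (hE x (interior_subset hx)).hasDerivWithinAt) fun x hx => ?_
    obtain ⟨⟨-, h1, h2⟩, h3⟩ := hb (interior_subset hx)
    have hx2 : 0 < x ^ 2 := by have := (interior_subset hx).2.ne; positivity
    have h4 : κ ≤ (k x - κ) / x ^ 2 * u x := by rw [div_mul_eq_mul_div, le_div_iff₀ hx2]; nlinarith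
    have e : (f x - k x / x ^ 2 * u x) * Real.exp (-(κ / x)) +
        u x * (Real.exp (-(κ / x)) * (κ / x ^ 2))
        = Real.exp (-(κ / x)) * (f x - (k x - κ) / x ^ 2 * u x) := by ring
    rw [e]
    exact mul_nonpos_of_nonneg_of_nonpos (Real.exp_pos _).le (by linarith)
  have hm : a / 2 ∈ Ioo a 0 := ⟨by linarith, by linarith⟩
  set C := u (a / 2) * Real.exp (-(κ / (a / 2)))
  have hC : 0 ≤ C := mul_nonneg ((sq_nonneg _).trans (hb hm).2.le) (Real.exp_pos _).le
  set x := max (a / 2) (-(κ ^ 3 / (6 * (C + 1)))) with hx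
  have hκ0 : 0 < κ := by positivity
  have hx0 : x < 0 := max_lt hm.2 (neg_lt_zero.2 (by positivity))
  have hxm : x ∈ Ioo a 0 := ⟨hm.1.trans_le (le_max_left _ _), hx0⟩
  have h1 := hanti hm hxm (le_max_left _ _)
  have hs : 0 ≤ -(κ / x) := by rw [← div_neg]; exact (div_pos hκ0 (by linarith)).le
  have h2 := Real.pow_div_factorial_le_exp _ hs 3
  have h3 : x ^ 2 * ((-(κ / x)) ^ 3 / (Nat.factorial 3 : ℝ)) = κ ^ 3 / (6 * -x) := by
    have := hx0.ne
    norm_num [Nat.factorial]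
    field_simp
  have h4 : C + 1 ≤ κ ^ 3 / (6 * -x) := by
    have h5 : -(κ ^ 3 / (6 * (C + 1))) ≤ x := le_max_right _ _
    rw [neg_le, le_div_iff₀ (by positivity)] at h5
    rw [le_div_iff₀ (by linarith)]
    linarith
  have h6 := mul_le_mul (hb hxm).2.le h2
    (div_nonneg (pow_nonneg hs 3) (by positivity)) ((sq_nonneg _).trans (hb hxm).2.le)
  linarith

/-- Solutions of `u' = f - k x⁻² u` with `f → 0`, `k → k₀ ≠ 0` that vanish at `0` are `o(x²)`. -/
theorem isLittleO_sq_of_singular_ode (hc : ∀ᶠ x in 𝓝 (0 : ℝ), ContinuousAt u x) (h0 : u 0 = 0)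
    (hk₀ : k₀ ≠ 0) (hd : ∀ᶠ x in 𝓝[≠] (0 : ℝ), HasDerivAt u (f x - k x / x ^ 2 * u x) x)
    (hf : Tendsto f (𝓝[≠] 0) (𝓝 0)) (hk : Tendsto k (𝓝[≠] 0) (𝓝 k₀)) :
    u =o[𝓝 (0 : ℝ)] fun x => x ^ 2 := by
  wlog hpos : 0 < k₀ generalizing u f k k₀
  · have hneg : Tendsto (fun x : ℝ => -x) (𝓝 0) (𝓝 0) := by
      simpa using (continuous_neg.tendsto (0 : ℝ))
    have hneg' : Tendsto (fun x : ℝ => -x) (𝓝[≠] 0) (𝓝[≠] 0) := by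
      refine tendsto_nhdsWithin_of_tendsto_nhds_of_eventually_within _
        (hneg.mono_left nhdsWithin_le_nhds) ?_
      filter_upwards [self_mem_nhdsWithin] with x hx
      exact neg_ne_zero.2 hx
    have key := this (u := fun x => u (-x)) (f := fun x => -f (-x)) (k := fun x => -k (-x))
      (k₀ := -k₀) ((hneg.eventually hc).mono fun x hx => hx.comp continuous_neg.continuousAt)
      (by simp [h0]) (neg_ne_zero.2 hk₀)
      ((hneg'.eventually hd).mono fun x hx => by
        have := hx.scomp x (hasDerivAt_neg x)
        refine this.congr_deriv ?_
        simp only [smul_eq_mul, even_two, Even.neg_pow]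
        ring)
      (by simpa using (hf.comp hneg').neg) (hk.comp hneg').neg
      (by have := lt_of_le_of_ne (not_lt.1 hpos) hk₀; linarith)
    refine (key.comp_tendsto hneg).congr (fun x => ?_) fun x => ?_ <;> simp
  have hf' : ∀ ε > 0, ∀ᶠ x in 𝓝[≠] (0 : ℝ), |f x| < ε := fun ε hε => by
    have := hf.abs
    rw [abs_zero] at this
    exact this.eventually (Iio_mem_nhds hε)
  have hk1 : ∀ᶠ x in 𝓝[≠] (0 : ℝ), k₀ / 2 < k x := hk.eventually (Ioi_mem_nhds (by linarith))
  refine isLittleO_sq_of_barriers hc h0 hd (fun δ hδ => ⟨k₀ * δ / 4, by positivity, ?_⟩) ?_ ?_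
  · filter_upwards [hf' (k₀ * δ / 4) (by positivity), hk1, self_mem_nhdsWithin] with x h1 h2 hx
    have hx2 : 0 < x ^ 2 := by have : x ≠ 0 := hx; positivity
    rw [abs_lt] at h1
    refine ⟨fun h3 => ?_, fun h3 => ?_⟩
    · have : k₀ * δ / 2 ≤ k x / x ^ 2 * u x := by
        rw [div_mul_eq_mul_div, le_div_iff₀ hx2]
        have := mul_le_mul h2.le h3.le (by positivity) (by linarith)
        linarith
      linarith
    · have : k₀ * δ / 2 ≤ k x / x ^ 2 * -u x := by
        rw [div_mul_eq_mul_div, le_div_iff₀ hx2]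
        have := mul_le_mul h2.le (show δ * x ^ 2 ≤ -u x by linarith) (by positivity) (by linarith)
        linarith
      linarith
  · exact frequently_le_sq_of_singular_ode hpos hd hf hk
  · refine (frequently_le_sq_of_singular_ode (u := fun x => -u x) (f := fun x => -f x)
      hpos (hd.mono fun x hx => hx.neg.congr_deriv (by ring))
      (by simpa using hf.neg) hk).mono fun x hx => by linarith

end Barrier

end

section

open Filter Asymptotics Complex

/-! ### A leaf tangent to the centre direction -/

/-- On a closed double sector that avoids the real axis the tangents are bounded away from 0. -/
theorem exists_le_abs_quarterTan (K : ℝ) : ∃ τ > 0, ∀ w : ℂ, |w.re| ≤ K * |w.im| → w.im ≠ 0 →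
    τ ≤ |quarterTan w| := by
  set S : Set ℂ := Metric.sphere 0 1 ∩ {w | |w.re| ≤ K * |w.im|} with hS
  have hSc : IsCompact S :=
    (isCompact_sphere 0 1).inter_right (isClosed_le (by fun_prop) (by fun_prop))
  have hSi : ∀ w ∈ S, w.im ≠ 0 := fun w hw hi => by
    have h2 : |w.re| ≤ K * |w.im| := hw.2
    rw [hi, abs_zero, mul_zero] at h2
    have h3 := hw.1
    rw [Complex.ext (z := w) (w := 0) (abs_eq_zero.1 (le_antisymm h2 (abs_nonneg _))) hi] at h3
    simp at h3
  have hpos : ∀ w ∈ S, 0 < |quarterTan w| := fun w hw => abs_pos.2 (by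
    rcases lt_or_gt_of_ne (hSi w hw) with h | h
    · exact (quarterTan_neg_of_im_neg h).ne
    · exact (quarterTan_pos_of_im_pos h).ne')
  have hcont : ContinuousOn (fun w => |quarterTan w|) S := fun w hw =>
    ((contDiffAt_quarterTan (n := 0) (mem_slitPlane_iff.2 (Or.inr (hSi w hw)))).continuousAt.abs
      ).continuousWithinAt
  obtain ⟨τ, hτ, hb⟩ := hSc.exists_forall_le' hcont hpos
  refine ⟨τ, hτ, fun w hw hi => ?_⟩
  have hn : 0 < ‖w‖ := norm_pos_iff.2 fun h => hi (by rw [h]; rfl)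
  have hmem : ((‖w‖⁻¹ : ℝ) : ℂ) * w ∈ S := by
    refine ⟨by simp [hn.ne'], ?_⟩
    simp only [mem_ofPred_eq, re_ofReal_mul, im_ofReal_mul, abs_mul, abs_inv, abs_norm]
    have := mul_le_mul_of_nonneg_left hw (inv_pos.2 hn).le
    linarith
  have := hb _ hmem
  rwa [quarterTan_smul (inv_pos.2 hn)] at this

theorem eventually_abs_slopeH_sub_le {a b : ℝ² → ℂ} {T : ℝ² → ℝ} (ha : ContinuousAt a 0)
    (hb : ContinuousAt b 0) (ha0 : a 0 = 1) (hb0 : b 0 = I) (hT : ∀ᶠ z in 𝓝 0, |T z| ≤ 1)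
    {ε : ℝ} (hε : 0 < ε) : ∀ᶠ z in 𝓝 (0 : ℝ²), |slopeH a b T z.1 z.2 - T z| ≤ ε := by
  set δ := min (1 / 4) (ε / 8) with hδ
  have hδ0 : 0 < δ := lt_min (by norm_num) (by positivity)
  have close : ∀ {f : ℝ² → ℂ} {w : ℂ}, ContinuousAt f 0 → f 0 = w →
      ∀ᶠ z in 𝓝 0, |(f z).re - w.re| ≤ δ ∧ |(f z).im - w.im| ≤ δ := fun {f w} hf hw => by
    filter_upwards [hf.eventually (Metric.ball_mem_nhds _ hδ0)] with z hz
    rw [hw, dist_eq_norm] at hz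
    exact ⟨(abs_re_le_norm (f z - w)).trans hz.le, (abs_im_le_norm (f z - w)).trans hz.le⟩
  filter_upwards [close ha ha0, close hb hb0, hT] with z h1 h2 h3
  simp only [one_re, one_im, I_re, I_im, sub_zero] at h1 h2
  obtain ⟨a1, a2⟩ := h1
  obtain ⟨b1, b2⟩ := h2
  have hδ1 := min_le_left (1 / 4) (ε / 8)
  have hδ2 := min_le_right (1 / 4) (ε / 8)
  have hbT : |(b z).re * T z| ≤ δ := by
    rw [abs_mul]; nlinarith [abs_nonneg (T z), abs_nonneg (b z).re]
  have hden : 1 / 2 ≤ (b z).im + -(b z).re * T z := by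
    have := abs_le.1 hbT
    have := abs_le.1 b2
    linarith
  have e : slopeH a b T z.1 z.2 - T z
      = (-(a z).im + ((a z).re - 1 - ((b z).im - 1)) * T z + (b z).re * T z * T z)
        / ((b z).im + -(b z).re * T z) := by
    rw [slopeH, eq_div_iff (by linarith), sub_mul, div_mul_cancel₀ _ (by
      change (b z).im + -(b z).re * T z ≠ 0; linarith)]
    ring
  rw [e, abs_div, abs_of_pos (by linarith : 0 < (b z).im + -(b z).re * T z), div_le_iff₀ (by linarith)]
  have n1 : |((a z).re - 1 - ((b z).im - 1)) * T z| ≤ 2 * δ := by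
    rw [abs_mul]
    have := abs_sub ((a z).re - 1) ((b z).im - 1)
    nlinarith [abs_nonneg (T z), abs_nonneg ((a z).re - 1 - ((b z).im - 1))]
  have n2 : |(b z).re * T z * T z| ≤ δ := by
    rw [abs_mul]; nlinarith [abs_nonneg (T z), abs_nonneg ((b z).re * T z)]
  have n3 := abs_add_three (-(a z).im) (((a z).re - 1 - ((b z).im - 1)) * T z) ((b z).re * T z * T z)
  rw [abs_neg] at n3
  nlinarith

namespace SaddleNodeGerm

variable {A B : ℝ² → ℝ} {α β : ℝ} {a b : ℝ² → ℂ}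

theorem exists_le_abs_tangent (h : SaddleNodeGerm A B α β) {δ : ℝ} (hδ : 0 < δ) :
    ∃ τ > 0, ∀ᶠ z in 𝓝 (0 : ℝ²), z.1 ≠ 0 → (δ * z.1 ^ 2 < A z → quarterTan ⟨B z, -A z⟩ ≤ -τ) ∧
      (A z < -(δ * z.1 ^ 2) → τ ≤ quarterTan ⟨B z, -A z⟩) := by
  obtain ⟨c, hc, K, hK, hb⟩ := h.exists_bounds
  have hα := h.pos
  set K' := |β| * (2 / α * (1 + K / δ)) + K * (1 / δ + 2 / α * (1 + K / δ)) with hK'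
  obtain ⟨τ, hτ, hT⟩ := exists_le_abs_quarterTan K'
  refine ⟨τ, hτ, ?_⟩
  filter_upwards [hb, eventually_norm_le (show 0 < min 1 (α / (2 * K)) from
    lt_min one_pos (by positivity))] with z hz hn hz1
  have key : δ * z.1 ^ 2 < |A z| → τ ≤ |quarterTan ⟨B z, -A z⟩| := fun hA => by
    have hx2 : z.1 ^ 2 ≤ |A z| / δ := by rw [le_div_iff₀ hδ]; linarith
    have hy1 : |z.2| ≤ min 1 (α / (2 * K)) := (norm_snd_le z).trans hn
    have hy2 : |z.2| ≤ α / (2 * K) := hy1.trans (min_le_right _ _)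
    rw [le_div_iff₀ (by positivity)] at hy2
    have hns := norm_sq_le z
    have hys : z.2 ^ 2 = |z.2| * |z.2| := by rw [← sq_abs]; ring
    have hKy : K * z.2 ^ 2 ≤ α / 2 * |z.2| := by rw [hys]; nlinarith [abs_nonneg z.2]
    have h1 : α * |z.2| ≤ |A z| + K * ‖z‖ ^ 2 := by
      have := abs_sub_abs_le_abs_sub (α * z.2) (A z)
      rw [abs_sub_comm, abs_mul, abs_of_pos hα] at this
      linarith [hz.valA]
    have h2 : |z.2| ≤ 2 / α * (1 + K / δ) * |A z| := by
      have : α / 2 * |z.2| ≤ (1 + K / δ) * |A z| := by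
        have e : (1 + K / δ) * |A z| = |A z| + K * (|A z| / δ) := by ring
        rw [e]; nlinarith
      calc |z.2| = 2 / α * (α / 2 * |z.2|) := by field_simp
        _ ≤ 2 / α * ((1 + K / δ) * |A z|) := mul_le_mul_of_nonneg_left this (by positivity)
        _ = _ := by ring
    have h3 : z.2 ^ 2 ≤ |z.2| := by
      rw [hys]; nlinarith [abs_nonneg z.2, hy1.trans (min_le_left 1 _)]
    have h4 : |B z| ≤ |β| * |z.2| + K * ‖z‖ ^ 2 := by
      have := abs_sub_abs_le_abs_sub (B z) (β * z.2)
      rw [abs_mul] at this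
      linarith [hz.valB]
    have hAne : A z ≠ 0 := fun h0 => by rw [h0, abs_zero] at hA; nlinarith [sq_nonneg z.1]
    refine hT ⟨B z, -A z⟩ ?_ (neg_ne_zero.2 hAne)
    rw [abs_neg]
    calc |B z| ≤ |β| * |z.2| + K * ‖z‖ ^ 2 := h4
      _ ≤ |β| * (2 / α * (1 + K / δ) * |A z|)
          + K * (|A z| / δ + 2 / α * (1 + K / δ) * |A z|) :=
        add_le_add (mul_le_mul_of_nonneg_left h2 (abs_nonneg β))
          (mul_le_mul_of_nonneg_left (by linarith) hK.le)
      _ = K' * |A z| := by rw [hK']; ring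
  have hδz : 0 ≤ δ * z.1 ^ 2 := by positivity
  refine ⟨fun hA => ?_, fun hA => ?_⟩
  · have h1 := key (by rwa [abs_of_pos (by linarith)])
    have h2 : quarterTan ⟨B z, -A z⟩ < 0 := quarterTan_neg_of_im_neg (by
      change -A z < 0; linarith)
    rw [abs_of_neg h2] at h1
    linarith
  · have h1 := key (by rw [abs_of_neg (by linarith)]; linarith)
    have h2 : 0 < quarterTan ⟨B z, -A z⟩ := quarterTan_pos_of_im_pos (by
      change 0 < -A z; linarith)
    rwa [abs_of_pos h2] at h1

/-- Along the field of slopes `A` decreases where it is positive, and increases where it is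
negative. -/
theorem exists_rate (h : SaddleNodeGerm A B α β) {P : ℝ → ℝ → ℝ}
    (hP1 : ∀ᶠ z : ℝ² in 𝓝 0, |P z.1 z.2| ≤ 1)
    (hP : ∀ ε > 0, ∀ᶠ z : ℝ² in 𝓝 0, |P z.1 z.2 - quarterTan ⟨B z, -A z⟩| ≤ ε)
    {δ : ℝ} (hδ : 0 < δ) :
    ∃ c > 0, ∀ᶠ z in 𝓝 (0 : ℝ²), z.1 ≠ 0 →
      (δ * z.1 ^ 2 < A z → 𝐃 A z (1, P z.1 z.2) ≤ -c) ∧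
      (A z < -(δ * z.1 ^ 2) → c ≤ 𝐃 A z (1, P z.1 z.2)) := by
  obtain ⟨τ, hτ, hT⟩ := h.exists_le_abs_tangent hδ
  obtain ⟨c₁, -, K, hK, hb⟩ := h.exists_bounds
  have hα := h.pos
  refine ⟨α * τ / 4, by positivity, ?_⟩
  filter_upwards [hT, hb, hP1, hP (τ / 2) (by positivity),
    eventually_norm_le (show 0 < α * τ / (4 * K) by positivity)] with z hT hb hP1 hP hn hz
  rw [le_div_iff₀ (by positivity)] at hn
  have hv : ‖((1, P z.1 z.2) : ℝ²)‖ ≤ 1 := by rw [Prod.norm_def]; exact max_le (by simp) hP1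
  have hd := abs_le.1 ((hb.fderivA (1, P z.1 z.2)).trans
    (mul_le_of_le_one_right (by positivity) hv))
  have hP' := abs_le.1 hP
  simp only at hd
  refine ⟨fun hA => ?_, fun hA => ?_⟩
  · have := (hT hz).1 hA
    nlinarith
  · have := (hT hz).2 hA
    nlinarith

theorem exists_zero_on_vertical (h : SaddleNodeGerm A B α β) :
    ∀ᶠ x in 𝓝 (0 : ℝ), ∃ y, |y| ≤ |x| ∧ A (x, y) = 0 := by
  obtain ⟨c₁, -, K, hK, hb⟩ := h.exists_bounds
  have hα := h.pos
  obtain ⟨ρ, hρ, hball⟩ := Metric.eventually_nhds_iff.1 hb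
  filter_upwards [Ioo_mem_nhds (neg_lt_zero.2 (show 0 < min ρ (α / K) from lt_min hρ (by positivity)))
    (lt_min hρ (show 0 < α / K by positivity))] with x hx
  have hxm := abs_lt.2 hx
  have hxρ : |x| < ρ := hxm.trans_le (min_le_left _ _)
  have hxα : |x| < α / K := hxm.trans_le (min_le_right _ _)
  rw [lt_div_iff₀ hK] at hxα
  have hnorm : ∀ y, |y| ≤ |x| → ‖(x, y)‖ = |x| := fun y hy => by
    rw [Prod.norm_def, Real.norm_eq_abs, Real.norm_eq_abs]; exact max_eq_left hy
  have hB : ∀ y, |y| ≤ |x| → GermBounds A B α β _ K (x, y) := fun y hy => hball (by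
    rw [dist_zero_right, hnorm y hy]; exact hxρ)
  have hcont : ContinuousOn (fun y => A (x, y)) (Icc (-|x|) |x|) := fun y hy =>
    (ContinuousAt.comp (f := fun y => (x, y)) (hB y (abs_le.2 hy)).contDiffA.continuousAt
      (by fun_prop)).continuousWithinAt
  have h1 := abs_le.1 (hB |x| (abs_abs x).le).valA
  have h2 := abs_le.1 (hB (-|x|) (by rw [abs_neg, abs_abs])).valA
  rw [hnorm _ (abs_abs x).le] at h1
  rw [hnorm _ (by rw [abs_neg, abs_abs])] at h2
  simp only at h1 h2
  have hx0 := abs_nonneg x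
  have hKx : K * |x| ^ 2 ≤ α * |x| := by nlinarith
  obtain ⟨y, hy, hy0⟩ := intermediate_value_Icc (by linarith) hcont
    (show (0 : ℝ) ∈ Icc _ _ from ⟨by linarith, by linarith⟩)
  exact ⟨y, abs_le.2 hy, hy0⟩

theorem exists_leaf_to_zero (h : SaddleNodeGerm A B α β) {κ R : ℝ} {P : ℝ → ℝ → ℝ}
    (hp : LocalSlope κ R P) (hR : 0 < R)
    (hP : ∀ ε > 0, ∀ᶠ z : ℝ² in 𝓝 0, |P z.1 z.2 - quarterTan ⟨B z, -A z⟩| ≤ ε) :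
    ∃ η : ℝ → ℝ, Continuous η ∧ (∀ x, |η x| ≤ |x|) ∧
      (∀ᶠ x in 𝓝[≠] (0 : ℝ), HasDerivAt η (P x (η x)) x) ∧
      (fun x => A (x, η x)) =o[𝓝 (0 : ℝ)] fun x => x ^ 2 := by
  have hP1 : ∀ᶠ z : ℝ² in 𝓝 0, |P z.1 z.2| ≤ 1 := by
    filter_upwards [eventually_norm_le hR] with z hz
    exact (hp.bound _ _ ((norm_fst_le z).trans hz) ((norm_snd_le z).trans hz)).trans hp.lt_one.le
  obtain ⟨c, -, K, hK, hb⟩ := h.exists_bounds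
  have hα := h.pos
  obtain ⟨c₁, hc₁, hrate⟩ := h.exists_rate hP1 hP one_pos
  obtain ⟨ρ, hρ, hball⟩ := Metric.eventually_nhds_iff.1 (hb.and hrate)
  simp only [dist_zero_right] at hball
  set m := min (min (ρ / 2) (R / 2)) (min (c₁ / 2) (α / (2 * K))) with hm
  have hm0 : 0 < m := lt_min (lt_min (by linarith) (by linarith)) (lt_min (by linarith) (by positivity))
  have hm1 : m ≤ ρ / 2 := (min_le_left _ _).trans (min_le_left _ _)
  have hm2 : m ≤ R / 2 := (min_le_left _ _).trans (min_le_right _ _)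
  have hm3 : m ≤ c₁ / 2 := (min_le_right _ _).trans (min_le_left _ _)
  have hm4 : m ≤ α / (2 * K) := (min_le_right _ _).trans (min_le_right _ _)
  obtain ⟨x₀, ⟨⟨y₀, hy₀, hA₀⟩, hx₀m⟩, hx₀⟩ := ((eventually_nhdsWithin_of_eventually_nhds
    (s := Iio (0 : ℝ)) (h.exists_zero_on_vertical.and
      (Ioi_mem_nhds (neg_lt_zero.2 hm0)))).and self_mem_nhdsWithin).exists
  have hx₀' : x₀ < 0 := hx₀
  have hx₀m' : -m < x₀ := hx₀m
  rw [abs_of_neg hx₀'] at hy₀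
  have hP0 := hp.slopeField hR one_pos
  obtain ⟨η, hη, hη₀⟩ := hP0.exists_leaf x₀ y₀
  have hη1 : ∀ x y, |η x - η y| ≤ |x - y| := fun x y =>
    (hη.lip x y).trans (mul_le_of_le_one_left (abs_nonneg _) hp.lt_one.le)
  have hder : ∀ x, x ≠ 0 → |x| ≤ R → |η x| ≤ R → HasDerivAt η (P x (η x)) x := fun x h0 h1 h2 => by
    have := hη.deriv x (Or.inl h0)
    rwa [one_mul, one_mul, clamp_of_abs_le h1, clamp_of_abs_le h2] at this
  have hderA : ∀ x, HasDerivAt η (P x (η x)) x → ContDiffAt ℝ 1 A (x, η x) →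
      HasDerivAt (fun x => A (x, η x)) (𝐃 A (x, η x) (1, P x (η x))) x := fun x h1 h2 =>
    (h2.differentiableAt one_ne_zero).hasFDerivAt.comp_hasDerivAt x ((hasDerivAt_id x).prodMk h1)
  have hin : ∀ x ∈ Icc x₀ 0, |x| < m ∧ |η x| < 2 * m := fun x hx => by
    have h1 := abs_le.1 (hη1 x x₀)
    rw [hη₀, abs_of_nonneg (by linarith [hx.1])] at h1
    have h2 := abs_le.1 hy₀
    exact ⟨abs_lt.2 ⟨by linarith [hx.1], by linarith [hx.2]⟩,
      abs_lt.2 ⟨by linarith [hx.2], by linarith [hx.2]⟩⟩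
  have hnorm : ∀ x ∈ Icc x₀ 0, ‖(x, η x)‖ < ρ := fun x hx => by
    obtain ⟨h1, h2⟩ := hin x hx
    rw [Prod.norm_def]
    exact max_lt (by rw [Real.norm_eq_abs]; linarith) (by rw [Real.norm_eq_abs]; linarith)
  have hcA : ∀ x ∈ Icc x₀ 0, ContinuousAt (fun x => A (x, η x)) x := fun x hx =>
    ContinuousAt.comp (f := fun x => (x, η x)) (hball (hnorm x hx)).1.contDiffA.continuousAt
      (continuousAt_id.prodMk hη.continuous.continuousAt)
  have hinv : ∀ σ : ℝ, σ = 1 ∨ σ = -1 → ∀ x ∈ Icc x₀ 0, σ * A (x, η x) - x ^ 2 ≤ 0 := by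
    intro σ hσ
    refine nonpos_of_deriv_neg
      (φ' := fun x => σ * 𝐃 A (x, η x) (1, P x (η x)) - 2 * x)
      (fun x hx => ((continuousAt_const.mul (hcA x hx)).sub (by fun_prop)).continuousWithinAt)
      (fun x hx => ?_) (fun x hx hpos => ?_) ?_
    · have hx' := Ioo_subset_Icc_self hx
      obtain ⟨h1, h2⟩ := hin x hx'
      have h3 : HasDerivAt (fun x : ℝ => x ^ 2) (2 * x) x := by simpa using hasDerivAt_pow 2 x
      exact ((hderA x (hder x hx.2.ne (by linarith) (by linarith))
        (hball (hnorm x hx')).1.contDiffA).const_mul σ).sub h3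
    · have hx' := Ioo_subset_Icc_self hx
      have h1 := (hin x hx').1
      rw [abs_of_neg hx.2] at h1
      obtain ⟨h2, h3⟩ := (hball (hnorm x hx')).2 hx.2.ne
      simp only [one_mul] at h2 h3
      rcases hσ with rfl | rfl
      · have := h2 (by linarith)
        linarith
      · have := h3 (by linarith)
        linarith
    · rw [hη₀, hA₀]; nlinarith [sq_nonneg x₀]
  have hu : ∀ x ∈ Icc x₀ 0, A (x, η x) ≤ x ^ 2 ∧ -x ^ 2 ≤ A (x, η x) := fun x hx => by
    have h1 := hinv 1 (Or.inl rfl) x hx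
    have h2 := hinv (-1) (Or.inr rfl) x hx
    constructor <;> linarith
  have h00 : (0 : ℝ) ∈ Icc x₀ 0 := ⟨hx₀'.le, le_rfl⟩
  have hη0 : η 0 = 0 := by
    have hA0 : A (0, η 0) = 0 := by
      obtain ⟨h1, h2⟩ := hu 0 h00
      have : (0 : ℝ) ^ 2 = 0 := by norm_num
      linarith
    have hv := (hball (hnorm 0 h00)).1.valA
    have hn : ‖((0, η 0) : ℝ²)‖ = |η 0| := by rw [Prod.norm_def]; simp
    rw [hn, hA0, zero_sub, abs_neg, abs_mul, abs_of_pos hα] at hv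
    by_contra hne
    have hpos := abs_pos.2 hne
    have h1 : α ≤ K * |η 0| := by
      have : α * |η 0| ≤ K * |η 0| * |η 0| := by simp only at hv; linarith
      exact le_of_mul_le_mul_right this hpos
    have h2 := (hin 0 h00).2
    rw [le_div_iff₀ (by positivity)] at hm4
    nlinarith
  have habs : ∀ x, |η x| ≤ |x| := fun x => by simpa [hη0] using hη1 x 0
  have hlim : Tendsto (fun x => (x, η x)) (𝓝 0) (𝓝 0) := by
    have := (continuous_id.prodMk hη.continuous).tendsto 0
    rwa [id, hη0] at this
  have hlim' : Tendsto (fun x => (x, η x)) (𝓝[≠] 0) (𝓝 0) := hlim.mono_left nhdsWithin_le_nhds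
  have hderη : ∀ᶠ x in 𝓝[≠] (0 : ℝ), HasDerivAt η (P x (η x)) x := by
    filter_upwards [hlim'.eventually (eventually_norm_le hR), self_mem_nhdsWithin] with x h1 h2
    exact hder x h2 ((norm_fst_le (x, η x)).trans h1) ((norm_snd_le (x, η x)).trans h1)
  have hK : ∀ᶠ x in 𝓝[<] (0 : ℝ), A (x, η x) ≤ x ^ 2 ∧ -x ^ 2 ≤ A (x, η x) := by
    filter_upwards [Ioo_mem_nhdsLT hx₀'] with x hx using hu x (Ioo_subset_Icc_self hx)
  refine ⟨η, hη.continuous, habs, hderη, isLittleO_sq_of_barriers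
    (u' := fun x => 𝐃 A (x, η x) (1, P x (η x))) ?_ ?_ ?_ (fun δ hδ => ?_)
    (hK.mono fun x hx => hx.1).frequently (hK.mono fun x hx => hx.2).frequently⟩
  · filter_upwards [hlim.eventually hb] with x hx
    exact ContinuousAt.comp (f := fun x => (x, η x)) hx.contDiffA.continuousAt
      (continuousAt_id.prodMk hη.continuous.continuousAt)
  · rw [hη0]; exact h.zeroA
  · filter_upwards [hderη, hlim'.eventually hb] with x h1 h2 using hderA x h1 h2.contDiffA
  · obtain ⟨c, hc, hr⟩ := h.exists_rate hP1 hP hδ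
    refine ⟨c, hc, ?_⟩
    filter_upwards [hlim'.eventually hr, self_mem_nhdsWithin] with x h1 h2 using h1 h2

/-- The leaf with slopes `p` passing through the saddle-node in the centre direction. -/
theorem exists_central_leaf (h : SaddleNodeGerm A B α β) (ha : ContDiffAt ℝ 1 a 0)
    (hb : ContDiffAt ℝ 1 b 0) (ha0 : a 0 = 1) (hb0 : b 0 = I) :
    ∃ η p : ℝ → ℝ, Continuous η ∧ η 0 = 0 ∧ p 0 = 0 ∧ ContinuousAt p 0 ∧
      (∀ᶠ x in 𝓝[≠] (0 : ℝ), HasDerivAt η (p x) x ∧ DifferentiableAt ℝ p x ∧ ∃ s : ℝ, 0 < s ∧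
          (a (x, η x) + b (x, η x) * p x) ^ 4 = s * (⟨B (x, η x), -A (x, η x)⟩ : ℂ)) ∧
      (fun x => A (x, η x)) =o[𝓝 (0 : ℝ)] fun x => x ^ 2 := by
  obtain ⟨κ₀, hκ0, hκ1, hT⟩ := h.exists_tangent_bounds
  set T : ℝ² → ℝ := fun z => quarterTan ⟨B z, -A z⟩ with hTd
  obtain ⟨R, hR, κ, K₁, -, hp, hq, hd⟩ := exists_slopes (T := T) ha hb ha0 hb0 hκ0 hκ1
    (hT.mono fun z hz => hz.1) (hT.mono fun z hz h0 => (hz.2 h0).2.1)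
  have hclose : ∀ ε > 0, ∀ᶠ z : ℝ² in 𝓝 0, |slopeH a b T z.1 z.2 - T z| ≤ ε := fun ε hε =>
    eventually_abs_slopeH_sub_le ha.continuousAt hb.continuousAt ha0 hb0
      (hT.mono fun z hz => hz.1.trans hκ1.le) hε
  obtain ⟨η, hη, habs, hder, hA⟩ := h.exists_leaf_to_zero hp hR hclose
  have hη0 : η 0 = 0 := abs_nonpos_iff.1 ((habs 0).trans_eq abs_zero)
  have hlim : Tendsto (fun x => (x, η x)) (𝓝 0) (𝓝 0) := by
    have := (continuous_id.prodMk hη).tendsto 0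
    rwa [id, hη0] at this
  have hlim' : Tendsto (fun x => (x, η x)) (𝓝[≠] 0) (𝓝 0) := hlim.mono_left nhdsWithin_le_nhds
  have hT0 : T (0, 0) = 0 := by
    change quarterTan ⟨B 0, -A 0⟩ = 0
    rw [h.zeroA, h.zeroB, neg_zero]
    exact quarterTan_zero
  have hp0 : slopeH a b T 0 0 = 0 := by
    have : a (0, 0) = 1 := ha0
    rw [slopeH, hT0, this]; simp
  obtain ⟨c, hc, K, hK, hbd⟩ := h.exists_bounds
  have hα := h.pos
  have hBpos : ∀ᶠ x in 𝓝[≠] (0 : ℝ), c / 2 * x ^ 2 ≤ B (x, η x) := by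
    set ε := c / (4 * (|β / α| + 1)) with hε
    have hε0 : 0 < ε := by positivity
    filter_upwards [hlim'.eventually hbd, (hA.bound hε0).filter_mono nhdsWithin_le_nhds,
      (hA.bound one_pos).filter_mono nhdsWithin_le_nhds,
      eventually_nhdsWithin_of_eventually_nhds (Ioo_mem_nhds
        (neg_lt_zero.2 (show 0 < min 1 (c * α ^ 2 / (4 * K * (1 + K) ^ 2)) from
          lt_min one_pos (by positivity)))
        (lt_min one_pos (show 0 < c * α ^ 2 / (4 * K * (1 + K) ^ 2) by positivity)))]
      with x hx h1 h2 hxs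
    rw [Real.norm_eq_abs, Real.norm_eq_abs, abs_of_nonneg (sq_nonneg x)] at h1 h2
    have hxm := abs_lt.2 hxs
    have hx1 := hxm.trans_le (min_le_left _ _)
    have hx2 := (hxm.trans_le (min_le_right _ _)).le
    rw [le_div_iff₀ (by positivity)] at hx2
    have hn : ‖(x, η x)‖ = |x| := by
      rw [Prod.norm_def, Real.norm_eq_abs, Real.norm_eq_abs]; exact max_eq_left (habs x)
    have hv := hx.valA
    rw [hn, sq_abs] at hv
    simp only at hv
    have hy : α * |η x| ≤ (1 + K) * x ^ 2 := by
      have := abs_sub_abs_le_abs_sub (α * η x) (A (x, η x))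
      rw [abs_sub_comm, abs_mul, abs_of_pos hα] at this
      linarith
    have hy2 : K * η x ^ 2 ≤ c / 4 * x ^ 2 := by
      have e1 : (α * |η x|) ^ 2 ≤ ((1 + K) * x ^ 2) ^ 2 := pow_le_pow_left₀ (by positivity) hy 2
      rw [mul_pow, sq_abs] at e1
      have hxx : x ^ 2 ≤ |x| := by rw [← sq_abs]; nlinarith [abs_nonneg x]
      have e2 : 4 * K * ((1 + K) * x ^ 2) ^ 2 ≤ c * α ^ 2 * x ^ 2 := by
        have : 4 * K * ((1 + K) * x ^ 2) ^ 2 = (x ^ 2 * (4 * K * (1 + K) ^ 2)) * x ^ 2 := by ring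
        rw [this]
        refine mul_le_mul_of_nonneg_right ?_ (sq_nonneg x)
        exact (mul_le_mul_of_nonneg_right hxx (by positivity)).trans hx2
      have hα2 : 0 < α ^ 2 := by positivity
      have e3 : α ^ 2 * (4 * (K * η x ^ 2)) ≤ α ^ 2 * (c * x ^ 2) := by nlinarith
      have := le_of_mul_le_mul_left e3 hα2
      linarith
    have hAb : |β / α * A (x, η x)| ≤ c / 4 * x ^ 2 := by
      rw [abs_mul]
      have h3 : |β / α| * ε ≤ c / 4 := by
        rw [hε, mul_div_assoc', div_le_div_iff₀ (by positivity) (by norm_num)]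
        nlinarith [abs_nonneg (β / α)]
      nlinarith [abs_nonneg (β / α), sq_nonneg x]
    have hl := hx.lower
    simp only at hl
    have := abs_le.1 hAb
    linarith
  have hTlim : Tendsto (fun x => T (x, η x)) (𝓝[≠] 0) (𝓝 0) := by
    have hq : Tendsto (fun x => A (x, η x) / B (x, η x)) (𝓝[≠] 0) (𝓝 0) := by
      have h1 : (fun x => x ^ 2) =O[𝓝[≠] (0 : ℝ)] fun x => B (x, η x) :=
        IsBigO.of_bound (2 / c) (hBpos.mono fun x hx => by
          rw [Real.norm_eq_abs, Real.norm_eq_abs, abs_of_nonneg (sq_nonneg x),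
            abs_of_nonneg ((by positivity : 0 ≤ c / 2 * x ^ 2).trans hx)]
          calc x ^ 2 = 2 / c * (c / 2 * x ^ 2) := by field_simp
            _ ≤ _ := mul_le_mul_of_nonneg_left hx (by positivity))
      exact ((hA.mono nhdsWithin_le_nhds).trans_isBigO h1).tendsto_div_nhds_zero
    have h1 : Tendsto (fun x => (1 : ℂ) - (A (x, η x) / B (x, η x) : ℝ) • I) (𝓝[≠] 0) (𝓝 1) := by
      simpa using tendsto_const_nhds.sub (hq.smul_const I)
    have h2 := (contDiffAt_quarterTan (n := 0) one_mem_slitPlane).continuousAt.tendsto.comp h1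
    have h3 : quarterTan 1 = 0 := by simp [quarterTan]
    rw [h3] at h2
    refine h2.congr' ?_
    filter_upwards [hBpos, self_mem_nhdsWithin] with x hx hx0
    have hB : 0 < B (x, η x) := by
      have : x ≠ 0 := hx0
      exact (by positivity : 0 < c / 2 * x ^ 2).trans_le hx
    simp only [Function.comp, hTd]
    rw [← quarterTan_smul hB]
    congr 1
    apply Complex.ext
    · simp
    · simp only [im_ofReal_mul, sub_im, one_im, smul_im, I_im, zero_sub, smul_eq_mul]
      field_simp
  have hplim : Tendsto (fun x => slopeH a b T x (η x)) (𝓝[≠] 0) (𝓝 0) := by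
    have h1 : Tendsto (fun x => slopeH a b T x (η x) - T (x, η x)) (𝓝[≠] 0) (𝓝 0) := by
      rw [Metric.tendsto_nhds]
      intro ε hε
      filter_upwards [hlim'.eventually (hclose (ε / 2) (by positivity))] with x hx
      rw [dist_zero_right, Real.norm_eq_abs]
      linarith
    simpa using h1.add hTlim
  refine ⟨η, fun x => slopeH a b T x (η x), hη, hη0, by simp only [hη0, hp0], ?_, ?_, hA⟩
  · rw [continuousAt_iff_punctured_nhds, hη0, hp0]
    exact hplim
  · filter_upwards [hder, hlim'.eventually hT, hlim'.eventually (eventually_norm_le hR),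
      self_mem_nhdsWithin] with x h1 h2 h3 h4
    have h40 : x ≠ 0 := h4
    have hz0 : (x, η x) ≠ 0 := fun h0 => h40 (congrArg Prod.fst h0)
    refine ⟨h1, ?_, ?_⟩
    · have := (hp.contDiffAt x (η x) ((norm_fst_le (x, η x)).trans h3)
        ((norm_snd_le (x, η x)).trans h3) (Or.inl h40)).differentiableAt one_ne_zero
      exact this.comp x (differentiableAt_id.prodMk h1.differentiableAt)
    · have hs := (h2.2 hz0).1
      obtain ⟨d1, d2, -⟩ := hd (x, η x) h3
      rw [pow_four_ray_iff hs, pow_four_pos_iff]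
      have him := (netDirection_iff_aux (v₁ := 1) (v₂ := slopeH a b T x (η x)) d1 d2 rfl rfl).1.1
        (mul_one _).symm
      rw [ofReal_one, mul_one] at him
      refine ⟨fun h0 => ?_, Or.inl him⟩
      have hre := (netDirection_iff_aux (v₁ := 1) (v₂ := slopeH a b T x (η x)) d1 d2 rfl rfl).2.2
        (by rw [ofReal_one, mul_one, h0]; rfl)
      have b1 := hp.bound x (η x) ((norm_fst_le (x, η x)).trans h3) ((norm_snd_le (x, η x)).trans h3)
      have b2 := hq.bound (η x) x ((norm_snd_le (x, η x)).trans h3) ((norm_fst_le (x, η x)).trans h3)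
      have b3 : |slopeV a b T (η x) x| * |slopeH a b T x (η x)| = 1 := by
        rw [← abs_mul, ← abs_one]; exact congrArg abs hre.symm
      nlinarith [hp.lt_one, hp.nonneg, abs_nonneg (slopeV a b T (η x) x),
        abs_nonneg (slopeH a b T x (η x))]

end SaddleNodeGerm

end

section

open Filter Asymptotics Complex

/-! ### The saddle-node germ of an axiumbilic point -/

/-- The coordinates `(σ x, σ y)`. -/
def coordL (σ : ℝ) : ℝ² →L[ℝ] Plane := (ContinuousLinearMap.fst ℝ ℝ ℝ).smulRight (σ • e 0)
    + (ContinuousLinearMap.snd ℝ ℝ ℝ).smulRight (σ • e 1)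

theorem coordL_zero (σ : ℝ) (z : ℝ²) : coordL σ z 0 = σ * z.1 := by simp [coordL, e, mul_comm]

theorem coordL_one (σ : ℝ) (z : ℝ²) : coordL σ z 1 = σ * z.2 := by simp [coordL, e, mul_comm]

theorem JetEq.fderiv_const {k : Plane → ℝ} {c : ℝ} (h : JetEq k fun _ => c) : 𝐃 k 0 = 0 := by
  rw [h.fderiv_eq]; simp

theorem fderiv_mul_of_jet {f k : Plane → ℝ} {c : ℝ} (hk : JetEq k fun _ => c)
    (hf : DifferentiableAt ℝ f 0) (h0 : f 0 = 0) :
    HasFDerivAt (fun z => k z * f z) (c • 𝐃 f 0) 0 := by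
  obtain ⟨k0, L, h1, -⟩ := hk
  refine (h1.mul hf.hasFDerivAt).congr_fderiv ?_
  rw [h0, k0, zero_smul, add_zero]

theorem fderiv_fderiv_mul_of_jet {f k : Plane → ℝ} {c : ℝ} (hk : JetEq k fun _ => c)
    (hk2 : ContDiffAt ℝ 2 k 0) (hf : ContDiffAt ℝ 2 f 0) (h0 : f 0 = 0) (u v : Plane) :
    𝐃 (𝐃 fun z => k z * f z) 0 u v = c * 𝐃 (𝐃 f) 0 u v := by
  rw [fderiv_fderiv_mul hk2 hf, h0, hk.1, hk.fderiv_const]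
  simp

theorem fderiv_fderiv_add {f g : Plane → ℝ} (hf : ContDiffAt ℝ 2 f 0) (hg : ContDiffAt ℝ 2 g 0) :
    𝐃 (𝐃 fun z => f z + g z) 0
      = 𝐃 (𝐃 f) 0 + 𝐃 (𝐃 g) 0 := by
  have ev : (𝐃 fun z => f z + g z) =ᶠ[𝓝 0] fun z => 𝐃 f z + 𝐃 g z := by
    filter_upwards [hf.eventually (by simp), hg.eventually (by simp)] with z h1 h2
    exact fderiv_add (h1.differentiableAt (by norm_num)) (h2.differentiableAt (by norm_num))
  have d : ∀ {f : Plane → ℝ}, ContDiffAt ℝ 2 f 0 → DifferentiableAt ℝ (𝐃 f) 0 :=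
    fun hf => (hf.fderiv_right (m := 1) (by norm_num)).differentiableAt (by norm_num)
  rw [ev.fderiv_eq]
  exact fderiv_add (d hf) (d hg)

namespace NormalAtZero

variable {X : Plane → Space4}

theorem contDiffAt_cD (h : NormalAtZero X) : ContDiffAt ℝ 2 (cD X) 0 :=
  h.contDiffAt_disc.sqrt (by rw [h.disc_zero]; norm_num)

theorem jet_cD (h : NormalAtZero X) : JetEq (cD X) fun _ => 1 := by
  have h1 := (h.jet_cE.mul h.jet_cG).sub h.jet_cF.sq
  obtain ⟨-, L, h2, h3⟩ := h1
  have hL : L = 0 := h3.unique (hasFDerivAt_const _ _)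
  refine ⟨by rw [cD, h.disc_zero, Real.sqrt_one], 0, ?_, hasFDerivAt_const _ _⟩
  refine (h2.sqrt (by simp only [h.disc_zero]; norm_num)).congr_fderiv ?_
  rw [hL, smul_zero]

theorem eventually_cD_pos (h : NormalAtZero X) : ∀ᶠ z in 𝓝 0, 0 < cD X z :=
  h.eventually_pos.mono fun _ hz => Real.sqrt_pos.2 hz.2

end NormalAtZero

/-- The coefficients of the conformal form `ζ = a dx + b dy` in complex notation. -/
def zetaA (X : Plane → Space4) (z : Plane) : ℂ := ⟨cE X z, 0⟩

def zetaB (X : Plane → Space4) (z : Plane) : ℂ := ⟨cF X z, cD X z⟩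

theorem zetaForm_eq (X : Plane → Space4) (z v : Plane) :
    zetaForm X z v = zetaA X z * v 0 + zetaB X z * v 1 := by
  apply Complex.ext <;> simp [zetaForm, zeta, zetaA, zetaB]

theorem contDiffAt_complex {V : Type*} [NormedAddCommGroup V] [NormedSpace ℝ V] {n : ℕ∞ω}
    {f g : V → ℝ} {z : V} (hf : ContDiffAt ℝ n f z) (hg : ContDiffAt ℝ n g z) :
    ContDiffAt ℝ n (fun z => (⟨f z, g z⟩ : ℂ)) z := by
  have : (fun z => (⟨f z, g z⟩ : ℂ)) = fun z => f z • (1 : ℂ) + g z • I := by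
    funext z; apply Complex.ext <;> simp
  rw [this]
  exact (hf.smul contDiffAt_const).add (hg.smul contDiffAt_const)

/-- Minus the imaginary part and the real part of `ε • axialForm`. -/
def germA (X : Plane → Space4) (ε : ℝ) (z : Plane) : ℝ := ε * cD X z * a0 X z

def germB (X : Plane → Space4) (ε : ℝ) (z : Plane) : ℝ :=
  ε / 4 * cE X z * a1 X z + -ε * cF X z * a0 X z

theorem germ_eq (X : Plane → Space4) (ε : ℝ) (z : Plane) :
    (⟨germB X ε z, -germA X ε z⟩ : ℂ) = ε * axialForm X z := by
  apply Complex.ext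
  · simp only [re_ofReal_mul, axialForm, axialN, germB]; ring
  · simp only [im_ofReal_mul, axialForm, axialN, germA]; ring

namespace AxialGerm

variable {X : Plane → Space4} {α β : ℝ}

theorem saddleNodeGerm (h : AxialGerm X α β) {ε σ : ℝ} (hσ : σ ^ 2 = 1) (hα : 0 < ε * (σ * α))
    (hχ : 0 < ε * chi X) :
    SaddleNodeGerm (fun z => germA X ε (coordL σ z)) (fun z => germB X ε (coordL σ z))
      (ε * (σ * α)) (ε / 4 * (σ * β)) := by
  have kA : JetEq (fun z => ε * cD X z) fun _ => ε := by simpa using h.jet_cD.const_mul ε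
  have kB : JetEq (fun z => ε / 4 * cE X z) fun _ => ε / 4 := by simpa using h.jet_cE.const_mul (ε / 4)
  have kC : JetEq (fun z => -ε * cF X z) fun _ => 0 := by simpa using h.jet_cF.const_mul (-ε)
  have cA : ContDiffAt ℝ 2 (fun z => ε * cD X z) 0 := contDiffAt_const.mul h.contDiffAt_cD
  have cB : ContDiffAt ℝ 2 (fun z => ε / 4 * cE X z) 0 := contDiffAt_const.mul h.contDiffAt_cE
  have cC : ContDiffAt ℝ 2 (fun z => -ε * cF X z) 0 := contDiffAt_const.mul h.contDiffAt_cF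
  have d0 := h.contDiffAt_a0.differentiableAt (by norm_num)
  have d1 := h.contDiffAt_a1.differentiableAt (by norm_num)
  have hA : ContDiffAt ℝ 2 (germA X ε) (coordL σ 0) := by
    rw [map_zero]; exact cA.mul h.contDiffAt_a0
  have hB : ContDiffAt ℝ 2 (germB X ε) (coordL σ 0) := by
    rw [map_zero]; exact (cB.mul h.contDiffAt_a1).add (cC.mul h.contDiffAt_a0)
  have e10 : coordL σ (1, 0) = σ • e 0 := by simp [coordL]
  refine ⟨hA.comp 0 (coordL σ).contDiff.contDiffAt, hB.comp 0 (coordL σ).contDiff.contDiffAt, ?_, ?_,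
    fun v => ?_, fun v => ?_, hα, ?_⟩
  · simp [germA, h.zero0]
  · simp [germB, h.zero0, h.zero1]
  · rw [fderiv_comp_clm (hA.differentiableAt (by norm_num)), map_zero]
    have : HasFDerivAt (germA X ε) _ 0 := fderiv_mul_of_jet kA d0 h.zero0
    rw [this.fderiv, smul_apply, h.fderiv0, coordL_one, smul_eq_mul]
    ring
  · rw [fderiv_comp_clm (hB.differentiableAt (by norm_num)), map_zero]
    have : HasFDerivAt (germB X ε) _ 0 :=
      (fderiv_mul_of_jet kB d1 h.zero1).add (fderiv_mul_of_jet kC d0 h.zero0)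
    rw [this.fderiv, add_apply, smul_apply, smul_apply, h.fderiv1, coordL_one, smul_eq_mul]
    simp only [zero_smul]
    ring
  · rw [fderiv_fderiv_comp_clm hA, fderiv_fderiv_comp_clm hB, map_zero, e10]
    have eA : 𝐃 (𝐃 (germA X ε)) 0 (e 0) (e 0)
        = ε * 𝐃 (𝐃 (a0 X)) 0 (e 0) (e 0) :=
      fderiv_fderiv_mul_of_jet kA cA h.contDiffAt_a0 h.zero0 _ _
    have eB : 𝐃 (𝐃 (germB X ε)) 0 (e 0) (e 0)
        = ε / 4 * 𝐃 (𝐃 (a1 X)) 0 (e 0) (e 0) := by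
      have := fderiv_fderiv_add (cB.mul h.contDiffAt_a1) (cC.mul h.contDiffAt_a0)
      refine (congrArg (fun L => L (e 0) (e 0)) this).trans ?_
      simp only [add_apply]
      rw [fderiv_fderiv_mul_of_jet kB cB h.contDiffAt_a1 h.zero1,
        fderiv_fderiv_mul_of_jet kC cC h.contDiffAt_a0 h.zero0]
      ring
    simp only [map_smul, smul_apply, smul_eq_mul, eA, eB]
    rw [chi_eq h] at hχ
    have hαn := h.ne_zero
    have hσ0 : σ ≠ 0 := fun h0 => by rw [h0] at hσ; norm_num at hσ
    have hε0 : ε ≠ 0 := fun h0 => by rw [h0] at hα; norm_num at hα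
    have key : σ * (σ * (ε / 4 * 𝐃 (𝐃 (a1 X)) 0 (e 0) (e 0)))
        - ε / 4 * (σ * β) / (ε * (σ * α)) * (σ * (σ * (ε * 𝐃 (𝐃 (a0 X)) 0 (e 0) (e 0))))
        = σ ^ 2 * (ε * (𝐃 (𝐃 (a1 X)) 0 (e 0) (e 0)
          - 𝐃 (𝐃 (a0 X)) 0 (e 0) (e 0) * β / α)) / 4 := by
      field_simp
    rw [key, hσ, one_mul]
    linarith

theorem contDiffAt_zetaA (h : AxialGerm X α β) : ContDiffAt ℝ 2 (zetaA X) 0 :=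
  contDiffAt_complex h.contDiffAt_cE contDiffAt_const

theorem contDiffAt_zetaB (h : AxialGerm X α β) : ContDiffAt ℝ 2 (zetaB X) 0 :=
  contDiffAt_complex h.contDiffAt_cF h.contDiffAt_cD

theorem zetaA_zero (h : AxialGerm X α β) : zetaA X 0 = 1 := by
  apply Complex.ext <;> simp [zetaA, h.jet_cE.1]

theorem zetaB_zero (h : AxialGerm X α β) : zetaB X 0 = I := by
  apply Complex.ext <;> simp [zetaB, h.jet_cF.1, h.jet_cD.1]

theorem exists_signs (h : AxialGerm X α β) (hχ : chi X ≠ 0) :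
    ∃ ε σ : ℝ, ε ^ 2 = 1 ∧ σ ^ 2 = 1 ∧ 0 < ε * (σ * α) ∧ 0 < ε * chi X := by
  have key : ∀ x : ℝ, x ≠ 0 → ∃ s : ℝ, s ^ 2 = 1 ∧ 0 < s * x := fun x hx => by
    rcases lt_or_gt_of_ne hx with h | h
    · exact ⟨-1, by norm_num, by linarith⟩
    · exact ⟨1, by norm_num, by linarith⟩
  obtain ⟨ε, h1, h2⟩ := key _ hχ
  obtain ⟨σ, h3, h4⟩ := key (ε * α) (mul_ne_zero (left_ne_zero_of_mul h2.ne') h.ne_zero)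
  exact ⟨ε, σ, h1, h3, by linarith, h2⟩

/-- The axial line tangent to the centre direction, and its slopes. -/
theorem exists_centre (h : AxialGerm X α β) (hχ : chi X ≠ 0) :
    ∃ η p : ℝ → ℝ, Continuous η ∧ η 0 = 0 ∧ p 0 = 0 ∧ ContinuousAt p 0 ∧
      (∀ᶠ x in 𝓝[≠] (0 : ℝ), HasDerivAt η (p x) x ∧ DifferentiableAt ℝ p x ∧
        lieCartan X (e 0) (x • e 0 + η x • e 1, p x) = 0) ∧
      (fun x => a0 X (x • e 0 + η x • e 1)) =o[𝓝 (0 : ℝ)] fun x => x ^ 2 := by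
  obtain ⟨ε, σ, hε, hσ, hα, hεχ⟩ := h.exists_signs hχ
  have h0 : coordL σ 0 = 0 := map_zero _
  have hcomp : ∀ {f : Plane → ℂ}, ContDiffAt ℝ 2 f 0 →
      ContDiffAt ℝ 1 (fun z => f (coordL σ z)) 0 := fun {f} hf =>
    ContDiffAt.comp (0 : ℝ²) (g := f) (by rw [h0]; exact hf.of_le (by norm_num))
      (coordL σ).contDiff.contDiffAt
  obtain ⟨η, p, hη, hη0, hp0, hpc, hd, hA⟩ := (h.saddleNodeGerm hσ hα hεχ).exists_central_leaf
    (hcomp h.contDiffAt_zetaA) (hcomp h.contDiffAt_zetaB) (by rw [h0, h.zetaA_zero])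
    (by rw [h0, h.zetaB_zero])
  have hσ0 : σ ≠ 0 := fun h0 => by rw [h0] at hσ; norm_num at hσ
  have hε0 : ε ≠ 0 := fun h0 => by rw [h0] at hε; norm_num at hε
  have hlim : Tendsto (fun x : ℝ => σ * x) (𝓝 0) (𝓝 0) := by
    simpa using ((continuous_const_mul σ).tendsto (0 : ℝ))
  have hlim' : Tendsto (fun x : ℝ => σ * x) (𝓝[≠] 0) (𝓝[≠] 0) := by
    refine tendsto_nhdsWithin_of_tendsto_nhds_of_eventually_within _
      (hlim.mono_left nhdsWithin_le_nhds) ?_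
    filter_upwards [self_mem_nhdsWithin] with x hx
    exact mul_ne_zero hσ0 hx
  have hpt : ∀ x, coordL σ (σ * x, η (σ * x)) = x • e 0 + (σ * η (σ * x)) • e 1 := fun x => by
    simp only [coordL, add_apply, ContinuousLinearMap.smulRight_apply, ContinuousLinearMap.coe_fst',
      ContinuousLinearMap.coe_snd', smul_smul]
    rw [show σ * x * σ = σ ^ 2 * x by ring, hσ, one_mul, mul_comm (η _)]
  have hlimP : Tendsto (fun x => x • e 0 + (σ * η (σ * x)) • e 1) (𝓝 0) (𝓝 (0 : Plane)) := by
    have hc : Continuous fun x : ℝ => x • e 0 + (σ * η (σ * x)) • e 1 := by fun_prop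
    have := hc.tendsto 0
    simpa [hη0] using this
  refine ⟨fun x => σ * η (σ * x), fun x => p (σ * x), by fun_prop, by simp [hη0], by simp [hp0], ?_,
    ?_, ?_⟩
  · have : ContinuousAt p (σ * 0) := by rwa [mul_zero]
    exact ContinuousAt.comp (f := fun x => σ * x) this (by fun_prop)
  · filter_upwards [hlim'.eventually hd, (hlimP.mono_left nhdsWithin_le_nhds).eventually
      h.eventually_pos] with x ⟨h1, h2, s, hs, h3⟩ hpos
    refine ⟨?_, h2.comp x (by fun_prop), ?_⟩
    · have := (h1.comp x ((hasDerivAt_id x).const_mul σ)).const_mul σ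
      refine this.congr_deriv ?_
      rw [mul_one, mul_comm, mul_assoc, ← pow_two, hσ, mul_one]
    · simp only [hpt] at h3
      set z := x • e 0 + (σ * η (σ * x)) • e 1 with hz
      have hz3 : zetaForm X z (e 0 + p (σ * x) • J (e 0)) ^ 4 = (s * ε : ℝ) * axialForm X z := by
        rw [zetaForm_eq]
        have e0 : (e 0 + p (σ * x) • J (e 0)) 0 = 1 := by simp [J_zero, e]
        have e1 : (e 0 + p (σ * x) • J (e 0)) 1 = p (σ * x) := by simp [J_one, e]
        rw [e0, e1, ofReal_one, mul_one, h3, germ_eq]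
        push_cast; ring
      have hq := quartic_eq hpos.2 (e 0 + p (σ * x) • J (e 0))
      rw [hz3, mul_assoc, mul_conj, ← ofReal_mul, ofReal_im] at hq
      have hD := Real.sqrt_pos.2 hpos.2
      exact (mul_eq_zero.1 hq.symm).resolve_left (mul_ne_zero hpos.1.ne' hD.ne')
  · have h1 := hA.comp_tendsto hlim
    have h2 : (fun x => ε * (cD X (x • e 0 + (σ * η (σ * x)) • e 1))⁻¹) =O[𝓝 (0 : ℝ)]
        fun _ => (1 : ℝ) := by
      have hc : Tendsto (fun x => ε * (cD X (x • e 0 + (σ * η (σ * x)) • e 1))⁻¹) (𝓝 0)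
          (𝓝 (ε * (cD X 0)⁻¹)) :=
        (((h.contDiffAt_cD.continuousAt.tendsto.comp hlimP).inv₀
          (by rw [h.jet_cD.1]; norm_num)).const_mul ε)
      exact hc.isBigO_one ℝ
    refine (h2.mul_isLittleO h1).congr' ?_ (Eventually.of_forall fun x => ?_)
    · filter_upwards [hlimP.eventually h.eventually_cD_pos] with x hx
      simp only [Function.comp, hpt, germA]
      field_simp
      rw [hε, one_mul]
    · simp only [Function.comp, mul_pow, hσ, one_mul]

end AxialGerm

end

section

open Filter Asymptotics

/-! ### The centre manifold -/

section OneVariable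

variable {F : Type*} [NormedAddCommGroup F] [NormedSpace ℝ F]

theorem hasDerivAt_zero_of_punctured {f g : ℝ → ℝ} {l : ℝ} (hc : ContinuousAt f 0)
    (hd : ∀ᶠ x in 𝓝[≠] (0 : ℝ), HasDerivAt f (g x) x) (hg : Tendsto g (𝓝[≠] 0) (𝓝 l)) :
    HasDerivAt f l 0 := by
  have hg' : Tendsto (deriv f) (𝓝[≠] 0) (𝓝 l) := hg.congr' (hd.mono fun x hx => hx.deriv.symm)
  have hs : {x | DifferentiableAt ℝ f x} ∈ 𝓝[≠] (0 : ℝ) := hd.mono fun x hx => hx.differentiableAt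
  have h1 := hasDerivWithinAt_Ici_of_tendsto_deriv (s := {x | DifferentiableAt ℝ f x})
    (fun x hx => hx.differentiableWithinAt) hc.continuousWithinAt
    (nhdsWithin_mono 0 (fun x hx => ne_of_gt hx) hs)
    (hg'.mono_left (nhdsWithin_mono 0 fun x hx => ne_of_gt hx))
  have h2 := hasDerivWithinAt_Iic_of_tendsto_deriv (s := {x | DifferentiableAt ℝ f x})
    (fun x hx => hx.differentiableWithinAt) hc.continuousWithinAt
    (nhdsWithin_mono 0 (fun x hx => ne_of_lt hx) hs)
    (hg'.mono_left (nhdsWithin_mono 0 fun x hx => ne_of_lt hx))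
  simpa [Iic_union_Ici] using h2.union h1

theorem contDiffAt_one_of_hasDerivAt {f g : ℝ → F} {x₀ : ℝ}
    (hd : ∀ᶠ x in 𝓝 x₀, HasDerivAt f (g x) x) (hc : ∀ᶠ x in 𝓝 x₀, ContinuousAt g x) :
    ContDiffAt ℝ 1 f x₀ := by
  rw [contDiffAt_one_iff]
  refine ⟨fun x => ContinuousLinearMap.toSpanSingleton ℝ (g x), _, hd.and hc, fun x hx => ?_,
    fun x hx => hx.1.hasFDerivAt⟩
  exact ((ContinuousLinearMap.toSpanSingletonCLE (𝕜 := ℝ) (E := F)).continuous.continuousAt.comp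
    hx.2).continuousWithinAt

theorem tendsto_clm_apply {ι E : Type*} [NormedAddCommGroup E] [NormedSpace ℝ E] {l : Filter ι}
    {L : ι → E →L[ℝ] F} {L₀ : E →L[ℝ] F} {v : ι → E} {v₀ : E} (hL : Tendsto L l (𝓝 L₀))
    (hv : Tendsto v l (𝓝 v₀)) : Tendsto (fun x => L x (v x)) l (𝓝 (L₀ v₀)) :=
  (isBoundedBilinearMap_apply.continuous.tendsto (L₀, v₀)).comp (hL.prodMk_nhds hv)

end OneVariable

theorem J_smul (a : ℝ) (w : Plane) : J (a • w) = a • J w := by ext i; fin_cases i <;> simp [J]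

theorem J_e_zero : J (e 0) = e 1 := by ext i; fin_cases i <;> simp [J, e]

theorem lieCartan_smul (X : Plane → Space4) (a : ℝ) (w : Plane) (m : Plane × ℝ) :
    lieCartan X (a • w) m = a ^ 4 * lieCartan X w m := by
  rw [lieCartan, J_smul, smul_comm, ← smul_add]
  simp only [lieCartan, quartic, PiLp.smul_apply, smul_eq_mul]
  ring

theorem lieCartanField_smul (X : Plane → Space4) (a : ℝ) (w : Plane) (m : Plane × ℝ) :
    lieCartanField X (a • w) m = a ^ 5 • lieCartanField X w m := by
  have h : 𝐃 (lieCartan X (a • w)) m = a ^ 4 • 𝐃 (lieCartan X w) m := by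
    rw [funext (lieCartan_smul X a w)]
    exact congrFun (fderiv_const_smul_field (𝕜 := ℝ) (f := lieCartan X w) (a ^ 4)) m
  have e1 : a • w + m.2 • J (a • w) = a • (w + m.2 • J w) := by rw [J_smul, smul_comm, smul_add]
  have e2 : ((a • (w + m.2 • J w), 0) : Plane × ℝ) = a • (w + m.2 • J w, 0) := by simp
  have e3 : 𝐃 (lieCartan X (a • w)) m (a • w + m.2 • J (a • w), 0)
      = a ^ 5 * 𝐃 (lieCartan X w) m (w + m.2 • J w, 0) := by
    rw [h, e1, e2, smul_apply, map_smul, smul_eq_mul, smul_eq_mul]; ring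
  refine Prod.ext ?_ ?_
  · change 𝐃 (lieCartan X (a • w)) m (0, 1) • (a • w + m.2 • J (a • w))
      = a ^ 5 • 𝐃 (lieCartan X w) m (0, 1) • (w + m.2 • J w)
    rw [h, e1, smul_apply, smul_smul, smul_smul, smul_eq_mul]
    congr 1; ring
  · change -_ = a ^ 5 • -_
    rw [e3, smul_eq_mul, mul_neg]

theorem cos4_axis (a : ℝ) : cos4 (a • e 0) = a ^ 4 := by simp [cos4, e]

theorem sin4_axis (a : ℝ) : sin4 (a • e 0) = 0 := by simp [sin4, e]

namespace AxialGerm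

variable {X : Plane → Space4} {α β : ℝ}

/-- Along a curve tangent to the axis on which `a₀ = o(x²)` the function `a₁` is asymptotic to
`χ x² / 2`. -/
theorem tendsto_a1_div (h : AxialGerm X α β) {η : ℝ → ℝ} (hη : HasDerivAt η 0 0) (hη0 : η 0 = 0)
    (hA : (fun x => a0 X (x • e 0 + η x • e 1)) =o[𝓝 (0 : ℝ)] fun x => x ^ 2) :
    Tendsto (fun x => a1 X (x • e 0 + η x • e 1) / x ^ 2) (𝓝[≠] 0) (𝓝 (chi X / 2)) := by
  have hα := h.ne_zero
  have kα : JetEq (fun _ : Plane => α) fun _ => α := JetEq.const α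
  have kβ : JetEq (fun _ : Plane => -β) fun _ => -β := JetEq.const _
  have cα : ContDiffAt ℝ 2 (fun z => α * a1 X z) 0 := contDiffAt_const.mul h.contDiffAt_a1
  have cβ : ContDiffAt ℝ 2 (fun z => -β * a0 X z) 0 := contDiffAt_const.mul h.contDiffAt_a0
  set f : Plane → ℝ := fun z => α * a1 X z + -β * a0 X z with hf
  have hf0 : f 0 = 0 := by simp [hf, h.zero0, h.zero1]
  have hf1 : 𝐃 f 0 = 0 := by
    have : HasFDerivAt f _ 0 := (fderiv_mul_of_jet kα (h.contDiffAt_a1.differentiableAt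
      (by norm_num)) h.zero1).add (fderiv_mul_of_jet kβ (h.contDiffAt_a0.differentiableAt
      (by norm_num)) h.zero0)
    rw [this.fderiv]
    ext v
    simp only [add_apply, smul_apply, h.fderiv0, h.fderiv1, smul_eq_mul, zero_apply]
    ring
  have hf2 : 𝐃 (𝐃 f) 0 (e 0) (e 0) = α * chi X := by
    rw [hf, fderiv_fderiv_add cα cβ, add_apply, add_apply,
      fderiv_fderiv_mul_of_jet kα contDiffAt_const h.contDiffAt_a1 h.zero1,
      fderiv_fderiv_mul_of_jet kβ contDiffAt_const h.contDiffAt_a0 h.zero0, chi_eq h]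
    field_simp
    ring
  have ho := isLittleO_jet_two (cα.add cβ)
  change (fun z => f z - f 0 - 𝐃 f 0 z - 1 / 2 * 𝐃 (𝐃 f) 0 z z) =o[𝓝 0] _ at ho
  simp only [hf0, hf1, zero_apply, sub_zero] at ho
  set ζ : ℝ → Plane := fun x => e 0 + (η x / x) • e 1 with hζ
  have hq : Tendsto (fun x => η x / x) (𝓝[≠] 0) (𝓝 0) := by
    have := hη.tendsto_slope_zero
    simpa [hη0, div_eq_inv_mul] using this
  have hζl : Tendsto ζ (𝓝[≠] 0) (𝓝 (e 0)) := by
    simpa using tendsto_const_nhds.add (hq.smul_const (e 1))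
  have hpt : ∀ x : ℝ, x ≠ 0 → x • e 0 + η x • e 1 = x • ζ x := fun x hx => by
    rw [hζ, smul_add, smul_smul, mul_div_cancel₀ _ hx]
  have hlim : Tendsto (fun x => x • e 0 + η x • e 1) (𝓝[≠] 0) (𝓝 (0 : Plane)) := by
    have hη' : Tendsto η (𝓝 0) (𝓝 0) := by simpa [hη0] using hη.continuousAt.tendsto
    have : Tendsto (fun x => x • e 0 + η x • e 1) (𝓝 0) (𝓝 ((0 : ℝ) • e 0 + (0 : ℝ) • e 1)) :=
      (tendsto_id.smul_const _).add (hη'.smul_const _)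
    simp only [zero_smul, add_zero] at this
    exact this.mono_left nhdsWithin_le_nhds
  have hrem : Tendsto (fun x => (f (x • e 0 + η x • e 1)
      - 1 / 2 * 𝐃 (𝐃 f) 0 (x • e 0 + η x • e 1) (x • e 0 + η x • e 1)) / x ^ 2)
      (𝓝[≠] 0) (𝓝 0) := by
    refine ((ho.comp_tendsto hlim).trans_isBigO ?_).tendsto_div_nhds_zero
    have hb : (fun x => ‖ζ x‖ ^ 2) =O[𝓝[≠] (0 : ℝ)] fun _ => (1 : ℝ) := (hζl.norm.pow 2).isBigO_one ℝ
    refine ((isBigO_refl (fun x : ℝ => x ^ 2) _).mul hb).congr' ?_ (by simp)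
    filter_upwards [self_mem_nhdsWithin] with x hx
    simp only [Function.comp]
    rw [hpt x hx, norm_smul, mul_pow, Real.norm_eq_abs, sq_abs]
  have hquad : Tendsto (fun x => 1 / 2 * 𝐃 (𝐃 f) 0 (ζ x) (ζ x)) (𝓝[≠] 0)
      (𝓝 (1 / 2 * (α * chi X))) := by
    rw [← hf2]
    exact (tendsto_clm_apply (((𝐃 (𝐃 f) 0).continuous.tendsto _).comp hζl)
      hζl).const_mul _
  have hA' := (hA.mono (nhdsWithin_le_nhds (s := {0}ᶜ))).tendsto_div_nhds_zero
  have key := (((hrem.add hquad).add (hA'.const_mul β))).const_mul α⁻¹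
  have hl : α⁻¹ * (0 + 1 / 2 * (α * chi X) + β * 0) = chi X / 2 := by field_simp; ring
  rw [hl] at key
  refine key.congr' ?_
  filter_upwards [self_mem_nhdsWithin] with x hx
  have hx0 : x ≠ 0 := hx
  rw [hpt x hx0]
  simp only [map_smul, smul_apply, smul_eq_mul, hf]
  field_simp
  ring

/-- The derivative of the Lie-Cartan function along the fibre is asymptotic to `χ x² / 2` along
the centre curve. -/
theorem tendsto_fibre_deriv_div (h : AxialGerm X α β) {η p : ℝ → ℝ} (hη : HasDerivAt η 0 0)
    (hη0 : η 0 = 0) (hp0 : p 0 = 0) (hp : ContinuousAt p 0)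
    (hA : (fun x => a0 X (x • e 0 + η x • e 1)) =o[𝓝 (0 : ℝ)] fun x => x ^ 2) :
    Tendsto (fun x => 𝐃 (lieCartan X (e 0)) (x • e 0 + η x • e 1, p x) (0, 1) / x ^ 2)
      (𝓝[≠] 0) (𝓝 (chi X / 2)) := by
  have hγ : Tendsto (fun x => ((x • e 0 + η x • e 1, p x) : Plane × ℝ)) (𝓝[≠] 0) (𝓝 0) := by
    have h1 : ContinuousAt (fun x => ((x • e 0 + η x • e 1, p x) : Plane × ℝ)) 0 :=
      ((continuousAt_id.smul continuousAt_const).add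
        (hη.continuousAt.smul continuousAt_const)).prodMk hp
    have := h1.tendsto
    simp only [zero_smul, hη0, hp0, add_zero] at this
    exact this.mono_left nhdsWithin_le_nhds
  have D := fun {f : Plane × ℝ → ℝ} (hf : ContDiffAt ℝ 2 f 0) =>
    (((hf.fderiv_right (m := 1) (by norm_num)).continuousAt.clm_apply
      (continuousAt_const (y := ((0, 1) : Plane × ℝ)))).tendsto.comp hγ)
  have hA' := (hA.mono (nhdsWithin_le_nhds (s := {0}ᶜ))).tendsto_div_nhds_zero
  have key := (hA'.mul (D (h.contDiffAt_cosForm (e 0)))).add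
    ((h.tendsto_a1_div hη hη0 hA).mul (D (h.contDiffAt_sinForm (e 0))))
  have c1 : cos4 (e 0) = 1 := by simpa using cos4_axis 1
  rw [zero_mul, h.fderiv_sinForm, c1, mul_one, mul_one, zero_add] at key
  refine key.congr' ?_
  have ev := fun {f : Plane × ℝ → ℝ} (hf : ContDiffAt ℝ 2 f 0) =>
    hγ.eventually (hf.eventually (by simp))
  filter_upwards [hγ.eventually (continuousAt_fst.eventually (h.contDiffAt_a0.eventually (by simp))),
    hγ.eventually (continuousAt_fst.eventually (h.contDiffAt_a1.eventually (by simp))),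
    ev (h.contDiffAt_cosForm (e 0)), ev (h.contDiffAt_sinForm (e 0))] with x h1 h2 h3 h4
  have n2 : (2 : ℕ∞ω) ≠ 0 := by norm_num
  have := ((fderiv_comp_fst (h1.differentiableAt n2)).fun_mul
    (h3.differentiableAt n2).hasFDerivAt).fun_add
    ((fderiv_comp_fst (h2.differentiableAt n2)).fun_mul (h4.differentiableAt n2).hasFDerivAt)
  rw [funext (lieCartan_eq X (e 0)), this.fderiv]
  simp
  ring

theorem isTransverseSaddleNode (h : AxialGerm X α β) (hχ : chi X ≠ 0) :
    IsTransverseSaddleNode X axisDir.rep := by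
  obtain ⟨a, ha, hrep⟩ := exists_axisDir_rep
  obtain ⟨η, p, hηc, hη0, hp0, hpc, hev, hA⟩ := h.exists_centre hχ
  have hα := h.ne_zero
  have hp' : Tendsto p (𝓝[≠] 0) (𝓝 0) := by
    have := hpc.tendsto
    rw [hp0] at this
    exact this.mono_left nhdsWithin_le_nhds
  have hη' : HasDerivAt η 0 0 := hasDerivAt_zero_of_punctured hηc.continuousAt
    (hev.mono fun x hx => hx.1) hp'
  have hq := h.tendsto_fibre_deriv_div hη' hη0 hp0 hpc hA
  set G := lieCartan X (e 0) with hG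
  set γ : ℝ → Plane × ℝ := fun x => (x • e 0 + η x • e 1, p x) with hγd
  set q : ℝ → ℝ := fun x => 𝐃 G (γ x) (0, 1) with hqd
  set a20 := 𝐃 (𝐃 (a0 X)) 0 (e 0) (e 0) with ha20
  set F : Plane × ℝ → ℝ := fun m => -(lieCartanField X (e 0) m).2 with hF
  set v : ℝ → ℝ := fun x => F (γ x) with hv
  have hγ0 : γ 0 = 0 := by simp [hγd, hη0, hp0]
  have hγc : ContinuousAt γ 0 := ((continuousAt_id.smul continuousAt_const).add
    (hηc.continuousAt.smul continuousAt_const)).prodMk hpc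
  have hγ : Tendsto γ (𝓝 0) (𝓝 0) := by
    have := hγc.tendsto
    rwa [hγ0] at this
  have hγ' : Tendsto γ (𝓝[≠] 0) (𝓝 0) := hγ.mono_left nhdsWithin_le_nhds
  have hGc : ContDiffAt ℝ 2 G 0 := h.contDiffAt_lieCartan (e 0)
  have hwc : ContDiff ℝ 1 fun m : Plane × ℝ => ((e 0 + m.2 • J (e 0), 0) : Plane × ℝ) := by fun_prop
  have hFe : ∀ m, F m = 𝐃 G m (e 0 + m.2 • J (e 0), 0) := fun m => neg_neg _
  have hFc : ContDiffAt ℝ 1 F 0 := by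
    rw [funext hFe]
    exact (hGc.fderiv_right (m := 1) (by norm_num)).clm_apply hwc.contDiffAt
  have hF0 : F 0 = 0 := by simp [hF, h.lieCartanField_zero, e]
  have hFd : ∀ u, 𝐃 F 0 u = 𝐃 (𝐃 (a0 X)) 0 u.1 (e 0) + α * u.2 := fun u => by
    have c1 : cos4 (e 0) = 1 := by simpa using cos4_axis 1
    have s1 : sin4 (e 0) = 0 := by simpa using sin4_axis 1
    have hY : DifferentiableAt ℝ (lieCartanField X (e 0)) 0 := by
      have hd := (hGc.fderiv_right (m := 1) (by norm_num)).differentiableAt (by norm_num)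
      have hw : DifferentiableAt ℝ (fun m : Plane × ℝ => e 0 + m.2 • J (e 0)) 0 := by fun_prop
      exact ((hd.clm_apply (differentiableAt_const _)).smul hw).prodMk
        (hd.clm_apply (hwc.differentiable one_ne_zero).differentiableAt).neg
    have : HasFDerivAt F _ 0 := hY.hasFDerivAt.snd.neg
    rw [this.fderiv]
    simp only [neg_apply, ContinuousLinearMap.coe_comp, Function.comp_apply,
      ContinuousLinearMap.coe_snd', h.fderiv_lieCartanField, baseHess, c1, s1, e_zero_one,
      e_zero_zero]
    ring
  set p₁ : ℝ → ℝ := fun x => -v x / q x with hp₁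
  have hq0 : ∀ᶠ x in 𝓝[≠] (0 : ℝ), q x ≠ 0 := by
    filter_upwards [hq.eventually_ne (div_ne_zero hχ two_ne_zero)] with x hx h0
    exact hx (by change q x / x ^ 2 = 0; rw [h0, zero_div])
  have hGd : ∀ᶠ x in 𝓝[≠] (0 : ℝ), ContDiffAt ℝ 2 G (γ x) ∧ ContDiffAt ℝ 1 F (γ x) :=
    hγ'.eventually ((hGc.eventually (by simp)).and (hFc.eventually (by simp)))
  have hder : ∀ᶠ x in 𝓝[≠] (0 : ℝ), HasDerivAt p (p₁ x) x ∧
      HasDerivAt γ (e 0 + p x • e 1, p₁ x) x := by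
    filter_upwards [hev, eventually_eventually_nhdsWithin.2 hev, hGd, hq0, self_mem_nhdsWithin]
      with x ⟨h1, h2, h3⟩ h4 ⟨h5, _⟩ hqx hx
    have hγx : HasDerivAt γ (e 0 + p x • e 1, deriv p x) x := by
      have := ((hasDerivAt_id x).smul_const (e 0)).add (h1.smul_const (e 1))
      rw [one_smul] at this
      exact this.prodMk h2.hasDerivAt
    have hz : (fun x => G (γ x)) =ᶠ[𝓝 x] fun _ => 0 := by
      rw [isOpen_compl_singleton.nhdsWithin_eq hx] at h4
      exact h4.mono fun y hy => hy.2.2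
    have h6 := ((h5.differentiableAt (by norm_num)).hasFDerivAt.comp_hasDerivAt x hγx).deriv
    have h7 : deriv (G ∘ γ) x = 0 := (EventuallyEq.deriv_eq hz).trans (deriv_const x 0)
    have e1 : ((e 0 + p x • e 1, deriv p x) : Plane × ℝ)
        = (e 0 + (γ x).2 • J (e 0), 0) + deriv p x • (0, 1) := by simp [J_e_zero, hγd]
    rw [h7, e1, map_add, map_smul, ← hFe] at h6
    have h8 : deriv p x = p₁ x := by
      rw [hp₁, eq_div_iff hqx]
      change deriv p x * 𝐃 G (γ x) (0, 1) = -F (γ x)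
      rw [smul_eq_mul] at h6
      linarith
    rw [h8] at hγx
    exact ⟨h8 ▸ h2.hasDerivAt, hγx⟩
  have hFl : ∀ w : ℝ → Plane × ℝ, ∀ w₀, Tendsto w (𝓝[≠] 0) (𝓝 w₀) →
      Tendsto (fun x => 𝐃 F (γ x) (w x)) (𝓝[≠] 0) (𝓝 (𝐃 F 0 w₀)) := fun w w₀ hw =>
    tendsto_clm_apply ((hFc.fderiv_right (m := 0) (by norm_num)).continuousAt.tendsto.comp hγ') hw
  have hf₁ := hFl (fun x => (e 0 + p x • e 1, 0)) (e 0, 0) (by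
    have : Tendsto (fun x => e 0 + p x • e 1) (𝓝[≠] 0) (𝓝 (e 0)) := by
      simpa using tendsto_const_nhds.add (hp'.smul_const (e 1))
    exact this.prodMk_nhds tendsto_const_nhds)
  have hh₁ := hFl (fun _ => (0, 1)) (0, 1) tendsto_const_nhds
  rw [hFd] at hf₁ hh₁
  simp only [mul_zero, add_zero, mul_one, map_zero, zero_apply, zero_add, ← ha20] at hf₁ hh₁
  set f₁ : ℝ → ℝ := fun x => 𝐃 F (γ x) (e 0 + p x • e 1, 0)
  set h₁ : ℝ → ℝ := fun x => 𝐃 F (γ x) (0, 1)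
  set k : ℝ → ℝ := fun x => h₁ x / (q x / x ^ 2) with hk
  have hkl : Tendsto k (𝓝[≠] 0) (𝓝 (α / (chi X / 2))) := hh₁.div hq (div_ne_zero hχ two_ne_zero)
  set c₂ := a20 * chi X / (2 * α) with hc₂
  have hvd : ∀ᶠ x in 𝓝[≠] (0 : ℝ), HasDerivAt v (f₁ x - k x / x ^ 2 * v x) x := by
    filter_upwards [hder, hGd, hq0, self_mem_nhdsWithin] with x h1 h2 h3 h4
    have hx : x ≠ 0 := h4
    refine ((h2.2.differentiableAt one_ne_zero).hasFDerivAt.comp_hasDerivAt x h1.2).congr_deriv ?_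
    have e1 : ((e 0 + p x • e 1, p₁ x) : Plane × ℝ) = (e 0 + p x • e 1, 0) + p₁ x • (0, 1) := by simp
    rw [e1, map_add, map_smul, smul_eq_mul]
    change f₁ x + -v x / q x * h₁ x = f₁ x - h₁ x / (q x / x ^ 2) / x ^ 2 * v x
    field_simp
    ring
  have hvo : (fun x => v x - c₂ * x ^ 2) =o[𝓝 (0 : ℝ)] fun x => x ^ 2 := by
    refine isLittleO_sq_of_singular_ode (k := k) (f := fun x => f₁ x - k x * c₂ - c₂ * (2 * x)) ?_ ?_
      (div_ne_zero hα (div_ne_zero hχ two_ne_zero)) ?_ ?_ hkl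
    · have h2 := eventually_nhdsWithin_iff.1 (hvd.mono fun x hx => hx.continuousAt)
      filter_upwards [h2] with x hx
      refine ContinuousAt.sub ?_ (by fun_prop)
      by_cases h0 : x = 0
      · have h3 : ContinuousAt F (γ 0) := by rw [hγ0]; exact hFc.continuousAt
        rw [h0]; exact h3.comp hγc
      · exact hx h0
    · simp [hv, hγ0, hF0]
    · filter_upwards [hvd, self_mem_nhdsWithin] with x h1 h2
      have hx : x ≠ 0 := h2
      have h3 : HasDerivAt (fun x : ℝ => x ^ 2) (2 * x) x := by simpa using hasDerivAt_pow 2 x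
      refine (h1.sub (h3.const_mul c₂)).congr_deriv ?_
      field_simp
      ring
    · have h1 : Tendsto (fun x : ℝ => c₂ * (2 * x)) (𝓝[≠] 0) (𝓝 0) := by
        have : Continuous fun x : ℝ => c₂ * (2 * x) := by fun_prop
        simpa using (this.tendsto 0).mono_left nhdsWithin_le_nhds
      have h2 := (hf₁.sub (hkl.mul_const c₂)).sub h1
      have e1 : a20 - α / (chi X / 2) * c₂ - 0 = 0 := by rw [hc₂]; field_simp; ring
      rwa [e1] at h2
  have hp₁l : Tendsto p₁ (𝓝[≠] 0) (𝓝 (-(a20 / α))) := by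
    have h1 : Tendsto (fun x => v x / x ^ 2) (𝓝[≠] 0) (𝓝 c₂) := by
      have := ((hvo.mono (nhdsWithin_le_nhds (s := {0}ᶜ))).tendsto_div_nhds_zero).add_const c₂
      rw [zero_add] at this
      refine this.congr' ?_
      filter_upwards [self_mem_nhdsWithin] with x hx
      have hx0 : x ≠ 0 := hx
      field_simp
      ring
    have h2 := (h1.div hq (div_ne_zero hχ two_ne_zero)).neg
    have e1 : c₂ / (chi X / 2) = a20 / α := by rw [hc₂]; field_simp
    rw [e1] at h2
    refine h2.congr' ?_
    filter_upwards [hq0, self_mem_nhdsWithin] with x h3 hx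
    have hx0 : x ≠ 0 := hx
    change -(v x / x ^ 2 / (q x / x ^ 2)) = -v x / q x
    field_simp
  have hpd : HasDerivAt p (-(a20 / α)) 0 :=
    hasDerivAt_zero_of_punctured hpc (hder.mono fun x hx => hx.1) hp₁l
  have hγd0 : HasDerivAt γ (e 0, -(a20 / α)) 0 := by
    have := (((hasDerivAt_id (0 : ℝ)).smul_const (e 0)).add (hη'.smul_const (e 1))).prodMk hpd
    simpa using this
  set g : ℝ → Plane × ℝ := fun x => (e 0 + p x • e 1, Function.update p₁ 0 (-(a20 / α)) x) with hg
  have hg0 : g 0 = (e 0, -(a20 / α)) := by simp [hg, hp0]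
  have hgne : ∀ x, x ≠ 0 → g x = (e 0 + p x • e 1, p₁ x) := fun x hx => by simp [hg, hx]
  have hγg : ∀ᶠ x in 𝓝 (0 : ℝ), HasDerivAt γ (g x) x := by
    have := hder
    rw [eventually_nhdsWithin_iff] at this
    filter_upwards [this] with x hx
    by_cases h0 : x = 0
    · rw [h0, hg0]; exact hγd0
    · rw [hgne x h0]; exact (hx h0).2
  have hfield : ∀ᶠ x in 𝓝[≠] (0 : ℝ), lieCartanField X (e 0) (γ x) = q x • g x := by
    filter_upwards [hq0, self_mem_nhdsWithin] with x h1 h2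
    rw [hgne x h2, Prod.smul_mk, smul_eq_mul]
    refine Prod.ext ?_ ?_
    · change q x • (e 0 + p x • J (e 0)) = _
      rw [J_e_zero]
    · change (lieCartanField X (e 0) (γ x)).2 = q x * (-v x / q x)
      rw [mul_div_cancel₀ _ h1]
      simp [hv, hF]
  rw [hrep]
  have hw1 : (a • e 0 : Plane) 1 = 0 := by simp [e]
  have hw0 : (a • e 0 : Plane) 0 = a := by simp [e]
  refine ⟨h.lieCartan_zero _, fun h0 => ?_, ?_, ⟨-(α * a ^ 5), ?_, ?_⟩, γ, fun x => a ^ 5 * q x,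
    a ^ 5 * (chi X / 2), mul_ne_zero (pow_ne_zero 5 ha) (div_ne_zero hχ two_ne_zero), ?_, hγ0, ?_,
    ?_, ?_, ?_⟩
  · have := h.fderiv_lieCartan (a • e 0) (e 1, 0)
    rw [h0, cos4_axis, sin4_axis, e_one_one] at this
    have h4 := mul_ne_zero hα (pow_ne_zero 4 ha)
    exact h4 (by simpa using this.symm)
  · rw [h.lieCartanField_zero, hw1]; simp
  · exact neg_ne_zero.2 (mul_ne_zero hα (pow_ne_zero 5 ha))
  · rw [h.fderiv_lieCartanField, cos4_axis, sin4_axis, hw0, hw1]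
    simp [baseHess]
    ring
  · refine contDiffAt_one_of_hasDerivAt hγg ?_
    have hev2 : ∀ᶠ x in 𝓝[≠] (0 : ℝ), ContinuousAt g x := by
      filter_upwards [hder, hvd, hGd, hq0, self_mem_nhdsWithin] with x h1 h2 h3 h4 h5
      have hx : x ≠ 0 := h5
      have hqc : ContinuousAt q x := ((h3.1.fderiv_right (m := 1) (by norm_num)).continuousAt.comp
          h1.2.continuousAt).clm_apply continuousAt_const
      refine (continuousAt_const.add (h1.1.continuousAt.smul continuousAt_const)).prodMk ?_
      exact (continuousAt_update_of_ne hx).2 (h2.continuousAt.neg.div hqc h4)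
    rw [eventually_nhdsWithin_iff] at hev2
    filter_upwards [hev2] with x hx
    by_cases h0 : x = 0
    · rw [h0]
      refine (continuousAt_const.add (hpc.smul continuousAt_const)).prodMk ?_
      exact continuousAt_update_same.2 hp₁l
    · exact hx h0
  · rw [hγd0.deriv, h.fderiv_lieCartanField, cos4_axis, sin4_axis, hw0, hw1]
    simp only [baseHess, e_zero_one, mul_zero, zero_smul, zero_mul, add_zero, cos4_axis, sin4_axis,
      map_smul, smul_eq_mul, ← ha20, Prod.mk_eq_zero, true_and]
    field_simp
    ring
  · rw [hγd0.deriv]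
    intro h0
    have := congrArg (fun w : Plane => w 0) h0
    simp [e] at this
  · have h1 := hev
    have h2 := hfield
    rw [eventually_nhdsWithin_iff] at h1 h2
    filter_upwards [h1, h2, hγg] with x h1 h2 h3
    rw [lieCartan_smul, lieCartanField_smul, h3.deriv, mul_smul]
    by_cases h0 : x = 0
    · have hq00 : q 0 = 0 := by
        change 𝐃 G (γ 0) (0, 1) = 0
        rw [hγ0, h.fderiv_lieCartan]; simp
      rw [h0, hγ0, h.lieCartan_zero, h.lieCartanField_zero, hq00, e_zero_one]
      simp
    · have h5 : lieCartan X (e 0) (γ x) = 0 := (h1 h0).2.2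
      rw [h5, h2 h0]
      simp
  · have h1 : (fun x => a ^ 5 * (q x - chi X / 2 * x ^ 2)) =o[𝓝 (0 : ℝ)] fun x => x ^ 2 := by
      refine IsLittleO.const_mul_left ?_ _
      have h0 : q 0 - chi X / 2 * 0 ^ 2 = 0 := by
        change 𝐃 G (γ 0) (0, 1) - _ = 0
        rw [hγ0, h.fderiv_lieCartan]; simp
      rw [isLittleO_iff_tendsto (fun x hx => by
        have : x = 0 := by simpa using hx
        rw [this, h0])]
      have h2 : Tendsto (fun x => (q x - chi X / 2 * x ^ 2) / x ^ 2) (𝓝[≠] 0) (𝓝 0) := by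
        have := hq.sub_const (chi X / 2)
        rw [sub_self] at this
        refine this.congr' ?_
        filter_upwards [self_mem_nhdsWithin] with x hx
        have hx0 : x ≠ 0 := hx
        change q x / x ^ 2 - _ = _
        field_simp
      have h3 : ContinuousAt (fun x => (q x - chi X / 2 * x ^ 2) / x ^ 2) 0 := by
        rw [continuousAt_iff_punctured_nhds, h0]
        simpa using h2
      have := h3.tendsto
      rw [h0] at this
      simpa using this
    refine h1.congr_left fun x => ?_
    ring

end AxialGerm

end

section

open Filter

/-! ### Invariance of the deviation -/

theorem det_ne_zero_of_injective {L : Plane →L[ℝ] Plane} (hL : Function.Injective L) :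
    L (e 0) 0 * L (e 1) 1 - L (e 0) 1 * L (e 1) 0 ≠ 0 := by
  intro h
  have key : ∀ i, L (e 0) i = 0 ∧ L (e 1) i = 0 := fun i => by
    have h1 : L (e 1) i • e 0 - L (e 0) i • e 1 = 0 := by
      refine hL ?_
      rw [map_zero, map_sub, map_smul, map_smul]
      ext j
      fin_cases i <;> fin_cases j <;> simp <;> linarith
    have h2 := congrArg (fun v : Plane => v 0) h1
    have h3 := congrArg (fun v : Plane => v 1) h1
    simp [e] at h2 h3
    exact ⟨h3, h2⟩
  have h4 : e 0 = 0 := hL (by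
    rw [map_zero]; ext i; exact (key i).1)
  have := e_zero_zero
  rw [h4] at this
  simp at this

theorem deviation_eq_of_forms {X Y : Plane → Space4} {z z' : Plane} {L : Plane →L[ℝ] Plane}
    {B : Space4 →ₗᵢ[ℝ] Space4} (hL : Function.Injective L) (hX : ContDiffAt ℝ 2 X z')
    (h1 : ∀ v w, firstForm Y z v w = firstForm X z' (L v) (L w))
    (h2 : ∀ v w, secondForm Y z v w = B (secondForm X z' (L v) (L w))) (v : Plane) :
    deviation Y z v = deviation X z' (L v) := by
  have hH : meanCurv Y z = B (meanCurv X z') := by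
    have hΔ := det_ne_zero_of_injective hL
    rw [meanCurv, meanCurv, cE, cF, cG, ve, vf, vg, h1, h1, h1, h2, h2, h2, firstForm_eq,
      firstForm_eq X z' (L (e 0)) (L (e 1)), firstForm_eq X z' (L (e 1)) (L (e 1)),
      secondForm_self hX, secondForm_self hX, secondForm_add_smul,
      secondForm_comm hX (e 1) (e 0), ← vf]
    set a := L (e 0) 0
    set b := L (e 0) 1
    set c := L (e 1) 0
    set d := L (e 1) 1
    simp only [← map_smul, ← map_sub, ← map_add]
    congr 1
    have e1 : (2 * (cE X z' * cG X z' - cF X z' ^ 2))⁻¹ = (2 * ((a * d - b * c) ^ 2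
        * (cE X z' * cG X z' - cF X z' ^ 2)))⁻¹ * (a * d - b * c) ^ 2 := by
      rw [mul_left_comm, mul_inv_rev _ (2 * _), mul_assoc, inv_mul_cancel₀ (pow_ne_zero 2 hΔ),
        mul_one]
    rw [e1, mul_smul _⁻¹ ((a * d - b * c) ^ 2)]
    congr 1
    · congr 1; ring
    · module
  rw [deviation, deviation, hH, normalCurv, normalCurv, h1, h2, ← map_smul, ← map_sub,
    LinearIsometry.norm_map]

theorem deviation_comp {X Y : Plane → Space4} {g : Plane → Plane} {z : Plane}
    {B : Space4 →ₗᵢ[ℝ] Space4} {c : Space4} (hX : ContDiffAt ℝ 2 X (g z)) (hg : ContDiffAt ℝ 2 g z)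
    (hL : Function.Bijective (𝐃 g z)) (hY : Y =ᶠ[𝓝 z] fun u => c + B (X (g u))) (v : Plane) :
    deviation Y z v = deviation X (g z) (𝐃 g z v) := by
  have hd : ∀ᶠ u in 𝓝 z, ∀ w, 𝐃 Y u w = B (𝐃 X (g u) (𝐃 g u w)) := by
    filter_upwards [hY.eventuallyEq_nhds, hg.continuousAt.eventually (hX.eventually (by simp)),
      hg.eventually (by simp)] with u h1 h2 h3 w
    have h4 : HasFDerivAt (fun u => B (X (g u))) _ u :=
      B.toContinuousLinearMap.hasFDerivAt.comp u ((h2.differentiableAt (by norm_num)).hasFDerivAt.comp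
        u (h3.differentiableAt (by norm_num)).hasFDerivAt)
    rw [h1.fderiv_eq, (h4.const_add c).fderiv]
    rfl
  have hd0 := hd.self_of_nhds
  have hYc : ContDiffAt ℝ 2 Y z := (contDiffAt_const.add
    (B.toContinuousLinearMap.contDiff.contDiffAt.comp z (hX.comp z hg))).congr_of_eventuallyEq hY
  have hX1 := ((hX.fderiv_right (m := 1) (by norm_num)).differentiableAt (by norm_num)).hasFDerivAt
  have hg1 := ((hg.fderiv_right (m := 1) (by norm_num)).differentiableAt (by norm_num)).hasFDerivAt
  have hgd := (hg.differentiableAt (by norm_num)).hasFDerivAt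
  have h2 : ∀ v w, 𝐃 (𝐃 Y) z v w
      = B (𝐃 (𝐃 X) (g z) (𝐃 g z v) (𝐃 g z w)
        + 𝐃 X (g z) (𝐃 (𝐃 g) z v w)) := fun v w => by
    rw [← fderiv_fderiv_apply hYc, (show (fun u => 𝐃 Y u w) =ᶠ[𝓝 z] _ from
      hd.mono fun u hu => hu w).fderiv_eq]
    have h4 := B.toContinuousLinearMap.hasFDerivAt.comp z ((hX1.comp z hgd).clm_apply
      (hg1.clm_apply (hasFDerivAt_const w z)))
    have h5 : 𝐃 (fun u => B (𝐃 X (g u) (𝐃 g u w))) z = _ := h4.fderiv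
    rw [h5]
    simp [add_comm]
  have hr : LinearMap.range (𝐃 Y z).toLinearMap
      = (LinearMap.range (𝐃 X (g z)).toLinearMap).map B.toLinearMap := by
    ext x
    constructor
    · rintro ⟨w, rfl⟩
      exact ⟨_, ⟨𝐃 g z w, rfl⟩, (hd0 w).symm⟩
    · rintro ⟨_, ⟨w, rfl⟩, rfl⟩
      obtain ⟨w, rfl⟩ := hL.2 w
      exact ⟨w, hd0 w⟩
  refine deviation_eq_of_forms (B := B) hL.1 hX (fun v w => ?_) (fun v w => ?_) v
  · rw [firstForm, firstForm, hd0, hd0, LinearIsometry.inner_map_map]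
  · have h6 : ∀ w, (LinearMap.range (𝐃 X (g z)).toLinearMap).starProjection
        (𝐃 X (g z) w) = 𝐃 X (g z) w := fun w =>
      Submodule.starProjection_eq_self_iff.2 ⟨w, rfl⟩
    have hK : ∀ {K K' : Submodule ℝ Space4}, K = K' → ∀ x,
        Kᗮ.starProjection x = x - K'.starProjection x := by
      rintro K _ rfl x
      exact K.starProjection_orthogonal_val x
    rw [secondForm, secondForm, h2, hK hr, hK rfl, ← LinearIsometry.map_starProjection, ← map_sub,
      map_add, h6]
    congr 1
    abel

end

section

open Filter

/-! ### Transport of nets to the surface -/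

section Transport

variable {M : Type*} [TopologicalSpace M] [ChartedSpace Plane M] {α : M → Space4} {p q : M}
  {X : Plane → Space4}

theorem deriv_chart_comp {Ψ : OpenPartialHomeomorph M ℝ²} [IsManifold (𝓡 2) 1 M]
    (hΨ : ContMDiffOn (𝓡 2) 𝓘(ℝ, ℝ²) 1 Ψ Ψ.source) {c : ℝ → M} {t : ℝ}
    (hc : MDifferentiableAt 𝓘(ℝ, ℝ) (𝓡 2) c t) (ht : c t ∈ Ψ.source) :
    deriv (fun s => Ψ (c s)) t
      = mfderiv (𝓡 2) 𝓘(ℝ, ℝ²) Ψ (c t) (mfderiv 𝓘(ℝ, ℝ) (𝓡 2) c t (1 : ℝ)) := by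
  have h1 : MDifferentiableAt (𝓡 2) 𝓘(ℝ, ℝ²) Ψ (c t) :=
    ((hΨ _ ht).contMDiffAt (Ψ.open_source.mem_nhds ht)).mdifferentiableAt one_ne_zero
  have h2 := mfderiv_comp t h1 hc
  rw [mfderiv_eq_fderiv] at h2
  rw [← fderiv_apply_one_eq_deriv]
  exact DFunLike.congr_fun h2 (1 : ℝ)

theorem dev_eq {Ψ : OpenPartialHomeomorph M ℝ²} {Λ : ℝ² →L[ℝ] Plane}
    {B : Space4 →ₗᵢ[ℝ] Space4} {c : Space4}
    (hΨ : ContMDiffOn (𝓡 2) 𝓘(ℝ, ℝ²) 2 Ψ Ψ.source) (hq : q ∈ Ψ.source)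
    (hα : ∀ q ∈ Ψ.source, α q = c + B (X (Λ (Ψ q)))) (hX : ContDiffAt ℝ 2 X (Λ (Ψ q)))
    (hL : Function.Bijective fun v => Λ (mfderiv (𝓡 2) 𝓘(ℝ, ℝ²) Ψ q v))
    (v : TangentSpace (𝓡 2) q) :
    dev α q v = deviation X (Λ (Ψ q)) (Λ (mfderiv (𝓡 2) 𝓘(ℝ, ℝ²) Ψ q v)) := by
  set k := extChartAt (𝓡 2) q
  have h1 : ContMDiffAt (𝓡 2) 𝓘(ℝ, ℝ²) 2 Ψ q := (hΨ q hq).contMDiffAt (Ψ.open_source.mem_nhds hq)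
  have hk : k.symm (k q) = q := extChartAt_to_inv q
  have h2 : ContDiffAt ℝ 2 (Ψ ∘ k.symm) (k q) := by
    have := (contMDiffAt_iff.1 h1).2
    simpa [k, contDiffWithinAt_univ, chartAt_self_eq] using this
  have h3 : mfderiv (𝓡 2) 𝓘(ℝ, ℝ²) Ψ q = 𝐃 (Ψ ∘ k.symm) (k q) := by
    rw [(h1.mdifferentiableAt (by norm_num)).mfderiv]
    simp [writtenInExtChartAt, k, chartAt_self_eq]
    rfl
  have h4 : HasFDerivAt (fun u => Λ (Ψ (k.symm u))) (Λ.comp (𝐃 (Ψ ∘ k.symm) (k q))) (k q) :=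
    Λ.hasFDerivAt.comp _ (h2.differentiableAt (by norm_num)).hasFDerivAt
  have e1 : Λ (Ψ (k.symm (k q))) = Λ (Ψ q) := by rw [hk]
  have h5 := deviation_comp (Y := α ∘ k.symm) (c := c) (B := B) (X := X) (z := k q)
    (g := fun u => Λ (Ψ (k.symm u))) (by simp only [e1]; exact hX)
    (Λ.contDiff.contDiffAt.comp _ h2) (by rw [h4.fderiv, ← h3]; exact hL) (by
      have hs : ∀ᶠ u in 𝓝 (k q), k.symm u ∈ Ψ.source := by
        refine (continuousAt_extChartAt_symm q).eventually ?_
        rw [hk]; exact Ψ.open_source.mem_nhds hq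
      exact hs.mono fun u hu => hα _ hu) v
  rw [h4.fderiv] at h5
  rw [h3, ← e1]
  exact h5

theorem isAxiumbilic_iff {z : Plane} {m : TangentSpace (𝓡 2) q → Plane} (hm : Function.Bijective m)
    (hm0 : ∀ v, m v = 0 ↔ v = 0) (hd : ∀ v, dev α q v = deviation X z (m v))
    (hX : ContDiffAt ℝ 2 X z) (hE : 0 < cE X z) (hΔ : 0 < cE X z * cG X z - cF X z ^ 2) :
    IsAxiumbilic α q ↔ axialForm X z = 0 := by
  rw [← deviation_constant_iff hX hE hΔ, IsAxiumbilic, hm.2.forall₂]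
  simp only [hd, ne_eq, hm0]

theorem isPrincipal_iff {z : Plane} {m : TangentSpace (𝓡 2) q → Plane} (hm : Function.Bijective m)
    (hm0 : ∀ v, m v = 0 ↔ v = 0) (hd : ∀ v, dev α q v = deviation X z (m v))
    (hX : ContDiffAt ℝ 2 X z) (hE : 0 < cE X z) (hΔ : 0 < cE X z * cG X z - cF X z ^ 2)
    (hN : axialForm X z ≠ 0) (v : TangentSpace (𝓡 2) q) :
    IsPrincipal α q v ↔
      m v ≠ 0 ∧ ∃ s : ℝ, 0 < s ∧ zetaForm X z (m v) ^ 4 = s * ((1 : ℝ) * axialForm X z) := by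
  rw [Complex.ofReal_one, one_mul, ← deviation_maximal_iff hX hE hΔ hN, IsPrincipal, hm.2.forall]
  simp only [hd, ne_eq, hm0]

theorem isMean_iff {z : Plane} {m : TangentSpace (𝓡 2) q → Plane} (hm : Function.Bijective m)
    (hm0 : ∀ v, m v = 0 ↔ v = 0) (hd : ∀ v, dev α q v = deviation X z (m v))
    (hX : ContDiffAt ℝ 2 X z) (hE : 0 < cE X z) (hΔ : 0 < cE X z * cG X z - cF X z ^ 2)
    (hN : axialForm X z ≠ 0) (v : TangentSpace (𝓡 2) q) :
    IsMean α q v ↔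
      m v ≠ 0 ∧ ∃ s : ℝ, 0 < s ∧ zetaForm X z (m v) ^ 4 = s * ((-1 : ℝ) * axialForm X z) := by
  rw [Complex.ofReal_neg, Complex.ofReal_one, neg_one_mul, ← deviation_minimal_iff hX hE hΔ hN,
    IsMean, hm.2.forall]
  simp only [hd, ne_eq, hm0]

theorem isAxialArc_iff [IsManifold (𝓡 2) 1 M] {P : ∀ q : M, TangentSpace (𝓡 2) q → Prop}
    {Dir : ℝ² → ℝ² → Prop} {Ψ : OpenPartialHomeomorph M ℝ²} {U : Set ℝ²}
    (hΨ : ContMDiffOn (𝓡 2) 𝓘(ℝ, ℝ²) 1 Ψ Ψ.source)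
    (hΨ' : ContMDiffOn 𝓘(ℝ, ℝ²) (𝓡 2) 1 Ψ.symm Ψ.target) (hU : U ⊆ Ψ.target)
    (hp : p ∈ Ψ.source) (hp0 : Ψ p = 0)
    (hA : ∀ q ∈ Ψ.source, Ψ q ∈ U → (IsAxiumbilic α q ↔ q = p))
    (hP : ∀ q ∈ Ψ.source, Ψ q ∈ U → q ≠ p → ∀ v,
      P q v ↔ Dir (Ψ q) (mfderiv (𝓡 2) 𝓘(ℝ, ℝ²) Ψ q v)) {L : Set M} (hL : L ⊆ Ψ.source) :
    IsAxialArc α P (Ψ.source ∩ Ψ ⁻¹' U) L ↔ IsDirArc Dir U (Ψ '' L) := by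
  have h0 : ∀ q ∈ Ψ.source, Ψ q = 0 ↔ q = p := fun q hq => by rw [← hp0]; exact Ψ.injOn.eq_iff hq hp
  have hd : ∀ {c : ℝ → M} {t : ℝ}, ContMDiffOn 𝓘(ℝ, ℝ) (𝓡 2) 1 c (Ioo 0 1) → t ∈ Ioo (0 : ℝ) 1 →
      MDifferentiableAt 𝓘(ℝ, ℝ) (𝓡 2) c t := fun hc ht =>
    ((hc _ ht).contMDiffAt (isOpen_Ioo.mem_nhds ht)).mdifferentiableAt one_ne_zero
  constructor
  · rintro ⟨c, hc, rfl, h⟩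
    refine ⟨fun t => Ψ (c t), ?_, by rw [image_image], fun t ht => ?_⟩
    · rw [← contMDiffOn_iff_contDiffOn]
      exact hΨ.comp hc fun t ht => (h t ht).1.1
    · obtain ⟨⟨h1, h2⟩, h3, h4⟩ := h t ht
      have h5 : c t ≠ p := fun h => h3 ((hA _ h1 h2).2 h)
      refine ⟨h2, fun h => h5 ((h0 _ h1).1 h), ?_⟩
      rw [deriv_chart_comp hΨ (hd hc ht) h1]
      exact (hP _ h1 h2 h5 _).1 h4
  · rintro ⟨c, hc, hcL, h⟩
    have hcm : ContMDiffOn 𝓘(ℝ, ℝ) (𝓡 2) 1 (fun t => Ψ.symm (c t)) (Ioo 0 1) :=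
      hΨ'.comp hc.contMDiffOn fun t ht => hU (h t ht).1
    refine ⟨fun t => Ψ.symm (c t), hcm, ?_, fun t ht => ?_⟩
    · rw [← image_image, ← hcL]
      exact (Ψ.symm_image_image_of_subset_source hL).symm
    · obtain ⟨h1, h2, h3⟩ := h t ht
      have h4 := Ψ.right_inv (hU h1)
      have h5 := Ψ.map_target (hU h1)
      have h6 : Ψ (Ψ.symm (c t)) ∈ U := by rwa [h4]
      have h7 : Ψ.symm (c t) ≠ p := fun h => h2 (by rw [← h4, h, hp0])
      refine ⟨⟨h5, h6⟩, fun h => h7 ((hA _ h5 h6).1 h), (hP _ h5 h6 h7 _).2 ?_⟩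
      have h8 : deriv (fun s => Ψ (Ψ.symm (c s))) t = deriv c t :=
        EventuallyEq.deriv_eq (eventually_of_mem (isOpen_Ioo.mem_nhds ht) fun s hs =>
          Ψ.right_inv (hU (h s hs).1))
      rw [← deriv_chart_comp hΨ (hd hcm ht) h5, h8, h4]
      exact h3

theorem looksLike_of_isLocalNet [IsManifold (𝓡 2) 1 M] {P : ∀ q : M, TangentSpace (𝓡 2) q → Prop}
    {Dir : ℝ² → ℝ² → Prop} {Ψ : OpenPartialHomeomorph M ℝ²} {𝓕 : Set (Set ℝ²)}
    (hnet : IsLocalNet Dir 𝓕) (hΨ : ContMDiffOn (𝓡 2) 𝓘(ℝ, ℝ²) 1 Ψ Ψ.source)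
    (hΨ' : ContMDiffOn 𝓘(ℝ, ℝ²) (𝓡 2) 1 Ψ.symm Ψ.target) (hp : p ∈ Ψ.source) (hp0 : Ψ p = 0)
    (h : ∀ᶠ z in 𝓝 (0 : ℝ²), ∀ q ∈ Ψ.source, Ψ q = z → (IsAxiumbilic α q ↔ q = p) ∧
      (q ≠ p → ∀ v, P q v ↔ Dir (Ψ q) (mfderiv (𝓡 2) 𝓘(ℝ, ℝ²) Ψ q v))) :
    LooksLike α P p 𝓕 := by
  obtain ⟨R₀, hR₀, hnet⟩ := hnet
  have ht : Ψ.target ∈ 𝓝 (0 : ℝ²) := Ψ.open_target.mem_nhds (hp0 ▸ Ψ.map_source hp)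
  obtain ⟨ρ, hρ, hball⟩ := Metric.nhds_basis_closedBall.eventually_iff.1 (h.and ht)
  obtain ⟨g, hg0, hgR, hg⟩ := hnet (min R₀ ρ) (lt_min hR₀ hρ) (min_le_left _ _)
  set U := g ⁻¹' square with hUd
  have hUo : IsOpen U := (isOpen_Ioo.prod isOpen_Ioo).preimage g.continuous
  have hUb : ∀ z ∈ U, _ := fun z hz =>
    hball (mem_closedBall_zero_iff.2 ((hgR z hz).trans (min_le_right _ _)))
  have hUt : U ⊆ Ψ.target := fun z hz => (hUb z hz).2
  have hA : ∀ q ∈ Ψ.source, Ψ q ∈ U → (IsAxiumbilic α q ↔ q = p) := fun q hq hqU =>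
    ((hUb _ hqU).1 q hq rfl).1
  have arc := fun {L : Set M} => isAxialArc_iff (L := L) hΨ hΨ' hUt hp hp0 hA
    fun q hq hqU => ((hUb _ hqU).1 q hq rfl).2
  set k := Ψ ≫ₕ g.toOpenPartialHomeomorphOfImageEq U hUo square (g.image_preimage square) with hk
  have hks : k.source = Ψ.source ∩ Ψ ⁻¹' U := rfl
  have hkL : ∀ L, k '' L = g '' (Ψ '' L) := fun L => image_comp g Ψ L
  refine ⟨k, ?_, ?_, ?_, fun q hq => ?_, fun L hL => ?_⟩
  · refine ⟨hp, ?_⟩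
    change g (Ψ p) ∈ square
    rw [hp0, hg0]; constructor <;> constructor <;> norm_num
  · change g (Ψ p) = 0
    rw [hp0, hg0]
  · refine inter_eq_left.2 fun z hz => hUt ?_
    change g (g.symm z) ∈ square
    rwa [g.apply_symm_apply]
  · exact hA q hq.1 hq.2
  · rw [hkL, ← hg, hks]
    have hsub : ∀ {L}, L ⊆ k.source → L ⊆ Ψ.source := fun h => h.trans inter_subset_left
    have hsub' : ∀ {L}, IsAxialArc α P (Ψ.source ∩ Ψ ⁻¹' U) L → L ⊆ Ψ.source := by
      rintro _ ⟨c, -, rfl, h⟩ _ ⟨t, ht, rfl⟩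
      exact (h t ht).1.1
    constructor
    · rintro ⟨h1, h2⟩
      refine ⟨(arc (hsub hL)).1 h1, fun L' hL' hle => ?_⟩
      have hL'U : L' ⊆ U := by
        obtain ⟨c, -, rfl, h⟩ := hL'
        rintro _ ⟨t, ht, rfl⟩
        exact (h t ht).1
      have e1 : Ψ '' (Ψ.symm '' L') = L' :=
        Ψ.symm.symm_image_image_of_subset_source (hL'U.trans hUt)
      have e2 : Ψ.symm '' L' ⊆ Ψ.source := by
        rintro _ ⟨z, hz, rfl⟩
        exact Ψ.map_target (hUt (hL'U hz))
      have h3 : L ⊆ Ψ.symm '' L' := by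
        rw [← Ψ.symm_image_image_of_subset_source (hsub hL)]
        exact image_mono hle
      rw [← e1]
      exact image_mono (h2 ((arc e2).2 (by rwa [e1])) h3)
    · rintro ⟨h1, h2⟩
      refine ⟨(arc (hsub hL)).2 h1, fun L' hL' hle => ?_⟩
      have h3 := h2 ((arc (hsub' hL')).1 hL') (image_mono hle)
      intro q hq
      obtain ⟨q', hq', he⟩ := h3 (mem_image_of_mem Ψ hq)
      rwa [← Ψ.injOn (hsub hL hq') (hsub' hL' hq) he]

end Transport

end

section

open Filter Complex

/-! ### The axial nets in a Monge chart -/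

/-- The axial directions (principal for `δ = 1`, mean for `δ = -1`) in the linear coordinates
`Λ`. -/
def axialDir (X : Plane → Space4) (Λ : ℝ² →L[ℝ] Plane) (δ : ℝ) (z v : ℝ²) : Prop :=
  v ≠ 0 ∧ ∃ s : ℝ, 0 < s ∧ zetaForm X (Λ z) (Λ v) ^ 4 = s * (δ * axialForm X (Λ z))

theorem bijective_coordL {σ : ℝ} (hσ : σ ^ 2 = 1) : Function.Bijective (coordL σ) := by
  refine Function.bijective_iff_has_inverse.2 ⟨fun z => (σ * z 0, σ * z 1), fun z => ?_, fun z => ?_⟩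
  · simp only [coordL_zero, coordL_one, ← mul_assoc, ← sq, hσ, one_mul]
  · ext i
    fin_cases i
    · exact (coordL_zero σ _).trans (by simp only [← mul_assoc, ← sq, hσ, one_mul]; rfl)
    · exact (coordL_one σ _).trans (by simp only [← mul_assoc, ← sq, hσ, one_mul]; rfl)

theorem bijective_eighthTurn : Function.Bijective eighthTurn := by
  refine Function.bijective_iff_has_inverse.2
    ⟨fun z => ((z.1 + z.2) / 2, (z.2 - z.1) / 2), fun z => ?_, fun z => ?_⟩ <;>
  · rw [eighthTurn_apply]
    refine Prod.ext ?_ ?_ <;> · simp only; ring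

theorem bijective_rotL (θ : ℝ) : Function.Bijective (rotL θ) := by
  have key : ∀ θ : ℝ, Function.LeftInverse (rotL (-θ)) (rotL θ) := fun θ z => by
    have := Real.sin_sq_add_cos_sq θ
    rw [rotL_apply, rotL_apply]
    ext i
    fin_cases i
    · simp [rot]; linear_combination z 0 * this
    · simp [rot]; linear_combination z 1 * this
  have h2 := key (-θ)
  rw [neg_neg] at h2
  exact ⟨(key θ).injective, h2.rightInverse.surjective⟩

namespace AxialGerm

variable {X : Plane → Space4} {α β ε σ : ℝ}

theorem isLocalNet_saddleNode (h : AxialGerm X α β) (hσ : σ ^ 2 = 1) (hα : 0 < ε * (σ * α))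
    (hχ : 0 < ε * chi X) : IsLocalNet (axialDir X (coordL σ) ε) saddleNodeNet := by
  have h0 : coordL σ 0 = 0 := map_zero _
  have hc : ∀ {f : Plane → ℂ}, ContDiffAt ℝ 2 f 0 → ContDiffAt ℝ 1 (fun z => f (coordL σ z)) 0 :=
    fun hf => ContDiffAt.comp 0 (by rw [h0]; exact hf.of_le (by norm_num))
      (coordL σ).contDiff.contDiffAt
  convert (h.saddleNodeGerm hσ hα hχ).isLocalNet_saddleNode (hc h.contDiffAt_zetaA)
    (hc h.contDiffAt_zetaB) (by rw [h0, h.zetaA_zero]) (by rw [h0, h.zetaB_zero]) using 1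
  funext z v
  have h4 : (σ : ℂ) ^ 4 = 1 := by
    have : σ ^ 4 = 1 := by rw [show σ ^ 4 = (σ ^ 2) ^ 2 by ring, hσ, one_pow]
    exact_mod_cast this
  simp only [axialDir, quarterDir, germ_eq, zetaForm_eq, coordL_zero, coordL_one, ofReal_mul]
  have e1 : ∀ a b : ℂ, (a * (σ * v.1) + b * (σ * v.2)) ^ 4 = (a * v.1 + b * v.2) ^ 4 := fun a b => by
    linear_combination (a * v.1 + b * v.2) ^ 4 * h4
  rw [e1]

theorem isLocalNet_trivial (h : AxialGerm X α β) (hσ : σ ^ 2 = 1) (hα : 0 < ε * (σ * α))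
    (hχ : 0 < ε * chi X) :
    IsLocalNet (axialDir X ((coordL σ).comp eighthTurn) (-ε)) trivialNet := by
  set Λ := (coordL σ).comp eighthTurn with hΛ
  have h0 : Λ 0 = 0 := map_zero _
  have hc : ∀ {f : Plane → ℂ}, ContDiffAt ℝ 2 f 0 → ContDiffAt ℝ 1 (fun z => f (Λ z)) 0 :=
    fun hf => ContDiffAt.comp 0 (by rw [h0]; exact hf.of_le (by norm_num)) Λ.contDiff.contDiffAt
  have hI : (1 + I : ℂ) ≠ 0 := fun h => by simpa using congrArg Complex.re h
  have cA := hc h.contDiffAt_zetaA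
  have cB := hc h.contDiffAt_zetaB
  have net := (h.saddleNodeGerm hσ hα hχ).isLocalNet_trivial
    (a := fun z => (zetaA X (Λ z) + zetaB X (Λ z)) / (1 + I))
    (b := fun z => (zetaB X (Λ z) - zetaA X (Λ z)) / (1 + I)) ((cA.add cB).div_const _)
    ((cB.sub cA).div_const _) (by rw [h0, h.zetaA_zero, h.zetaB_zero, div_self hI])
    (by rw [h0, h.zetaA_zero, h.zetaB_zero, div_eq_iff hI]; linear_combination -I_sq)
  convert net using 1
  funext z v
  have h4 : (σ : ℂ) ^ 4 = 1 := by
    have : σ ^ 4 = 1 := by rw [show σ ^ 4 = (σ ^ 2) ^ 2 by ring, hσ, one_pow]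
    exact_mod_cast this
  have hI4 : (1 + I : ℂ) ^ 4 = -4 := by linear_combination (I ^ 2 + 4 * I + 5) * I_sq
  have e1 : ∀ a b : ℂ, (a * (σ * (v.1 - v.2)) + b * (σ * (v.1 + v.2))) ^ 4
      = -4 * ((a + b) / (1 + I) * v.1 + (b - a) / (1 + I) * v.2) ^ 4 := fun a b => by
    rw [← hI4, ← mul_pow]
    field_simp
    linear_combination (a * (v.1 - v.2) + b * (v.1 + v.2)) ^ 4 * h4
  have e2 : zetaForm X (Λ z) (Λ v) ^ 4 = -4 * ((zetaA X (Λ z) + zetaB X (Λ z)) / (1 + I) * v.1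
      + (zetaB X (Λ z) - zetaA X (Λ z)) / (1 + I) * v.2) ^ 4 := by
    have e0 : Λ v 0 = σ * (v.1 - v.2) := coordL_zero σ _
    have e1' : Λ v 1 = σ * (v.1 + v.2) := coordL_one σ _
    rw [← e1, zetaForm_eq, e0, e1']
    push_cast
    rfl
  have e3 : (⟨germB X ε (coordL σ (eighthTurn z)), -germA X ε (coordL σ (eighthTurn z))⟩ : ℂ)
      = ε * axialForm X (Λ z) := germ_eq _ _ _
  simp only [axialDir, quarterDir, e2, e3, ofReal_neg]
  refine propext (and_congr_right fun _ => ⟨?_, ?_⟩)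
  · rintro ⟨s, hs, he⟩
    refine ⟨s / 4, by positivity, ?_⟩
    push_cast
    linear_combination -1 / 4 * he
  · rintro ⟨s, hs, he⟩
    refine ⟨4 * s, by positivity, ?_⟩
    push_cast
    linear_combination -4 * he

theorem eventually_axialForm_ne_zero (h : AxialGerm X α β) (hσ : σ ^ 2 = 1) (hα : 0 < ε * (σ * α))
    (hχ : 0 < ε * chi X) : ∀ᶠ z in 𝓝 (0 : Plane), z ≠ 0 → axialForm X z ≠ 0 := by
  obtain ⟨_, _, _, hT⟩ := (h.saddleNodeGerm hσ hα hχ).exists_tangent_bounds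
  set Γ := (LinearEquiv.ofBijective (coordL σ).toLinearMap (bijective_coordL hσ)).toContinuousLinearEquiv
  have hlim : Tendsto Γ.symm (𝓝 0) (𝓝 0) := by
    have := Γ.symm.continuous.tendsto 0
    rwa [map_zero] at this
  filter_upwards [hlim.eventually hT] with z hz h0 hN
  have h1 : coordL σ (Γ.symm z) = z := Γ.apply_symm_apply z
  have h2 := (hz.2 fun h => h0 (by rw [← h1, h, map_zero])).1
  rw [germ_eq, h1, hN, mul_zero] at h2
  exact zero_notMem_slitPlane h2

end AxialGerm

/-- The rotation of 4-space that rotates the first two coordinates. -/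
def rotIsometry (θ : ℝ) : Space4 →ₗᵢ[ℝ] Space4 where
  toFun u := !₂[Real.cos θ * u 0 + Real.sin θ * u 1, -Real.sin θ * u 0 + Real.cos θ * u 1, u 2, u 3]
  map_add' u v := by ext i; fin_cases i <;> simp <;> ring
  map_smul' c v := by ext i; fin_cases i <;> simp <;> ring
  norm_map' u := by
    have := Real.sin_sq_add_cos_sq θ
    simp only [EuclideanSpace.norm_eq, Fin.sum_univ_four, Real.norm_eq_abs, sq_abs]
    congr 1
    simp
    linear_combination (u 0 ^ 2 + u 1 ^ 2) * this

theorem rotIsometry_monge (θ : ℝ) (R S : Plane → ℝ) (z : Plane) :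
    rotIsometry θ (monge (R ∘ rot θ) (S ∘ rot θ) z) = monge R S (rot θ z) := by
  ext i; fin_cases i <;> rfl

namespace IsMongeChart

variable {M : Type*} [TopologicalSpace M] [ChartedSpace Plane M] [IsManifold (𝓡 2) ∞ M] {r : ℕ∞}
  {α : M → Space4} {p : M} {φ : OpenPartialHomeomorph M Plane} {R S : Plane → ℝ}

theorem contMDiffOn_chart (hφ : IsMongeChart r α p φ R S) :
    ContMDiffOn (𝓡 2) (𝓡 2) r φ φ.source ∧ ContMDiffOn (𝓡 2) (𝓡 2) r φ.symm φ.target := by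
  have : IsManifold (𝓡 2) r M := .of_le (n := ∞) (by exact_mod_cast le_top)
  exact ⟨contMDiffOn_of_mem_maximalAtlas hφ.mem_atlas,
    contMDiffOn_symm_of_mem_maximalAtlas hφ.mem_atlas⟩

theorem contDiffAt_components (hφ : IsMongeChart r α p φ R S)
    (hα : ContMDiff (𝓡 2) 𝓘(ℝ, Space4) r α) : ContDiffAt ℝ r R 0 ∧ ContDiffAt ℝ r S 0 := by
  obtain ⟨A, hA⟩ := hφ.graph
  have h0 : φ.target ∈ 𝓝 (0 : Plane) :=
    φ.open_target.mem_nhds (hφ.map_base ▸ φ.map_source hφ.mem_source)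
  have h1 : ContDiffOn ℝ r (α ∘ φ.symm) φ.target := by
    rw [← contMDiffOn_iff_contDiffOn]
    exact hα.comp_contMDiffOn hφ.contMDiffOn_chart.2
  have h2 : ContDiffAt ℝ r (monge R S) 0 := by
    have h3 : ContDiffAt ℝ r (fun y => A (α (φ.symm y) - α p)) 0 :=
      A.contDiff.contDiffAt.comp 0 ((h1.contDiffAt h0).sub contDiffAt_const)
    refine h3.congr_of_eventuallyEq (eventually_of_mem h0 fun y hy => ?_)
    change _ = A (α (φ.symm y) - α p)
    rw [hA _ (φ.map_target hy), φ.right_inv hy]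
  rw [contDiffAt_euclidean] at h2
  exact ⟨h2 2, h2 3⟩

theorem looksLike (hφ : IsMongeChart r α p φ R S) (hr : 2 ≤ r) {X : Plane → Space4} {θ a b δ : ℝ}
    (hX : X = monge (R ∘ rot θ) (S ∘ rot θ)) (h : AxialGerm X a b)
    (hN : ∀ᶠ z in 𝓝 (0 : Plane), z ≠ 0 → axialForm X z ≠ 0) {Λ : ℝ² →L[ℝ] Plane}
    (hΛ : Function.Bijective Λ) {P : ∀ q : M, TangentSpace (𝓡 2) q → Prop}
    (hP : ∀ {q : M} {z : Plane} {m : TangentSpace (𝓡 2) q → Plane}, Function.Bijective m →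
      (∀ v, m v = 0 ↔ v = 0) → (∀ v, dev α q v = deviation X z (m v)) → ContDiffAt ℝ 2 X z →
      0 < cE X z → 0 < cE X z * cG X z - cF X z ^ 2 → axialForm X z ≠ 0 →
      ∀ v, P q v ↔ m v ≠ 0 ∧ ∃ s : ℝ, 0 < s ∧ zetaForm X z (m v) ^ 4 = s * (δ * axialForm X z))
    {𝓕 : Set (Set ℝ²)} (hnet : IsLocalNet (axialDir X Λ δ) 𝓕) : LooksLike α P p 𝓕 := by
  have h1M : IsManifold (𝓡 2) 1 M := .of_le (n := ∞) (by exact_mod_cast le_top)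
  obtain ⟨A, hA⟩ := hφ.graph
  obtain ⟨hc, hc'⟩ := hφ.contMDiffOn_chart
  have hr2 : (2 : ℕ∞ω) ≤ r := WithTop.coe_le_coe.2 hr
  set Γ : ℝ² ≃L[ℝ] Plane := (LinearEquiv.ofBijective ((rotL θ).comp Λ).toLinearMap
    ((bijective_rotL θ).comp hΛ)).toContinuousLinearEquiv
  have hΓ : ∀ z, Γ z = rot θ (Λ z) := fun z => rfl
  set Ψ := φ.transHomeomorph Γ.symm.toHomeomorph with hΨd
  have hΨΓ : ∀ q, rot θ (Λ (Ψ q)) = φ q := fun q => Γ.apply_symm_apply (φ q)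
  have hΨ : ContMDiffOn (𝓡 2) 𝓘(ℝ, ℝ²) 2 Ψ Ψ.source :=
    Γ.symm.contDiff.contMDiff.comp_contMDiffOn (hc.of_le hr2)
  have hΨ' : ContMDiffOn 𝓘(ℝ, ℝ²) (𝓡 2) 2 Ψ.symm Ψ.target :=
    (hc'.of_le hr2).comp (Γ.contDiff.contMDiff.contMDiffOn) fun z hz => hz
  have hp : p ∈ Ψ.source := hφ.mem_source
  have hp0 : Ψ p = 0 := by
    change Γ.symm (φ p) = 0
    rw [hφ.map_base, map_zero]
  have hαX : ∀ q ∈ Ψ.source, α q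
      = α p + (A.symm.toLinearIsometry.comp (rotIsometry θ)) (X (Λ (Ψ q))) := fun q hq => by
    rw [LinearIsometry.coe_comp, Function.comp_apply, hX, rotIsometry_monge, hΨΓ, ← hA q hq]
    simp
  have hmd : Ψ.MDifferentiable (𝓡 2) 𝓘(ℝ, ℝ²) :=
    ⟨hΨ.mdifferentiableOn (by norm_num), hΨ'.mdifferentiableOn (by norm_num)⟩
  refine looksLike_of_isLocalNet hnet (hΨ.of_le (by norm_num)) (hΨ'.of_le (by norm_num)) hp hp0 ?_
  have hlim : Tendsto Λ (𝓝 0) (𝓝 0) := by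
    have := Λ.continuous.tendsto 0
    rwa [map_zero] at this
  filter_upwards [hlim.eventually hN, hlim.eventually h.eventually_pos, hlim.eventually
    ((h.contDiffAt.of_le (m := 2) (by norm_num)).eventually (by simp))] with z hNz ⟨hE, hΔ⟩ hXz q hq hqz
  subst hqz
  have hm : Function.Bijective fun v => Λ (mfderiv (𝓡 2) 𝓘(ℝ, ℝ²) Ψ q v) :=
    hΛ.comp (hmd.mfderiv_bijective hq)
  have hm0 : ∀ v, Λ (mfderiv (𝓡 2) 𝓘(ℝ, ℝ²) Ψ q v) = 0 ↔ v = 0 := fun v =>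
    ⟨fun h0 => hm.1 (by simp only [h0, map_zero]; exact (map_zero Λ).symm), fun h0 => by
      rw [h0, map_zero]; exact map_zero Λ⟩
  have hd := dev_eq hΨ hq hαX hXz hm
  have hqp : Λ (Ψ q) = 0 ↔ q = p :=
    ⟨fun h0 => Ψ.injOn hq hp (by rw [hp0]; exact hΛ.1 (by rw [h0, map_zero])),
      fun h0 => by rw [h0, hp0, map_zero]⟩
  constructor
  · rw [isAxiumbilic_iff hm hm0 hd hXz hE hΔ, ← hqp]
    refine ⟨fun h0 => by_contra fun h1 => hNz h1 h0, fun h0 => ?_⟩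
    rw [h0]
    apply Complex.ext <;> simp [axialForm, axialN, h.zero0, h.zero1]
  · intro hne v
    refine (hP hm hm0 hd hXz hE hΔ (hNz fun h0 => hne (hqp.1 h0)) v).trans
      (and_congr_left fun _ => not_congr ⟨fun h0 => hΛ.1 (by rw [h0, map_zero]), fun h0 => ?_⟩)
    rw [h0, map_zero]

end IsMongeChart

end

end Axial

end

theorem proposition16 {M : Type*} [TopologicalSpace M] [ChartedSpace Axial.Plane M]
    [IsManifold (𝓡 2) ∞ M] (r : ℕ∞) (hr : 5 ≤ r) (α : M → Axial.Space4)
    (hα : Axial.IsImmersionOfClass r α) (p : M) (hp : Axial.IsAxiumbilic α p)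
    (φ : OpenPartialHomeomorph M Axial.Plane) (R S : Axial.Plane → ℝ)
    (hφ : Axial.IsMongeChart r α p φ R S)
    (hα₁ : Axial.alpha1 R S = 0) (hα₃ : Axial.alpha3 R S = 0)
    (θ : ℝ) (X : Axial.Plane → Axial.Space4)
    (hX : X = Axial.monge (R ∘ Axial.rot θ) (S ∘ Axial.rot θ))
    (h₁₀ : Axial.jet (Axial.a0 X) 1 0 = 0) (h₀₁ : Axial.jet (Axial.a0 X) 0 1 ≠ 0)
    (hχ : Axial.chi X ≠ 0) :
    Axial.IsTypeE45 X ∧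
    (∀ d ∈ Axial.singularDirections X, Axial.IsConical X d.rep ∧ Axial.IsSaddle X d.rep) ∧
    (∃ d₀ ∉ Axial.singularDirections X,
      Axial.equilibria X = insert d₀ (Axial.singularDirections X) ∧
      Axial.IsTransverseSaddleNode X d₀.rep) ∧
    (0 < Axial.chi X →
      Axial.LooksLike α (Axial.IsPrincipal α) p Axial.saddleNodeNet ∧
      Axial.LooksLike α (Axial.IsMean α) p Axial.trivialNet) ∧
    (Axial.chi X < 0 →
      Axial.LooksLike α (Axial.IsMean α) p Axial.saddleNodeNet ∧
      Axial.LooksLike α (Axial.IsPrincipal α) p Axial.trivialNet) := by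
  subst hX
  have hle : ∀ {n : ℕ∞}, n ≤ 5 → (n : ℕ∞ω) ≤ r := fun hn => WithTop.coe_le_coe.2 (hn.trans hr)
  obtain ⟨hR, hS⟩ := hφ.contDiffAt_components hα.1
  have h := Axial.axialGerm_of_monge (hR.of_le (hle (n := 4) (by norm_num)))
    (hS.of_le (hle (n := 4) (by norm_num))) hφ.tangent_R hφ.tangent_S hφ.r11 hφ.s11 hα₁ hα₃ h₁₀ h₀₁
  obtain ⟨ε, σ, hε, hσ, hεα, hεχ⟩ := h.exists_signs hχ
  have hN := h.eventually_axialForm_ne_zero hσ hεα hεχ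
  have hs := h.isLocalNet_saddleNode hσ hεα hεχ
  have ht := h.isLocalNet_trivial hσ hεα hεχ
  have bs := Axial.bijective_coordL hσ
  have bt := bs.comp Axial.bijective_eighthTurn
  have hr2 : 2 ≤ r := le_trans (by norm_num) hr
  refine ⟨h.isTypeE45 hχ, fun d hd => ?_, ⟨Axial.axisDir, h.axisDir_notMem, h.equilibria_eq,
    h.isTransverseSaddleNode hχ⟩, fun h0 => ?_, fun h0 => ?_⟩
  · rw [h.singularDirections_eq] at hd
    exact ⟨h.isConical hχ d.rep_nonzero hd, h.isSaddle d.rep_nonzero hd⟩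
  · have hε1 : ε = 1 := by
      rcases mul_self_eq_one_iff.1 ((sq ε).symm.trans hε) with h1 | h1
      · exact h1
      · rw [h1] at hεχ; linarith
    rw [hε1] at hs ht
    exact ⟨hφ.looksLike hr2 rfl h hN bs Axial.isPrincipal_iff hs,
      hφ.looksLike hr2 rfl h hN bt Axial.isMean_iff ht⟩
  · have hε1 : ε = -1 := by
      rcases mul_self_eq_one_iff.1 ((sq ε).symm.trans hε) with h1 | h1
      · rw [h1] at hεχ; linarith
      · exact h1
    rw [hε1] at hs ht
    rw [neg_neg] at ht
    exact ⟨hφ.looksLike hr2 rfl h hN bs Axial.isMean_iff hs,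
      hφ.looksLike hr2 rfl h hN bt Axial.isPrincipal_iff ht⟩
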